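/- **Setting.** Let $m\ge 1$, let $S$ be a smooth $m$-manifold, and let $\overline M=\mathbb R\times S$ be a globally hyperbolic spacetime written through a splitting time function $\tau$ (the first projection): $\bar g=\bar\alpha^2(-d\tau^2+\bar\sigma)$, where $\bar\alpha>0$ is smooth, $\bar\sigma$ is a smooth symmetric $2$-tensor with kernel $\mathbb R\,\partial_\tau$ that is positive definite on every slice $\{t\}\times S$, and all slices are Cauchy hypersurfaces. Let $\pi:\overline M\to S$ be the second projection and $T=\bar\alpha^{-1}\partial_\tau$. Let $\Sigma\subset\overline M$ be a connected, smooth, compact, embedded, achronal, spacelike (up to the boundary) hypersurface with boundary, with interior $\mathring\Sigma$ and height $\varphi=\tau|_\Sigma$, such that its Cauchy development $D(\Sigma)=D^+(\Sigma)\cup D^-(\Sigma)$ is precompact. For $u:\Sigma\to\mathbb R$ put $F_u=(u,\pi|_\Sigma):\Sigma\to\mathbb R\times S$, $\sigma_u=F_u^*\bar\sigma$, with volume measure $dV_{\sigma_u}$, distance $\mathrm d_{\sigma_u}$ and balls $B^{\sigma_u}_r(x)$, and $$\mathscr Y_\tau(\Sigma)=\{u\in \mathrm{Lip}(\Sigma):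 |du|_{\sigma_u}\le 1 \text{ a.e.},\ u=\varphi\text{ on }\partial\Sigma\}.$$ Where $u$ is differentiable and $|du|_{\sigma_u}<1$, $N_u$ is the future unit normal of the graph $F_u(\Sigma)$ and $w_u=-\bar g(T,N_u)=(1-|du|^2_{\sigma_u})^{-1/2}$; if $u$ is smooth, $H_u$ is the mean curvature (trace of the second fundamental form $-\bar g(\overline\nabla_{F_*\cdot}F_*\cdot,N_u)$). $\mathscr M(\Sigma)$ denotes the finite signed Borel measures with the weak$^*$ topology, and $\mathscr C^\infty(\Sigma)$ those $\mu\in\mathscr M(\Sigma)$ that, for every $k\in\mathbb N$ and every $u\in\mathscr Y_\tau(\Sigma)\cap C^k(\Sigma)$, have a $C^k$ density with respect to $dV_{\sigma_u}$. Hausdorff measure $\mathscr H^1$ and uniform integrability on $\Sigma$ are taken with respect to $\sigma_\varphi$; a sequence is locally uniformly integrable in an open $U\subseteq\mathring\Sigma$ if for every compact $Q\subseteq U$ and $\epsilon>0$ there is $\delta>0$ such that $\sup_j\int_A|w_j|\,dV_{\sigma_\varphi}<\epsilon$ for all measurable $A\subseteq Q$ of measure $<\delta$. **Data.** Let $\rho:(\mathscr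 Y_\tau(\Sigma),\|\cdot\|_{C(\Sigma)})\to\mathscr M(\Sigma)$ be continuous, let $X$ be a continuous vector field on $\overline{D(\Sigma)}$, and let $C_\rho,\Lambda\ge 0$. **Theorem.** There is a constant $C=C_{\rho,X}\ge 0$, depending only on $\overline M,\tau,\Sigma,\rho,X,C_\rho,\Lambda$, with the following property. Let $\rho_j:\mathscr Y_\tau(\Sigma)\to\mathscr C^\infty(\Sigma)$ and let $X_j$ be smooth vector fields on $\overline{D(\Sigma)}$, $j\in\mathbb N$, such that - $\rho_j(v_j)\rightharpoonup\rho(v)$ weakly$^*$ whenever $v_j\to v$ uniformly in $\mathscr Y_\tau(\Sigma)$; - the total variation of $\rho_j(v)$ is at most $C_\rho$ for all $j$ and all $v\in\mathscr Y_\tau(\Sigma)$; - $X_j\to X$ uniformly on $\overline{D(\Sigma)}$; - $|\bar g(X_j,N_v)|\le\Lambda w_v$ for all $j$ and $v\in\mathscr Y_\tau(\Sigma)$, at all points of $\mathring\Sigma$ where $v$ is differentiable and $|dv|_{\sigma_v}<1$. For each $j$ let $u_j\in\mathscr Y_\tau(\Sigma)\cap C^\infty(\Sigma)$ be spacelike ($|du_j|_{\sigma_{u_j}}<1$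 on $\Sigma$) with $$H_{u_j}=\frac{d\rho_j(u_j)}{dV_{\sigma_{u_j}}}+\bar g(X_j,N_{u_j})\quad\text{in }\mathring\Sigma,$$ and set $\sigma_j=\sigma_{u_j}$, $dV_j=dV_{\sigma_j}$, $w_j=w_{u_j}$ and $r_x=\frac12\inf_j \mathrm d_{\sigma_j}(x,\partial\Sigma)$. Then: 1. for every $x\in\mathring\Sigma$, every $r\in(0,r_x)$ and every $j$, $$\int_{B_r^{\sigma_j}(x)}w_j\,dV_j\le\frac{C}{r_x}\,r;$$ 2. for every compact $E\subset\mathring\Sigma$ with $\mathscr H^1(E)=0$, the sequence $\{w_j\}$ is locally uniformly integrable in $\mathring\Sigma\setminus E$ if and only if it is locally uniformly integrable in $\mathring\Sigma$. -/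

import Mathlib

open Set Filter Topology MeasureTheory
open scoped Manifold ContDiff ENNReal NNReal

noncomputable section

/-! ### Second fundamental forms in coordinates -/

section Coordinates

variable {E P : Type*} [NormedAddCommGroup E] [NormedSpace ℝ E]
  [NormedAddCommGroup P] [NormedSpace ℝ P]

/-- The Levi-Civita connection of the metric `b` in linear coordinates, with its vector index
lowered: the Koszul formula for the constant vector fields `V`, `W`, `Z`, that is the value of
`b (∇_V W, Z)` at `p`. -/
def christoffelLower (b : P → P → P → ℝ) (p V W Z : P) : ℝ :=
  (fderiv ℝ (fun q => b q W Z) p V + fderiv ℝ (fun q => b q V Z) p W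
    - fderiv ℝ (fun q => b q V W) p Z) / 2

/-- Second fundamental form, in the direction of the normal `N`, of the map `F` into the coordinate
space `P` with metric `b`: `II (v, w) = - b (∇_{F_* v} F_* w, N)`. -/
def coordSecondFundForm (b : P → P → P → ℝ) (F : E → P) (N : P) (y v w : E) : ℝ :=
  -(b (F y) (fderiv ℝ (fun z => fderiv ℝ F z w) y v) N
    + christoffelLower b (F y) (fderiv ℝ F y v) (fderiv ℝ F y w) N)

end Coordinates

/-! ### Split space-times -/

/-- A space-time `ℝ × S` with metric `ḡ = ᾱ² (-dτ² + σ̄)`; here `τ` is the first projection,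
`ᾱ > 0` the lapse and `σ̄` restricts to a Riemannian metric on every slice `{t} × S` and vanishes on
`∂_τ`. -/
structure SplitSpacetime (m : ℕ) (S : Type*) [TopologicalSpace S]
    [ChartedSpace (EuclideanSpace ℝ (Fin m)) S] where
  lapse : ℝ × S → ℝ
  lapse_pos : ∀ p, 0 < lapse p
  lapse_smooth : ContMDiff (𝓘(ℝ, ℝ).prod (𝓡 m)) 𝓘(ℝ, ℝ) ∞ lapse
  spatial : ℝ → (x : S) → TangentSpace (𝓡 m) x →L[ℝ] TangentSpace (𝓡 m) x →L[ℝ] ℝ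
  spatial_symm : ∀ t x v w, spatial t x v w = spatial t x w v
  spatial_pos : ∀ t x v, v ≠ 0 → 0 < spatial t x v v
  /-- The coefficients of `σ̄` in the coordinates of a chart are smooth. -/
  spatial_smooth : ∀ (c : S) (v w : EuclideanSpace ℝ (Fin m)),
    ContDiffOn ℝ ∞ (fun q : ℝ × EuclideanSpace ℝ (Fin m) =>
      spatial q.1 ((extChartAt (𝓡 m) c).symm q.2)
        (mfderiv 𝓘(ℝ, EuclideanSpace ℝ (Fin m)) (𝓡 m) (extChartAt (𝓡 m) c).symm q.2 v)
        (mfderiv 𝓘(ℝ, EuclideanSpace ℝ (Fin m)) (𝓡 m) (extChartAt (𝓡 m) c).symm q.2 w))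
      (univ ×ˢ (extChartAt (𝓡 m) c).target)

namespace SplitSpacetime

variable {m : ℕ} {S : Type*} [TopologicalSpace S] [ChartedSpace (EuclideanSpace ℝ (Fin m)) S]
  (G : SplitSpacetime m S)

/-- The Lorentzian metric `ḡ`; a tangent vector at `(t, x)` is a pair (`∂_τ`-component, vector
tangent to `S` at `x`). -/
def metric (p : ℝ × S) (V W : ℝ × TangentSpace (𝓡 m) p.2) : ℝ :=
  G.lapse p ^ 2 * (-(V.1 * W.1) + G.spatial p.1 p.2 V.2 W.2)

/-- Norm of a tangent vector in the Riemannian metric `ḡ + 2 T♭ ⊗ T♭ = ᾱ² (dτ² + σ̄)`. -/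
def euclNorm (p : ℝ × S) (V : ℝ × TangentSpace (𝓡 m) p.2) : ℝ :=
  Real.sqrt (G.lapse p ^ 2 * (V.1 ^ 2 + G.spatial p.1 p.2 V.2 V.2))

/-- Future pointing timelike vectors (`∂_τ` is future pointing). -/
def FutureTimelike (p : ℝ × S) (V : ℝ × TangentSpace (𝓡 m) p.2) : Prop :=
  0 < V.1 ∧ G.metric p V V < 0

/-- Future pointing causal (timelike or null) vectors. -/
def FutureCausal (p : ℝ × S) (V : ℝ × TangentSpace (𝓡 m) p.2) : Prop :=
  0 < V.1 ∧ G.metric p V V ≤ 0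

/-- `γ` is continuous on the interval `J` and piecewise `C¹` there, the breaks being locally finite,
and its one-sided velocities all satisfy `Q`. -/
def PiecewiseCurve (Q : (p : ℝ × S) → ℝ × TangentSpace (𝓡 m) p.2 → Prop) (J : Set ℝ)
    (γ : ℝ → ℝ × S) : Prop :=
  ContinuousOn γ J ∧ ∃ B : Set ℝ, (∀ a b, (B ∩ Icc a b).Finite) ∧
    ∀ a b, a < b → Icc a b ⊆ J → Disjoint B (Ioo a b) →
      ContMDiffOn 𝓘(ℝ, ℝ) (𝓘(ℝ, ℝ).prod (𝓡 m)) 1 γ (Icc a b) ∧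
      ∀ s ∈ Icc a b, Q (γ s)
        (derivWithin (fun r => (γ r).1) (Icc a b) s,
          mfderivWithin 𝓘(ℝ, ℝ) (𝓡 m) (fun r => (γ r).2) (Icc a b) s (1 : ℝ))

/-- Inextendible future directed timelike curves, parametrized by the real line. -/
def InextendibleTimelike (γ : ℝ → ℝ × S) : Prop :=
  PiecewiseCurve G.FutureTimelike univ γ ∧
    (¬ ∃ q, Tendsto γ atTop (𝓝 q)) ∧ ¬ ∃ q, Tendsto γ atBot (𝓝 q)

/-- Every slice `{τ = t}` is a Cauchy hypersurface: each inextendible timelike curve meets it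
exactly once. -/
def SlicesCauchy : Prop :=
  ∀ γ : ℝ → ℝ × S, G.InextendibleTimelike γ → ∀ t : ℝ, ∃! s : ℝ, (γ s).1 = t

/-- Every inextendible timelike curve meets `A` at most once. -/
def Achronal (A : Set (ℝ × S)) : Prop :=
  ∀ γ : ℝ → ℝ × S, G.InextendibleTimelike γ → ∀ s s' : ℝ, γ s ∈ A → γ s' ∈ A → s = s'

/-- Future Cauchy development: all past inextendible causal curves from the point meet `A`. -/
def futureDevelopment (A : Set (ℝ × S)) : Set (ℝ × S) :=
  {p | ∀ γ : ℝ → ℝ × S, PiecewiseCurve G.FutureCausal (Iic 0) γ → γ 0 = p →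
    (¬ ∃ q, Tendsto γ atBot (𝓝 q)) → ∃ s ≤ 0, γ s ∈ A}

/-- Past Cauchy development: all future inextendible causal curves from the point meet `A`. -/
def pastDevelopment (A : Set (ℝ × S)) : Set (ℝ × S) :=
  {p | ∀ γ : ℝ → ℝ × S, PiecewiseCurve G.FutureCausal (Ici 0) γ → γ 0 = p →
    (¬ ∃ q, Tendsto γ atTop (𝓝 q)) → ∃ s ≥ 0, γ s ∈ A}

/-- The Cauchy development `D(A)`. -/
def development (A : Set (ℝ × S)) : Set (ℝ × S) :=
  G.futureDevelopment A ∪ G.pastDevelopment A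

/-- Continuity of a vector field on a subset of `ℝ × S`. -/
def ContinuousField [IsManifold (𝓡 m) ∞ S] (A : Set (ℝ × S)) (X : (p : ℝ × S) → ℝ × TangentSpace (𝓡 m) p.2) : Prop :=
  ContinuousOn (fun p => (X p).1) A ∧
    ContinuousOn (fun p => (⟨p.2, (X p).2⟩ : TangentBundle (𝓡 m) S)) A

/-- Smoothness of a vector field on a subset of `ℝ × S`. -/
def SmoothField [IsManifold (𝓡 m) ∞ S] (A : Set (ℝ × S))
    (X : (p : ℝ × S) → ℝ × TangentSpace (𝓡 m) p.2) : Prop :=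
  ContMDiffOn (𝓘(ℝ, ℝ).prod (𝓡 m)) 𝓘(ℝ, ℝ) ∞ (fun p => (X p).1) A ∧
    ContMDiffOn (𝓘(ℝ, ℝ).prod (𝓡 m)) (𝓡 m).tangent ∞
      (fun p => (⟨p.2, (X p).2⟩ : TangentBundle (𝓡 m) S)) A

end SplitSpacetime

/-! ### Metrics on a manifold with boundary -/

section RiemannianData

variable {m : ℕ} [NeZero m] {Sig : Type*} [TopologicalSpace Sig]
  [ChartedSpace (EuclideanHalfSpace m) Sig]

/-- The `i`-th coordinate vector at `x`. -/
def coordVec (x : Sig) (i : Fin m) : TangentSpace (𝓡∂ m) x :=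
  (EuclideanSpace.single i (1 : ℝ) : EuclideanSpace ℝ (Fin m))

/-- Gram matrix of `σ` at `x`. -/
def gramMatrix (σ : (x : Sig) → TangentSpace (𝓡∂ m) x → TangentSpace (𝓡∂ m) x → ℝ) (x : Sig) :
    Matrix (Fin m) (Fin m) ℝ :=
  Matrix.of fun i j => σ x (coordVec x i) (coordVec x j)

/-- The derivative `du (v)` of a real function. -/
def dAlong (u : Sig → ℝ) (x : Sig) (v : TangentSpace (𝓡∂ m) x) : ℝ :=
  mfderiv (𝓡∂ m) 𝓘(ℝ, ℝ) u x v

/-- The `σ`-gradient `Du` of `u` at `x`. -/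
def gradVec (σ : (x : Sig) → TangentSpace (𝓡∂ m) x → TangentSpace (𝓡∂ m) x → ℝ) (u : Sig → ℝ)
    (x : Sig) : TangentSpace (𝓡∂ m) x :=
  ∑ i, (∑ j, (gramMatrix σ x)⁻¹ i j * dAlong u x (coordVec x j)) • coordVec x i

/-- `|du|²_σ = du (Du)`. -/
def gradNormSq (σ : (x : Sig) → TangentSpace (𝓡∂ m) x → TangentSpace (𝓡∂ m) x → ℝ) (u : Sig → ℝ)
    (x : Sig) : ℝ :=
  dAlong u x (gradVec σ u x)

/-- Riemannian distance of `σ`: infimum of the lengths of `C¹` curves in `Sig`. -/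
def metricDist (σ : (x : Sig) → TangentSpace (𝓡∂ m) x → TangentSpace (𝓡∂ m) x → ℝ)
    (x y : Sig) : ℝ≥0∞ :=
  ⨅ (γ : ℝ → Sig) (_ : ContMDiffOn 𝓘(ℝ, ℝ) (𝓡∂ m) 1 γ (Icc 0 1)) (_ : γ 0 = x) (_ : γ 1 = y),
    ∫⁻ s in Icc (0 : ℝ) 1, ENNReal.ofReal (Real.sqrt (σ (γ s)
      (mfderivWithin 𝓘(ℝ, ℝ) (𝓡∂ m) γ (Icc 0 1) s (1 : ℝ))
      (mfderivWithin 𝓘(ℝ, ℝ) (𝓡∂ m) γ (Icc 0 1) s (1 : ℝ))))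

/-- Open ball of the distance of `σ`. -/
def metricBall (σ : (x : Sig) → TangentSpace (𝓡∂ m) x → TangentSpace (𝓡∂ m) x → ℝ)
    (x : Sig) (r : ℝ) : Set Sig :=
  {y | metricDist σ x y < ENNReal.ofReal r}

/-- One-dimensional Hausdorff measure of `A` in the distance of `σ`. -/
def hausdorffOne (σ : (x : Sig) → TangentSpace (𝓡∂ m) x → TangentSpace (𝓡∂ m) x → ℝ)
    (A : Set Sig) : ℝ≥0∞ :=
  ⨆ (δ : ℝ≥0∞) (_ : 0 < δ), ⨅ (t : ℕ → Set Sig) (_ : A ⊆ ⋃ n, t n)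
    (_ : ∀ n, (⨆ x ∈ t n, ⨆ y ∈ t n, metricDist σ x y) ≤ δ),
    ∑' n, ⨆ x ∈ t n, ⨆ y ∈ t n, metricDist σ x y

/-- Density `√ det σ_ij` of `σ` in the chart around `c`. -/
def chartDensity (σ : (x : Sig) → TangentSpace (𝓡∂ m) x → TangentSpace (𝓡∂ m) x → ℝ) (c : Sig)
    (y : EuclideanSpace ℝ (Fin m)) : ℝ :=
  let e := (extChartAt (𝓡∂ m) c).symm
  let d := fun i : Fin m => mfderivWithin 𝓘(ℝ, EuclideanSpace ℝ (Fin m)) (𝓡∂ m) e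
    (range (𝓡∂ m)) y (EuclideanSpace.single i (1 : ℝ) : EuclideanSpace ℝ (Fin m))
  Real.sqrt (Matrix.det (Matrix.of fun i j => σ (e y) (d i) (d j)))

variable (m Sig) in
/-- A sequence of points whose charts cover a nonempty compact manifold. -/
theorem exists_chart_cover [CompactSpace Sig] [Nonempty Sig] :
    ∃ c : ℕ → Sig, ⋃ n, (chartAt (EuclideanHalfSpace m) (c n)).source = univ := by
  obtain ⟨s, hs, hcov⟩ := countable_cover_nhds_of_sigmaCompact
    (f := fun x : Sig => (chartAt (EuclideanHalfSpace m) x).source)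
    (fun x => chart_source_mem_nhds (EuclideanHalfSpace m) x)
  have hne : s.Nonempty := by
    by_contra h
    rw [Set.not_nonempty_iff_eq_empty] at h
    subst h
    obtain ⟨x⟩ := ‹Nonempty Sig›
    have hx := Set.mem_univ x
    rw [← hcov] at hx
    simp at hx
  obtain ⟨c, rfl⟩ := hs.exists_eq_range hne
  exact ⟨c, by simpa using hcov⟩

variable [CompactSpace Sig] [Nonempty Sig] [MeasurableSpace Sig]

/-- Riemannian volume measure of `σ`: the manifold is cut into disjoint pieces, each contained in a
chart, on which the measure is `√ det σ_ij dy`. By the change of variables formula, the choice of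
the charts is irrelevant. -/
def metricVolume (σ : (x : Sig) → TangentSpace (𝓡∂ m) x → TangentSpace (𝓡∂ m) x → ℝ) :
    Measure Sig :=
  Measure.sum fun n : ℕ =>
    let c := Classical.choose (exists_chart_cover m Sig)
    (Measure.map (extChartAt (𝓡∂ m) (c n)).symm
      (((volume : Measure (EuclideanSpace ℝ (Fin m))).restrict
        (extChartAt (𝓡∂ m) (c n)).target).withDensity
          fun y => ENNReal.ofReal (chartDensity σ (c n) y))).restrict
      (disjointed (fun k => (chartAt (EuclideanHalfSpace m) (c k)).source) n)

end RiemannianData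

/-- Integral of a continuous function against a finite signed measure. -/
def signedIntegral {Z : Type*} [MeasurableSpace Z] (μ : SignedMeasure Z) (f : Z → ℝ) : ℝ :=
  (∫ x, f x ∂μ.toJordanDecomposition.posPart) - ∫ x, f x ∂μ.toJordanDecomposition.negPart

/-- The sequence `w` is locally uniformly integrable in `U` with respect to `μ`: it is uniformly
integrable in every compact subset of `U`. -/
def LocallyUniformlyIntegrable {Z : Type*} [TopologicalSpace Z] [MeasurableSpace Z]
    (μ : Measure Z) (w : ℕ → Z → ℝ) (U : Set Z) : Prop :=
  ∀ Q : Set Z, IsCompact Q → Q ⊆ U → ∀ ε : ℝ≥0, 0 < ε → ∃ δ : ℝ≥0, 0 < δ ∧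
    ∀ A : Set Z, MeasurableSet A → A ⊆ Q → μ A < δ →
      (⨆ j, ∫⁻ x in A, ENNReal.ofReal |w j x| ∂μ) < ε

/-! ### Spacelike hypersurfaces and graphs over them -/

/-- A smooth, compact, spacelike, achronal embedded hypersurface `x ↦ (φ x, π x)` of `ℝ × S` with
boundary, parametrized by a compact manifold with boundary `Sig`. -/
structure SpacelikeHypersurface {m : ℕ} [NeZero m] {S : Type*} [TopologicalSpace S]
    [ChartedSpace (EuclideanSpace ℝ (Fin m)) S] (G : SplitSpacetime m S)
    (Sig : Type*) [TopologicalSpace Sig] [ChartedSpace (EuclideanHalfSpace m) Sig] where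
  /-- The height function `φ`. -/
  height : C(Sig, ℝ)
  /-- The projection `π` to `S`. -/
  proj : Sig → S
  height_smooth : ContMDiff (𝓡∂ m) 𝓘(ℝ, ℝ) ∞ height
  proj_smooth : ContMDiff (𝓡∂ m) (𝓡 m) ∞ proj
  injective : Function.Injective fun x => (height x, proj x)
  /-- The metric induced by `ḡ` is positive definite, up to the boundary. -/
  spacelike : ∀ (x : Sig) (v : TangentSpace (𝓡∂ m) x), v ≠ 0 →
    0 < G.metric (height x, proj x)
      (dAlong height x v, mfderiv (𝓡∂ m) (𝓡 m) proj x v)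
      (dAlong height x v, mfderiv (𝓡∂ m) (𝓡 m) proj x v)
  achronal : G.Achronal (range fun x => (height x, proj x))

namespace SpacelikeHypersurface

variable {m : ℕ} [NeZero m] {S : Type*} [TopologicalSpace S]
  [ChartedSpace (EuclideanSpace ℝ (Fin m)) S] {G : SplitSpacetime m S}
  {Sig : Type*} [TopologicalSpace Sig] [ChartedSpace (EuclideanHalfSpace m) Sig]
  (D : SpacelikeHypersurface G Sig)

/-- The hypersurface as a subset of the space-time. -/
def carrier : Set (ℝ × S) := range fun x => (D.height x, D.proj x)

/-- The graph map `F_u`. -/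
abbrev graphMap (u : Sig → ℝ) (x : Sig) : ℝ × S := (u x, D.proj x)

/-- The metric `σ_u = F_u^* σ̄` on `Sig`. -/
def sigma (u : Sig → ℝ) (x : Sig) (v w : TangentSpace (𝓡∂ m) x) : ℝ :=
  G.spatial (u x) (D.proj x) (mfderiv (𝓡∂ m) (𝓡 m) D.proj x v)
    (mfderiv (𝓡∂ m) (𝓡 m) D.proj x w)

/-- The lapse along the graph, `α_u = F_u^* ᾱ`. -/
def lapseAlong (u : Sig → ℝ) (x : Sig) : ℝ := G.lapse (D.graphMap u x)

/-- The tilt function `w_u = (1 - |du|²)^(-1/2)`. -/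
def tilt (u : Sig → ℝ) (x : Sig) : ℝ := 1 / Real.sqrt (1 - gradNormSq (D.sigma u) u x)

/-- The future pointing unit normal of the graph of `u`,
`N_u = w (T + U) = (w / α) (∂_τ + π_* Du)`. -/
def normal (u : Sig → ℝ) (x : Sig) : ℝ × TangentSpace (𝓡 m) (D.graphMap u x).2 :=
  (D.tilt u x / D.lapseAlong u x) •
    ((1 : ℝ), mfderiv (𝓡∂ m) (𝓡 m) D.proj x (gradVec (D.sigma u) u x))

/-- The metric `ḡ` in the coordinates `(t, y) ↦ (t, π (e⁻¹ y))` of the space-time given by the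
chart `e` of `Sig` around `c`. -/
def coordMetric (c : Sig) (p V W : ℝ × EuclideanSpace ℝ (Fin m)) : ℝ :=
  let f := fun y : EuclideanSpace ℝ (Fin m) => D.proj ((extChartAt (𝓡∂ m) c).symm y)
  G.metric (p.1, f p.2)
    (V.1, mfderiv 𝓘(ℝ, EuclideanSpace ℝ (Fin m)) (𝓡 m) f p.2 V.2)
    (W.1, mfderiv 𝓘(ℝ, EuclideanSpace ℝ (Fin m)) (𝓡 m) f p.2 W.2)

/-- The graph map in the coordinates of `coordMetric`. -/
def coordGraph (u : Sig → ℝ) (c : Sig) (y : EuclideanSpace ℝ (Fin m)) :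
    ℝ × EuclideanSpace ℝ (Fin m) :=
  (u ((extChartAt (𝓡∂ m) c).symm y), y)

/-- The unit normal at `c` in the coordinates of `coordMetric`; tangent vectors of `Sig` at `c` are
already expressed in the chart around `c`. -/
def coordNormal (u : Sig → ℝ) (c : Sig) : ℝ × EuclideanSpace ℝ (Fin m) :=
  (D.tilt u c / D.lapseAlong u c) • ((1 : ℝ), gradVec (D.sigma u) u c)

/-- The mean curvature `H_u = tr_g II` of the graph of `u` in the direction of `N_u`, at interior
points of `Sig`. -/
def meanCurvature (u : Sig → ℝ) (x : Sig) : ℝ :=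
  let b := D.coordMetric x
  let F := coordGraph u x
  let y := extChartAt (𝓡∂ m) x x
  let ε := fun i : Fin m => EuclideanSpace.single i (1 : ℝ)
  let g : Matrix (Fin m) (Fin m) ℝ :=
    Matrix.of fun i j => b (F y) (fderiv ℝ F y (ε i)) (fderiv ℝ F y (ε j))
  ∑ i, ∑ j, g⁻¹ i j * coordSecondFundForm b F (D.coordNormal u x) y (ε i) (ε j)

/-- The function `ḡ(X, N_u)` along the graph of `u`. -/
def fieldNormal (X : (p : ℝ × S) → ℝ × TangentSpace (𝓡 m) p.2) (u : Sig → ℝ) (x : Sig) : ℝ :=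
  G.metric (D.graphMap u x) (X (D.graphMap u x)) (D.normal u x)

variable [CompactSpace Sig] [Nonempty Sig] [MeasurableSpace Sig]

/-- The set of heights of weakly spacelike graphs: Lipschitz functions `u` with `|du|_{σ_u} ≤ 1`
almost everywhere and `u = φ` on the boundary. -/
def weaklySpacelike : Set C(Sig, ℝ) :=
  {u | (∃ L : ℝ≥0, ∀ x y, ENNReal.ofReal |u x - u y| ≤ L * metricDist (D.sigma D.height) x y) ∧
    (∀ᵐ x ∂(metricVolume (D.sigma D.height)), gradNormSq (D.sigma u) u x ≤ 1) ∧
    ∀ x ∈ (𝓡∂ m).boundary Sig, u x = D.height x}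

/-- Signed measures that have, for each `k`, a `C^k` density with respect to the volume of `σ_u`,
for all weakly spacelike `u` of class `C^k`. -/
def SmoothMeasure (μ : SignedMeasure Sig) : Prop :=
  ∀ k : ℕ, ∀ u ∈ D.weaklySpacelike, ContMDiff (𝓡∂ m) 𝓘(ℝ, ℝ) k u →
    ∃ f : Sig → ℝ, ContMDiff (𝓡∂ m) 𝓘(ℝ, ℝ) k f ∧
      μ = (metricVolume (D.sigma u)).withDensityᵥ f

/-- `(ρ_j, X_j)` approximates the data `(ρ, X)`, with constants `Cρ` and `Λ`. -/
structure Approximates [IsManifold (𝓡 m) ∞ S]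
    (ρ : D.weaklySpacelike → SignedMeasure Sig)
    (X : (p : ℝ × S) → ℝ × TangentSpace (𝓡 m) p.2) (Cρ Λ : ℝ≥0)
    (ρs : ℕ → D.weaklySpacelike → SignedMeasure Sig)
    (Xs : ℕ → (p : ℝ × S) → ℝ × TangentSpace (𝓡 m) p.2) : Prop where
  measure_smooth : ∀ j u, D.SmoothMeasure (ρs j u)
  measure_tendsto : ∀ (v : ℕ → D.weaklySpacelike) (u : D.weaklySpacelike),
    Tendsto v atTop (𝓝 u) → ∀ η : C(Sig, ℝ),
      Tendsto (fun j => signedIntegral (ρs j (v j)) η) atTop (𝓝 (signedIntegral (ρ u) η))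
  measure_bound : ∀ j u, (ρs j u).totalVariation univ ≤ Cρ
  field_smooth : ∀ j, SplitSpacetime.SmoothField (closure (G.development D.carrier)) (Xs j)
  field_tendsto : ∀ ε : ℝ, 0 < ε → ∀ᶠ j in atTop, ∀ p ∈ closure (G.development D.carrier),
    G.euclNorm p (Xs j p - X p) ≤ ε
  field_bound : ∀ j, ∀ u ∈ D.weaklySpacelike, ∀ x ∈ (𝓡∂ m).interior Sig,
    MDifferentiableAt (𝓡∂ m) 𝓘(ℝ, ℝ) u x → gradNormSq (D.sigma u) u x < 1 →
      |D.fieldNormal (Xs j) u x| ≤ Λ * D.tilt u x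

/-- `u` is a smooth spacelike solution, with the right boundary values, of
`H_u = dμ/dV_{σ_u} + ḡ(X, N_u)`, where `μ = ρ(u)`. -/
structure IsSmoothSolution (ρ : D.weaklySpacelike → SignedMeasure Sig)
    (X : (p : ℝ × S) → ℝ × TangentSpace (𝓡 m) p.2) (u : D.weaklySpacelike) : Prop where
  smooth : ContMDiff (𝓡∂ m) 𝓘(ℝ, ℝ) ∞ u.1
  spacelike : ∀ x, gradNormSq (D.sigma u.1) u.1 x < 1
  equation : ∃ f : Sig → ℝ, ContMDiff (𝓡∂ m) 𝓘(ℝ, ℝ) ∞ f ∧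
    ρ u = (metricVolume (D.sigma u.1)).withDensityᵥ f ∧
    ∀ x ∈ (𝓡∂ m).interior Sig,
      D.meanCurvature u.1 x = f x + D.fieldNormal X u.1 x

/-- `r_x`, one half of the infimum over `j` of the `σ_{u_j}`-distances of `x` from the boundary. -/
def halfBoundaryDist (u : ℕ → D.weaklySpacelike) (x : Sig) : ℝ≥0∞ :=
  (⨅ j, ⨅ y ∈ (𝓡∂ m).boundary Sig, metricDist (D.sigma (u j).1) x y) / 2

end SpacelikeHypersurface

end

/-! ### Matrices -/

section Matrices

open Matrix

variable {n : Type*} [Fintype n] [DecidableEq n]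

/-! The proof tests one divergence-form equation with three families of functions. On the graph of u
the tangential part of -∂_τ, multiplied by the volume density, is the flux α^m w √(det σ_u) Du. Its
divergence is the trace of the second fundamental form in the direction αwN, which is the part of
∂_τ normal to the graph, minus half the trace of the time derivative of the ambient metric
(`div_graphFlux`). Relative to dV_σ this reads div = α^(m+1) H + O(w), with a constant that is
uniform for bounded heights (`exists_abs_fluxDiv_sub_le`). Hence, for η supported in the interior, ∫
α^m w ⟨Du, Dη⟩ dV_σ ≤ C (sup |η| + ∫ |η| w dV_σ): the bound on the total variation pays for the
first term, and the bound on the field together with the lower order terms pays for the second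
(`exists_integral_gradInner_le`).

All constants have to be independent of u. A causal curve that starts on a spacelike graph with the
boundary values of Σ and avoids Σ is trapped between the two graphs and therefore has an endpoint.
So the graph lies in D(Σ), precompactness bounds the heights by one number T
(`exists_abs_le_of_isCompact`), and all the metrics σ_u become uniformly equivalent. The same fact
forces ∂Σ to be nonempty.

Global bound. Let Φ be a spacelike graph with the same boundary. Test with ± a truncation of (e^(ku)
- e^(kΦ))⁺, with |k| large. Since |dΦ| ≤ 1 - δ, the gradient term is at least a multiple of |k|
e^(ku) (δw - 2) on the support, which absorbs C ∫ |η| w. Thus w is integrable on {u ≠ Φ}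
(`exists_lintegral_tilt_le_of_ne`). For the choices Φ = φ and Φ = φ + cζ, with ζ positive in the
interior, no interior point lies in both coincidence sets, so ∫ w over the interior is bounded
(`exists_lintegral_tilt_interior_le`).

Local bound. The function u is 1-Lipschitz for σ_u, so it varies by at most r on B_r(x). Test with
r·arctan((u - u(x))/r) times a cutoff that vanishes near ∂Σ. The test function is of size r, and its
derivative in u is bounded below on the ball, so ∫_B w|Du|² ≤ C r/R, where 2R bounds the distance
from ∂Σ below; the global bound controls the error terms. Finally w - w|Du|² = 1/w ≤ 1, and balls
have volume at most linear in r (`exists_lintegral_tilt_ball_le`). This is the first claim.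

Non-concentration. A compact E with ℋ¹(E) = 0 is covered by balls centred on E with arbitrarily
small total radius. By the local bound they carry arbitrarily small tilt, uniformly in j, and the
rest of a compact set avoids E (`locallyUniformlyIntegrable_of_diff`). -/

theorem contDiff_matrix_det : ContDiff ℝ ∞ (fun A : n → n → ℝ => (Matrix.of A).det) := by
  simp only [Matrix.det_apply, Matrix.of_apply]
  fun_prop

/-- Factor A out of A + sA'; the determinant of 1 + sB is 1 + s tr B plus s² times a polynomial in
s. -/
theorem hasDerivAt_det_line (A A' : Matrix n n ℝ) (hA : A.det ≠ 0) :
    HasDerivAt (fun s : ℝ => (A + s • A').det) (A.det * (A⁻¹ * A').trace) 0 := by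
  have hu : IsUnit A.det := isUnit_iff_ne_zero.2 hA
  have key : ∀ s : ℝ, (A + s • A').det = A.det * (1 + (A⁻¹ * A').trace * s +
      (Matrix.det (1 + (Polynomial.X : Polynomial ℝ) • (A⁻¹ * A').map Polynomial.C)).divX.divX.eval s
        * s ^ 2) := by
    intro s
    rw [← Matrix.det_one_add_smul, ← Matrix.det_mul, mul_add, mul_one, Matrix.mul_smul,
      Matrix.mul_nonsing_inv_cancel_left _ _ hu]
  simp_rw [key]
  set q := (Matrix.det (1 + (Polynomial.X : Polynomial ℝ) •
    (A⁻¹ * A').map Polynomial.C)).divX.divX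
  have h := (((hasDerivAt_const (0 : ℝ) (1 : ℝ)).add
    ((hasDerivAt_id (0 : ℝ)).const_mul (A⁻¹ * A').trace)).add
    ((q.hasDerivAt 0).mul ((hasDerivAt_id (0 : ℝ)).pow 2))).const_mul A.det
  refine h.congr_deriv ?_
  simp

/-- Jacobi's formula. -/
theorem HasDerivAt.matrix_det {A : ℝ → Matrix n n ℝ} {A' : Matrix n n ℝ} {t : ℝ}
    (h : ∀ i j, HasDerivAt (fun s => A s i j) (A' i j) t) (hA : (A t).det ≠ 0) :
    HasDerivAt (fun s => (A s).det) ((A t).det * ((A t)⁻¹ * A').trace) t := by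
  have hd : DifferentiableAt ℝ (fun B : n → n → ℝ => (Matrix.of B).det) (A t) :=
    contDiff_matrix_det.differentiable (by simp) _
  have hA1 : HasDerivAt (fun s => (fun i j => A s i j : n → n → ℝ)) (fun i j => A' i j) t :=
    hasDerivAt_pi.2 fun i => hasDerivAt_pi.2 fun j => h i j
  have h1 := hd.hasFDerivAt.comp_hasDerivAt t hA1
  -- The differential of det at A t in the direction A' is found by comparing with the straight
  -- line, where `hasDerivAt_det_line` computes it.
  have hl : HasDerivAt (fun s : ℝ => (fun i j => A t i j + s * A' i j : n → n → ℝ))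
      (fun i j => A' i j) 0 := by
    refine hasDerivAt_pi.2 fun i => hasDerivAt_pi.2 fun j => ?_
    simpa using ((hasDerivAt_id (0 : ℝ)).mul_const (A' i j)).const_add (A t i j)
  have hd2 : HasFDerivAt (fun B : n → n → ℝ => (Matrix.of B).det)
      (fderiv ℝ (fun B : n → n → ℝ => (Matrix.of B).det) (A t))
      ((fun s : ℝ => (fun i j => A t i j + s * A' i j : n → n → ℝ)) 0) := by
    simpa using hd.hasFDerivAt
  have h2 := hd2.comp_hasDerivAt (0 : ℝ) hl
  have h3 := hasDerivAt_det_line (A t) A' hA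
  have h4 := h2.unique h3
  exact h1.congr_deriv h4

/-- Cramer's rule gives differentiability of the inverse; its derivative then comes from
differentiating A A⁻¹ = 1, valid near t because the determinant stays nonzero. -/
theorem HasDerivAt.matrix_inv {A : ℝ → Matrix n n ℝ} {A' : Matrix n n ℝ} {t : ℝ}
    (h : ∀ i j, HasDerivAt (fun s => A s i j) (A' i j) t) (hA : (A t).det ≠ 0) (i j : n) :
    HasDerivAt (fun s => (A s)⁻¹ i j) (-((A t)⁻¹ * A' * (A t)⁻¹) i j) t := by
  have hdet := HasDerivAt.matrix_det h hA
  have hadj : ∀ i j, DifferentiableAt ℝ (fun s => (A s).adjugate i j) t := by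
    intro i j
    simp only [Matrix.adjugate_apply, Matrix.det_apply, Matrix.updateRow_apply]
    have : ∀ i j, DifferentiableAt ℝ (fun s => A s i j) t := fun i j => (h i j).differentiableAt
    refine DifferentiableAt.fun_sum fun σ _ => ?_
    refine DifferentiableAt.const_smul ?_ _
    refine DifferentiableAt.fun_finsetProd fun k _ => ?_
    split_ifs
    · fun_prop
    · exact this _ _
  have hdiff : ∀ i j, DifferentiableAt ℝ (fun s => (A s)⁻¹ i j) t := by
    intro i j
    simp only [Matrix.inv_def, Matrix.smul_apply, Ring.inverse_eq_inv', smul_eq_mul]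
    exact (hdet.differentiableAt.inv hA).mul (hadj i j)
  set B' : Matrix n n ℝ := Matrix.of fun i j => _root_.deriv (fun s => (A s)⁻¹ i j) t with hB'
  have hB : ∀ i j, HasDerivAt (fun s => (A s)⁻¹ i j) (B' i j) t := fun i j =>
    (hdiff i j).hasDerivAt
  have hev : ∀ᶠ s in 𝓝 t, (A s).det ≠ 0 := hdet.continuousAt.eventually_ne hA
  have hprod : A' * (A t)⁻¹ + A t * B' = 0 := by
    ext i j
    have h1 : HasDerivAt (fun s => (A s * (A s)⁻¹) i j) ((A' * (A t)⁻¹ + A t * B') i j) t := by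
      simp only [Matrix.mul_apply, Matrix.add_apply, ← Finset.sum_add_distrib]
      exact HasDerivAt.fun_sum fun k _ => (h i k).mul (hB k j)
    have h2 : (fun s => (A s * (A s)⁻¹) i j) =ᶠ[𝓝 t] fun _ => (1 : Matrix n n ℝ) i j := by
      filter_upwards [hev] with s hs
      rw [Matrix.mul_nonsing_inv _ (isUnit_iff_ne_zero.2 hs)]
    have h3 := (hasDerivAt_const t ((1 : Matrix n n ℝ) i j)).congr_of_eventuallyEq h2
    simpa using h1.unique h3
  have hfin : B' = -((A t)⁻¹ * A' * (A t)⁻¹) := by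
    have hu : IsUnit (A t).det := isUnit_iff_ne_zero.2 hA
    have h5 : A t * B' = -(A' * (A t)⁻¹) := eq_neg_of_add_eq_zero_right hprod
    have h6 := congrArg ((A t)⁻¹ * ·) h5
    simp only [Matrix.nonsing_inv_mul_cancel_left _ _ hu] at h6
    rw [h6, Matrix.mul_neg, Matrix.mul_assoc]
  have := hB i j
  rw [hfin] at this
  exact this

/-- A positive definite matrix has a factorization `M = Bᵀ B` with `B` invertible. -/
theorem Matrix.PosDef.exists_factor {M : Matrix n n ℝ} (hM : M.PosDef) :
    ∃ B : Matrix n n ℝ, IsUnit B.det ∧ M = Bᵀ * B := by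
  open scoped MatrixOrder Matrix.Norms.L2Operator in
  obtain ⟨B, hB⟩ := CStarAlgebra.nonneg_iff_eq_star_mul_self.mp hM.posSemidef.nonneg
  rw [Matrix.star_eq_conjTranspose, Matrix.conjTranspose_eq_transpose_of_trivial] at hB
  refine ⟨B, ?_, hB⟩
  have := hM.det_pos
  rw [hB, Matrix.det_mul, Matrix.det_transpose] at this
  exact isUnit_iff_ne_zero.2 fun h => by simp [h] at this

/-- Write M = BᵀB. The columns of B⁻¹ form an M-orthonormal basis, and the trace is the sum of the
values of S on it, each at most C in absolute value. -/
theorem Matrix.PosDef.abs_trace_inv_mul_le {M S : Matrix n n ℝ} (hM : M.PosDef) {C : ℝ}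
    (h : ∀ v : n → ℝ, |v ⬝ᵥ S *ᵥ v| ≤ C * (v ⬝ᵥ M *ᵥ v)) :
    |(M⁻¹ * S).trace| ≤ C * Fintype.card n := by
  obtain ⟨B, hu, rfl⟩ := hM.exists_factor
  have hut : IsUnit (Bᵀ).det := by rwa [Matrix.det_transpose]
  have e1 : ((Bᵀ * B)⁻¹ * S).trace = ((B⁻¹)ᵀ * S * B⁻¹).trace := by
    rw [Matrix.mul_inv_rev, Matrix.trace_mul_comm, ← Matrix.mul_assoc, Matrix.trace_mul_comm,
      ← Matrix.mul_assoc, Matrix.transpose_nonsing_inv]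
  have e2 : ∀ T : Matrix n n ℝ, ∀ i, ((B⁻¹)ᵀ * T * B⁻¹) i i
      = (fun k => B⁻¹ k i) ⬝ᵥ T *ᵥ (fun k => B⁻¹ k i) := by
    intro T i
    simp only [Matrix.mul_apply, Matrix.transpose_apply, dotProduct, Matrix.mulVec,
      Finset.sum_mul, Finset.mul_sum]
    rw [Finset.sum_comm]
    simp only [mul_assoc]
  have e3 : (B⁻¹)ᵀ * (Bᵀ * B) * B⁻¹ = 1 := by
    rw [Matrix.mul_assoc, Matrix.mul_assoc, Matrix.mul_nonsing_inv _ hu, Matrix.mul_one,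
      Matrix.transpose_nonsing_inv, Matrix.nonsing_inv_mul _ hut]
  rw [e1, Matrix.trace]
  simp only [Matrix.diag_apply]
  refine (Finset.abs_sum_le_sum_abs _ _).trans ?_
  have : ∀ i ∈ Finset.univ, |((B⁻¹)ᵀ * S * B⁻¹) i i| ≤ C := by
    intro i _
    rw [e2]
    refine (h _).trans_eq ?_
    rw [← e2, e3]
    simp
  refine (Finset.sum_le_card_nsmul _ _ _ this).trans_eq ?_
  simp [mul_comm]

/-- The congruence by B⁻¹, where M = BᵀB, turns M into the identity and S into a matrix with
eigenvalues in [0, C]; the determinant is their product. -/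
theorem Matrix.PosDef.det_le_of_forall_le {M S : Matrix n n ℝ} (hM : M.PosDef) (hS : S.PosDef)
    {C : ℝ} (h : ∀ v : n → ℝ, v ⬝ᵥ S *ᵥ v ≤ C * (v ⬝ᵥ M *ᵥ v)) :
    S.det ≤ C ^ Fintype.card n * M.det := by
  obtain ⟨B, hu, rfl⟩ := hM.exists_factor
  have hut : IsUnit (Bᵀ).det := by rwa [Matrix.det_transpose]
  have hN : ((B⁻¹)ᵀ * S * B⁻¹).PosSemidef := by
    have := hS.posSemidef.conjTranspose_mul_mul_same (B⁻¹)
    rwa [Matrix.conjTranspose_eq_transpose_of_trivial] at this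
  set N := (B⁻¹)ᵀ * S * B⁻¹ with hNdef
  have hSN : S = Bᵀ * N * B := by
    rw [hNdef]
    simp only [Matrix.mul_assoc, Matrix.nonsing_inv_mul _ hu, Matrix.mul_one]
    rw [← Matrix.mul_assoc, Matrix.transpose_nonsing_inv, Matrix.mul_nonsing_inv _ hut,
      Matrix.one_mul]
  have hNv : ∀ v : n → ℝ, v ⬝ᵥ N *ᵥ v ≤ C * (v ⬝ᵥ v) := by
    intro v
    have h1 := h (B⁻¹ *ᵥ v)
    have e : ∀ T : Matrix n n ℝ, (B⁻¹ *ᵥ v) ⬝ᵥ T *ᵥ (B⁻¹ *ᵥ v)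
        = v ⬝ᵥ ((B⁻¹)ᵀ * T * B⁻¹) *ᵥ v := by
      intro T
      rw [Matrix.mul_assoc, ← Matrix.mulVec_mulVec, ← Matrix.mulVec_mulVec,
        Matrix.dotProduct_mulVec v, Matrix.vecMul_transpose]
    rw [e, e] at h1
    have e3 : (B⁻¹)ᵀ * (Bᵀ * B) * B⁻¹ = 1 := by
      rw [Matrix.mul_assoc, Matrix.mul_assoc, Matrix.mul_nonsing_inv _ hu, Matrix.mul_one,
        Matrix.transpose_nonsing_inv, Matrix.nonsing_inv_mul _ hut]
    rwa [e3, Matrix.one_mulVec] at h1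
  have heig : ∀ i, hN.1.eigenvalues i ≤ C := by
    intro i
    have h1 := hN.1.eigenvalues_eq i
    have h2 := hNv (hN.1.eigenvectorBasis i)
    have h3 : ((hN.1.eigenvectorBasis i : EuclideanSpace ℝ n) : n → ℝ) ⬝ᵥ
        (hN.1.eigenvectorBasis i : EuclideanSpace ℝ n) = 1 := by
      have h4 := hN.1.eigenvectorBasis.orthonormal.1 i
      rw [EuclideanSpace.norm_eq, Real.sqrt_eq_one] at h4
      rw [← h4, dotProduct]
      refine Finset.sum_congr rfl fun k _ => ?_
      rw [Real.norm_eq_abs, sq_abs, sq]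
    rw [h3, mul_one] at h2
    rw [h1]
    simpa using h2
  have hdetN : N.det ≤ C ^ Fintype.card n := by
    rw [hN.1.det_eq_prod_eigenvalues]
    refine (Finset.prod_le_prod (fun i _ => hN.eigenvalues_nonneg i) fun i _ => heig i).trans_eq ?_
    simp
  clear_value N
  rw [hSN, Matrix.det_mul, Matrix.det_mul, Matrix.det_mul, Matrix.det_transpose]
  have : 0 ≤ B.det ^ 2 := sq_nonneg _
  nlinarith [mul_le_mul_of_nonneg_left hdetN this]

/-- Determinant and inverse of a rank one perturbation `a (M - p pᵀ)` of a positive matrix. -/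
theorem Matrix.PosDef.det_smul_sub_vecMulVec {M : Matrix n n ℝ} (hM : M.PosDef) (p : n → ℝ)
    (a : ℝ) : (a • (M - vecMulVec p p)).det
      = a ^ Fintype.card n * (M.det * (1 - p ⬝ᵥ M⁻¹ *ᵥ p)) := by
  have hu : IsUnit M.det := isUnit_iff_ne_zero.2 hM.det_pos.ne'
  have : M - vecMulVec p p
      = M * (1 + replicateCol Unit (-(M⁻¹ *ᵥ p)) * replicateRow Unit p) := by
    rw [mul_add, mul_one, ← Matrix.mul_assoc, ← Matrix.replicateCol_mulVec, Matrix.mulVec_neg,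
      Matrix.mulVec_mulVec, Matrix.mul_nonsing_inv _ hu, Matrix.one_mulVec]
    ext i j
    simp [vecMulVec_apply, Matrix.mul_apply, sub_eq_add_neg]
  rw [Matrix.det_smul, this, Matrix.det_mul, Matrix.det_one_add_replicateCol_mul_replicateRow,
    dotProduct_neg, ← sub_eq_add_neg]

/-- The Sherman–Morrison formula. In the application M is the Gram matrix of σ_u and p = du, so that
1 / (1 - p·M⁻¹p) is w². -/
theorem Matrix.PosDef.inv_smul_sub_vecMulVec {M : Matrix n n ℝ} (hM : M.PosDef) {p : n → ℝ}
    {a : ℝ} (ha : a ≠ 0) (hp : p ⬝ᵥ M⁻¹ *ᵥ p < 1) :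
    (a • (M - vecMulVec p p))⁻¹ = a⁻¹ • (M⁻¹ + (1 / (1 - p ⬝ᵥ M⁻¹ *ᵥ p)) •
      vecMulVec (M⁻¹ *ᵥ p) (M⁻¹ *ᵥ p)) := by
  have hu : IsUnit M.det := isUnit_iff_ne_zero.2 hM.det_pos.ne'
  have hMt : Mᵀ = M := by
    have := hM.1.eq
    rwa [Matrix.conjTranspose_eq_transpose_of_trivial] at this
  apply Matrix.inv_eq_right_inv
  have h1 : M * vecMulVec (M⁻¹ *ᵥ p) (M⁻¹ *ᵥ p) = vecMulVec p (M⁻¹ *ᵥ p) := by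
    rw [Matrix.mul_vecMulVec, Matrix.mulVec_mulVec, Matrix.mul_nonsing_inv _ hu,
      Matrix.one_mulVec]
  have h2 : vecMulVec p p * M⁻¹ = vecMulVec p (M⁻¹ *ᵥ p) := by
    rw [Matrix.vecMulVec_mul, ← Matrix.mulVec_transpose, Matrix.transpose_nonsing_inv, hMt]
  have h3 : vecMulVec p p * vecMulVec (M⁻¹ *ᵥ p) (M⁻¹ *ᵥ p)
      = (p ⬝ᵥ M⁻¹ *ᵥ p) • vecMulVec p (M⁻¹ *ᵥ p) := by
    rw [Matrix.vecMulVec_mul_vecMulVec]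
    ext i j
    simp [vecMulVec_apply]; ring
  set d := p ⬝ᵥ M⁻¹ *ᵥ p
  rw [Matrix.smul_mul, Matrix.mul_smul, smul_smul, mul_inv_cancel₀ ha, one_smul, Matrix.sub_mul,
    Matrix.mul_add, Matrix.mul_add, Matrix.mul_smul, Matrix.mul_smul, h1, h2, h3,
    Matrix.mul_nonsing_inv _ hu]
  have hd : 1 - d ≠ 0 := by linarith
  ext i j
  simp only [Matrix.add_apply, Matrix.sub_apply, Matrix.smul_apply, smul_eq_mul]
  field_simp
  ring

end Matrices

/-! ### The mean curvature of a graph as a divergence -/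

section GraphDivergence

open Matrix

variable {m : ℕ}

/-- A contraction with a symmetric matrix sees only the symmetric part. It is used where two
expressions agree after symmetrization but not entry by entry. -/
theorem sum_sum_symm_eq_of_add_eq {n : Type*} [Fintype n] {G L K : n → n → ℝ}
    (hG : ∀ a b, G a b = G b a) (h : ∀ a b, L a b + L b a = K a b + K b a) :
    ∑ a, ∑ b, G a b * L a b = ∑ a, ∑ b, G a b * K a b := by
  have key : ∀ L : n → n → ℝ, ∑ a, ∑ b, G a b * L a b
      = (∑ a, ∑ b, G a b * (L a b + L b a)) / 2 := by
    intro L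
    have h1 : ∑ a, ∑ b, G a b * L b a = ∑ a, ∑ b, G a b * L a b := by
      rw [Finset.sum_comm]
      exact Finset.sum_congr rfl fun a _ => Finset.sum_congr rfl fun b _ => by rw [hG]
    simp only [mul_add, Finset.sum_add_distrib, h1]
    ring
  rw [key L, key K]
  simp only [h]

/-- A metric on coordinate space that is differentiable at `q₀`. -/
structure DifferentiableMetricAt {P : Type*} [NormedAddCommGroup P] [NormedSpace ℝ P]
    (b : P → P → P → ℝ) (q₀ : P) : Prop where
  symm : ∀ q V W, b q V W = b q W V
  add_left : ∀ q V V' W, b q (V + V') W = b q V W + b q V' W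
  smul_left : ∀ q (c : ℝ) V W, b q (c • V) W = c * b q V W
  diff : ∀ V W, DifferentiableAt ℝ (fun q => b q V W) q₀

namespace DifferentiableMetricAt

variable {P : Type*} [NormedAddCommGroup P] [NormedSpace ℝ P] {b : P → P → P → ℝ} {q₀ : P}
  (hb : DifferentiableMetricAt b q₀)

include hb in
theorem add_right (q V W W') : b q V (W + W') = b q V W + b q V W' := by
  rw [hb.symm, hb.add_left, hb.symm q W, hb.symm q W']

include hb in
theorem smul_right (q) (c : ℝ) (V W) : b q V (c • W) = c * b q V W := by
  rw [hb.symm, hb.smul_left, hb.symm q W]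

include hb in
theorem fderiv_symm (V W Z) : fderiv ℝ (fun q => b q V W) q₀ Z
    = fderiv ℝ (fun q => b q W V) q₀ Z := by
  simp only [hb.symm _ V W]

include hb in
theorem fderiv_add_left (V V' W Z) : fderiv ℝ (fun q => b q (V + V') W) q₀ Z
    = fderiv ℝ (fun q => b q V W) q₀ Z + fderiv ℝ (fun q => b q V' W) q₀ Z := by
  simp only [hb.add_left]
  rw [fderiv_fun_add (hb.diff _ _) (hb.diff _ _)]
  rfl

include hb in
theorem fderiv_smul_left (c : ℝ) (V W Z) : fderiv ℝ (fun q => b q (c • V) W) q₀ Z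
    = c * fderiv ℝ (fun q => b q V W) q₀ Z := by
  simp only [hb.smul_left]
  rw [fderiv_const_mul (hb.diff _ _)]
  rfl

include hb in
theorem fderiv_add_right (V W W' Z) : fderiv ℝ (fun q => b q V (W + W')) q₀ Z
    = fderiv ℝ (fun q => b q V W) q₀ Z + fderiv ℝ (fun q => b q V W') q₀ Z := by
  rw [hb.fderiv_symm, hb.fderiv_add_left, hb.fderiv_symm W, hb.fderiv_symm W']

include hb in
theorem fderiv_smul_right (c : ℝ) (V W Z) : fderiv ℝ (fun q => b q V (c • W)) q₀ Z
    = c * fderiv ℝ (fun q => b q V W) q₀ Z := by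
  rw [hb.fderiv_symm, hb.fderiv_smul_left, hb.fderiv_symm W]

include hb in
theorem sum_right {ι : Type*} (s : Finset ι) (q V) (c : ι → ℝ) (W : ι → P) :
    b q V (∑ i ∈ s, c i • W i) = ∑ i ∈ s, c i * b q V (W i) := by
  classical
  induction s using Finset.induction_on with
  | empty => simpa using hb.smul_right q 0 V 0
  | insert a s ha ih => rw [Finset.sum_insert ha, Finset.sum_insert ha, hb.add_right, ih,
      hb.smul_right]

include hb in
theorem christoffelLower_add (V W Z Z') : christoffelLower b q₀ V W (Z + Z')
    = christoffelLower b q₀ V W Z + christoffelLower b q₀ V W Z' := by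
  simp only [christoffelLower, hb.fderiv_add_right, map_add]
  ring

include hb in
theorem christoffelLower_smul (c : ℝ) (V W Z) : christoffelLower b q₀ V W (c • Z)
    = c * christoffelLower b q₀ V W Z := by
  simp only [christoffelLower, hb.fderiv_smul_right, map_smul, smul_eq_mul]
  ring

include hb in
theorem christoffelLower_sum {ι : Type*} (s : Finset ι) (V W) (c : ι → ℝ) (Z : ι → P) :
    christoffelLower b q₀ V W (∑ i ∈ s, c i • Z i)
      = ∑ i ∈ s, c i * christoffelLower b q₀ V W (Z i) := by
  classical
  induction s using Finset.induction_on with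
  | empty => simpa using hb.christoffelLower_smul 0 V W 0
  | insert a s ha ih => rw [Finset.sum_insert ha, Finset.sum_insert ha, hb.christoffelLower_add,
      ih, hb.christoffelLower_smul]

end DifferentiableMetricAt

/-- The tangent vector `F_* ε_i` of the graph of `u`. -/
noncomputable def graphTangent (u : EuclideanSpace ℝ (Fin m) → ℝ) (y : EuclideanSpace ℝ (Fin m)) (i : Fin m) :
    ℝ × EuclideanSpace ℝ (Fin m) :=
  (fderiv ℝ u y (EuclideanSpace.single i 1), EuclideanSpace.single i 1)

theorem graphTangent_eq (u : EuclideanSpace ℝ (Fin m) → ℝ) (y : EuclideanSpace ℝ (Fin m)) (i : Fin m) :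
    graphTangent u y i = fderiv ℝ u y (EuclideanSpace.single i 1) •
      ((1 : ℝ), (0 : EuclideanSpace ℝ (Fin m))) + (0, EuclideanSpace.single i 1) := by
  simp [graphTangent]

/-- Gram matrix of the graph of `u` in the metric `b`. -/
noncomputable def graphGram (b : ℝ × EuclideanSpace ℝ (Fin m) → ℝ × EuclideanSpace ℝ (Fin m) →
      ℝ × EuclideanSpace ℝ (Fin m) → ℝ) (u : EuclideanSpace ℝ (Fin m) → ℝ)
    (y : EuclideanSpace ℝ (Fin m)) : Matrix (Fin m) (Fin m) ℝ :=
  Matrix.of fun i j => b (u y, y) (graphTangent u y i) (graphTangent u y j)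

variable {b : ℝ × EuclideanSpace ℝ (Fin m) → ℝ × EuclideanSpace ℝ (Fin m) →
      ℝ × EuclideanSpace ℝ (Fin m) → ℝ} {u : EuclideanSpace ℝ (Fin m) → ℝ}
    {y₀ : EuclideanSpace ℝ (Fin m)}

/-- Derivatives along coordinate lines. -/
theorem hasDerivAt_line {f : EuclideanSpace ℝ (Fin m) → ℝ} (hf : DifferentiableAt ℝ f y₀)
    (v : EuclideanSpace ℝ (Fin m)) :
    HasDerivAt (fun s : ℝ => f (y₀ + s • v)) (fderiv ℝ f y₀ v) 0 := by
  have h1 : HasDerivAt (fun s : ℝ => y₀ + s • v) v 0 := by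
    simpa using ((hasDerivAt_id (0 : ℝ)).smul_const v).const_add y₀
  have h2 : HasFDerivAt f (fderiv ℝ f y₀) (y₀ + (0 : ℝ) • v) := by simpa using hf.hasFDerivAt
  exact h2.comp_hasDerivAt 0 h1

/-- Both quantities depend on y in two ways: through the base point (u y, y), which moves with
velocity F_*ε_k, and through the tangent vectors F_*ε_i, whose derivative is the second derivative
of u times ∂_t. -/
theorem graphGram_hasDerivAt (hb : DifferentiableMetricAt b (u y₀, y₀))
    (hu : ContDiffAt ℝ 2 u y₀) (k i j : Fin m) :
    HasDerivAt (fun s : ℝ => graphGram b u (y₀ + s • EuclideanSpace.single k 1) i j)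
      (fderiv ℝ (fun q => b q (graphTangent u y₀ i) (graphTangent u y₀ j)) (u y₀, y₀)
          (graphTangent u y₀ k)
        + fderiv ℝ (fun z => fderiv ℝ u z (EuclideanSpace.single i 1)) y₀ (EuclideanSpace.single k 1)
          * b (u y₀, y₀) (1, 0) (graphTangent u y₀ j)
        + fderiv ℝ (fun z => fderiv ℝ u z (EuclideanSpace.single j 1)) y₀ (EuclideanSpace.single k 1)
          * b (u y₀, y₀) (1, 0) (graphTangent u y₀ i)) 0 ∧
    HasDerivAt (fun s : ℝ => b (u (y₀ + s • EuclideanSpace.single k 1),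
        y₀ + s • EuclideanSpace.single k 1) (1, 0) (graphTangent u (y₀ + s • EuclideanSpace.single k 1) j))
      (fderiv ℝ (fun q => b q (1, 0) (graphTangent u y₀ j)) (u y₀, y₀) (graphTangent u y₀ k)
        + fderiv ℝ (fun z => fderiv ℝ u z (EuclideanSpace.single j 1)) y₀ (EuclideanSpace.single k 1)
          * b (u y₀, y₀) (1, 0) (1, 0)) 0 := by
  set T : ℝ × EuclideanSpace ℝ (Fin m) := (1, 0) with hT
  set e : Fin m → ℝ × EuclideanSpace ℝ (Fin m) := fun i => (0, EuclideanSpace.single i 1) with he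
  have hud : DifferentiableAt ℝ u y₀ := hu.differentiableAt (by norm_num)
  have hp : ∀ i, HasDerivAt (fun s : ℝ => fderiv ℝ u (y₀ + s • EuclideanSpace.single k (1 : ℝ))
      (EuclideanSpace.single i 1)) (fderiv ℝ (fun z => fderiv ℝ u z (EuclideanSpace.single i 1)) y₀
        (EuclideanSpace.single k 1)) 0 := by
    intro i
    refine hasDerivAt_line (f := fun z => fderiv ℝ u z (EuclideanSpace.single i 1)) ?_ _
    have : DifferentiableAt ℝ (fderiv ℝ u) y₀ :=
      (hu.fderiv_right (m := 1) (by norm_num)).differentiableAt (by norm_num)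
    exact this.clm_apply (differentiableAt_const _)
  have hX : ∀ V W, HasDerivAt (fun s : ℝ => b (u (y₀ + s • EuclideanSpace.single k (1 : ℝ)),
        y₀ + s • EuclideanSpace.single k 1) V W)
      (fderiv ℝ (fun q => b q V W) (u y₀, y₀) (graphTangent u y₀ k)) 0 := by
    intro V W
    have hF : HasFDerivAt (fun y => (u y, y)) ((fderiv ℝ u y₀).prod (.id ℝ _)) y₀ :=
      hud.hasFDerivAt.prodMk (hasFDerivAt_id y₀)
    have h2 : HasFDerivAt (fun y => b (u y, y) V W) _ y₀ :=
      HasFDerivAt.comp (g := fun q => b q V W) y₀ (hb.diff V W).hasFDerivAt hF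
    have h3 := hasDerivAt_line h2.differentiableAt (EuclideanSpace.single k 1)
    rw [h2.fderiv] at h3
    exact h3
  have hgt : ∀ y i, graphTangent u y i = fderiv ℝ u y (EuclideanSpace.single i 1) • T + e i :=
    fun y i => graphTangent_eq u y i
  constructor
  · have e1 : ∀ y, graphGram b u y i j
        = fderiv ℝ u y (EuclideanSpace.single i 1) * (fderiv ℝ u y (EuclideanSpace.single j 1)
            * b (u y, y) T T + b (u y, y) T (e j))
          + (fderiv ℝ u y (EuclideanSpace.single j 1) * b (u y, y) (e i) T
            + b (u y, y) (e i) (e j)) := by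
      intro y
      simp only [graphGram, Matrix.of_apply, hgt, hb.add_left, hb.add_right, hb.smul_left,
        hb.smul_right]
      ring
    simp only [e1]
    refine (((hp i).mul (((hp j).mul (hX T T)).add (hX T (e j)))).add
      (((hp j).mul (hX (e i) T)).add (hX (e i) (e j)))).congr_deriv ?_
    simp only [hgt, hb.fderiv_add_left, hb.fderiv_add_right, hb.fderiv_smul_left,
        hb.fderiv_smul_right, map_add, map_smul, smul_eq_mul]
    simp only [hb.add_right, hb.smul_right, hb.symm _ T (e i), zero_smul, add_zero, Pi.add_apply,
      Pi.mul_apply]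
    ring
  · have e1 : ∀ y, b (u y, y) T (graphTangent u y j)
        = fderiv ℝ u y (EuclideanSpace.single j 1) * b (u y, y) T T + b (u y, y) T (e j) := by
      intro y
      simp only [hgt, hb.add_right, hb.smul_right]
    simp only [e1]
    refine (((hp j).mul (hX T T)).add (hX T (e j))).congr_deriv ?_
    simp only [hgt, hb.fderiv_add_right, hb.fderiv_smul_right, zero_smul, add_zero, map_add,
      map_smul, smul_eq_mul]
    ring

theorem graphGram_symm (hb : DifferentiableMetricAt b (u y₀, y₀)) (y) :
    (graphGram b u y)ᵀ = graphGram b u y := by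
  ext i j
  simp only [Matrix.transpose_apply, graphGram, Matrix.of_apply]
  exact hb.symm _ _ _

/-- The vector field `√det g · grad τ`, `grad τ` being the tangential part of `-∂_t`. -/
noncomputable def graphFlux (b : ℝ × EuclideanSpace ℝ (Fin m) → ℝ × EuclideanSpace ℝ (Fin m) →
      ℝ × EuclideanSpace ℝ (Fin m) → ℝ) (u : EuclideanSpace ℝ (Fin m) → ℝ)
    (y : EuclideanSpace ℝ (Fin m)) (i : Fin m) : ℝ :=
  -(√(graphGram b u y).det *
    ((graphGram b u y)⁻¹ *ᵥ fun j => b (u y, y) (1, 0) (graphTangent u y j)) i)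

/-- The field N is the component of ∂_t normal to the graph, so the tangential part of -∂_t equals N
- ∂_t. The divergence of N along the graph is the trace of the second fundamental form in the
direction N. That of ∂_t is half the trace of the Lie derivative of the metric along ∂_t, that is,
of its time derivative. The proof checks this in coordinates, with Jacobi's formula for √det g and
the Koszul formula for the connection. -/
theorem div_graphFlux (hb : DifferentiableMetricAt b (u y₀, y₀)) (hu : ContDiffAt ℝ 2 u y₀)
    (hg : 0 < (graphGram b u y₀).det)
    (hZ : ∀ i, DifferentiableAt ℝ (fun y => graphFlux b u y i) y₀) {N : ℝ × EuclideanSpace ℝ (Fin m)}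
    (hN : N = ((1 : ℝ), (0 : EuclideanSpace ℝ (Fin m))) +
      ∑ k, (-((graphGram b u y₀)⁻¹ *ᵥ fun j => b (u y₀, y₀) (1, 0) (graphTangent u y₀ j)) k) •
        graphTangent u y₀ k) :
    ∑ i, fderiv ℝ (fun y => graphFlux b u y i) y₀ (EuclideanSpace.single i 1)
      = √(graphGram b u y₀).det * ∑ i, ∑ j, (graphGram b u y₀)⁻¹ i j *
        (coordSecondFundForm b (fun y => (u y, y)) N y₀ (EuclideanSpace.single i 1)
          (EuclideanSpace.single j 1)
          - 1 / 2 * fderiv ℝ (fun q => b q (graphTangent u y₀ i) (graphTangent u y₀ j)) (u y₀, y₀)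
            (1, 0)) := by
  set T : ℝ × EuclideanSpace ℝ (Fin m) := (1, 0) with hT
  set e : Fin m → EuclideanSpace ℝ (Fin m) := fun i => EuclideanSpace.single i 1 with he
  set Fv := graphTangent u y₀ with hFv
  set U : Fin m → Fin m → ℝ := fun k i => fderiv ℝ (fun z => fderiv ℝ u z (e i)) y₀ (e k) with hU
  set X := fun V W Z => fderiv ℝ (fun q => b q V W) (u y₀, y₀) Z with hX
  set t : Fin m → ℝ := fun j => b (u y₀, y₀) T (Fv j) with ht
  set A := graphGram b u y₀ with hA
  set R : Fin m → ℝ := fun k => -(A⁻¹ *ᵥ t) k with hR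
  set Dg : Fin m → Matrix (Fin m) (Fin m) ℝ := fun k => Matrix.of fun i j =>
    X (Fv i) (Fv j) (Fv k) + U k i * t j + U k j * t i with hDg
  set Dt : Fin m → Fin m → ℝ := fun k j => X T (Fv j) (Fv k) + U k j * b (u y₀, y₀) T T with hDt
  have hGs : ∀ a c, A⁻¹ a c = A⁻¹ c a := by
    intro a c
    have h1 : A⁻¹ᵀ = A⁻¹ := by
      rw [Matrix.transpose_nonsing_inv, hA, graphGram_symm hb]
    exact (congrFun (congrFun h1 c) a)
  have hXs : ∀ V W Z, X V W Z = X W V Z := fun V W Z => hb.fderiv_symm V W Z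
  have hUs : ∀ k i, U k i = U i k := by
    intro k i
    have hdd : DifferentiableAt ℝ (fderiv ℝ u) y₀ :=
      (hu.fderiv_right (m := 1) (by norm_num)).differentiableAt (by norm_num)
    have e1 : ∀ k i, U k i = fderiv ℝ (fderiv ℝ u) y₀ (e k) (e i) := by
      intro k i
      simp only [hU]
      rw [fderiv_clm_apply hdd (differentiableAt_const _)]
      simp
    rw [e1, e1]
    exact (hu.isSymmSndFDerivAt (by simp)) _ _
  have hderiv : ∀ k i, HasDerivAt (fun s : ℝ => graphFlux b u (y₀ + s • e k) i)
      (√A.det * (1 / 2 * (A⁻¹ * Dg k).trace * R i - (A⁻¹ *ᵥ (Dg k *ᵥ R)) i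
        - (A⁻¹ *ᵥ Dt k) i)) 0 := by
    intro k i
    have h1 : ∀ i j, HasDerivAt (fun s : ℝ => graphGram b u (y₀ + s • e k) i j) (Dg k i j) 0 :=
      fun i j => (graphGram_hasDerivAt hb hu k i j).1
    have h2 : ∀ j, HasDerivAt (fun s : ℝ => b (u (y₀ + s • e k), y₀ + s • e k) T
        (graphTangent u (y₀ + s • e k) j)) (Dt k j) 0 :=
      fun j => (graphGram_hasDerivAt hb hu k j j).2
    have e0 : graphGram b u (y₀ + (0 : ℝ) • e k) = A := by simp [hA]
    have hA0 : (graphGram b u (y₀ + (0 : ℝ) • e k)).det ≠ 0 := by rw [e0]; exact hg.ne'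
    have h3 := (HasDerivAt.matrix_det (A := fun s => graphGram b u (y₀ + s • e k)) h1 hA0).sqrt hA0
    have h4 := fun i j => HasDerivAt.matrix_inv (A := fun s => graphGram b u (y₀ + s • e k)) h1 hA0 i j
    simp only [e0] at h3 h4
    have h5 : HasDerivAt (fun s : ℝ => ((graphGram b u (y₀ + s • e k))⁻¹ *ᵥ
        fun j => b (u (y₀ + s • e k), y₀ + s • e k) T (graphTangent u (y₀ + s • e k) j)) i)
        (∑ j, (-(A⁻¹ * Dg k * A⁻¹) i j * t j + A⁻¹ i j * Dt k j)) 0 := by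
      simp only [Matrix.mulVec, dotProduct]
      refine (HasDerivAt.fun_sum fun j _ => (h4 i j).mul (h2 j)).congr_deriv ?_
      simp [ht, hFv, hA]
    refine ((h3.mul h5).neg).congr_deriv ?_
    have hs : √A.det * √A.det = A.det := Real.mul_self_sqrt hg.le
    have hs0 : √A.det ≠ 0 := (Real.sqrt_pos.2 hg).ne'
    have e2 : A.det * (A⁻¹ * Dg k).trace / (2 * √A.det) = √A.det * (1 / 2 * (A⁻¹ * Dg k).trace) := by
      rw [div_eq_iff (by positivity)]
      linear_combination (-(A⁻¹ * Dg k).trace) * hs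
    have e3 : (A⁻¹ *ᵥ (Dg k *ᵥ R)) i = ∑ j, -(A⁻¹ * Dg k * A⁻¹) i j * t j := by
      have : R = -(A⁻¹ *ᵥ t) := rfl
      rw [this, Matrix.mulVec_neg, Matrix.mulVec_neg, Matrix.mulVec_mulVec, Matrix.mulVec_mulVec]
      simp only [Pi.neg_apply, Matrix.mulVec, dotProduct, Matrix.mul_assoc, neg_mul,
        Finset.sum_neg_distrib]
    have e4 : ((graphGram b u (y₀ + (0 : ℝ) • e k))⁻¹ *ᵥ fun j => b (u (y₀ + (0 : ℝ) • e k),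
        y₀ + (0 : ℝ) • e k) T (graphTangent u (y₀ + (0 : ℝ) • e k) j)) i = - R i := by
      simp [hR, ht, hFv, hA]
    rw [e2, e3, e4, e0, Finset.sum_add_distrib]
    simp only [Matrix.mulVec, dotProduct]
    ring
  have hdiv : ∀ i, fderiv ℝ (fun y => graphFlux b u y i) y₀ (e i)
      = √A.det * (1 / 2 * (A⁻¹ * Dg i).trace * R i - (A⁻¹ *ᵥ (Dg i *ᵥ R)) i
        - (A⁻¹ *ᵥ Dt i) i) := fun i =>
    (hasDerivAt_line (hZ i) (e i)).unique (hderiv i i)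
  rw [Finset.sum_congr rfl fun i _ => hdiv i, ← Finset.mul_sum]
  congr 1
  have hsec : ∀ a c, coordSecondFundForm b (fun y => (u y, y)) N y₀ (e a) (e c)
      = -(U a c * (b (u y₀, y₀) T T + ∑ k, R k * t k)
        + (X (Fv c) T (Fv a) + X (Fv a) T (Fv c) - X (Fv a) (Fv c) T) / 2
        + ∑ k, R k * ((X (Fv c) (Fv k) (Fv a) + X (Fv a) (Fv k) (Fv c) - X (Fv a) (Fv c) (Fv k)) / 2)) := by
    intro a c
    have hudev : ∀ᶠ z in 𝓝 y₀, DifferentiableAt ℝ u z :=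
      (hu.eventually (by simp)).mono fun z hz => hz.differentiableAt (by norm_num)
    have hF1 : ∀ z, DifferentiableAt ℝ u z → ∀ v, fderiv ℝ (fun y => (u y, y)) z v
        = (fderiv ℝ u z v, v) := by
      intro z hz v
      have := (hz.hasFDerivAt.prodMk (hasFDerivAt_id z)).fderiv
      simp only [id] at this
      rw [this]; rfl
    have hF2 : fderiv ℝ (fun z => fderiv ℝ (fun y => (u y, y)) z (e c)) y₀ (e a)
        = U a c • T := by
      have h1 : (fun z => fderiv ℝ (fun y => (u y, y)) z (e c)) =ᶠ[𝓝 y₀]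
          fun z => (fderiv ℝ u z (e c), e c) := hudev.mono fun z hz => hF1 z hz _
      rw [h1.fderiv_eq]
      have hdd : DifferentiableAt ℝ (fderiv ℝ u) y₀ :=
        (hu.fderiv_right (m := 1) (by norm_num)).differentiableAt (by norm_num)
      have h2 : DifferentiableAt ℝ (fun z => fderiv ℝ u z (e c)) y₀ :=
        hdd.clm_apply (differentiableAt_const _)
      rw [(h2.hasFDerivAt.prodMk (hasFDerivAt_const (e c) y₀)).fderiv]
      simp [hT, hU]
    have hFa : ∀ a, fderiv ℝ (fun y => (u y, y)) y₀ (e a) = Fv a := fun a =>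
      hF1 y₀ hudev.self_of_nhds _
    rw [coordSecondFundForm, hF2, hFa, hFa, hN, hb.christoffelLower_add, hb.christoffelLower_sum,
      hb.smul_left, hb.add_right, hb.sum_right]
    simp only [christoffelLower]
    ring
  have eL : ∑ i, (1 / 2 * (A⁻¹ * Dg i).trace * R i - (A⁻¹ *ᵥ (Dg i *ᵥ R)) i - (A⁻¹ *ᵥ Dt i) i)
      = ∑ a, ∑ c, A⁻¹ a c * ((∑ k, 1 / 2 * R k * Dg k c a) - (∑ k, R k * Dg a c k) - Dt a c) := by
    rw [Finset.sum_sub_distrib, Finset.sum_sub_distrib]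
    have e5 : ∀ a c : Fin m, A⁻¹ a c * ((∑ k, 1 / 2 * R k * Dg k c a) - (∑ k, R k * Dg a c k)
        - Dt a c) = A⁻¹ a c * (∑ k, 1 / 2 * R k * Dg k c a) - A⁻¹ a c * (∑ k, R k * Dg a c k)
          - A⁻¹ a c * Dt a c := fun a c => by ring
    rw [Finset.sum_congr rfl fun a _ => Finset.sum_congr rfl fun c _ => e5 a c]
    simp_rw [Finset.sum_sub_distrib]
    congr 1
    · congr 1
      · simp only [Matrix.trace, Matrix.diag_apply, Matrix.mul_apply, Finset.mul_sum,
          Finset.sum_mul]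
        rw [Finset.sum_comm]
        refine Finset.sum_congr rfl fun a _ => ?_
        rw [Finset.sum_comm]
        refine Finset.sum_congr rfl fun c _ => Finset.sum_congr rfl fun k _ => ?_
        ring
      · simp only [Matrix.mulVec, dotProduct]
        refine Finset.sum_congr rfl fun a _ => Finset.sum_congr rfl fun c _ => ?_
        congr 1
        exact Finset.sum_congr rfl fun k _ => mul_comm _ _
  rw [eL]
  -- Both sides are contractions with the symmetric g⁻¹, and the entries match only after
  -- symmetrization. The second derivatives of u then cancel by their symmetry, and the rest is
  -- linear in the first derivatives of b.
  refine sum_sum_symm_eq_of_add_eq hGs fun a c => ?_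
  rw [hsec, hsec]
  simp only [hDg, hDt, Matrix.of_apply]
  have expand : ∀ a c, (∑ k, R k * ((X (Fv c) (Fv k) (Fv a) + X (Fv a) (Fv k) (Fv c)
      - X (Fv a) (Fv c) (Fv k)) / 2)) = 1 / 2 * (∑ k, R k * X (Fv c) (Fv k) (Fv a))
        + 1 / 2 * (∑ k, R k * X (Fv a) (Fv k) (Fv c))
        - 1 / 2 * ∑ k, R k * X (Fv a) (Fv c) (Fv k) := by
    intro a c
    simp only [Finset.mul_sum, ← Finset.sum_add_distrib, ← Finset.sum_sub_distrib]
    exact Finset.sum_congr rfl fun k _ => by ring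
  have ex1 : ∀ a c, (∑ k, 1 / 2 * R k * (X (Fv c) (Fv a) (Fv k) + U k c * t a + U k a * t c))
      = 1 / 2 * (∑ k, R k * X (Fv c) (Fv a) (Fv k)) + 1 / 2 * (∑ k, R k * U k c) * t a
        + 1 / 2 * (∑ k, R k * U k a) * t c := by
    intro a c
    simp only [Finset.mul_sum, Finset.sum_mul, ← Finset.sum_add_distrib]
    exact Finset.sum_congr rfl fun k _ => by ring
  have ex2 : ∀ a c, (∑ k, R k * (X (Fv c) (Fv k) (Fv a) + U a c * t k + U a k * t c))
      = (∑ k, R k * X (Fv c) (Fv k) (Fv a)) + U a c * (∑ k, R k * t k)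
        + (∑ k, R k * U k a) * t c := by
    intro a c
    simp only [Finset.mul_sum, Finset.sum_mul, ← Finset.sum_add_distrib]
    exact Finset.sum_congr rfl fun k _ => by rw [hUs a k]; ring
  simp only [expand, ex1, ex2]
  rw [hXs T (Fv c), hXs T (Fv a), hUs c a]
  have s2 : ∑ k, R k * X (Fv c) (Fv a) (Fv k) = ∑ k, R k * X (Fv a) (Fv c) (Fv k) :=
    Finset.sum_congr rfl fun k _ => by rw [hXs]
  have s3 : ∀ a c, fderiv ℝ (fun q => b q (Fv a) (Fv c)) (u y₀, y₀) T = X (Fv a) (Fv c) T :=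
    fun _ _ => rfl
  rw [s2, s3, s3, hXs (Fv c) (Fv a) T]
  ring

end GraphDivergence

/-! ### Inner products and gradients in a frame -/

section InnerForms

open Matrix

/-- A positive definite symmetric bilinear form. -/
structure IsInnerForm {T : Type*} [AddCommGroup T] [Module ℝ T] (s : T → T → ℝ) : Prop where
  symm : ∀ v w, s v w = s w v
  add_left : ∀ v v' w, s (v + v') w = s v w + s v' w
  smul_left : ∀ (c : ℝ) v w, s (c • v) w = c * s v w
  pos : ∀ v, v ≠ 0 → 0 < s v v

namespace IsInnerForm

variable {T : Type*} [AddCommGroup T] [Module ℝ T] {s : T → T → ℝ} (hs : IsInnerForm s)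

include hs

theorem add_right (v w w') : s v (w + w') = s v w + s v w' := by
  rw [hs.symm, hs.add_left, hs.symm w, hs.symm w']

theorem smul_right (c : ℝ) (v w) : s v (c • w) = c * s v w := by
  rw [hs.symm, hs.smul_left, hs.symm w]

theorem zero_left (w) : s 0 w = 0 := by simpa using hs.smul_left 0 0 w

theorem sum_left {ι : Type*} (t : Finset ι) (v : ι → T) (w) :
    s (∑ i ∈ t, v i) w = ∑ i ∈ t, s (v i) w := by
  classical
  induction t using Finset.induction_on with
  | empty => simpa using hs.zero_left w
  | insert a t ha ih => rw [Finset.sum_insert ha, Finset.sum_insert ha, hs.add_left, ih]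

theorem sum_right {ι : Type*} (t : Finset ι) (v : ι → T) (w) :
    s w (∑ i ∈ t, v i) = ∑ i ∈ t, s w (v i) := by
  rw [hs.symm, hs.sum_left]
  exact Finset.sum_congr rfl fun i _ => hs.symm _ _

theorem self_nonneg (v) : 0 ≤ s v v := by
  by_cases h : v = 0
  · rw [h, hs.zero_left]
  · exact (hs.pos v h).le

theorem sub_left (v v' w) : s (v - v') w = s v w - s v' w := by
  rw [sub_eq_add_neg, ← neg_one_smul ℝ v', hs.add_left, hs.smul_left]; ring

theorem sub_right (v w w') : s v (w - w') = s v w - s v w' := by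
  rw [hs.symm, hs.sub_left, hs.symm w, hs.symm w']

theorem eq_of_forall_eq {g g' : T} (h : ∀ v, s g v = s g' v) : g = g' := by
  by_contra hne
  have h1 := hs.pos (g - g') (sub_ne_zero.2 hne)
  rw [hs.sub_left, h] at h1
  simp at h1

theorem cauchy_schwarz (v w) : s v w ^ 2 ≤ s v v * s w w := by
  by_cases h : w = 0
  · simp [h, hs.symm v, hs.zero_left]
  have hw := hs.pos w h
  have h1 := hs.self_nonneg (s w w • v - s v w • w)
  have e : s (s w w • v - s v w • w) (s w w • v - s v w • w)
      = s w w * (s v v * s w w - s v w ^ 2) := by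
    simp only [hs.sub_left, hs.sub_right, hs.smul_left, hs.smul_right, hs.symm w v]
    ring
  rw [e] at h1
  nlinarith [nonneg_of_mul_nonneg_right h1 hw]

theorem comp {T' : Type*} [AddCommGroup T'] [Module ℝ T'] {A : T' →ₗ[ℝ] T}
    (hA : Function.Injective A) : IsInnerForm fun v w => s (A v) (A w) where
  symm v w := hs.symm _ _
  add_left v v' w := by simp [hs.add_left]
  smul_left c v w := by simp [hs.smul_left]
  pos v hv := hs.pos _ fun h => hv (hA (by simpa using h))

omit hs in
/-- Gram matrix of a family of vectors. -/
def gram {n : Type*} (s : T → T → ℝ) (a : n → T) : Matrix n n ℝ :=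
  Matrix.of fun i j => s (a i) (a j)

variable {n : Type*} [Fintype n]

theorem dotProduct_gram (a : n → T) (c d : n → ℝ) :
    c ⬝ᵥ gram s a *ᵥ d = s (∑ i, c i • a i) (∑ i, d i • a i) := by
  simp only [hs.sum_left, hs.sum_right, hs.smul_left, hs.smul_right, dotProduct, Matrix.mulVec,
    gram, Matrix.of_apply, Finset.mul_sum]
  exact Finset.sum_congr rfl fun i _ => Finset.sum_congr rfl fun j _ => by ring

theorem gram_posDef {a : n → T} (ha : LinearIndependent ℝ a) : (gram s a).PosDef := by
  refine Matrix.PosDef.of_dotProduct_mulVec_pos ?_ ?_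
  · ext i j
    simp [gram, hs.symm (a j)]
  · intro x hx
    rw [star_trivial, hs.dotProduct_gram]
    refine hs.pos _ fun h => hx ?_
    ext i
    exact (Fintype.linearIndependent_iff.1 ha) x h i

variable [DecidableEq n]

/-- The gradient of a covector `p`, computed in a frame `a`. -/
theorem gradient_frame {a : n → T} (ha : LinearIndependent ℝ a) (hsp : ⊤ ≤ Submodule.span ℝ (range a))
    (p : T →ₗ[ℝ] ℝ) (v : T) :
    s (∑ i, ((gram s a)⁻¹ *ᵥ fun j => p (a j)) i • a i) v = p v := by
  have hG := hs.gram_posDef ha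
  have hu : IsUnit (gram s a).det := isUnit_iff_ne_zero.2 hG.det_pos.ne'
  have hbase : ∀ k, s (∑ i, ((gram s a)⁻¹ *ᵥ fun j => p (a j)) i • a i) (a k) = p (a k) := by
    intro k
    have h1 : (gram s a *ᵥ ((gram s a)⁻¹ *ᵥ fun j => p (a j))) k = p (a k) := by
      rw [Matrix.mulVec_mulVec, Matrix.mul_nonsing_inv _ hu, Matrix.one_mulVec]
    rw [← h1, hs.sum_left]
    simp only [hs.smul_left, Matrix.mulVec, dotProduct, gram, Matrix.of_apply]
    exact Finset.sum_congr rfl fun i _ => by rw [hs.symm (a k)]; ring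
  have hv : v ∈ Submodule.span ℝ (range a) := hsp trivial
  induction hv using Submodule.span_induction with
  | mem x hx => obtain ⟨k, rfl⟩ := hx; exact hbase k
  | zero => rw [hs.symm, hs.zero_left, map_zero]
  | add x y _ _ hx hy => rw [hs.add_right, hx, hy, map_add]
  | smul c x _ hx => rw [hs.smul_right, hx, map_smul, smul_eq_mul]

end IsInnerForm

end InnerForms

/-! ### Gradients on a manifold with boundary -/

section Gradients

open Matrix

variable {m : ℕ} [NeZero m] {Sig : Type*} [TopologicalSpace Sig]
  [ChartedSpace (EuclideanHalfSpace m) Sig] {x : Sig}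
  {σ : (x : Sig) → TangentSpace (𝓡∂ m) x → TangentSpace (𝓡∂ m) x → ℝ} 

omit [NeZero m] in
theorem single_linearIndependent :
    LinearIndependent ℝ (fun i : Fin m => (EuclideanSpace.single i (1 : ℝ) : EuclideanSpace ℝ (Fin m))) := by
  have := (EuclideanSpace.basisFun (Fin m) ℝ).toBasis.linearIndependent
  convert! this using 1
  ext i; simp

omit [NeZero m] in
theorem single_span :
    ⊤ ≤ Submodule.span ℝ (range fun i : Fin m => (EuclideanSpace.single i (1 : ℝ) : EuclideanSpace ℝ (Fin m))) := by
  have := (EuclideanSpace.basisFun (Fin m) ℝ).toBasis.span_eq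
  convert! this.ge using 3
  ext i; simp

omit [NeZero m] in
theorem sum_single_smul (v : EuclideanSpace ℝ (Fin m)) :
    ∑ i, v i • (EuclideanSpace.single i (1 : ℝ) : EuclideanSpace ℝ (Fin m)) = v := by
  ext k
  simp [Finset.sum_apply, Pi.single_apply]

theorem sigma_gradVec (hσ : IsInnerForm (σ x)) (u : Sig → ℝ) (v : TangentSpace (𝓡∂ m) x) :
    σ x (gradVec σ u x) v = dAlong u x v := by
  exact hσ.gradient_frame (a := fun i => coordVec x i) (single_linearIndependent (m := m))
    (single_span (m := m)) ((mfderiv (𝓡∂ m) 𝓘(ℝ, ℝ) u x).toLinearMap) v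

theorem gradVec_eq_of_forall (hσ : IsInnerForm (σ x)) {u : Sig → ℝ} {g : TangentSpace (𝓡∂ m) x}
    (h : ∀ v, σ x g v = dAlong u x v) : gradVec σ u x = g :=
  hσ.eq_of_forall_eq fun v => by rw [h, sigma_gradVec hσ]

theorem gradNormSq_eq (hσ : IsInnerForm (σ x)) (u : Sig → ℝ) :
    gradNormSq σ u x = σ x (gradVec σ u x) (gradVec σ u x) := by
  rw [sigma_gradVec hσ]; rfl

theorem gradNormSq_nonneg (hσ : IsInnerForm (σ x)) (u : Sig → ℝ) : 0 ≤ gradNormSq σ u x := by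
  rw [gradNormSq_eq hσ]; exact hσ.self_nonneg _

theorem dAlong_sq_le (hσ : IsInnerForm (σ x)) (u : Sig → ℝ) (v : TangentSpace (𝓡∂ m) x) :
    dAlong u x v ^ 2 ≤ gradNormSq σ u x * σ x v v := by
  rw [gradNormSq_eq hσ, ← sigma_gradVec hσ]; exact hσ.cauchy_schwarz _ _

/-- The inner product `⟨Du, Dη⟩`. -/
noncomputable def gradInner (σ : (x : Sig) → TangentSpace (𝓡∂ m) x → TangentSpace (𝓡∂ m) x → ℝ) (u η : Sig → ℝ)
    (x : Sig) : ℝ := dAlong η x (gradVec σ u x)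

/-- The hypothesis, applied to the gradient itself, reads |du|⁴ ≤ K |du|². -/
theorem gradNormSq_le_of_forall (hσ : IsInnerForm (σ x)) {u : Sig → ℝ} {K : ℝ} (hK : 0 ≤ K)
    (h : ∀ v, dAlong u x v ^ 2 ≤ K * σ x v v) : gradNormSq σ u x ≤ K := by
  have h1 := h (gradVec σ u x)
  rw [← gradNormSq_eq hσ] at h1
  have h2 := gradNormSq_nonneg hσ u
  change gradNormSq σ u x ^ 2 ≤ _ at h1
  by_contra hlt
  push Not at hlt
  nlinarith

end Gradients

/-! ### Coordinate frames -/

section Frames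

variable {m : ℕ} [NeZero m] {Sig : Type*} [TopologicalSpace Sig]
  [ChartedSpace (EuclideanHalfSpace m) Sig]

/-- The coordinate frame of the chart around `c`, at the point with coordinates `y`. -/
noncomputable def chartFrame (c : Sig) (y : EuclideanSpace ℝ (Fin m)) :
    EuclideanSpace ℝ (Fin m) →L[ℝ] TangentSpace (𝓡∂ m) ((extChartAt (𝓡∂ m) c).symm y) :=
  mfderivWithin 𝓘(ℝ, EuclideanSpace ℝ (Fin m)) (𝓡∂ m) (extChartAt (𝓡∂ m) c).symm (range (𝓡∂ m)) y

/-- The vectors of the coordinate frame. -/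
noncomputable def frameVec (c : Sig) (y : EuclideanSpace ℝ (Fin m)) (i : Fin m) :
    TangentSpace (𝓡∂ m) ((extChartAt (𝓡∂ m) c).symm y) :=
  chartFrame c y (EuclideanSpace.single i (1 : ℝ))

theorem chartFrame_self (x : Sig) [IsManifold (𝓡∂ m) ∞ Sig] (v : EuclideanSpace ℝ (Fin m)) :
    (chartFrame x (extChartAt (𝓡∂ m) x x) v : EuclideanSpace ℝ (Fin m)) = v := by
  have := mfderivWithin_range_extChartAt_symm (I := 𝓡∂ m) (x := x)
  rw [chartFrame, this]
  rfl

variable [IsManifold (𝓡∂ m) ∞ Sig] {c : Sig} {y : EuclideanSpace ℝ (Fin m)}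

theorem chartFrame_bijective (hy : y ∈ (extChartAt (𝓡∂ m) c).target) :
    Function.Bijective (chartFrame c y) :=
  (isInvertible_mfderivWithin_extChartAt_symm (I := 𝓡∂ m) hy).bijective

theorem chartFrame_injective (hy : y ∈ (extChartAt (𝓡∂ m) c).target) :
    Function.Injective (chartFrame c y) := (chartFrame_bijective hy).1

theorem frameVec_linearIndependent (hy : y ∈ (extChartAt (𝓡∂ m) c).target) :
    LinearIndependent ℝ (frameVec c y) := by
  have := (single_linearIndependent (m := m)).map' ((chartFrame c y).toLinearMap)
    (LinearMap.ker_eq_bot.2 (chartFrame_injective hy))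
  exact this

theorem frameVec_span (hy : y ∈ (extChartAt (𝓡∂ m) c).target) :
    ⊤ ≤ Submodule.span ℝ (range (frameVec c y)) := by
  have h : range (frameVec c y) = (chartFrame c y).toLinearMap ''
      (range fun i : Fin m => (EuclideanSpace.single i (1 : ℝ) : EuclideanSpace ℝ (Fin m))) := by
    rw [← range_comp]; rfl
  rw [h, ← Submodule.map_span, top_le_iff.1 (single_span (m := m)), Submodule.map_top]
  exact (LinearMap.range_eq_top.2 (chartFrame_bijective hy).2).ge

omit [IsManifold (𝓡∂ m) ∞ Sig] in
theorem chartFrame_apply (v : EuclideanSpace ℝ (Fin m)) :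
    chartFrame c y v = ∑ i, v i • frameVec c y i := by
  conv_lhs => rw [← sum_single_smul v]
  rw [map_sum]
  exact Finset.sum_congr rfl fun i _ => by rw [map_smul]; rfl

/-- Derivatives in coordinates. -/
theorem dAlong_chartFrame {u : Sig → ℝ} (hy : y ∈ (extChartAt (𝓡∂ m) c).target)
    (hu : MDifferentiableAt (𝓡∂ m) 𝓘(ℝ, ℝ) u ((extChartAt (𝓡∂ m) c).symm y))
    (v : EuclideanSpace ℝ (Fin m)) :
    dAlong u ((extChartAt (𝓡∂ m) c).symm y) (chartFrame c y v)
      = fderivWithin ℝ (u ∘ (extChartAt (𝓡∂ m) c).symm) (range (𝓡∂ m)) y v := by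
  have hyr : y ∈ range (𝓡∂ m) := extChartAt_target_subset_range c hy
  have h := mfderiv_comp_mfderivWithin (I := 𝓘(ℝ, EuclideanSpace ℝ (Fin m))) (I' := 𝓡∂ m)
    (I'' := 𝓘(ℝ, ℝ)) (f := (extChartAt (𝓡∂ m) c).symm) (g := u) (s := range (𝓡∂ m)) y hu
    (mdifferentiableWithinAt_extChartAt_symm hy)
    ((𝓡∂ m).uniqueDiffOn.uniqueMDiffOn y hyr)
  rw [mfderivWithin_eq_fderivWithin] at h
  rw [h]; rfl

theorem contDiffOn_comp_extChartAt_symm {u : Sig → ℝ} {n : WithTop ℕ∞} (hn : n ≤ ((⊤ : ℕ∞) : WithTop ℕ∞))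
    (hu : ContMDiff (𝓡∂ m) 𝓘(ℝ, ℝ) n u) (c : Sig) :
    ContDiffOn ℝ n (u ∘ (extChartAt (𝓡∂ m) c).symm) (extChartAt (𝓡∂ m) c).target := by
  have : IsManifold (𝓡∂ m) n Sig := IsManifold.of_le hn
  rw [← contMDiffOn_iff_contDiffOn]
  exact hu.comp_contMDiffOn (contMDiffOn_extChartAt_symm c)

omit [IsManifold (𝓡∂ m) ∞ Sig] in
theorem target_mem_nhdsWithin_range (hy : y ∈ (extChartAt (𝓡∂ m) c).target) :
    (extChartAt (𝓡∂ m) c).target ∈ 𝓝[range (𝓡∂ m)] y :=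
  extChartAt_target_mem_nhdsWithin_of_mem hy

theorem continuousOn_fderivWithin_comp {u : Sig → ℝ}
    (hu : ContMDiff (𝓡∂ m) 𝓘(ℝ, ℝ) 1 u) (c : Sig) (v : EuclideanSpace ℝ (Fin m)) :
    ContinuousOn (fun y => fderivWithin ℝ (u ∘ (extChartAt (𝓡∂ m) c).symm) (range (𝓡∂ m)) y v)
      (extChartAt (𝓡∂ m) c).target := by
  intro y hy
  have hyr : y ∈ range (𝓡∂ m) := extChartAt_target_subset_range c hy
  have h1 := (contDiffOn_comp_extChartAt_symm (n := 1) (by exact_mod_cast le_top) hu c) y hy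
  have h2 : ContDiffWithinAt ℝ 1 (u ∘ (extChartAt (𝓡∂ m) c).symm) (range (𝓡∂ m)) y :=
    h1.mono_of_mem_nhdsWithin (target_mem_nhdsWithin_range hy)
  have h3 := (h2.fderivWithin_right (m := 0) (𝓡∂ m).uniqueDiffOn (by simp) hyr).continuousWithinAt
  exact (h3.mono (extChartAt_target_subset_range c)).clm_apply continuousWithinAt_const

end Frames

/-! ### Slice metrics on the hypersurface -/

namespace SpacelikeHypersurface

section Slice

variable {m : ℕ} [NeZero m] {S : Type*} [TopologicalSpace S]
  [ChartedSpace (EuclideanSpace ℝ (Fin m)) S] {G : SplitSpacetime m S}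
  {Sig : Type*} [TopologicalSpace Sig] [ChartedSpace (EuclideanHalfSpace m) Sig]
  (D : SpacelikeHypersurface G Sig)

/-- The pull-back to `Sig` of `σ̄` on the slice `{τ = t}`. -/
noncomputable def slice (t : ℝ) (x : Sig) (v w : TangentSpace (𝓡∂ m) x) : ℝ :=
  G.spatial t (D.proj x) (mfderiv (𝓡∂ m) (𝓡 m) D.proj x v)
    (mfderiv (𝓡∂ m) (𝓡 m) D.proj x w)

theorem sigma_eq_slice (u : Sig → ℝ) (x : Sig) : D.sigma u x = D.slice (u x) x := rfl

theorem mfderiv_proj_injective (x : Sig) :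
    Function.Injective (mfderiv (𝓡∂ m) (𝓡 m) D.proj x) := by
  rw [injective_iff_map_eq_zero]
  intro v hv
  by_contra hne
  have h := D.spacelike x v hne
  rw [hv] at h
  simp only [SplitSpacetime.metric, map_zero, add_zero] at h
  nlinarith [mul_self_nonneg (dAlong D.height x v), sq_nonneg (G.lapse (D.height x, D.proj x))]

omit [NeZero m] in
theorem spatial_isInnerForm (t : ℝ) (p : S) : IsInnerForm fun v w => G.spatial t p v w where
  symm := G.spatial_symm t p
  add_left v v' w := by simp
  smul_left c v w := by simp
  pos := G.spatial_pos t p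

theorem slice_isInnerForm (t : ℝ) (x : Sig) : IsInnerForm (D.slice t x) :=
  (spatial_isInnerForm (G := G) t (D.proj x)).comp
    (A := (mfderiv (𝓡∂ m) (𝓡 m) D.proj x).toLinearMap) (D.mfderiv_proj_injective x)

theorem sigma_isInnerForm (u : Sig → ℝ) (x : Sig) : IsInnerForm (D.sigma u x) :=
  D.slice_isInnerForm (u x) x

/-- Coefficients of the slice metrics in the chart around `c`. -/
noncomputable def chartMetric (c : Sig) (q : ℝ × EuclideanSpace ℝ (Fin m)) (i j : Fin m) : ℝ :=
  D.slice q.1 ((extChartAt (𝓡∂ m) c).symm q.2) (frameVec c q.2 i) (frameVec c q.2 j)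

variable [IsManifold (𝓡 m) ∞ S] [IsManifold (𝓡∂ m) ∞ Sig]

/-- Smoothness of σ̄ is given in charts of S. In charts the projection is f = e' ∘ π ∘ e⁻¹, and near
a point the coefficients are those of σ̄ along f contracted with two columns of Df. Derivatives of f
are taken within the half space, so boundary points are included. -/
theorem chartMetric_contDiffOn (c : Sig) (i j : Fin m) :
    ContDiffOn ℝ ∞ (fun q : ℝ × EuclideanSpace ℝ (Fin m) => D.chartMetric c q i j)
      (univ ×ˢ (extChartAt (𝓡∂ m) c).target) := by
  rintro ⟨t₀, y₀⟩ ⟨-, hy₀ : y₀ ∈ (extChartAt (𝓡∂ m) c).target⟩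
  set e := extChartAt (𝓡∂ m) c with he
  set x₀ := e.symm y₀ with hx₀
  set e' := extChartAt (𝓡 m) (D.proj x₀) with he'
  set f : EuclideanSpace ℝ (Fin m) → EuclideanSpace ℝ (Fin m) := e' ∘ D.proj ∘ e.symm with hf
  have hx₀s : x₀ ∈ (chartAt (EuclideanHalfSpace m) c).source := by
    rw [← extChartAt_source (𝓡∂ m)]; exact e.map_target hy₀
  have hex₀ : e x₀ = y₀ := e.right_inv hy₀
  have hfd : ContDiffWithinAt ℝ ∞ f (range (𝓡∂ m)) y₀ := by
    have := ((contMDiffAt_iff_of_mem_source (x := c) (y := D.proj x₀) hx₀s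
      (mem_chart_source _ _)).1 (D.proj_smooth x₀)).2
    rwa [← he, hex₀] at this
  have hyr : y₀ ∈ range (𝓡∂ m) := extChartAt_target_subset_range c hy₀
  have hfd' : ContDiffWithinAt ℝ ∞ (fderivWithin ℝ f (range (𝓡∂ m))) (range (𝓡∂ m)) y₀ :=
    hfd.fderivWithin_right (m := ∞) (𝓡∂ m).uniqueDiffOn (by exact_mod_cast le_rfl) hyr
  have hfy₀ : f y₀ ∈ e'.target := e'.map_source (mem_extChartAt_source _)
  have hsub : univ ×ˢ e.target ⊆ (Prod.snd : ℝ × EuclideanSpace ℝ (Fin m) → _) ⁻¹' (range (𝓡∂ m)) :=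
    fun q hq => extChartAt_target_subset_range c hq.2
  set W : Set (EuclideanSpace ℝ (Fin m)) := e.target ∩ e.symm ⁻¹' (D.proj ⁻¹' e'.source) with hW
  have hWy : W ∈ 𝓝[e.target] y₀ := by
    have hcont : ContinuousWithinAt e.symm e.target y₀ := continuousOn_extChartAt_symm c y₀ hy₀
    have hop : D.proj ⁻¹' e'.source ∈ 𝓝 (e.symm y₀) :=
      (isOpen_extChartAt_source (D.proj x₀)).preimage D.proj_smooth.continuous |>.mem_nhds
        (mem_extChartAt_source _)
    exact inter_mem self_mem_nhdsWithin (hcont.preimage_mem_nhdsWithin hop)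
  have hmain : ∀ q ∈ univ ×ˢ W, D.chartMetric c q i j
      = ∑ k, ∑ l, (fderivWithin ℝ f (range (𝓡∂ m)) q.2 (EuclideanSpace.single i 1)) k
        * (fderivWithin ℝ f (range (𝓡∂ m)) q.2 (EuclideanSpace.single j 1)) l
        * G.spatial q.1 (e'.symm (f q.2))
          (mfderiv 𝓘(ℝ, EuclideanSpace ℝ (Fin m)) (𝓡 m) e'.symm (f q.2) (EuclideanSpace.single k (1 : ℝ) : EuclideanSpace ℝ (Fin m)))
          (mfderiv 𝓘(ℝ, EuclideanSpace ℝ (Fin m)) (𝓡 m) e'.symm (f q.2) (EuclideanSpace.single l (1 : ℝ) : EuclideanSpace ℝ (Fin m))) := by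
    rintro ⟨t, y⟩ ⟨-, hyt, hys⟩
    have hyr : y ∈ range (𝓡∂ m) := extChartAt_target_subset_range c hyt
    have hps : D.proj (e.symm y) ∈ e'.source := hys
    have hlinv : e'.symm (f y) = D.proj (e.symm y) := e'.left_inv hps
    have hfy : f y ∈ e'.target := e'.map_source hps
    have hfmd : MDifferentiableWithinAt 𝓘(ℝ, EuclideanSpace ℝ (Fin m)) 𝓘(ℝ, EuclideanSpace ℝ (Fin m)) f (range (𝓡∂ m)) y := by
      have h1 : MDifferentiableAt (𝓡∂ m) 𝓘(ℝ, EuclideanSpace ℝ (Fin m)) (e' ∘ D.proj) (e.symm y) :=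
        (mdifferentiableAt_extChartAt (by rwa [← extChartAt_source (𝓡 m)])).comp _
          (D.proj_smooth.mdifferentiable (by simp) _)
      exact h1.comp_mdifferentiableWithinAt y (mdifferentiableWithinAt_extChartAt_symm hyt)
    have hvec : ∀ v : EuclideanSpace ℝ (Fin m), mfderiv (𝓡∂ m) (𝓡 m) D.proj (e.symm y) (chartFrame c y v)
        = mfderiv 𝓘(ℝ, EuclideanSpace ℝ (Fin m)) (𝓡 m) e'.symm (f y)
          (fderivWithin ℝ f (range (𝓡∂ m)) y v) := by
      intro v
      have hu := (𝓡∂ m).uniqueDiffOn.uniqueMDiffOn y hyr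
      have h1 := mfderiv_comp_mfderivWithin (I := 𝓘(ℝ, EuclideanSpace ℝ (Fin m))) (I' := 𝓡∂ m)
        (I'' := 𝓡 m) (f := e.symm) (g := D.proj) (s := range (𝓡∂ m)) y
        (D.proj_smooth.mdifferentiable (by simp) _)
        (mdifferentiableWithinAt_extChartAt_symm hyt) hu
      have hsm : MDifferentiableAt 𝓘(ℝ, EuclideanSpace ℝ (Fin m)) (𝓡 m) e'.symm (f y) := by
        have := mdifferentiableWithinAt_extChartAt_symm (I := 𝓡 m) hfy
        rwa [(𝓡 m).range_eq_univ, mdifferentiableWithinAt_univ] at this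
      have h2 := mfderiv_comp_mfderivWithin (I := 𝓘(ℝ, EuclideanSpace ℝ (Fin m)))
        (I' := 𝓘(ℝ, EuclideanSpace ℝ (Fin m)))
        (I'' := 𝓡 m) (f := f) (g := e'.symm) (s := range (𝓡∂ m)) y
        hsm hfmd hu
      rw [mfderivWithin_eq_fderivWithin] at h2
      have h3 : mfderivWithin 𝓘(ℝ, EuclideanSpace ℝ (Fin m)) (𝓡 m) (D.proj ∘ e.symm) (range (𝓡∂ m)) y
          = mfderivWithin 𝓘(ℝ, EuclideanSpace ℝ (Fin m)) (𝓡 m) (e'.symm ∘ f) (range (𝓡∂ m)) y := by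
        refine Filter.EventuallyEq.mfderivWithin_eq ?_ hlinv.symm
        have hcont : ContinuousWithinAt e.symm (range (𝓡∂ m)) y :=
          (continuousOn_extChartAt_symm c y hyt).mono_of_mem_nhdsWithin
            (target_mem_nhdsWithin_range hyt)
        have hop : D.proj ⁻¹' e'.source ∈ 𝓝 (e.symm y) :=
          ((isOpen_extChartAt_source (D.proj x₀)).preimage D.proj_smooth.continuous).mem_nhds hps
        filter_upwards [hcont.preimage_mem_nhdsWithin hop] with z hz
        exact (e'.left_inv hz).symm
      have h4 := congrArg (fun A => A v) (h1.symm.trans (h3.trans h2))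
      exact h4
    have hinner := spatial_isInnerForm (G := G) t (e'.symm (f y))
    have hexp : ∀ v : EuclideanSpace ℝ (Fin m), mfderiv 𝓘(ℝ, EuclideanSpace ℝ (Fin m)) (𝓡 m) e'.symm (f y) v
        = ∑ k, v k • mfderiv 𝓘(ℝ, EuclideanSpace ℝ (Fin m)) (𝓡 m) e'.symm (f y) (EuclideanSpace.single k (1 : ℝ) : EuclideanSpace ℝ (Fin m)) := by
      intro v
      conv_lhs => rw [← sum_single_smul v]
      exact (map_sum (mfderiv 𝓘(ℝ, EuclideanSpace ℝ (Fin m)) (𝓡 m) e'.symm (f y)) _ _).trans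
        (Finset.sum_congr rfl fun k _ => map_smul (mfderiv 𝓘(ℝ, EuclideanSpace ℝ (Fin m)) (𝓡 m) e'.symm (f y)) _ _)
    have hstep : D.chartMetric c (t, y) i j = G.spatial t (e'.symm (f y))
        (mfderiv 𝓘(ℝ, EuclideanSpace ℝ (Fin m)) (𝓡 m) e'.symm (f y)
          (fderivWithin ℝ f (range (𝓡∂ m)) y (EuclideanSpace.single i 1)))
        (mfderiv 𝓘(ℝ, EuclideanSpace ℝ (Fin m)) (𝓡 m) e'.symm (f y)
          (fderivWithin ℝ f (range (𝓡∂ m)) y (EuclideanSpace.single j 1))) := by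
      rw [← hvec, ← hvec]
      simp only [chartMetric, slice, frameVec]
      rw [hlinv]
    rw [hstep, hexp, hexp (fderivWithin ℝ f (range (𝓡∂ m)) y (EuclideanSpace.single j 1))]
    rw [hinner.sum_left]
    simp only [hinner.sum_right, hinner.smul_left, hinner.smul_right]
    exact Finset.sum_congr rfl fun k _ => Finset.sum_congr rfl fun l _ => by ring
  have hmem : univ ×ˢ W ∈ 𝓝[univ ×ˢ e.target] (t₀, y₀) := by
    rw [nhdsWithin_prod_eq]
    exact prod_mem_prod univ_mem hWy
  refine ContDiffWithinAt.congr_of_eventuallyEq ?_ (eventually_of_mem hmem hmain)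
    (hmain _ ⟨mem_univ _, mem_of_mem_nhdsWithin hy₀ hWy⟩)
  have hsnd : ContDiffWithinAt ℝ ∞ (Prod.snd : ℝ × EuclideanSpace ℝ (Fin m) → _)
      (univ ×ˢ e.target) (t₀, y₀) := contDiffWithinAt_snd
  have hfd'' : ContDiffWithinAt ℝ ∞ (fun q : ℝ × EuclideanSpace ℝ (Fin m) =>
      fderivWithin ℝ f (range (𝓡∂ m)) q.2) (univ ×ˢ e.target) (t₀, y₀) :=
    ContDiffWithinAt.comp (t := range (𝓡∂ m)) (g := fderivWithin ℝ f (range (𝓡∂ m)))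
      (t₀, y₀) hfd' hsnd hsub
  have hcoord : ∀ (i k : Fin m), ContDiffWithinAt ℝ ∞ (fun q : ℝ × EuclideanSpace ℝ (Fin m) =>
      (fderivWithin ℝ f (range (𝓡∂ m)) q.2 (EuclideanSpace.single i 1)) k)
      (univ ×ˢ e.target) (t₀, y₀) := fun i k =>
    (contDiffWithinAt_euclidean.1 (hfd''.clm_apply contDiffWithinAt_const)) k
  refine ContDiffWithinAt.sum fun k _ => ContDiffWithinAt.sum fun l _ => ?_
  refine ((hcoord i k).mul (hcoord j l)).mul ?_
  have h1 := G.spatial_smooth (D.proj x₀) (EuclideanSpace.single k 1) (EuclideanSpace.single l 1)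
    (t₀, f y₀) ⟨mem_univ _, hfy₀⟩
  have h2 : ContDiffWithinAt ℝ ∞ (fun q : ℝ × EuclideanSpace ℝ (Fin m) => (q.1, f q.2))
      (univ ×ˢ e.target) (t₀, y₀) :=
    contDiffWithinAt_fst.prodMk (ContDiffWithinAt.comp (t := range (𝓡∂ m)) (g := f)
      (t₀, y₀) hfd hsnd hsub)
  have h3 : univ ×ˢ e'.target ∈ 𝓝 (t₀, f y₀) := by
    rw [nhds_prod_eq]
    exact prod_mem_prod univ_mem (extChartAt_target_mem_nhds' hfy₀)
  exact ContDiffAt.comp_contDiffWithinAt (t₀, y₀) (h1.contDiffAt h3) h2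

end Slice

end SpacelikeHypersurface

/-! ### Uniform bounds for quadratic forms -/

section QuadraticBounds

variable {m : ℕ} [NeZero m] {Sig : Type*} [TopologicalSpace Sig]
  [ChartedSpace (EuclideanHalfSpace m) Sig] [IsManifold (𝓡∂ m) ∞ Sig]

/-- A time dependent homogeneous function of degree two on the tangent bundle, continuous in
charts. -/
structure ContinuousQuadratic (q : ℝ → (x : Sig) → TangentSpace (𝓡∂ m) x → ℝ) : Prop where
  smul : ∀ t x (c : ℝ) v, q t x (c • v) = c ^ 2 * q t x v
  cont : ∀ c : Sig, ContinuousOn (fun r : ℝ × EuclideanSpace ℝ (Fin m) × EuclideanSpace ℝ (Fin m) =>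
    q r.1 ((extChartAt (𝓡∂ m) c).symm r.2.1) (chartFrame c r.2.1 r.2.2))
    (univ ×ˢ (extChartAt (𝓡∂ m) c).target ×ˢ univ)

namespace ContinuousQuadratic

variable {P Q : ℝ → (x : Sig) → TangentSpace (𝓡∂ m) x → ℝ}
  (hP : ContinuousQuadratic P) (hQ : ContinuousQuadratic Q)

omit [IsManifold (𝓡∂ m) ∞ Sig] in
include hP in
theorem zero (t x) : P t x 0 = 0 := by
  have := hP.smul t x 0 0
  simpa using this

include hP hQ in
-- By homogeneity it suffices to compare the two functions on the unit sphere of a chart frame,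
-- which is compact; there a strict inequality at one point persists nearby, uniformly in the
-- direction.
theorem eventually_le {t₀ : ℝ} {x₀ : Sig} {C : ℝ} (h : ∀ v, v ≠ 0 → Q t₀ x₀ v < C * P t₀ x₀ v) :
    ∀ᶠ p in 𝓝 (t₀, x₀), ∀ v, Q p.1 p.2 v ≤ C * P p.1 p.2 v := by
  set e := extChartAt (𝓡∂ m) x₀ with he
  set F : ℝ × EuclideanSpace ℝ (Fin m) × EuclideanSpace ℝ (Fin m) → ℝ := fun r =>
    C * P r.1 (e.symm r.2.1) (chartFrame x₀ r.2.1 r.2.2)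
      - Q r.1 (e.symm r.2.1) (chartFrame x₀ r.2.1 r.2.2) with hF
  have hFc : ContinuousOn F (univ ×ˢ e.target ×ˢ univ) :=
    (continuousOn_const.mul (hP.cont x₀)).sub (hQ.cont x₀)
  have hy₀ : e x₀ ∈ e.target := mem_extChartAt_target x₀
  have hpos : ∀ v ∈ Metric.sphere (0 : EuclideanSpace ℝ (Fin m)) 1,
      ∀ᶠ z : (ℝ × Sig) × EuclideanSpace ℝ (Fin m) in 𝓝 ((t₀, x₀), v), 0 < F (z.1.1, e z.1.2, z.2) := by
    intro v hv
    have h0 : 0 < F (t₀, e x₀, v) := by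
      have hinj : chartFrame x₀ (e x₀) v ≠ 0 := by
        intro h0
        have : v = 0 := chartFrame_injective hy₀ (by rw [h0, map_zero])
        rw [this] at hv
        simp at hv
      have hx : e.symm (e x₀) = x₀ := e.left_inv (mem_extChartAt_source x₀)
      have gen : ∀ (x : Sig) (hx : x = x₀) (w : TangentSpace (𝓡∂ m) x), w ≠ 0 →
          0 < C * P t₀ x w - Q t₀ x w := by
        rintro x rfl w hw
        exact sub_pos.2 (h w hw)
      exact gen _ hx _ hinj
    have hc : ContinuousWithinAt F (univ ×ˢ e.target ×ˢ univ) (t₀, e x₀, v) :=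
      hFc _ ⟨mem_univ _, hy₀, mem_univ _⟩
    have hmap : Tendsto (fun z : (ℝ × Sig) × EuclideanSpace ℝ (Fin m) => (z.1.1, e z.1.2, z.2))
        (𝓝 ((t₀, x₀), v)) (𝓝[univ ×ˢ e.target ×ˢ univ] (t₀, e x₀, v)) := by
      refine tendsto_nhdsWithin_iff.2 ⟨?_, ?_⟩
      · have hce : ContinuousAt (fun z : (ℝ × Sig) × EuclideanSpace ℝ (Fin m) => e z.1.2)
            ((t₀, x₀), v) := ContinuousAt.comp (g := e) (continuousAt_extChartAt x₀) (by fun_prop)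
        exact (show ContinuousAt (fun z : (ℝ × Sig) × EuclideanSpace ℝ (Fin m) => z.1.1)
            ((t₀, x₀), v) by fun_prop).prodMk (hce.prodMk (by fun_prop))
      · have hs : ∀ᶠ z : (ℝ × Sig) × EuclideanSpace ℝ (Fin m) in 𝓝 ((t₀, x₀), v), z.1.2 ∈ e.source :=
          (show ContinuousAt (fun z : (ℝ × Sig) × EuclideanSpace ℝ (Fin m) => z.1.2)
            ((t₀, x₀), v) by fun_prop).eventually (extChartAt_source_mem_nhds x₀)
        filter_upwards [hs] with z hz
        exact ⟨mem_univ _, e.map_source hz, mem_univ _⟩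
    exact hmap.eventually (hc.eventually (lt_mem_nhds h0))
  have h1 := (isCompact_sphere (0 : EuclideanSpace ℝ (Fin m)) 1).eventually_forall_of_forall_eventually
    (P := fun (p : ℝ × Sig) v => 0 < F (p.1, e p.2, v)) hpos
  have hs : ∀ᶠ z : ℝ × Sig in 𝓝 (t₀, x₀), z.2 ∈ e.source :=
    continuousAt_snd.eventually (extChartAt_source_mem_nhds x₀)
  filter_upwards [h1, hs] with p hp hps
  obtain ⟨t, x⟩ := p
  obtain ⟨y, hy, rfl⟩ : ∃ y ∈ e.target, x = e.symm y := ⟨e x, e.map_source hps, (e.left_inv hps).symm⟩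
  intro v
  obtain ⟨v', rfl⟩ := (chartFrame_bijective hy).2 v
  by_cases hv : v' = 0
  · subst hv
    rw [map_zero, hQ.zero, hP.zero, mul_zero]
  have hn : ‖v'‖ ≠ 0 := norm_ne_zero_iff.2 hv
  have h2 := hp (‖v'‖⁻¹ • v') (by simp [norm_smul, hn])
  simp only [hF, e.right_inv hy, map_smul, hP.smul, hQ.smul] at h2
  have h3 : 0 < ‖v'‖⁻¹ ^ 2 := by positivity
  have h4 : 0 < ‖v'‖⁻¹ ^ 2 * (C * P t (e.symm y) (chartFrame x₀ y v')
      - Q t (e.symm y) (chartFrame x₀ y v')) := by linarith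
  have := pos_of_mul_pos_right h4 h3.le
  simp only at this ⊢
  linarith

include hP hQ in
-- The set J of admissible constants is closed under maxima, so local constants from J combine by
-- compactness into one constant that still lies in J. This serves both for nonnegative constants
-- and for constants strictly below 1.
theorem exists_bound {K : Set (ℝ × Sig)} (hK : IsCompact K) {J : Set ℝ} (hJ : J.Nonempty)
    (hpos : ∀ t x v, 0 ≤ P t x v)
    (h : ∀ p ∈ K, ∃ C ∈ J, ∀ v, v ≠ 0 → Q p.1 p.2 v < C * P p.1 p.2 v) :
    ∃ C ∈ J, ∀ p ∈ K, ∀ v, Q p.1 p.2 v ≤ C * P p.1 p.2 v := by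
  refine hK.induction_on (p := fun s => ∃ C ∈ J, ∀ p ∈ s, ∀ v, Q p.1 p.2 v ≤ C * P p.1 p.2 v)
    ⟨hJ.some, hJ.some_mem, by simp⟩ ?_ ?_ ?_
  · rintro s t hst ⟨C, hC, h⟩
    exact ⟨C, hC, fun p hp => h p (hst hp)⟩
  · rintro s t ⟨C, hC, h⟩ ⟨C', hC', h'⟩
    refine ⟨max C C', by rcases max_choice C C' with h | h <;> rw [h] <;> assumption, ?_⟩
    rintro p (hp | hp) v
    · exact (h p hp v).trans (mul_le_mul_of_nonneg_right (le_max_left _ _) (hpos _ _ _))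
    · exact (h' p hp v).trans (mul_le_mul_of_nonneg_right (le_max_right _ _) (hpos _ _ _))
  · intro p hp
    obtain ⟨C, hC, h1⟩ := h p hp
    exact ⟨_, mem_nhdsWithin_of_mem_nhds (hP.eventually_le hQ h1), C, hC, fun p hp v => hp v⟩

include hP hQ in
/-- A quadratic form attains its maximal ratio to a positive one. -/
theorem exists_max_ratio (hpos : ∀ t x v, v ≠ 0 → 0 < P t x v) (t : ℝ) (x : Sig) :
    ∃ v₀, v₀ ≠ 0 ∧ ∀ v, v ≠ 0 → Q t x v / P t x v ≤ Q t x v₀ / P t x v₀ := by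
  suffices H : ∀ (c x : Sig) (y), y ∈ (extChartAt (𝓡∂ m) c).target →
      x = (extChartAt (𝓡∂ m) c).symm y → ∃ v₀, v₀ ≠ 0 ∧ ∀ v, v ≠ 0 →
        Q t x v / P t x v ≤ Q t x v₀ / P t x v₀ from
    H x x _ (mem_extChartAt_target x)
      ((extChartAt (𝓡∂ m) x).left_inv (mem_extChartAt_source x)).symm
  rintro c x y hy rfl
  set e := extChartAt (𝓡∂ m) c with he
  have hne : ∀ v : EuclideanSpace ℝ (Fin m), v ≠ 0 → chartFrame c y v ≠ 0 := fun v hv h0 =>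
    hv (chartFrame_injective hy (by rw [h0, map_zero]))
  have hcont : ∀ {q : ℝ → (x : Sig) → TangentSpace (𝓡∂ m) x → ℝ}, ContinuousQuadratic q →
      Continuous fun v : EuclideanSpace ℝ (Fin m) => q t (e.symm y) (chartFrame c y v) := by
    intro q hq
    have := (hq.cont c).comp_continuous (f := fun v : EuclideanSpace ℝ (Fin m) => (t, y, v)) (by fun_prop)
      (fun v => ⟨mem_univ _, hy, mem_univ _⟩)
    exact this
  have hsn : (Metric.sphere (0 : EuclideanSpace ℝ (Fin m)) 1).Nonempty :=
    NormedSpace.sphere_nonempty.2 zero_le_one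
  obtain ⟨v₀, hv₀, hmax⟩ := (isCompact_sphere (0 : EuclideanSpace ℝ (Fin m)) 1).exists_isMaxOn hsn
    (f := fun v => Q t (e.symm y) (chartFrame c y v) / P t (e.symm y) (chartFrame c y v))
    ((hcont hQ).continuousOn.div (hcont hP).continuousOn fun v hv =>
      (hpos _ _ _ (hne v fun h => by simp [h] at hv)).ne')
  have hv₀0 : v₀ ≠ 0 := fun h => by simp [h] at hv₀
  refine ⟨chartFrame c y v₀, hne _ hv₀0, fun v hv => ?_⟩
  obtain ⟨v', rfl⟩ := (chartFrame_bijective hy).2 v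
  have hv' : v' ≠ 0 := fun h => hv (by rw [h, map_zero])
  have hn : ‖v'‖ ≠ 0 := norm_ne_zero_iff.2 hv'
  have h2 := hmax (a := ‖v'‖⁻¹ • v') (by simp [norm_smul, hn])
  have h3 : ‖v'‖⁻¹ ^ 2 ≠ 0 := by positivity
  simp only [mem_ofPred_eq, map_smul, hP.smul, hQ.smul] at h2
  rwa [mul_div_mul_left _ _ h3] at h2

include hP hQ in
theorem exists_le (hpos : ∀ t x v, v ≠ 0 → 0 < P t x v) {K : Set (ℝ × Sig)} (hK : IsCompact K) :
    ∃ C, 0 ≤ C ∧ ∀ p ∈ K, ∀ v, Q p.1 p.2 v ≤ C * P p.1 p.2 v := by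
  have hnn : ∀ t x v, 0 ≤ P t x v := fun t x v => by
    by_cases hv : v = 0
    · rw [hv, hP.zero]
    · exact (hpos t x v hv).le
  refine hP.exists_bound hQ hK (J := {C | 0 ≤ C}) ⟨0, le_refl (0 : ℝ)⟩ hnn fun p _ => ?_
  obtain ⟨v₀, _, hmax⟩ := hP.exists_max_ratio hQ hpos p.1 p.2
  refine ⟨max 0 (Q p.1 p.2 v₀ / P p.1 p.2 v₀ + 1), mem_ofPred.2 (le_max_left _ _), fun v hv => ?_⟩
  have := hmax v hv
  rw [← div_lt_iff₀ (hpos _ _ _ hv)]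
  exact (this.trans_lt (lt_add_one _)).trans_le (le_max_right _ _)

include hP hQ in
-- At each point the maximal ratio is attained, hence is below 1 and leaves room for a constant in
-- (0, 1); compactness keeps the constant in that interval.
theorem exists_le_of_lt (hpos : ∀ t x v, v ≠ 0 → 0 < P t x v) {K : Set (ℝ × Sig)} (hK : IsCompact K)
    (h : ∀ p ∈ K, ∀ v, v ≠ 0 → Q p.1 p.2 v < P p.1 p.2 v) :
    ∃ C, 0 < C ∧ C < 1 ∧ ∀ p ∈ K, ∀ v, Q p.1 p.2 v ≤ C * P p.1 p.2 v := by
  have hnn : ∀ t x v, 0 ≤ P t x v := fun t x v => by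
    by_cases hv : v = 0
    · rw [hv, hP.zero]
    · exact (hpos t x v hv).le
  obtain ⟨C, hC, hb⟩ := hP.exists_bound hQ hK (J := Ioo 0 1) ⟨1 / 2, by norm_num, by norm_num⟩ hnn
    fun p hp => by
      obtain ⟨v₀, hv₀, hmax⟩ := hP.exists_max_ratio hQ hpos p.1 p.2
      have h1 : Q p.1 p.2 v₀ / P p.1 p.2 v₀ < 1 := by
        rw [div_lt_one (hpos _ _ _ hv₀)]; exact h p hp v₀ hv₀
      obtain ⟨C, hC1, hC2⟩ := exists_between (max_lt h1 zero_lt_one)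
      refine ⟨C, ⟨(le_max_right _ _).trans_lt hC1, hC2⟩, fun v hv => ?_⟩
      rw [← div_lt_iff₀ (hpos _ _ _ hv)]
      exact (hmax v hv).trans_lt ((le_max_left _ _).trans_lt hC1)
  exact ⟨C, hC.1, hC.2, hb⟩

end ContinuousQuadratic

theorem dAlong_sq_continuousQuadratic {η : Sig → ℝ} (hη : ContMDiff (𝓡∂ m) 𝓘(ℝ, ℝ) 1 η) :
    ContinuousQuadratic fun (_ : ℝ) (x : Sig) (v : TangentSpace (𝓡∂ m) x) => dAlong η x v ^ 2 where
  smul t x c v := by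
    have : dAlong η x (c • v) = c * dAlong η x v := map_smul (mfderiv (𝓡∂ m) 𝓘(ℝ, ℝ) η x) c v
    rw [this, mul_pow]
  cont c := by
    refine ContinuousOn.pow ?_ 2
    have hc : ContinuousOn (fun r : ℝ × EuclideanSpace ℝ (Fin m) × EuclideanSpace ℝ (Fin m) =>
        ∑ i, r.2.2 i * fderivWithin ℝ (η ∘ (extChartAt (𝓡∂ m) c).symm) (range (𝓡∂ m)) r.2.1
          (EuclideanSpace.single i 1)) (univ ×ˢ (extChartAt (𝓡∂ m) c).target ×ˢ univ) := by
      refine continuousOn_finsetSum _ fun i _ => ?_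
      refine ContinuousOn.mul (by fun_prop) ?_
      exact (continuousOn_fderivWithin_comp hη c _).comp (f := fun r : ℝ × EuclideanSpace ℝ (Fin m) × EuclideanSpace ℝ (Fin m) => r.2.1) (by fun_prop) fun r hr => hr.2.1
    refine hc.congr fun r hr => ?_
    have h1 := dAlong_chartFrame (u := η) hr.2.1 (hη.mdifferentiable (by simp) _) r.2.2
    rw [h1]
    conv_lhs => rw [← sum_single_smul r.2.2]
    simp

end QuadraticBounds

namespace SpacelikeHypersurface

/-! ### Bounds for the slice metrics, uniform for bounded times -/

section SliceBounds

variable {m : ℕ} [NeZero m] {S : Type*} [TopologicalSpace S]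
  [ChartedSpace (EuclideanSpace ℝ (Fin m)) S] {G : SplitSpacetime m S}
  {Sig : Type*} [TopologicalSpace Sig] [ChartedSpace (EuclideanHalfSpace m) Sig]
  (D : SpacelikeHypersurface G Sig)

theorem slice_chartFrame (c : Sig) (t : ℝ) (y v w : EuclideanSpace ℝ (Fin m)) :
    D.slice t ((extChartAt (𝓡∂ m) c).symm y) (chartFrame c y v) (chartFrame c y w)
      = ∑ i, ∑ j, v i * w j * D.chartMetric c (t, y) i j := by
  have hi := D.slice_isInnerForm t ((extChartAt (𝓡∂ m) c).symm y)
  rw [chartFrame_apply, chartFrame_apply, hi.sum_left]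
  refine Finset.sum_congr rfl fun i _ => ?_
  rw [hi.sum_right]
  refine Finset.sum_congr rfl fun j _ => ?_
  rw [hi.smul_left, hi.smul_right]
  simp only [chartMetric]
  ring

theorem slice_pos (t : ℝ) (x : Sig) (v) (hv : v ≠ 0) : 0 < D.slice t x v v :=
  (D.slice_isInnerForm t x).pos v hv

theorem slice_nonneg (t : ℝ) (x : Sig) (v) : 0 ≤ D.slice t x v v :=
  (D.slice_isInnerForm t x).self_nonneg v

variable [IsManifold (𝓡 m) ∞ S] [IsManifold (𝓡∂ m) ∞ Sig]

theorem chartMetric_contDiff_time {c : Sig} {y : EuclideanSpace ℝ (Fin m)}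
    (hy : y ∈ (extChartAt (𝓡∂ m) c).target) (i j : Fin m) :
    ContDiff ℝ ∞ fun t => D.chartMetric c (t, y) i j := by
  rw [← contDiffOn_univ]
  exact (D.chartMetric_contDiffOn c i j).comp (t := univ ×ˢ (extChartAt (𝓡∂ m) c).target)
    (f := fun t : ℝ => (t, y)) (by fun_prop) (fun t _ => mk_mem_prod (mem_univ _) hy)

theorem slice_contDiff_time (x : Sig) (v w : TangentSpace (𝓡∂ m) x) :
    ContDiff ℝ ∞ fun t => D.slice t x v w := by
  obtain ⟨y, hy, hxy⟩ : ∃ y ∈ (extChartAt (𝓡∂ m) x).target, x = (extChartAt (𝓡∂ m) x).symm y :=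
    ⟨_, mem_extChartAt_target x, ((extChartAt (𝓡∂ m) x).left_inv (mem_extChartAt_source x)).symm⟩
  have gen : ∀ c x' : Sig, ∀ v w : TangentSpace (𝓡∂ m) x', y ∈ (extChartAt (𝓡∂ m) c).target →
      x' = (extChartAt (𝓡∂ m) c).symm y → ContDiff ℝ ∞ fun t => D.slice t x' v w := by
    rintro c x' v w hy rfl
    obtain ⟨v', rfl⟩ := (chartFrame_bijective hy).2 v
    obtain ⟨w', rfl⟩ := (chartFrame_bijective hy).2 w
    simp only [slice_chartFrame]
    exact ContDiff.sum fun i _ => ContDiff.sum fun j _ =>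
      contDiff_const.mul (D.chartMetric_contDiff_time hy i j)
  exact gen x x v w hy hxy

theorem slice_continuousQuadratic :
    ContinuousQuadratic fun t (x : Sig) v => D.slice t x v v where
  smul t x c v := by
    rw [(D.slice_isInnerForm t x).smul_left, (D.slice_isInnerForm t x).smul_right]; ring
  cont c := by
    simp only [slice_chartFrame]
    refine continuousOn_finsetSum _ fun i _ => continuousOn_finsetSum _ fun j _ => ?_
    refine ContinuousOn.mul (by fun_prop) ?_
    exact (D.chartMetric_contDiffOn c i j).continuousOn.comp (f := fun r : ℝ × EuclideanSpace ℝ (Fin m) × EuclideanSpace ℝ (Fin m) => (r.1, r.2.1))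
      (by fun_prop) fun r hr => ⟨mem_univ _, hr.2.1⟩

theorem continuousOn_deriv_chartMetric (c : Sig) (i j : Fin m) :
    ContinuousOn (fun q : ℝ × EuclideanSpace ℝ (Fin m) =>
      deriv (fun s => D.chartMetric c (s, q.2) i j) q.1)
      (univ ×ˢ (extChartAt (𝓡∂ m) c).target) := by
  have hU : UniqueDiffOn ℝ (univ ×ˢ (extChartAt (𝓡∂ m) c).target : Set (ℝ × EuclideanSpace ℝ (Fin m))) :=
    uniqueDiffOn_univ.prod (uniqueDiffOn_extChartAt_target c)
  have h1 := (D.chartMetric_contDiffOn c i j).continuousOn_fderivWithin hU (by simp)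
  have h2 := h1.clm_apply (continuousOn_const (c := ((1 : ℝ), (0 : EuclideanSpace ℝ (Fin m)))))
  refine h2.congr ?_
  rintro ⟨t, y⟩ ⟨-, hy⟩
  have h3 : HasFDerivWithinAt (fun q : ℝ × EuclideanSpace ℝ (Fin m) => D.chartMetric c q i j) _
      (univ ×ˢ (extChartAt (𝓡∂ m) c).target) (t, y) :=
    ((D.chartMetric_contDiffOn c i j).differentiableOn (by simp) (t, y) ⟨mem_univ _, hy⟩).hasFDerivWithinAt
  have h4 : HasDerivWithinAt (fun s : ℝ => (s, y)) ((1 : ℝ), (0 : EuclideanSpace ℝ (Fin m))) univ t :=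
    (hasDerivWithinAt_id t univ).prodMk (hasDerivWithinAt_const t univ y)
  have h5 := h3.comp_hasDerivWithinAt t h4 (fun s _ => mk_mem_prod (mem_univ _) hy)
  rw [hasDerivWithinAt_univ] at h5
  exact h5.deriv

theorem deriv_slice_chartFrame {c : Sig} {y : EuclideanSpace ℝ (Fin m)}
    (hy : y ∈ (extChartAt (𝓡∂ m) c).target) (t : ℝ) (v : EuclideanSpace ℝ (Fin m)) :
    deriv (fun s => D.slice s ((extChartAt (𝓡∂ m) c).symm y) (chartFrame c y v) (chartFrame c y v)) t
      = ∑ i, ∑ j, v i * v j * deriv (fun s => D.chartMetric c (s, y) i j) t := by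
  simp only [slice_chartFrame]
  have hd : ∀ i j, DifferentiableAt ℝ (fun s => D.chartMetric c (s, y) i j) t := fun i j =>
    (D.chartMetric_contDiff_time hy i j).differentiable (by simp) t
  exact (HasDerivAt.fun_sum fun i _ => HasDerivAt.fun_sum fun j _ =>
    (hd i j).hasDerivAt.const_mul (v i * v j)).deriv

theorem deriv_slice_continuousQuadratic (a : ℝ) :
    ContinuousQuadratic fun t (x : Sig) v => a * deriv (fun s => D.slice s x v v) t where
  smul t x c v := by
    have : (fun s => D.slice s x (c • v) (c • v)) = fun s => c ^ 2 * D.slice s x v v := by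
      ext s
      rw [(D.slice_isInnerForm s x).smul_left, (D.slice_isInnerForm s x).smul_right]; ring
    rw [this, deriv_const_mul _ ((D.slice_contDiff_time x v v).differentiable (by simp) t)]
    ring
  cont c := by
    refine continuousOn_const.mul ?_
    have hc : ContinuousOn (fun r : ℝ × EuclideanSpace ℝ (Fin m) × EuclideanSpace ℝ (Fin m) =>
        ∑ i, ∑ j, r.2.2 i * r.2.2 j * deriv (fun s => D.chartMetric c (s, r.2.1) i j) r.1)
        (univ ×ˢ (extChartAt (𝓡∂ m) c).target ×ˢ univ) := by
      refine continuousOn_finsetSum _ fun i _ => continuousOn_finsetSum _ fun j _ => ?_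
      refine ContinuousOn.mul (by fun_prop) ?_
      exact (D.continuousOn_deriv_chartMetric c i j).comp (f := fun r : ℝ × EuclideanSpace ℝ (Fin m) × EuclideanSpace ℝ (Fin m) => (r.1, r.2.1))
        (by fun_prop) fun r hr => ⟨mem_univ _, hr.2.1⟩
    exact hc.congr fun r hr => D.deriv_slice_chartFrame hr.2.1 _ _

variable [CompactSpace Sig]

/-- The time derivative of the slice metrics is bounded by the metric. -/
theorem exists_abs_deriv_slice_le (T : ℝ) : ∃ lam, 0 < lam ∧ ∀ t ∈ Icc (-T) T, ∀ (x : Sig) v,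
    |deriv (fun s => D.slice s x v v) t| ≤ lam * D.slice t x v v := by
  have hK : IsCompact (Icc (-T) T ×ˢ (univ : Set Sig)) := isCompact_Icc.prod isCompact_univ
  obtain ⟨C₁, hC₁, h₁⟩ := D.slice_continuousQuadratic.exists_le
    (D.deriv_slice_continuousQuadratic 1) D.slice_pos hK
  obtain ⟨C₂, hC₂, h₂⟩ := D.slice_continuousQuadratic.exists_le
    (D.deriv_slice_continuousQuadratic (-1)) D.slice_pos hK
  refine ⟨max C₁ C₂ + 1, by positivity, fun t ht x v => ?_⟩
  have a1 := h₁ (t, x) ⟨ht, mem_univ _⟩ v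
  have a2 := h₂ (t, x) ⟨ht, mem_univ _⟩ v
  have hp := D.slice_nonneg t x v
  have b1 : C₁ * D.slice t x v v ≤ (max C₁ C₂ + 1) * D.slice t x v v :=
    mul_le_mul_of_nonneg_right (by linarith [le_max_left C₁ C₂]) hp
  have b2 : C₂ * D.slice t x v v ≤ (max C₁ C₂ + 1) * D.slice t x v v :=
    mul_le_mul_of_nonneg_right (by linarith [le_max_right C₁ C₂]) hp
  simp only at a1 a2
  rw [abs_le]
  constructor <;> linarith

omit [CompactSpace Sig] in
-- Grönwall's argument: e^(-λt) σ_t(v, v) is nonincreasing and e^(λt) σ_t(v, v) is nondecreasing in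
-- t.
theorem slice_le_exp_mul {T lam : ℝ} (h : ∀ t ∈ Icc (-T) T, ∀ (x : Sig) v,
    |deriv (fun s => D.slice s x v v) t| ≤ lam * D.slice t x v v) {s t : ℝ} (hs : s ∈ Icc (-T) T)
    (ht : t ∈ Icc (-T) T) (x : Sig) (v) :
    D.slice t x v v ≤ Real.exp (lam * |t - s|) * D.slice s x v v := by
  have hd : ∀ r, HasDerivAt (fun s => D.slice s x v v) (deriv (fun s => D.slice s x v v) r) r :=
    fun r => ((D.slice_contDiff_time x v v).differentiable (by simp) r).hasDerivAt
  have hexp : ∀ (a r : ℝ), HasDerivAt (fun s => Real.exp (a * s)) (Real.exp (a * r) * a) r := by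
    intro a r
    simpa using ((hasDerivAt_id r).const_mul a).exp
  have hmul : ∀ (a r : ℝ), HasDerivAt (fun s => Real.exp (a * s) * D.slice s x v v)
      (Real.exp (a * r) * (a * D.slice r x v v + deriv (fun s => D.slice s x v v) r)) r := by
    intro a r
    exact ((hexp a r).mul (hd r)).congr_deriv (by ring)
  have hdiff : ∀ a, Differentiable ℝ (fun s => Real.exp (a * s) * D.slice s x v v) :=
    fun a r => (hmul a r).differentiableAt
  rcases le_total s t with hst | hst
  · have hanti : AntitoneOn (fun s => Real.exp (-lam * s) * D.slice s x v v) (Icc (-T) T) := by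
      refine antitoneOn_of_deriv_nonpos (convex_Icc _ _) (hdiff _).continuous.continuousOn
        (hdiff _).differentiableOn fun r hr => ?_
      rw [(hmul _ r).deriv]
      have h1 := (abs_le.1 (h r (interior_subset hr) x v)).2
      exact mul_nonpos_of_nonneg_of_nonpos (Real.exp_pos _).le (by linarith)
    have h2 := hanti hs ht hst
    simp only at h2
    rw [abs_of_nonneg (sub_nonneg.2 hst)]
    have e1 : Real.exp (lam * (t - s)) = Real.exp (lam * t) * Real.exp (-lam * s) := by
      rw [← Real.exp_add]; ring_nf
    have e2 : Real.exp (lam * t) * Real.exp (-lam * t) = 1 := by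
      rw [← Real.exp_add]; simp
    rw [e1, mul_assoc]
    calc D.slice t x v v = Real.exp (lam * t) * (Real.exp (-lam * t) * D.slice t x v v) := by
          rw [← mul_assoc, e2, one_mul]
      _ ≤ _ := mul_le_mul_of_nonneg_left h2 (Real.exp_pos _).le
  · have hmono : MonotoneOn (fun s => Real.exp (lam * s) * D.slice s x v v) (Icc (-T) T) := by
      refine monotoneOn_of_deriv_nonneg (convex_Icc _ _) (hdiff _).continuous.continuousOn
        (hdiff _).differentiableOn fun r hr => ?_
      rw [(hmul _ r).deriv]
      have h1 := (abs_le.1 (h r (interior_subset hr) x v)).1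
      exact mul_nonneg (Real.exp_pos _).le (by linarith)
    have h2 := hmono ht hs hst
    simp only at h2
    rw [abs_of_nonpos (sub_nonpos.2 hst)]
    have e1 : Real.exp (lam * -(t - s)) = Real.exp (-lam * t) * Real.exp (lam * s) := by
      rw [← Real.exp_add]; ring_nf
    have e2 : Real.exp (-lam * t) * Real.exp (lam * t) = 1 := by
      rw [← Real.exp_add]; simp
    rw [e1, mul_assoc]
    calc D.slice t x v v = Real.exp (-lam * t) * (Real.exp (lam * t) * D.slice t x v v) := by
          rw [← mul_assoc, e2, one_mul]
      _ ≤ _ := mul_le_mul_of_nonneg_left h2 (Real.exp_pos _).le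

/-- Differentials of `C¹` functions are uniformly bounded on slices. -/
theorem exists_dAlong_sq_le {η : Sig → ℝ} (hη : ContMDiff (𝓡∂ m) 𝓘(ℝ, ℝ) 1 η) (T : ℝ) :
    ∃ L, 0 ≤ L ∧ ∀ t ∈ Icc (-T) T, ∀ (x : Sig) v, dAlong η x v ^ 2 ≤ L ^ 2 * D.slice t x v v := by
  obtain ⟨C, hC, h⟩ := D.slice_continuousQuadratic.exists_le
    (dAlong_sq_continuousQuadratic hη) D.slice_pos
    (isCompact_Icc.prod isCompact_univ : IsCompact (Icc (-T) T ×ˢ (univ : Set Sig)))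
  refine ⟨√C, Real.sqrt_nonneg _, fun t ht x v => ?_⟩
  rw [Real.sq_sqrt hC]
  exact h (t, x) ⟨ht, mem_univ _⟩ v

/-- A smooth function with spacelike graph satisfies the gradient bound uniformly. -/
theorem exists_dAlong_sq_le_of_gradNormSq_lt {Φ : Sig → ℝ} (hΦ : ContMDiff (𝓡∂ m) 𝓘(ℝ, ℝ) 1 Φ)
    (h : ∀ x, gradNormSq (D.sigma Φ) Φ x < 1) :
    ∃ δ, 0 < δ ∧ δ < 1 ∧ ∀ x v, dAlong Φ x v ^ 2 ≤ (1 - δ) ^ 2 * D.slice (Φ x) x v v := by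
  have hK : IsCompact (range fun x : Sig => (Φ x, x)) :=
    isCompact_range (hΦ.continuous.prodMk continuous_id)
  obtain ⟨C, hC0, hC1, hb⟩ := D.slice_continuousQuadratic.exists_le_of_lt
    (dAlong_sq_continuousQuadratic hΦ) D.slice_pos hK (by
      rintro _ ⟨x, rfl⟩ v hv
      have h1 := dAlong_sq_le (D.sigma_isInnerForm Φ x) Φ v
      refine h1.trans_lt ?_
      have h2 : 0 < D.sigma Φ x v v := D.slice_pos _ _ _ hv
      calc _ < 1 * D.sigma Φ x v v := mul_lt_mul_of_pos_right (h x) h2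
        _ = _ := one_mul _)
  have hs1 : √C < 1 := by rw [Real.sqrt_lt' one_pos]; simpa using hC1
  -- With this δ the factor (1 - δ)² is exactly the constant C < 1 found above.
  refine ⟨1 - √C, by linarith, by linarith [Real.sqrt_pos.2 hC0], fun x v => ?_⟩
  rw [sub_sub_cancel, Real.sq_sqrt hC0.le]
  exact hb _ ⟨x, rfl⟩ v

end SliceBounds

end SpacelikeHypersurface

/-! ### The volume measure in a chart -/

section Volume

open Matrix

variable {m : ℕ} [NeZero m] {Sig : Type*} [TopologicalSpace Sig]
  [ChartedSpace (EuclideanHalfSpace m) Sig]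
  {σ : (x : Sig) → TangentSpace (𝓡∂ m) x → TangentSpace (𝓡∂ m) x → ℝ}

theorem chartDensity_eq (c : Sig) (y : EuclideanSpace ℝ (Fin m)) :
    chartDensity σ c y
      = √(IsInnerForm.gram (σ ((extChartAt (𝓡∂ m) c).symm y)) (frameVec c y)).det := rfl

theorem measurableSet_extChartAt_target (c : Sig) :
    MeasurableSet (extChartAt (𝓡∂ m) c).target := by
  rw [extChartAt_target]
  exact ((chartAt (EuclideanHalfSpace m) c).open_target.preimage
    (𝓡∂ m).continuous_symm).measurableSet.inter (𝓡∂ m).isClosed_range.measurableSet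

variable [MeasurableSpace Sig] [BorelSpace Sig]

theorem aemeasurable_extChartAt_symm (c : Sig) (μ : Measure (EuclideanSpace ℝ (Fin m))) :
    AEMeasurable (extChartAt (𝓡∂ m) c).symm (μ.restrict (extChartAt (𝓡∂ m) c).target) :=
  (continuousOn_extChartAt_symm c).aemeasurable (measurableSet_extChartAt_target c)

theorem measurableSet_chart_preimage (c : Sig) {A : Set Sig} (hA : MeasurableSet A) :
    MeasurableSet ((extChartAt (𝓡∂ m) c).target ∩ (extChartAt (𝓡∂ m) c).symm ⁻¹' A) := by
  have hT := measurableSet_extChartAt_target (m := m) c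
  have h1 : Measurable ((extChartAt (𝓡∂ m) c).target.domRestrict (extChartAt (𝓡∂ m) c).symm) :=
    (continuousOn_extChartAt_symm c).domRestrict.measurable
  have h2 := hT.subtype_image (h1 hA)
  convert h2 using 1
  ext y
  constructor
  · rintro ⟨hy, hyA⟩
    exact ⟨⟨y, hy⟩, hyA, rfl⟩
  · rintro ⟨⟨z, hz⟩, hzA, rfl⟩
    exact ⟨hz, hzA⟩

/-- The measure `√det σ dy`, transported by the chart around `c`. -/
noncomputable def chartMeasure (σ : (x : Sig) → TangentSpace (𝓡∂ m) x → TangentSpace (𝓡∂ m) x → ℝ) (c : Sig) :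
    Measure Sig :=
  Measure.map (extChartAt (𝓡∂ m) c).symm
      (((volume : Measure (EuclideanSpace ℝ (Fin m))).restrict
        (extChartAt (𝓡∂ m) c).target).withDensity
          fun y => ENNReal.ofReal (chartDensity σ c y))

theorem aemeasurable_symm_withDensity (c : Sig) :
    AEMeasurable (extChartAt (𝓡∂ m) c).symm (((volume : Measure (EuclideanSpace ℝ (Fin m))).restrict
        (extChartAt (𝓡∂ m) c).target).withDensity
          fun y => ENNReal.ofReal (chartDensity σ c y)) :=
  (aemeasurable_extChartAt_symm c _).mono_ac (withDensity_absolutelyContinuous _ _)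

theorem chartMeasure_apply (c : Sig) {A : Set Sig} (hA : MeasurableSet A) :
    chartMeasure σ c A = ∫⁻ y in (extChartAt (𝓡∂ m) c).target ∩ (extChartAt (𝓡∂ m) c).symm ⁻¹' A,
      ENNReal.ofReal (chartDensity σ c y) := by
  have hT := measurableSet_extChartAt_target (m := m) c
  rw [chartMeasure, Measure.map_apply_of_aemeasurable (aemeasurable_symm_withDensity c) hA]
  have hm := measurableSet_chart_preimage (m := m) c hA
  set ν := ((volume : Measure (EuclideanSpace ℝ (Fin m))).restrict
        (extChartAt (𝓡∂ m) c).target).withDensity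
          fun y => ENNReal.ofReal (chartDensity σ c y) with hν
  have hcompl : ν (extChartAt (𝓡∂ m) c).targetᶜ = 0 := by
    refine withDensity_absolutelyContinuous _ _ ?_
    rw [Measure.restrict_apply hT.compl]; simp
  have e1 : ν ((extChartAt (𝓡∂ m) c).symm ⁻¹' A)
      = ν ((extChartAt (𝓡∂ m) c).target ∩ (extChartAt (𝓡∂ m) c).symm ⁻¹' A) := by
    refine le_antisymm ?_ (measure_mono inter_subset_right)
    calc ν ((extChartAt (𝓡∂ m) c).symm ⁻¹' A)
        ≤ ν (((extChartAt (𝓡∂ m) c).target ∩ (extChartAt (𝓡∂ m) c).symm ⁻¹' A) ∪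
          (extChartAt (𝓡∂ m) c).targetᶜ) := measure_mono fun y hy => by
            by_cases h : y ∈ (extChartAt (𝓡∂ m) c).target
            · exact Or.inl ⟨h, hy⟩
            · exact Or.inr h
      _ ≤ _ := measure_union_le _ _
      _ = _ := by rw [hcompl, add_zero]
  rw [e1, hν, withDensity_apply _ hm, Measure.restrict_restrict hm]
  congr 2
  exact inter_eq_left.2 inter_subset_left

variable [IsManifold (𝓡∂ m) ∞ Sig]

omit [MeasurableSpace Sig] [BorelSpace Sig] in
/-- Transformation of the density under a change of charts. -/
theorem chartDensity_change (hσ : ∀ x, IsInnerForm (σ x)) {c c' : Sig} {y : EuclideanSpace ℝ (Fin m)}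
    (hy : y ∈ (extChartAt (𝓡∂ m) c).target)
    (hy' : (extChartAt (𝓡∂ m) c).symm y ∈ (extChartAt (𝓡∂ m) c').source) :
    HasFDerivWithinAt (extChartAt (𝓡∂ m) c' ∘ (extChartAt (𝓡∂ m) c).symm)
      (fderivWithin ℝ (extChartAt (𝓡∂ m) c' ∘ (extChartAt (𝓡∂ m) c).symm) (range (𝓡∂ m)) y)
      (range (𝓡∂ m)) y ∧
    chartDensity σ c y = |(fderivWithin ℝ (extChartAt (𝓡∂ m) c' ∘ (extChartAt (𝓡∂ m) c).symm)
        (range (𝓡∂ m)) y).det| *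
      chartDensity σ c' (extChartAt (𝓡∂ m) c' ((extChartAt (𝓡∂ m) c).symm y)) := by
  set e := extChartAt (𝓡∂ m) c with he
  set e' := extChartAt (𝓡∂ m) c' with he'
  have hyr : y ∈ range (𝓡∂ m) := extChartAt_target_subset_range c hy
  have hu := (𝓡∂ m).uniqueDiffOn.uniqueMDiffOn y hyr
  have hmd' : MDifferentiableAt (𝓡∂ m) 𝓘(ℝ, EuclideanSpace ℝ (Fin m)) e' (e.symm y) :=
    mdifferentiableAt_extChartAt (by rwa [← extChartAt_source (𝓡∂ m)])
  have hmd := mdifferentiableWithinAt_extChartAt_symm (I := 𝓡∂ m) hy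
  have hdiff : DifferentiableWithinAt ℝ (e' ∘ e.symm) (range (𝓡∂ m)) y :=
    (hmd'.comp_mdifferentiableWithinAt y hmd).differentiableWithinAt
  refine ⟨hdiff.hasFDerivWithinAt, ?_⟩
  set J := fderivWithin ℝ (e' ∘ e.symm) (range (𝓡∂ m)) y with hJ
  have hchain : ∀ v, mfderiv (𝓡∂ m) 𝓘(ℝ, EuclideanSpace ℝ (Fin m)) e' (e.symm y) (chartFrame c y v)
      = J v := by
    intro v
    have h := mfderiv_comp_mfderivWithin (I := 𝓘(ℝ, EuclideanSpace ℝ (Fin m))) (I' := 𝓡∂ m)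
      (I'' := 𝓘(ℝ, EuclideanSpace ℝ (Fin m))) (f := e.symm) (g := e') (s := range (𝓡∂ m)) y hmd' hmd hu
    rw [mfderivWithin_eq_fderivWithin] at h
    rw [hJ, h]; rfl
  have gen : ∀ (x : Sig) (y' : EuclideanSpace ℝ (Fin m)), y' ∈ e'.target → x = e'.symm y' →
      ∀ w w' : TangentSpace (𝓡∂ m) x, σ x w w' = σ (e'.symm y')
        (chartFrame c' y' (mfderiv (𝓡∂ m) 𝓘(ℝ, EuclideanSpace ℝ (Fin m)) e' x w))
        (chartFrame c' y' (mfderiv (𝓡∂ m) 𝓘(ℝ, EuclideanSpace ℝ (Fin m)) e' x w')) := by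
    rintro x y' hy' rfl w w'
    have h := mfderivWithin_extChartAt_symm_comp_mfderiv_extChartAt (I := 𝓡∂ m) hy'
    have h1 : ∀ w, chartFrame c' y' (mfderiv (𝓡∂ m) 𝓘(ℝ, EuclideanSpace ℝ (Fin m)) e' (e'.symm y') w) = w :=
      fun w => congrArg (fun A => A w) h
    rw [h1, h1]
  set y' := e' (e.symm y) with hy'def
  have hy't : y' ∈ e'.target := e'.map_source hy'
  set B : Matrix (Fin m) (Fin m) ℝ := LinearMap.toMatrix (EuclideanSpace.basisFun (Fin m) ℝ).toBasis
    (EuclideanSpace.basisFun (Fin m) ℝ).toBasis J.toLinearMap with hB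
  have hBapp : ∀ k i, B k i = J (EuclideanSpace.single i 1) k := by
    intro k i
    simp [hB, LinearMap.toMatrix_apply]
  have hgram : IsInnerForm.gram (σ (e.symm y)) (frameVec c y)
      = Bᵀ * IsInnerForm.gram (σ (e'.symm y')) (frameVec c' y') * B := by
    ext i j
    have h1 := gen (e.symm y) y' hy't (e'.left_inv hy').symm (frameVec c y i) (frameVec c y j)
    simp only [frameVec, hchain] at h1
    have hi := hσ (e'.symm y')
    simp only [IsInnerForm.gram, Matrix.of_apply, Matrix.mul_apply, Matrix.transpose_apply, hBapp]
    rw [show σ (e.symm y) (frameVec c y i) (frameVec c y j) = _ from h1, chartFrame_apply,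
      chartFrame_apply, hi.sum_left]
    simp only [hi.sum_right, hi.smul_left, hi.smul_right, Finset.sum_mul]
    rw [Finset.sum_comm]
    exact Finset.sum_congr rfl fun k _ => Finset.sum_congr rfl fun l _ => by ring
  have hdet : B.det = J.det := by
    rw [hB, LinearMap.det_toMatrix]
  rw [chartDensity_eq, chartDensity_eq, hgram, Matrix.det_mul, Matrix.det_mul, Matrix.det_transpose,
    hdet, mul_right_comm, ← sq, Real.sqrt_mul (sq_nonneg _), Real.sqrt_sq_eq_abs]

/-- The change of variables formula for the transition map: the Jacobian is exactly the factor by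
which the densities √det σ differ. -/
theorem chartMeasure_eq_of_subset (hσ : ∀ x, IsInnerForm (σ x)) {c c' : Sig} {A : Set Sig}
    (hA : MeasurableSet A) (hc : A ⊆ (extChartAt (𝓡∂ m) c).source)
    (hc' : A ⊆ (extChartAt (𝓡∂ m) c').source) : chartMeasure σ c A = chartMeasure σ c' A := by
  set e := extChartAt (𝓡∂ m) c with he
  set e' := extChartAt (𝓡∂ m) c' with he'
  set s := e.target ∩ e.symm ⁻¹' A with hs
  have hsm : MeasurableSet s := measurableSet_chart_preimage c hA
  have himg : (e' ∘ e.symm) '' s = e'.target ∩ e'.symm ⁻¹' A := by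
    ext z
    constructor
    · rintro ⟨y, ⟨hy, hyA⟩, rfl⟩
      refine ⟨e'.map_source (hc' hyA), ?_⟩
      simp only [mem_preimage, Function.comp_apply]
      rwa [e'.left_inv (hc' hyA)]
    · rintro ⟨hz, hzA⟩
      refine ⟨e (e'.symm z), ⟨e.map_source (hc hzA), ?_⟩, ?_⟩
      · simp only [mem_preimage]; rwa [e.left_inv (hc hzA)]
      · simp only [Function.comp_apply]; rw [e.left_inv (hc hzA), e'.right_inv hz]
  have hinj : InjOn (e' ∘ e.symm) s := by
    intro y hy z hz hyz
    exact e.symm.injOn hy.1 hz.1 (e'.injOn (hc' hy.2) (hc' hz.2) hyz)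
  have hsr : s ⊆ range (𝓡∂ m) := fun y hy => extChartAt_target_subset_range c hy.1
  rw [chartMeasure_apply c hA, chartMeasure_apply c' hA, ← himg,
    lintegral_image_eq_lintegral_abs_det_fderiv_mul volume hsm
      (fun y hy => ((chartDensity_change hσ hy.1 (hc' hy.2)).1.mono hsr)) hinj]
  refine setLIntegral_congr_fun hsm fun y hy => ?_
  simp only [Function.comp_apply]
  rw [← ENNReal.ofReal_mul (abs_nonneg _), ← (chartDensity_change hσ hy.1 (hc' hy.2)).2]

variable [CompactSpace Sig] [Nonempty Sig]

omit [IsManifold (𝓡∂ m) ∞ Sig] in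
/-- The pieces used in the definition of the volume measure. -/
theorem exists_pieces : ∃ (c : ℕ → Sig) (p : ℕ → Set Sig), (∀ n, MeasurableSet (p n)) ∧
    Pairwise (Function.onFun Disjoint p) ∧ (⋃ n, p n) = univ ∧
    (∀ n, p n ⊆ (extChartAt (𝓡∂ m) (c n)).source) ∧
    ∀ σ : (x : Sig) → TangentSpace (𝓡∂ m) x → TangentSpace (𝓡∂ m) x → ℝ,
      metricVolume σ = Measure.sum fun n => (chartMeasure σ (c n)).restrict (p n) := by
  refine ⟨Classical.choose (exists_chart_cover m Sig), disjointed (fun k =>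
    (chartAt (EuclideanHalfSpace m) (Classical.choose (exists_chart_cover m Sig) k)).source),
    fun n => ?_, disjoint_disjointed _, ?_, fun n => ?_, fun σ => rfl⟩
  · exact MeasurableSet.disjointed (fun k => (chartAt (EuclideanHalfSpace m) _).open_source.measurableSet) n
  · rw [iUnion_disjointed]
    exact Classical.choose_spec (exists_chart_cover m Sig)
  · rw [extChartAt_source]
    exact disjointed_subset _ _

theorem metricVolume_apply_of_subset (hσ : ∀ x, IsInnerForm (σ x)) {c : Sig} {A : Set Sig}
    (hA : MeasurableSet A) (hc : A ⊆ (extChartAt (𝓡∂ m) c).source) :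
    metricVolume σ A = chartMeasure σ c A := by
  obtain ⟨d, p, hpm, hpd, hpu, hps, hV⟩ := exists_pieces (m := m) (Sig := Sig)
  rw [hV, Measure.sum_apply _ hA]
  have h1 : ∀ n, (chartMeasure σ (d n)).restrict (p n) A = chartMeasure σ c (A ∩ p n) := by
    intro n
    rw [Measure.restrict_apply hA]
    exact chartMeasure_eq_of_subset hσ (hA.inter (hpm n)) (inter_subset_right.trans (hps n))
      (inter_subset_left.trans hc)
  simp_rw [h1]
  rw [← measure_iUnion (fun i j hij => (hpd hij).mono inter_subset_right inter_subset_right)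
    fun n => hA.inter (hpm n), ← inter_iUnion, hpu, inter_univ]

/-- In a chart, the volume measure is `√det σ dy`. -/
theorem metricVolume_restrict (hσ : ∀ x, IsInnerForm (σ x)) (c : Sig) :
    (metricVolume σ).restrict (extChartAt (𝓡∂ m) c).source = chartMeasure σ c := by
  have hs : MeasurableSet (extChartAt (𝓡∂ m) c).source := (isOpen_extChartAt_source c).measurableSet
  ext A hA
  rw [Measure.restrict_apply hA, metricVolume_apply_of_subset hσ (hA.inter hs) inter_subset_right,
    chartMeasure_apply c hA, chartMeasure_apply c (hA.inter hs)]
  congr 2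
  ext y
  simp only [mem_inter_iff, mem_preimage]
  exact ⟨fun h => ⟨h.1, h.2.1⟩, fun h => ⟨h.1, h.2, (extChartAt (𝓡∂ m) c).map_target h.1⟩⟩

theorem integral_metricVolume_chart (hσ : ∀ x, IsInnerForm (σ x)) {c : Sig}
    (hd : ContinuousOn (chartDensity σ c) (extChartAt (𝓡∂ m) c).target) {f : Sig → ℝ}
    (hf : ∀ x ∉ (extChartAt (𝓡∂ m) c).source, f x = 0)
    (hfm : AEStronglyMeasurable f (metricVolume σ)) :
    ∫ x, f x ∂(metricVolume σ) = ∫ y in (extChartAt (𝓡∂ m) c).target,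
      chartDensity σ c y * f ((extChartAt (𝓡∂ m) c).symm y) := by
  have hs : MeasurableSet (extChartAt (𝓡∂ m) c).source := (isOpen_extChartAt_source c).measurableSet
  have hT := measurableSet_extChartAt_target (m := m) c
  rw [← setIntegral_eq_integral_of_forall_compl_eq_zero hf, metricVolume_restrict hσ,
    chartMeasure, integral_map (aemeasurable_symm_withDensity c)]
  · have hdm : AEMeasurable (fun y => (chartDensity σ c y).toNNReal)
        (volume.restrict (extChartAt (𝓡∂ m) c).target) :=
      (hd.aemeasurable hT).real_toNNReal
    have e1 := integral_withDensity_eq_integral_smul₀ hdm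
      (fun y => f ((extChartAt (𝓡∂ m) c).symm y))
    refine Eq.trans e1 ?_
    refine integral_congr_ae (Eventually.of_forall fun y => ?_)
    simp only [NNReal.smul_def, smul_eq_mul]
    rw [Real.coe_toNNReal _ (show 0 ≤ chartDensity σ c y from Real.sqrt_nonneg _)]
  · change AEStronglyMeasurable f (chartMeasure σ c)
    rw [← metricVolume_restrict hσ]
    exact hfm.restrict

/-- Near each point the density is bounded in a chart, so the measure is locally finite, and the
manifold is compact. -/
theorem metricVolume_isFiniteMeasure (hσ : ∀ x, IsInnerForm (σ x))
    (hd : ∀ c, ContinuousOn (chartDensity σ c) (extChartAt (𝓡∂ m) c).target) :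
    IsFiniteMeasure (metricVolume σ) := by
  refine ⟨isCompact_univ.measure_lt_top_of_nhdsWithin fun x _ => ?_⟩
  set e := extChartAt (𝓡∂ m) x with he
  have hx : e x ∈ e.target := mem_extChartAt_target x
  have h1 : ∀ᶠ y in 𝓝[e.target] (e x), chartDensity σ x y < chartDensity σ x (e x) + 1 :=
    (hd x (e x) hx).eventually (gt_mem_nhds (lt_add_one _))
  obtain ⟨r, hr, h1'⟩ := Metric.nhdsWithin_basis_ball.eventually_iff.1 h1
  replace h1 : ∀ y ∈ Metric.ball (extChartAt (𝓡∂ m) x x) r, y ∈ (extChartAt (𝓡∂ m) x).target → _ :=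
    fun y hy hy' => h1' ⟨hy, hy'⟩
  set A := e.source ∩ e ⁻¹' Metric.ball (e x) r with hA
  have hAo : IsOpen A := (continuousOn_extChartAt x).isOpen_inter_preimage
    (isOpen_extChartAt_source x) Metric.isOpen_ball
  have hAx : x ∈ A := ⟨mem_extChartAt_source x, Metric.mem_ball_self hr⟩
  refine ⟨A, mem_nhdsWithin_of_mem_nhds (hAo.mem_nhds hAx), ?_⟩
  rw [metricVolume_apply_of_subset hσ hAo.measurableSet inter_subset_left,
    chartMeasure_apply x hAo.measurableSet]
  have hsub : e.target ∩ e.symm ⁻¹' A ⊆ Metric.ball (e x) r := by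
    rintro y ⟨hy, hyA⟩
    have := hyA.2
    rwa [mem_preimage, e.right_inv hy] at this
  calc ∫⁻ y in e.target ∩ e.symm ⁻¹' A, ENNReal.ofReal (chartDensity σ x y)
      ≤ ∫⁻ y in e.target ∩ e.symm ⁻¹' A, ENNReal.ofReal (chartDensity σ x (e x) + 1) :=
        setLIntegral_mono' (measurableSet_chart_preimage x hAo.measurableSet) fun y hy =>
          ENNReal.ofReal_le_ofReal (h1 y (hsub hy) hy.1).le
    _ = ENNReal.ofReal (chartDensity σ x (e x) + 1) * volume (e.target ∩ e.symm ⁻¹' A) := by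
        rw [lintegral_const, Measure.restrict_apply_univ]
    _ ≤ ENNReal.ofReal (chartDensity σ x (e x) + 1) * volume (Metric.ball (e x) r) := by gcongr
    _ < ⊤ := ENNReal.mul_lt_top ENNReal.ofReal_lt_top Metric.isBounded_ball.measure_lt_top

omit [IsManifold (𝓡∂ m) ∞ Sig] in
theorem metricVolume_le_smul {σ' : (x : Sig) → TangentSpace (𝓡∂ m) x → TangentSpace (𝓡∂ m) x → ℝ} {K : ℝ≥0}
    (h : ∀ c : Sig, ∀ y ∈ (extChartAt (𝓡∂ m) c).target, chartDensity σ c y ≤ K * chartDensity σ' c y) :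
    metricVolume σ ≤ K • metricVolume σ' := by
  obtain ⟨d, p, hpm, hpd, hpu, hps, hV⟩ := exists_pieces (m := m) (Sig := Sig)
  refine Measure.le_iff.2 fun A hA => ?_
  rw [Measure.smul_apply, hV σ, hV σ', Measure.sum_apply _ hA, Measure.sum_apply _ hA,
    ENNReal.smul_def, smul_eq_mul, ← ENNReal.tsum_mul_left]
  refine ENNReal.tsum_le_tsum fun n => ?_
  rw [Measure.restrict_apply hA, Measure.restrict_apply hA, chartMeasure_apply _ (hA.inter (hpm n)),
    chartMeasure_apply _ (hA.inter (hpm n)), ← lintegral_const_mul' _ _ ENNReal.coe_ne_top]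
  refine setLIntegral_mono' (measurableSet_chart_preimage _ (hA.inter (hpm n))) fun y hy => ?_
  rw [← ENNReal.ofReal_coe_nnreal, ← ENNReal.ofReal_mul K.coe_nonneg]
  exact ENNReal.ofReal_le_ofReal (h _ y hy.1)

end Volume

namespace SpacelikeHypersurface

/-! ### Volume densities of the graph metrics -/

section SliceVolume

open Matrix

variable {m : ℕ} [NeZero m] {S : Type*} [TopologicalSpace S]
  [ChartedSpace (EuclideanSpace ℝ (Fin m)) S] {G : SplitSpacetime m S}
  {Sig : Type*} [TopologicalSpace Sig] [ChartedSpace (EuclideanHalfSpace m) Sig]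
  (D : SpacelikeHypersurface G Sig)

theorem gram_sigma_frameVec (u : Sig → ℝ) (c : Sig) (y : EuclideanSpace ℝ (Fin m)) :
    IsInnerForm.gram (D.sigma u ((extChartAt (𝓡∂ m) c).symm y)) (frameVec c y)
      = Matrix.of fun i j => D.chartMetric c (u ((extChartAt (𝓡∂ m) c).symm y), y) i j := rfl

variable [IsManifold (𝓡 m) ∞ S] [IsManifold (𝓡∂ m) ∞ Sig]

theorem chartDensity_continuousOn {u : Sig → ℝ} (hu : Continuous u) (c : Sig) :
    ContinuousOn (chartDensity (D.sigma u) c) (extChartAt (𝓡∂ m) c).target := by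
  have h1 : ContinuousOn (fun y => (IsInnerForm.gram (D.sigma u ((extChartAt (𝓡∂ m) c).symm y))
      (frameVec c y))) (extChartAt (𝓡∂ m) c).target := by
    refine continuousOn_pi.2 fun i => continuousOn_pi.2 fun j => ?_
    simp only [gram_sigma_frameVec, Matrix.of_apply]
    refine (D.chartMetric_contDiffOn c i j).continuousOn.comp
      (f := fun y => (u ((extChartAt (𝓡∂ m) c).symm y), y)) ?_ fun y hy => ⟨mem_univ _, hy⟩
    exact (hu.comp_continuousOn (continuousOn_extChartAt_symm c)).prodMk continuousOn_id
  refine ContinuousOn.sqrt ?_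
  exact continuous_id.matrix_det.comp_continuousOn h1

omit [IsManifold (𝓡 m) ∞ S] in
theorem gram_sigma_posDef (u : Sig → ℝ) {c : Sig} {y : EuclideanSpace ℝ (Fin m)}
    (hy : y ∈ (extChartAt (𝓡∂ m) c).target) :
    (IsInnerForm.gram (D.sigma u ((extChartAt (𝓡∂ m) c).symm y)) (frameVec c y)).PosDef :=
  (D.sigma_isInnerForm u _).gram_posDef (frameVec_linearIndependent hy)

omit [IsManifold (𝓡 m) ∞ S] in
theorem chartDensity_pos (u : Sig → ℝ) {c : Sig} {y : EuclideanSpace ℝ (Fin m)}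
    (hy : y ∈ (extChartAt (𝓡∂ m) c).target) : 0 < chartDensity (D.sigma u) c y :=
  Real.sqrt_pos.2 (D.gram_sigma_posDef u hy).det_pos

omit [IsManifold (𝓡 m) ∞ S] in
theorem chartDensity_le {u u' : Sig → ℝ} {K : ℝ} 
    (h : ∀ x v, D.sigma u x v v ≤ K ^ 2 * D.sigma u' x v v) (hK : 0 ≤ K) {c : Sig}
    {y : EuclideanSpace ℝ (Fin m)} (hy : y ∈ (extChartAt (𝓡∂ m) c).target) :
    chartDensity (D.sigma u) c y ≤ K ^ m * chartDensity (D.sigma u') c y := by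
  have h1 := (D.gram_sigma_posDef u' hy).det_le_of_forall_le (D.gram_sigma_posDef u hy) (C := K ^ 2)
    fun v => by
      rw [(D.sigma_isInnerForm u _).dotProduct_gram, (D.sigma_isInnerForm u' _).dotProduct_gram]
      exact h _ _
  rw [Fintype.card_fin] at h1
  rw [chartDensity_eq, chartDensity_eq]
  calc _ ≤ √((K ^ 2) ^ m * _) := Real.sqrt_le_sqrt h1
    _ = _ := by
      rw [Real.sqrt_mul (by positivity), ← pow_mul, mul_comm 2, pow_mul, Real.sqrt_sq (by positivity)]

end SliceVolume

end SpacelikeHypersurface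

/-! ### Smoothness of matrix functions -/

section MatrixSmooth

open Matrix

variable {n : Type*} [Fintype n] [DecidableEq n] {E : Type*} [NormedAddCommGroup E] [NormedSpace ℝ E]
  {k : WithTop ℕ∞} {A : E → Matrix n n ℝ} {s : Set E} {x : E}

theorem ContDiffWithinAt.matrix_det_entries (hk : k ≤ ((⊤ : ℕ∞) : WithTop ℕ∞))
    (h : ∀ i j, ContDiffWithinAt ℝ k (fun y => A y i j) s x) :
    ContDiffWithinAt ℝ k (fun y => (A y).det) s x := by
  have h1 : ContDiffWithinAt ℝ k (fun y => (fun i j => A y i j : n → n → ℝ)) s x :=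
    contDiffWithinAt_pi.2 fun i => contDiffWithinAt_pi.2 fun j => h i j
  exact ((contDiff_matrix_det (n := n)).of_le hk).contDiffAt.comp_contDiffWithinAt x h1

theorem ContDiffWithinAt.matrix_inv_entries (hk : k ≤ ((⊤ : ℕ∞) : WithTop ℕ∞))
    (h : ∀ i j, ContDiffWithinAt ℝ k (fun y => A y i j) s x) (hx : (A x).det ≠ 0) (i j : n) :
    ContDiffWithinAt ℝ k (fun y => (A y)⁻¹ i j) s x := by
  simp only [Matrix.inv_def, Ring.inverse_eq_inv', Matrix.smul_apply, smul_eq_mul,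
    Matrix.adjugate_apply]
  refine ((ContDiffWithinAt.matrix_det_entries hk h).inv hx).mul
    (ContDiffWithinAt.matrix_det_entries hk fun a b => ?_)
  simp only [Matrix.updateRow_apply]
  split_ifs
  · exact contDiffWithinAt_const
  · exact h a b

end MatrixSmooth

namespace SpacelikeHypersurface

/-! ### The space-time metric and graphs in charts -/

section CoordMetric

open Matrix

variable {m : ℕ} [NeZero m] {S : Type*} [TopologicalSpace S]
  [ChartedSpace (EuclideanSpace ℝ (Fin m)) S] {G : SplitSpacetime m S}
  {Sig : Type*} [TopologicalSpace Sig] [ChartedSpace (EuclideanHalfSpace m) Sig]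
  (D : SpacelikeHypersurface G Sig) {c : Sig} {y : EuclideanSpace ℝ (Fin m)}

/-- The lapse in the coordinates of the chart around `c`. -/
noncomputable def chartLapse (c : Sig) (q : ℝ × EuclideanSpace ℝ (Fin m)) : ℝ :=
  G.lapse (q.1, D.proj ((extChartAt (𝓡∂ m) c).symm q.2))

variable [IsManifold (𝓡 m) ∞ S] [IsManifold (𝓡∂ m) ∞ Sig]

omit [IsManifold (𝓡 m) ∞ S] in
theorem chartLapse_contDiffOn (c : Sig) : ContDiffOn ℝ ∞ (D.chartLapse c)
    (univ ×ˢ (extChartAt (𝓡∂ m) c).target) := by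
  rw [← contMDiffOn_iff_contDiffOn]
  refine G.lapse_smooth.comp_contMDiffOn (ContMDiffOn.prodMk ?_ ?_)
  · exact contDiff_fst.contMDiff.contMDiffOn
  · refine D.proj_smooth.comp_contMDiffOn ?_
    exact (contMDiffOn_extChartAt_symm c).comp (contDiff_snd.contMDiff.contMDiffOn) fun q hq => hq.2

omit [IsManifold (𝓡 m) ∞ S] in
-- The point must be interior because `coordMetric` uses two-sided derivatives of the inverse chart;
-- there these agree with the derivatives within the half space that define the frame.
theorem coordMetric_eq (hy : y ∈ interior (extChartAt (𝓡∂ m) c).target) (t : ℝ)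
    (V W : ℝ × EuclideanSpace ℝ (Fin m)) :
    D.coordMetric c (t, y) V W = D.chartLapse c (t, y) ^ 2 * (-(V.1 * W.1) +
      ∑ i, ∑ j, V.2 i * W.2 j * D.chartMetric c (t, y) i j) := by
  rw [← slice_chartFrame]
  have hyt := interior_subset hy
  have hr : range (𝓡∂ m) ∈ 𝓝 y := mem_of_superset (isOpen_interior.mem_nhds hy)
    (interior_subset.trans (extChartAt_target_subset_range c))
  have hmd : MDifferentiableAt 𝓘(ℝ, EuclideanSpace ℝ (Fin m)) (𝓡∂ m) (extChartAt (𝓡∂ m) c).symm y :=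
    (mdifferentiableWithinAt_extChartAt_symm hyt).mdifferentiableAt hr
  have h := mfderiv_comp (I := 𝓘(ℝ, EuclideanSpace ℝ (Fin m))) (I' := 𝓡∂ m)
    (I'' := 𝓡 m) (f := (extChartAt (𝓡∂ m) c).symm) (g := D.proj) y
    (D.proj_smooth.mdifferentiable (by simp) _) hmd
  have h2 : ∀ v : EuclideanSpace ℝ (Fin m), mfderiv 𝓘(ℝ, EuclideanSpace ℝ (Fin m)) (𝓡 m)
      (fun y : EuclideanSpace ℝ (Fin m) => D.proj ((extChartAt (𝓡∂ m) c).symm y)) y v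
      = mfderiv (𝓡∂ m) (𝓡 m) D.proj ((extChartAt (𝓡∂ m) c).symm y) (chartFrame c y v) := by
    intro v
    have h3 := congrArg (fun A => A v) h
    refine h3.trans ?_
    rw [chartFrame, mfderivWithin_of_mem_nhds hr]
    rfl
  simp only [coordMetric, SplitSpacetime.metric, slice, chartLapse]
  rw [h2, h2]

omit [NeZero m] [IsManifold (𝓡 m) ∞ S] [IsManifold (𝓡∂ m) ∞ Sig] in
theorem _root_.mem_nhds_interior_strip {O : Set (EuclideanSpace ℝ (Fin m))} (hO : IsOpen O) {t : ℝ}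
    (hy : y ∈ O) : univ ×ˢ O ∈ 𝓝 ((t, y) : ℝ × EuclideanSpace ℝ (Fin m)) :=
  (isOpen_univ.prod hO).mem_nhds (mk_mem_prod (mem_univ _) hy)

theorem coordMetric_contDiffAt (hy : y ∈ interior (extChartAt (𝓡∂ m) c).target) (t : ℝ)
    (V W : ℝ × EuclideanSpace ℝ (Fin m)) :
    ContDiffAt ℝ ∞ (fun q => D.coordMetric c q V W) (t, y) := by
  have hn := mem_nhds_interior_strip (isOpen_interior (s := (extChartAt (𝓡∂ m) c).target)) (t := t) hy
  have hn' := mem_of_superset hn (prod_mono (Subset.refl univ) interior_subset)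
  have h : (fun q => D.coordMetric c q V W) =ᶠ[𝓝 (t, y)] fun q => D.chartLapse c q ^ 2 *
      (-(V.1 * W.1) + ∑ i, ∑ j, V.2 i * W.2 j * D.chartMetric c q i j) := by
    filter_upwards [hn] with q hq
    exact D.coordMetric_eq hq.2 q.1 V W
  refine ContDiffAt.congr_of_eventuallyEq ?_ h
  have h1 := (D.chartLapse_contDiffOn c).contDiffAt hn'
  have h2 : ∀ i j, ContDiffAt ℝ ∞ (fun q => D.chartMetric c q i j) (t, y) := fun i j =>
    (D.chartMetric_contDiffOn c i j).contDiffAt hn'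
  exact (h1.pow 2).mul (contDiffAt_const.add (ContDiffAt.sum fun i _ => ContDiffAt.sum fun j _ =>
    contDiffAt_const.mul (h2 i j)))

theorem coordMetric_differentiableMetricAt (hy : y ∈ interior (extChartAt (𝓡∂ m) c).target) (t : ℝ) :
    DifferentiableMetricAt (D.coordMetric c) (t, y) where
  symm q V W := by
    simp only [coordMetric, SplitSpacetime.metric]
    rw [G.spatial_symm, mul_comm V.1]
  add_left q V V' W := by
    set f := fun y : EuclideanSpace ℝ (Fin m) => D.proj ((extChartAt (𝓡∂ m) c).symm y) with hf
    set A := mfderiv 𝓘(ℝ, EuclideanSpace ℝ (Fin m)) (𝓡 m) f q.2 with hA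
    have h := (congrArg (fun z => G.spatial q.1 (f q.2) z (A W.2)) (map_add A V.2 V'.2)).trans
      ((spatial_isInnerForm (G := G) q.1 (f q.2)).add_left (A V.2) (A V'.2) (A W.2))
    change G.lapse _ ^ 2 * (-((V.1 + V'.1) * W.1) + G.spatial q.1 (f q.2) (A (V.2 + V'.2)) (A W.2))
      = G.lapse _ ^ 2 * (-(V.1 * W.1) + G.spatial q.1 (f q.2) (A V.2) (A W.2)) +
        G.lapse _ ^ 2 * (-(V'.1 * W.1) + G.spatial q.1 (f q.2) (A V'.2) (A W.2))
    linear_combination G.lapse (q.1, f q.2) ^ 2 * h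
  smul_left q a V W := by
    set f := fun y : EuclideanSpace ℝ (Fin m) => D.proj ((extChartAt (𝓡∂ m) c).symm y) with hf
    set A := mfderiv 𝓘(ℝ, EuclideanSpace ℝ (Fin m)) (𝓡 m) f q.2 with hA
    have h := (congrArg (fun z => G.spatial q.1 (f q.2) z (A W.2)) (map_smul A a V.2)).trans
      ((spatial_isInnerForm (G := G) q.1 (f q.2)).smul_left a (A V.2) (A W.2))
    change G.lapse _ ^ 2 * (-((a * V.1) * W.1) + G.spatial q.1 (f q.2) (A (a • V.2)) (A W.2))
      = a * (G.lapse _ ^ 2 * (-(V.1 * W.1) + G.spatial q.1 (f q.2) (A V.2) (A W.2)))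
    linear_combination G.lapse (q.1, f q.2) ^ 2 * h
  diff V W := (D.coordMetric_contDiffAt hy t V W).differentiableAt (by simp)

/-- The Gram matrix of the slice metric along the graph of `u`. -/
noncomputable def chartGram (u : Sig → ℝ) (c : Sig) (y : EuclideanSpace ℝ (Fin m)) :
    Matrix (Fin m) (Fin m) ℝ :=
  IsInnerForm.gram (D.sigma u ((extChartAt (𝓡∂ m) c).symm y)) (frameVec c y)

/-- The partial derivatives of `u`. -/
noncomputable def _root_.chartPartial (u : Sig → ℝ) (c : Sig) (y : EuclideanSpace ℝ (Fin m)) (i : Fin m) : ℝ :=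
  fderivWithin ℝ (u ∘ (extChartAt (𝓡∂ m) c).symm) (range (𝓡∂ m)) y (EuclideanSpace.single i 1)

omit [IsManifold (𝓡 m) ∞ S] in
theorem chartGram_posDef (u : Sig → ℝ) (hy : y ∈ (extChartAt (𝓡∂ m) c).target) :
    (D.chartGram u c y).PosDef := D.gram_sigma_posDef u hy

omit [IsManifold (𝓡 m) ∞ S] in
theorem gradVec_chart {u : Sig → ℝ} (hu : ContMDiff (𝓡∂ m) 𝓘(ℝ, ℝ) 1 u) (v : Sig → ℝ)
    (hy : y ∈ (extChartAt (𝓡∂ m) c).target) :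
    gradVec (D.sigma v) u ((extChartAt (𝓡∂ m) c).symm y)
      = ∑ i, ((D.chartGram v c y)⁻¹ *ᵥ chartPartial u c y) i • frameVec c y i := by
  have hi := D.sigma_isInnerForm v ((extChartAt (𝓡∂ m) c).symm y)
  refine gradVec_eq_of_forall hi fun w => ?_
  have h := hi.gradient_frame (frameVec_linearIndependent hy) (frameVec_span hy)
    ((mfderiv (𝓡∂ m) 𝓘(ℝ, ℝ) u ((extChartAt (𝓡∂ m) c).symm y)).toLinearMap) w
  refine Eq.trans ?_ h
  have e : chartPartial u c y = fun j => ((mfderiv (𝓡∂ m) 𝓘(ℝ, ℝ) u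
      ((extChartAt (𝓡∂ m) c).symm y)).toLinearMap) (frameVec c y j) := by
    ext j
    exact (dAlong_chartFrame hy (hu.mdifferentiable (by simp) _) _).symm
  rw [e]; rfl

omit [IsManifold (𝓡 m) ∞ S] in
theorem gradInner_chart {u η : Sig → ℝ} (hu : ContMDiff (𝓡∂ m) 𝓘(ℝ, ℝ) 1 u)
    (hη : ContMDiff (𝓡∂ m) 𝓘(ℝ, ℝ) 1 η) (v : Sig → ℝ) (hy : y ∈ (extChartAt (𝓡∂ m) c).target) :
    gradInner (D.sigma v) u η ((extChartAt (𝓡∂ m) c).symm y)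
      = ((D.chartGram v c y)⁻¹ *ᵥ chartPartial u c y) ⬝ᵥ chartPartial η c y := by
  rw [gradInner, D.gradVec_chart hu v hy]
  refine (map_sum (mfderiv (𝓡∂ m) 𝓘(ℝ, ℝ) η ((extChartAt (𝓡∂ m) c).symm y)) _ _).trans ?_
  refine Finset.sum_congr rfl fun i _ => ?_
  refine (map_smul (mfderiv (𝓡∂ m) 𝓘(ℝ, ℝ) η ((extChartAt (𝓡∂ m) c).symm y)) _ _).trans ?_
  exact congrArg (fun z : ℝ => ((D.chartGram v c y)⁻¹ *ᵥ chartPartial u c y) i * z)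
    (dAlong_chartFrame hy (hη.mdifferentiable (by simp) _) _)

omit [IsManifold (𝓡 m) ∞ S] in
theorem gradNormSq_chart {u : Sig → ℝ} (hu : ContMDiff (𝓡∂ m) 𝓘(ℝ, ℝ) 1 u)
    (v : Sig → ℝ) (hy : y ∈ (extChartAt (𝓡∂ m) c).target) :
    gradNormSq (D.sigma v) u ((extChartAt (𝓡∂ m) c).symm y)
      = chartPartial u c y ⬝ᵥ (D.chartGram v c y)⁻¹ *ᵥ chartPartial u c y := by
  rw [dotProduct_comm, ← D.gradInner_chart hu hu v hy]; rfl

theorem chartGram_continuousOn {v : Sig → ℝ} (hv : Continuous v) (c : Sig) (i j : Fin m) :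
    ContinuousOn (fun y => D.chartGram v c y i j) (extChartAt (𝓡∂ m) c).target := by
  refine (D.chartMetric_contDiffOn c i j).continuousOn.comp
      (f := fun y => (v ((extChartAt (𝓡∂ m) c).symm y), y)) ?_ fun y hy => ⟨mem_univ _, hy⟩
  exact (hv.comp_continuousOn (continuousOn_extChartAt_symm c)).prodMk continuousOn_id

omit [IsManifold (𝓡∂ m) ∞ Sig] in
theorem _root_.continuous_of_continuousOn_charts {f : Sig → ℝ} (h : ∀ c : Sig,
    ContinuousOn (f ∘ (extChartAt (𝓡∂ m) c).symm) (extChartAt (𝓡∂ m) c).target) : Continuous f := by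
  refine continuous_iff_continuousAt.2 fun x => ?_
  have h1 : ContinuousOn ((f ∘ (extChartAt (𝓡∂ m) x).symm) ∘ extChartAt (𝓡∂ m) x)
      (extChartAt (𝓡∂ m) x).source :=
    (h x).comp (continuousOn_extChartAt x) fun z hz => (extChartAt (𝓡∂ m) x).map_source hz
  have h2 : ContinuousOn f (extChartAt (𝓡∂ m) x).source := h1.congr fun z hz =>
    congrArg f ((extChartAt (𝓡∂ m) x).left_inv hz).symm
  exact h2.continuousAt (extChartAt_source_mem_nhds x)

theorem gradInner_continuous {u η v : Sig → ℝ} (hu : ContMDiff (𝓡∂ m) 𝓘(ℝ, ℝ) 1 u)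
    (hη : ContMDiff (𝓡∂ m) 𝓘(ℝ, ℝ) 1 η) (hv : Continuous v) :
    Continuous (gradInner (D.sigma v) u η) := by
  refine continuous_of_continuousOn_charts (m := m) fun c => ?_
  refine ContinuousOn.congr (f := fun y => ∑ i, (∑ j, (D.chartGram v c y)⁻¹ i j * chartPartial u c y j)
    * chartPartial η c y i) ?_ fun y hy => D.gradInner_chart hu hη v hy
  refine continuousOn_finsetSum _ fun i _ => ContinuousOn.mul (continuousOn_finsetSum _ fun j _ =>
    ContinuousOn.mul ?_ (continuousOn_fderivWithin_comp hu c _)) (continuousOn_fderivWithin_comp hη c _)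
  have h1 : ContinuousOn (fun y => D.chartGram v c y) (extChartAt (𝓡∂ m) c).target :=
    continuousOn_pi.2 fun i => continuousOn_pi.2 fun j => D.chartGram_continuousOn hv c i j
  have h2 : ContinuousOn (fun y => (D.chartGram v c y)⁻¹) (extChartAt (𝓡∂ m) c).target := by
    simp only [Matrix.inv_def, Ring.inverse_eq_inv']
    refine ContinuousOn.smul (ContinuousOn.inv₀ (continuous_id.matrix_det.comp_continuousOn h1) fun y hy => ?_)
      (continuous_id.matrix_adjugate.comp_continuousOn h1)
    exact (D.chartGram_posDef v hy).det_pos.ne'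
  exact (continuousOn_pi.1 (continuousOn_pi.1 h2 i) j)

theorem gradNormSq_continuous {u v : Sig → ℝ} (hu : ContMDiff (𝓡∂ m) 𝓘(ℝ, ℝ) 1 u)
    (hv : Continuous v) : Continuous (gradNormSq (D.sigma v) u) := D.gradInner_continuous hu hu hv

omit [IsManifold (𝓡 m) ∞ S] [IsManifold (𝓡∂ m) ∞ Sig] in
theorem tilt_sq {u : Sig → ℝ} {x : Sig} (h : gradNormSq (D.sigma u) u x < 1) :
    D.tilt u x ^ 2 = 1 / (1 - gradNormSq (D.sigma u) u x) := by
  rw [tilt, div_pow, Real.sq_sqrt (by linarith), one_pow]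

omit [IsManifold (𝓡 m) ∞ S] [IsManifold (𝓡∂ m) ∞ Sig] in
theorem one_le_tilt {u : Sig → ℝ} {x : Sig} (h : gradNormSq (D.sigma u) u x < 1) :
    1 ≤ D.tilt u x := by
  have h0 := gradNormSq_nonneg (D.sigma_isInnerForm u x) u
  rw [tilt, le_div_iff₀ (Real.sqrt_pos.2 (by linarith)), one_mul]
  exact Real.sqrt_le_one.2 (by linarith)

theorem tilt_continuous {u : Sig → ℝ} (hu : ContMDiff (𝓡∂ m) 𝓘(ℝ, ℝ) 1 u)
    (h : ∀ x, gradNormSq (D.sigma u) u x < 1) : Continuous (D.tilt u) := by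
  refine continuous_const.div (Real.continuous_sqrt.comp
    (continuous_const.sub (D.gradNormSq_continuous hu hu.continuous))) fun x => ?_
  exact (Real.sqrt_pos.2 (by linarith [h x])).ne'

omit [IsManifold (𝓡 m) ∞ S] [IsManifold (𝓡∂ m) ∞ Sig] in
theorem lapseAlong_pos (u : Sig → ℝ) (x : Sig) : 0 < D.lapseAlong u x := G.lapse_pos _

omit [IsManifold (𝓡 m) ∞ S] [IsManifold (𝓡∂ m) ∞ Sig] in
theorem lapseAlong_continuous {u : Sig → ℝ} (hu : Continuous u) : Continuous (D.lapseAlong u) :=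
  G.lapse_smooth.continuous.comp (hu.prodMk D.proj_smooth.continuous)

end CoordMetric

end SpacelikeHypersurface

namespace SpacelikeHypersurface

/-! ### The divergence of the flux in a chart -/

section Flux

open Matrix

variable {m : ℕ} [NeZero m] {S : Type*} [TopologicalSpace S]
  [ChartedSpace (EuclideanSpace ℝ (Fin m)) S] {G : SplitSpacetime m S}
  {Sig : Type*} [TopologicalSpace Sig] [ChartedSpace (EuclideanHalfSpace m) Sig]
  (D : SpacelikeHypersurface G Sig) {c : Sig} {y : EuclideanSpace ℝ (Fin m)} {u : Sig → ℝ}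

theorem _root_.chartPartial_interior (u : Sig → ℝ) (hy : y ∈ interior (extChartAt (𝓡∂ m) c).target) (i : Fin m) :
    chartPartial u c y i = fderiv ℝ (u ∘ (extChartAt (𝓡∂ m) c).symm) y (EuclideanSpace.single i 1) := by
  rw [chartPartial, fderivWithin_of_mem_nhds]
  exact mem_of_superset (isOpen_interior.mem_nhds hy)
    (interior_subset.trans (extChartAt_target_subset_range c))

/-- The flux `√det g · grad τ` in the chart around `c`. -/
noncomputable def chartFlux (u : Sig → ℝ) (c : Sig) : EuclideanSpace ℝ (Fin m) → Fin m → ℝ :=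
  graphFlux (D.coordMetric c) (u ∘ (extChartAt (𝓡∂ m) c).symm)

variable [IsManifold (𝓡 m) ∞ S] [IsManifold (𝓡∂ m) ∞ Sig]

omit [IsManifold (𝓡 m) ∞ S] in
theorem graphGram_coordMetric (u : Sig → ℝ) (hy : y ∈ interior (extChartAt (𝓡∂ m) c).target) :
    graphGram (D.coordMetric c) (u ∘ (extChartAt (𝓡∂ m) c).symm) y
      = (D.lapseAlong u ((extChartAt (𝓡∂ m) c).symm y)) ^ 2 •
        (D.chartGram u c y - vecMulVec (chartPartial u c y) (chartPartial u c y)) := by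
  ext i j
  simp only [graphGram, Matrix.of_apply, Matrix.smul_apply, Matrix.sub_apply, vecMulVec_apply,
    smul_eq_mul, chartPartial_interior u hy]
  rw [D.coordMetric_eq hy]
  simp only [graphTangent, PiLp.single_apply, ite_mul, one_mul, zero_mul]
  have : D.chartGram u c y i j = D.chartMetric c ((u ∘ (extChartAt (𝓡∂ m) c).symm) y, y) i j := rfl
  rw [this]
  have e2 : D.chartLapse c ((u ∘ (extChartAt (𝓡∂ m) c).symm) y, y)
      = D.lapseAlong u ((extChartAt (𝓡∂ m) c).symm y) := rfl
  rw [e2]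
  simp [Finset.sum_ite_irrel]
  left
  ring

omit [IsManifold (𝓡 m) ∞ S] in
theorem coordMetric_time (u : Sig → ℝ) (hy : y ∈ interior (extChartAt (𝓡∂ m) c).target) (j : Fin m) :
    D.coordMetric c ((u ∘ (extChartAt (𝓡∂ m) c).symm) y, y) (1, 0)
      (graphTangent (u ∘ (extChartAt (𝓡∂ m) c).symm) y j)
      = -((D.lapseAlong u ((extChartAt (𝓡∂ m) c).symm y)) ^ 2 * chartPartial u c y j) := by
  rw [D.coordMetric_eq hy, chartPartial_interior u hy]
  have e2 : D.chartLapse c ((u ∘ (extChartAt (𝓡∂ m) c).symm) y, y)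
      = D.lapseAlong u ((extChartAt (𝓡∂ m) c).symm y) := rfl
  rw [e2]
  simp [graphTangent]

section AtPoint

variable (hu : ContMDiff (𝓡∂ m) 𝓘(ℝ, ℝ) 1 u)
  (hs : gradNormSq (D.sigma u) u ((extChartAt (𝓡∂ m) c).symm y) < 1)
  (hy : y ∈ interior (extChartAt (𝓡∂ m) c).target)

include hu hs hy

omit [IsManifold (𝓡 m) ∞ S] in
-- The induced metric is g = α²(σ - du ⊗ du), a rank one perturbation, so det g = α^(2m) det σ (1 -
-- |du|²), and the last factor is w⁻².
theorem sqrt_det_graphGram :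
    0 < (graphGram (D.coordMetric c) (u ∘ (extChartAt (𝓡∂ m) c).symm) y).det ∧
    √(graphGram (D.coordMetric c) (u ∘ (extChartAt (𝓡∂ m) c).symm) y).det
      = D.lapseAlong u ((extChartAt (𝓡∂ m) c).symm y) ^ m * chartDensity (D.sigma u) c y
        / D.tilt u ((extChartAt (𝓡∂ m) c).symm y) := by
  set x := (extChartAt (𝓡∂ m) c).symm y with hx
  have hpd := D.chartGram_posDef u (interior_subset hy)
  have ha := D.lapseAlong_pos u x
  have hd := hpd.det_pos
  rw [D.graphGram_coordMetric u hy, hpd.det_smul_sub_vecMulVec,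
    ← D.gradNormSq_chart hu u (interior_subset hy), ← hx, Fintype.card_fin]
  refine ⟨by have : 0 < 1 - gradNormSq (D.sigma u) u x := by linarith
             positivity, ?_⟩
  rw [Real.sqrt_mul (by positivity), Real.sqrt_mul hd.le, ← pow_mul, mul_comm 2, pow_mul,
    Real.sqrt_sq (by positivity), tilt, div_div_eq_mul_div, div_one, mul_assoc]
  rfl

omit [IsManifold (𝓡 m) ∞ S] in
theorem inv_graphGram :
    (graphGram (D.coordMetric c) (u ∘ (extChartAt (𝓡∂ m) c).symm) y)⁻¹
      = ((D.lapseAlong u ((extChartAt (𝓡∂ m) c).symm y)) ^ 2)⁻¹ • ((D.chartGram u c y)⁻¹ +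
        (D.tilt u ((extChartAt (𝓡∂ m) c).symm y) ^ 2) •
        vecMulVec ((D.chartGram u c y)⁻¹ *ᵥ chartPartial u c y)
          ((D.chartGram u c y)⁻¹ *ᵥ chartPartial u c y)) := by
  have hpd := D.chartGram_posDef u (interior_subset hy)
  have ha := D.lapseAlong_pos u ((extChartAt (𝓡∂ m) c).symm y)
  have e := D.gradNormSq_chart hu u (interior_subset hy)
  rw [D.graphGram_coordMetric u hy, hpd.inv_smul_sub_vecMulVec (by positivity) (by rwa [← e]), ← e,
    D.tilt_sq hs]

omit [IsManifold (𝓡 m) ∞ S] in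
-- Here ḡ(∂_t, F_*ε_j) = -α² ∂_j u, so the Sherman–Morrison formula gives -(1 + w²|Du|²) Du, and 1 +
-- w²|Du|² = w².
theorem inv_graphGram_mulVec_time :
    ((graphGram (D.coordMetric c) (u ∘ (extChartAt (𝓡∂ m) c).symm) y)⁻¹ *ᵥ fun j =>
      D.coordMetric c ((u ∘ (extChartAt (𝓡∂ m) c).symm) y, y) (1, 0)
        (graphTangent (u ∘ (extChartAt (𝓡∂ m) c).symm) y j))
      = -(D.tilt u ((extChartAt (𝓡∂ m) c).symm y) ^ 2 •
        ((D.chartGram u c y)⁻¹ *ᵥ chartPartial u c y)) := by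
  set x := (extChartAt (𝓡∂ m) c).symm y with hx
  have ha := D.lapseAlong_pos u x
  simp only [D.coordMetric_time u hy]
  have e1 : (fun j => -(D.lapseAlong u x ^ 2 * chartPartial u c y j))
      = (-(D.lapseAlong u x ^ 2)) • chartPartial u c y := by
    ext j; simp
  rw [← hx, e1, D.inv_graphGram hu hs hy, ← hx, Matrix.mulVec_smul, Matrix.smul_mulVec, Matrix.add_mulVec,
    Matrix.smul_mulVec, Matrix.vecMulVec_mulVec, smul_smul]
  have e := D.gradNormSq_chart hu u (interior_subset hy)
  rw [dotProduct_comm] at e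
  rw [← e, ← hx]
  have ht := D.tilt_sq hs
  ext i
  simp only [Pi.smul_apply, Pi.add_apply, Pi.neg_apply, smul_eq_mul, MulOpposite.smul_eq_mul_unop,
    MulOpposite.unop_op, ht]
  have h1 : 1 - gradNormSq (D.sigma u) u x ≠ 0 := by linarith
  field_simp
  ring

omit [IsManifold (𝓡 m) ∞ S] in
-- One factor w² comes from raising the index with g⁻¹ and one factor w⁻¹ from √det g; together they
-- leave a single w.
theorem chartFlux_eq (i : Fin m) :
    D.chartFlux u c y i = D.lapseAlong u ((extChartAt (𝓡∂ m) c).symm y) ^ m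
      * chartDensity (D.sigma u) c y * D.tilt u ((extChartAt (𝓡∂ m) c).symm y) *
      ((D.chartGram u c y)⁻¹ *ᵥ chartPartial u c y) i := by
  rw [chartFlux, graphFlux, D.inv_graphGram_mulVec_time hu hs hy, (D.sqrt_det_graphGram hu hs hy).2]
  have h1 := D.one_le_tilt hs
  simp only [Pi.neg_apply, Pi.smul_apply, smul_eq_mul]
  have : D.tilt u ((extChartAt (𝓡∂ m) c).symm y) ≠ 0 := by positivity
  field_simp

end AtPoint

theorem chartFlux_contDiffAt (hu : ContMDiff (𝓡∂ m) 𝓘(ℝ, ℝ) ∞ u)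
    (hs : gradNormSq (D.sigma u) u ((extChartAt (𝓡∂ m) c).symm y) < 1)
    (hy : y ∈ interior (extChartAt (𝓡∂ m) c).target) (i : Fin m) :
    ContDiffAt ℝ 1 (fun y => D.chartFlux u c y i) y := by
  have hu1 : ContMDiff (𝓡∂ m) 𝓘(ℝ, ℝ) 1 u := hu.of_le (by exact_mod_cast le_top)
  have hdet := (D.sqrt_det_graphGram hu1 hs hy).1
  set û := u ∘ (extChartAt (𝓡∂ m) c).symm with hû
  have hûc : ContDiffAt ℝ ∞ û y := (contDiffOn_comp_extChartAt_symm le_rfl hu c).contDiffAt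
    (mem_of_superset (isOpen_interior.mem_nhds hy) interior_subset)
  have hp : ∀ i : Fin m, ContDiffAt ℝ ∞ (fun z => fderiv ℝ û z (EuclideanSpace.single i 1)) y := fun i =>
    (hûc.fderiv_right (m := ∞) (by exact_mod_cast le_rfl)).clm_apply contDiffAt_const
  have hpair : ContDiffAt ℝ ∞ (fun z => (û z, z)) y := hûc.prodMk contDiffAt_id
  have hb : ∀ V W, ContDiffAt ℝ ∞ (fun z => D.coordMetric c (û z, z) V W) y := fun V W =>
    ContDiffAt.comp (g := fun q => D.coordMetric c q V W) (f := fun z => (û z, z)) y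
      (D.coordMetric_contDiffAt hy (û y) V W) hpair
  have hdm := fun q => D.coordMetric_differentiableMetricAt hy q
  have hbt : ∀ (V : ℝ × EuclideanSpace ℝ (Fin m)) (j : Fin m), ContDiffAt ℝ ∞ (fun z => D.coordMetric c (û z, z) V (graphTangent û z j)) y := by
    intro V j
    simp only [graphTangent_eq, (hdm 0).add_right, (hdm 0).smul_right]
    exact ((hp j).mul (hb _ _)).add (hb _ _)
  have hg : ∀ i j, ContDiffAt ℝ ∞ (fun z => graphGram (D.coordMetric c) û z i j) y := by
    intro i j
    simp only [graphGram, Matrix.of_apply]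
    simp only [graphTangent_eq û _ i, (hdm 0).add_left, (hdm 0).smul_left]
    exact ((hp i).mul (hbt _ _)).add (hbt _ _)
  simp only [chartFlux, graphFlux, Matrix.mulVec, dotProduct]
  refine ContDiffAt.of_le ?_ (show (1 : WithTop ℕ∞) ≤ ((⊤ : ℕ∞) : WithTop ℕ∞) by exact_mod_cast le_top)
  have h1 : ContDiffAt ℝ ∞ (fun z => (graphGram (D.coordMetric c) û z).det) y :=
    ContDiffWithinAt.matrix_det_entries (s := univ) le_rfl fun i j => (hg i j).contDiffWithinAt
  have h2 : ∀ i j, ContDiffAt ℝ ∞ (fun z => (graphGram (D.coordMetric c) û z)⁻¹ i j) y := fun i j =>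
    ContDiffWithinAt.matrix_inv_entries (s := univ) le_rfl (fun i j => (hg i j).contDiffWithinAt)
      hdet.ne' i j
  exact ((h1.sqrt hdet.ne').mul (ContDiffAt.sum fun j _ => (h2 i j).mul (hbt _ _))).neg

/-- The divergence of the flux, divided by the density. -/
noncomputable def chartDiv (u : Sig → ℝ) (c : Sig) (y : EuclideanSpace ℝ (Fin m)) : ℝ :=
  (∑ i, fderiv ℝ (fun z => D.chartFlux u c z i) y (EuclideanSpace.single i 1))
    / chartDensity (D.sigma u) c y

end Flux

end SpacelikeHypersurface

/-! ### Integration by parts in a chart -/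

section CoordinateParts

variable {m : ℕ}

theorem integrable_of_continuousOn_of_eq_zero {E : Type*} [TopologicalSpace E] [T2Space E] [MeasurableSpace E] [OpensMeasurableSpace E]
    {μ : Measure E} [IsFiniteMeasureOnCompacts μ] {F : E → ℝ} {O K : Set E} (hK : IsCompact K)
    (hKO : K ⊆ O) (hF : ContinuousOn F O) (h0 : ∀ y ∉ K, F y = 0) : Integrable F μ := by
  rw [← integrableOn_iff_integrable_of_support_subset (s := K)]
  · exact (hF.mono hKO).integrableOn_compact hK
  · intro y hy
    by_contra h
    exact hy (h0 y h)

theorem fderiv_eq_zero_of_notMem_compact {E : Type*} [NormedAddCommGroup E] [NormedSpace ℝ E]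
    {g : E → ℝ} {K : Set E} (hK : IsCompact K) (hg0 : ∀ y ∉ K, g y = 0) {y : E} (hy : y ∉ K) :
    fderiv ℝ g y = 0 := by
  have : g =ᶠ[𝓝 y] fun _ => 0 := by
    filter_upwards [hK.isClosed.isOpen_compl.mem_nhds hy] with z hz using hg0 z hz
  rw [this.fderiv_eq]; simp

/-- The function f need be regular only on O, since g vanishes off a compact subset of O. For this
reason no boundary term appears later for test functions supported in the interior. -/
theorem integral_mul_fderiv_of_compact {f g : EuclideanSpace ℝ (Fin m) → ℝ}
    {O K : Set (EuclideanSpace ℝ (Fin m))} (hO : IsOpen O) (hK : IsCompact K) (hKO : K ⊆ O)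
    (hf : ContDiffOn ℝ 1 f O) (hg : ContDiff ℝ 1 g) (hg0 : ∀ y ∉ K, g y = 0)
    (v : EuclideanSpace ℝ (Fin m)) :
    Integrable (fun y => f y * fderiv ℝ g y v) ∧ Integrable (fun y => fderiv ℝ f y v * g y) ∧
    ∫ y, f y * fderiv ℝ g y v = -∫ y, fderiv ℝ f y v * g y := by
  have hts : tsupport g ⊆ K := closure_minimal (fun y hy => by
    by_contra h; exact hy (hg0 y h)) hK.isClosed
  have hf' : ContinuousOn (fun y => fderiv ℝ f y v) O :=
    (hf.continuousOn_fderiv_of_isOpen hO (by simp)).clm_apply continuousOn_const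
  have hg' : Continuous (fun y => fderiv ℝ g y v) :=
    (hg.continuous_fderiv (by simp)).clm_apply continuous_const
  have i1 : Integrable (fun y => fderiv ℝ f y v * g y) :=
    integrable_of_continuousOn_of_eq_zero hK hKO (hf'.mul hg.continuous.continuousOn) fun y hy => by
      rw [hg0 y hy, mul_zero]
  have i2 : Integrable (fun y => f y * fderiv ℝ g y v) :=
    integrable_of_continuousOn_of_eq_zero hK hKO (hf.continuousOn.mul hg'.continuousOn) fun y hy => by
      rw [fderiv_eq_zero_of_notMem_compact hK hg0 hy]; simp
  have i3 : Integrable (fun y => f y * g y) :=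
    integrable_of_continuousOn_of_eq_zero hK hKO (hf.continuousOn.mul hg.continuous.continuousOn)
      fun y hy => by rw [hg0 y hy, mul_zero]
  exact ⟨i2, i1, integral_mul_fderiv_eq_neg_fderiv_mul_of_integrable i1 i2 i3
    (fun y hy => (hf.contDiffAt (hO.mem_nhds (hKO (hts hy)))).differentiableAt (by simp))
    fun y _ => hg.differentiable (by simp) y⟩

end CoordinateParts

/-! ### Test functions supported in the interior -/

section ChartInterior

variable {m : ℕ} [NeZero m] {Sig : Type*} [TopologicalSpace Sig]
  [ChartedSpace (EuclideanHalfSpace m) Sig] [IsManifold (𝓡∂ m) ∞ Sig]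

theorem isInteriorPoint_iff_extChartAt {c x : Sig} (hx : x ∈ (extChartAt (𝓡∂ m) c).source) :
    x ∈ (𝓡∂ m).interior Sig ↔ extChartAt (𝓡∂ m) c x ∈ interior (extChartAt (𝓡∂ m) c).target := by
  rw [extChartAt_source] at hx
  exact (𝓡∂ m).isInteriorPoint_iff_of_mem_atlas (n := ∞) (by simp) (chart_mem_atlas _ c) hx

theorem isOpen_manifold_interior : IsOpen ((𝓡∂ m).interior Sig) :=
  (𝓡∂ m).isOpen_interior (n := ∞) (by simp)

omit [IsManifold (𝓡∂ m) ∞ Sig] in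
theorem mfderiv_eq_zero_of_notMem_tsupport {η : Sig → ℝ} {x : Sig} (hx : x ∉ tsupport η) :
    mfderiv (𝓡∂ m) 𝓘(ℝ, ℝ) η x = 0 := by
  have h : η =ᶠ[𝓝 x] fun _ => (0 : ℝ) := by
    filter_upwards [(isClosed_tsupport η).isOpen_compl.mem_nhds hx] with z hz
    exact image_eq_zero_of_notMem_tsupport hz
  rw [h.mfderiv_eq]
  exact mfderiv_const

omit [IsManifold (𝓡∂ m) ∞ Sig] in
theorem gradInner_eq_zero_of_notMem_tsupport
    {σ : (x : Sig) → TangentSpace (𝓡∂ m) x → TangentSpace (𝓡∂ m) x → ℝ} {u η : Sig → ℝ} {x : Sig}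
    (hx : x ∉ tsupport η) : gradInner σ u η x = 0 := by
  rw [gradInner, dAlong, mfderiv_eq_zero_of_notMem_tsupport hx]; rfl

variable [CompactSpace Sig]

/-- A function supported in the interior of a chart, in coordinates. -/
theorem exists_coordinate_test [T2Space Sig] {η : Sig → ℝ} (hη : ContMDiff (𝓡∂ m) 𝓘(ℝ, ℝ) 1 η) {c : Sig}
    (hc : tsupport η ⊆ (extChartAt (𝓡∂ m) c).source) (hi : tsupport η ⊆ (𝓡∂ m).interior Sig) :
    ∃ (g : EuclideanSpace ℝ (Fin m) → ℝ) (K : Set (EuclideanSpace ℝ (Fin m))), IsCompact K ∧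
      K ⊆ interior (extChartAt (𝓡∂ m) c).target ∧ ContDiff ℝ 1 g ∧ (∀ y ∉ K, g y = 0) ∧
      (∀ y ∈ (extChartAt (𝓡∂ m) c).target, y ∉ K → (extChartAt (𝓡∂ m) c).symm y ∉ tsupport η) ∧
      ∀ y ∈ interior (extChartAt (𝓡∂ m) c).target, g y = η ((extChartAt (𝓡∂ m) c).symm y) ∧
        ∀ i, fderiv ℝ g y (EuclideanSpace.single i 1) = chartPartial η c y i := by
  set e := extChartAt (𝓡∂ m) c with he
  set O := interior e.target with hO
  have hOo : IsOpen O := isOpen_interior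
  have hK : IsCompact (e '' tsupport η) :=
    ((isClosed_tsupport η).isCompact).image_of_continuousOn ((continuousOn_extChartAt c).mono hc)
  have hKO : e '' tsupport η ⊆ O := by
    rintro _ ⟨x, hx, rfl⟩
    exact (isInteriorPoint_iff_extChartAt (hc hx)).1 (hi hx)
  have hnot : ∀ y ∈ e.target, y ∉ e '' tsupport η → e.symm y ∉ tsupport η := fun y hy hyK h =>
    hyK ⟨e.symm y, h, e.right_inv hy⟩
  have hg0 : ∀ y ∉ e '' tsupport η, O.indicator (η ∘ e.symm) y = 0 := by
    intro y hy
    by_cases hyO : y ∈ O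
    · rw [indicator_of_mem hyO]
      change η (e.symm y) = 0
      exact image_eq_zero_of_notMem_tsupport (hnot y (interior_subset hyO) hy)
    · rw [indicator_of_notMem hyO]
  have heq : ∀ y ∈ O, O.indicator (η ∘ e.symm) =ᶠ[𝓝 y] η ∘ e.symm := fun y hy => by
    filter_upwards [hOo.mem_nhds hy] with z hz using indicator_of_mem hz _
  refine ⟨O.indicator (η ∘ e.symm), e '' tsupport η, hK, hKO, ?_, hg0, hnot, fun y hy =>
    ⟨indicator_of_mem hy _, fun i => ?_⟩⟩
  · refine contDiff_iff_contDiffAt.2 fun y => ?_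
    by_cases hyO : y ∈ O
    · refine ContDiffAt.congr_of_eventuallyEq ?_ (heq y hyO)
      exact (contDiffOn_comp_extChartAt_symm (n := 1) (by exact_mod_cast le_top) hη c).contDiffAt
        (mem_of_superset (hOo.mem_nhds hyO) interior_subset)
    · have hyK : y ∉ e '' tsupport η := fun h => hyO (hKO h)
      refine ContDiffAt.congr_of_eventuallyEq (contDiffAt_const (c := (0 : ℝ))) ?_
      filter_upwards [hK.isClosed.isOpen_compl.mem_nhds hyK] with z hz using hg0 z hz
  · rw [(heq y hy).fderiv_eq, chartPartial_interior η hy]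

end ChartInterior

namespace SpacelikeHypersurface

/-! ### The weak equation in one chart -/

section WeakEquation

open Matrix

variable {m : ℕ} [NeZero m] {S : Type*} [TopologicalSpace S]
  [ChartedSpace (EuclideanSpace ℝ (Fin m)) S] {G : SplitSpacetime m S}
  {Sig : Type*} [TopologicalSpace Sig] [ChartedSpace (EuclideanHalfSpace m) Sig]
  (D : SpacelikeHypersurface G Sig) {c : Sig} {y : EuclideanSpace ℝ (Fin m)} {u : Sig → ℝ}
  [IsManifold (𝓡 m) ∞ S] [IsManifold (𝓡∂ m) ∞ Sig]

section Regularity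

variable (hu : ContMDiff (𝓡∂ m) 𝓘(ℝ, ℝ) ∞ u) (hs : ∀ x, gradNormSq (D.sigma u) u x < 1)

include hu hs

theorem chartFlux_contDiffOn (c : Sig) (i : Fin m) :
    ContDiffOn ℝ 1 (fun y => D.chartFlux u c y i) (interior (extChartAt (𝓡∂ m) c).target) :=
  fun _ hy => (D.chartFlux_contDiffAt hu (hs _) hy i).contDiffWithinAt

theorem chartDiv_continuousOn (c : Sig) :
    ContinuousOn (D.chartDiv u c) (interior (extChartAt (𝓡∂ m) c).target) := by
  refine ContinuousOn.div (continuousOn_finsetSum _ fun i _ =>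
    ((D.chartFlux_contDiffOn hu hs c i).continuousOn_fderiv_of_isOpen isOpen_interior
      (by simp)).clm_apply continuousOn_const)
    ((D.chartDensity_continuousOn hu.continuous c).mono interior_subset) fun y hy =>
    (D.chartDensity_pos u (interior_subset hy)).ne'

theorem chartDiv_comp_continuousOn (c : Sig) :
    ContinuousOn (fun x => D.chartDiv u c (extChartAt (𝓡∂ m) c x))
      ((extChartAt (𝓡∂ m) c).source ∩ (𝓡∂ m).interior Sig) :=
  (D.chartDiv_continuousOn hu hs c).comp ((continuousOn_extChartAt c).mono inter_subset_left)
    fun _ hx => (isInteriorPoint_iff_extChartAt hx.1).1 hx.2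

omit [IsManifold (𝓡 m) ∞ S] [IsManifold (𝓡∂ m) ∞ Sig] hu hs in
theorem _root_.continuous_mul_of_tsupport_subset {η h : Sig → ℝ} {O : Set Sig} (hO : IsOpen O) (hη : Continuous η)
    (hts : tsupport η ⊆ O) (hh : ContinuousOn h O) : Continuous fun x => η x * h x := by
  refine continuous_iff_continuousAt.2 fun x => ?_
  by_cases hx : x ∈ O
  · exact hη.continuousAt.mul (hh.continuousAt (hO.mem_nhds hx))
  · have hx' : x ∉ tsupport η := fun h => hx (hts h)
    refine ContinuousAt.congr (continuousAt_const (y := (0 : ℝ))) ?_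
    filter_upwards [(isClosed_tsupport η).isOpen_compl.mem_nhds hx'] with z hz
    rw [image_eq_zero_of_notMem_tsupport hz, zero_mul]

variable [CompactSpace Sig] [T2Space Sig] [Nonempty Sig] [MeasurableSpace Sig] [BorelSpace Sig]

omit [T2Space Sig] hs in
theorem isFiniteMeasure_sigma : IsFiniteMeasure (metricVolume (D.sigma u)) :=
  metricVolume_isFiniteMeasure (D.sigma_isInnerForm u) (D.chartDensity_continuousOn hu.continuous)

/-- In coordinates √det σ · α^m w ⟨Du, Dη⟩ is the flux paired with the partial derivatives of η, so
this is integration by parts; the density is divided out again in `chartDiv`. -/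
theorem integral_gradInner_chart {η : Sig → ℝ} (hη : ContMDiff (𝓡∂ m) 𝓘(ℝ, ℝ) 1 η) {c : Sig}
    (hc : tsupport η ⊆ (extChartAt (𝓡∂ m) c).source) (hi : tsupport η ⊆ (𝓡∂ m).interior Sig) :
    ∫ x, D.lapseAlong u x ^ m * D.tilt u x * gradInner (D.sigma u) u η x ∂(metricVolume (D.sigma u))
      = -∫ x, η x * D.chartDiv u c (extChartAt (𝓡∂ m) c x) ∂(metricVolume (D.sigma u)) := by
  set e := extChartAt (𝓡∂ m) c with he
  have hu1 : ContMDiff (𝓡∂ m) 𝓘(ℝ, ℝ) 1 u := hu.of_le (by exact_mod_cast le_top)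
  have hfin := D.isFiniteMeasure_sigma hu
  obtain ⟨g, K, hK, hKO, hg, hg0, hnot, hgO⟩ := exists_coordinate_test hη hc hi
  have hns : ∀ x ∉ e.source, x ∉ tsupport η := fun x hx h => hx (hc h)
  have hTm := measurableSet_extChartAt_target (m := m) c
  have hd := D.chartDensity_continuousOn hu.continuous c
  rw [integral_metricVolume_chart (c := c) (D.sigma_isInnerForm u) hd, integral_metricVolume_chart (c := c) (D.sigma_isInnerForm u) hd]
  · have e1 : ∫ y in e.target, chartDensity (D.sigma u) c y * (D.lapseAlong u (e.symm y) ^ m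
        * D.tilt u (e.symm y) * gradInner (D.sigma u) u η (e.symm y))
        = ∫ y, ∑ i, D.chartFlux u c y i * fderiv ℝ g y (EuclideanSpace.single i 1) := by
      refine Eq.trans ?_ (setIntegral_eq_integral_of_forall_compl_eq_zero (s := e.target) ?_)
      · refine setIntegral_congr_fun hTm fun y hy => ?_
        by_cases hyK : y ∈ K
        · have hyO := hKO hyK
          simp only [(hgO y hyO).2]
          rw [D.gradInner_chart hu1 hη u hy]
          simp only [D.chartFlux_eq hu1 (hs _) hyO, dotProduct, Finset.mul_sum]
          exact Finset.sum_congr rfl fun i _ => by ring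
        · rw [gradInner_eq_zero_of_notMem_tsupport (hnot y hy hyK),
            fderiv_eq_zero_of_notMem_compact hK hg0 hyK]
          simp
      · intro y hy
        have hyK : y ∉ K := fun h => hy (interior_subset (hKO h))
        rw [fderiv_eq_zero_of_notMem_compact hK hg0 hyK]
        simp
    have e2 : ∫ y in e.target, chartDensity (D.sigma u) c y * (η (e.symm y) *
        D.chartDiv u c (e (e.symm y)))
        = ∫ y, ∑ i, fderiv ℝ (fun z => D.chartFlux u c z i) y (EuclideanSpace.single i 1) * g y := by
      refine Eq.trans ?_ (setIntegral_eq_integral_of_forall_compl_eq_zero (s := e.target) ?_)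
      · refine setIntegral_congr_fun hTm fun y hy => ?_
        simp only [← Finset.sum_mul]
        by_cases hyK : y ∈ K
        · have hyO := hKO hyK
          have hpos := D.chartDensity_pos u hy
          rw [(hgO y hyO).1, e.right_inv hy, chartDiv]
          field_simp
          ring
        · rw [image_eq_zero_of_notMem_tsupport (hnot y hy hyK), hg0 y hyK]
          simp
      · intro y hy
        have hyK : y ∉ K := fun h => hy (interior_subset (hKO h))
        rw [hg0 y hyK]
        simp
    have h3 := fun i : Fin m => integral_mul_fderiv_of_compact isOpen_interior hK hKO
      (D.chartFlux_contDiffOn hu hs c i) hg hg0 (EuclideanSpace.single i 1)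
    rw [e1, e2, integral_finsetSum _ fun i _ => (h3 i).1, integral_finsetSum _ fun i _ => (h3 i).2.1,
      ← Finset.sum_neg_distrib]
    exact Finset.sum_congr rfl fun i _ => (h3 i).2.2
  · intro x hx
    rw [image_eq_zero_of_notMem_tsupport (hns x hx), zero_mul]
  · refine Continuous.aestronglyMeasurable ?_
    exact continuous_mul_of_tsupport_subset ((isOpen_extChartAt_source c).inter isOpen_manifold_interior)
      hη.continuous (subset_inter hc hi) (D.chartDiv_comp_continuousOn hu hs c)
  · intro x hx
    rw [gradInner_eq_zero_of_notMem_tsupport (hns x hx), mul_zero]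
  · refine Continuous.aestronglyMeasurable ?_
    exact (((D.lapseAlong_continuous hu.continuous).pow m).mul (D.tilt_continuous hu1 hs)).mul
      (D.gradInner_continuous hu1 hη hu.continuous)

end Regularity

end WeakEquation

end SpacelikeHypersurface

/-! ### Rules for differentials of real functions -/

section Derivatives

variable {m : ℕ} [NeZero m] {Sig : Type*} [TopologicalSpace Sig]
  [ChartedSpace (EuclideanHalfSpace m) Sig] {x : Sig} {f g : Sig → ℝ}

theorem dAlong_const (a : ℝ) (v : TangentSpace (𝓡∂ m) x) : dAlong (fun _ : Sig => a) x v = 0 := by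
  rw [dAlong, mfderiv_const]; rfl

theorem dAlong_add (hf : MDifferentiableAt (𝓡∂ m) 𝓘(ℝ, ℝ) f x)
    (hg : MDifferentiableAt (𝓡∂ m) 𝓘(ℝ, ℝ) g x) (v : TangentSpace (𝓡∂ m) x) :
    dAlong (fun x => f x + g x) x v = dAlong f x v + dAlong g x v :=
  congrArg (fun A => A v) (hf.hasMFDerivAt.add hg.hasMFDerivAt).mfderiv

theorem dAlong_sub (hf : MDifferentiableAt (𝓡∂ m) 𝓘(ℝ, ℝ) f x)
    (hg : MDifferentiableAt (𝓡∂ m) 𝓘(ℝ, ℝ) g x) (v : TangentSpace (𝓡∂ m) x) :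
    dAlong (fun x => f x - g x) x v = dAlong f x v - dAlong g x v :=
  congrArg (fun A => A v) (hf.hasMFDerivAt.sub hg.hasMFDerivAt).mfderiv

theorem dAlong_mul (hf : MDifferentiableAt (𝓡∂ m) 𝓘(ℝ, ℝ) f x)
    (hg : MDifferentiableAt (𝓡∂ m) 𝓘(ℝ, ℝ) g x) (v : TangentSpace (𝓡∂ m) x) :
    dAlong (fun x => f x * g x) x v = f x * dAlong g x v + g x * dAlong f x v :=
  congrArg (fun A => A v) (hf.hasMFDerivAt.mul hg.hasMFDerivAt).mfderiv

/-- Chain rule for functions of one variable. -/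
theorem dAlong_comp {h : ℝ → ℝ} {h' : ℝ} (hh : HasDerivAt h h' (f x))
    (hf : MDifferentiableAt (𝓡∂ m) 𝓘(ℝ, ℝ) f x) (v : TangentSpace (𝓡∂ m) x) :
    dAlong (fun x => h (f x)) x v = h' * dAlong f x v := by
  have h1 := (hh.hasFDerivAt.hasMFDerivAt.comp x hf.hasMFDerivAt).mfderiv
  have h2 := congrArg (fun A => A v) h1
  refine Eq.trans h2 ?_
  change dAlong f x v • h' = _
  rw [smul_eq_mul, mul_comm]

theorem dAlong_sum {ι : Type*} (t : Finset ι) {f : ι → Sig → ℝ}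
    (hf : ∀ i ∈ t, MDifferentiableAt (𝓡∂ m) 𝓘(ℝ, ℝ) (f i) x) (v : TangentSpace (𝓡∂ m) x) :
    dAlong (fun x => ∑ i ∈ t, f i x) x v = ∑ i ∈ t, dAlong (f i) x v := by
  classical
  suffices h : MDifferentiableAt (𝓡∂ m) 𝓘(ℝ, ℝ) (fun x => ∑ i ∈ t, f i x) x ∧
      dAlong (fun x => ∑ i ∈ t, f i x) x v = ∑ i ∈ t, dAlong (f i) x v from h.2
  induction t using Finset.induction_on with
  | empty => simpa using ⟨mdifferentiableAt_const, dAlong_const 0 v⟩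
  | insert a t ha ih =>
    have hi := ih fun i hi => hf i (Finset.mem_insert_of_mem hi)
    have h1 := hf a (Finset.mem_insert_self a t)
    simp only [Finset.sum_insert ha]
    exact ⟨h1.add hi.1, by rw [dAlong_add h1 hi.1, hi.2]⟩

end Derivatives

namespace SpacelikeHypersurface

/-! ### The weak equation on the whole hypersurface -/

section WeakEquation

variable {m : ℕ} [NeZero m] {S : Type*} [TopologicalSpace S]
  [ChartedSpace (EuclideanSpace ℝ (Fin m)) S] {G : SplitSpacetime m S}
  {Sig : Type*} [TopologicalSpace Sig] [ChartedSpace (EuclideanHalfSpace m) Sig]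
  (D : SpacelikeHypersurface G Sig) {u : Sig → ℝ}
  [IsManifold (𝓡 m) ∞ S] [IsManifold (𝓡∂ m) ∞ Sig]
  [CompactSpace Sig] [Nonempty Sig] [MeasurableSpace Sig] [BorelSpace Sig]

/-- In a chart a nonempty open set contains a relatively open piece of the half space. Even at a
boundary point this piece meets the open half space, hence has positive Lebesgue measure, and the
density is positive. -/
theorem metricVolume_pos_of_isOpen (hu : Continuous u) {U : Set Sig} (hU : IsOpen U)
    (hne : U.Nonempty) : metricVolume (D.sigma u) U ≠ 0 := by
  obtain ⟨x, hx⟩ := hne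
  set e := extChartAt (𝓡∂ m) x with he
  set A := U ∩ e.source with hA
  have hAo : IsOpen A := hU.inter (isOpen_extChartAt_source x)
  suffices h : metricVolume (D.sigma u) A ≠ 0 from fun h0 => h (measure_mono_null inter_subset_left h0)
  rw [metricVolume_apply_of_subset (D.sigma_isInnerForm u) hAo.measurableSet inter_subset_right,
    chartMeasure_apply x hAo.measurableSet]
  have hm := measurableSet_chart_preimage (m := m) x hAo.measurableSet
  set B := e.target ∩ e.symm ⁻¹' A with hB
  have hae : AEMeasurable (fun y => ENNReal.ofReal (chartDensity (D.sigma u) x y)) (volume.restrict B) :=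
    (((D.chartDensity_continuousOn hu x).mono inter_subset_left).aemeasurable hm).ennreal_ofReal
  intro h0
  rw [setLIntegral_eq_zero_iff' hm hae] at h0
  have h1 : volume B = 0 := by
    refine measure_mono_null (fun y hy => ?_) h0
    intro h2
    have h3 := D.chartDensity_pos u hy.1
    exact (ENNReal.ofReal_pos.2 h3).ne' (h2 hy)
  have hxB : e x ∈ e.target := mem_extChartAt_target x
  have hnh : B ∈ 𝓝[range (𝓡∂ m)] (e x) := by
    have h4 : e.target ∈ 𝓝[range (𝓡∂ m)] (e x) := target_mem_nhdsWithin_range hxB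
    refine inter_mem h4 ?_
    have h5 : ContinuousWithinAt e.symm (range (𝓡∂ m)) (e x) :=
      (continuousOn_extChartAt_symm x _ hxB).mono_of_mem_nhdsWithin h4
    refine h5.preimage_mem_nhdsWithin (hAo.mem_nhds ?_)
    rw [e.left_inv (mem_extChartAt_source x)]
    exact ⟨hx, mem_extChartAt_source x⟩
  obtain ⟨V, hVo, hxV, hVB⟩ := mem_nhdsWithin.1 hnh
  have hcl : e x ∈ closure (interior (range (𝓡∂ m))) :=
    (𝓡∂ m).range_subset_closure_interior (extChartAt_target_subset_range x hxB)
  obtain ⟨z, hzV, hzi⟩ := mem_closure_iff.1 hcl V hVo hxV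
  have hpos := (hVo.inter isOpen_interior).measure_pos volume ⟨z, hzV, hzi⟩
  exact hpos.ne' (measure_mono_null ((inter_subset_inter_right V interior_subset).trans hVB) h1)

theorem isOpenPosMeasure_sigma (hu : Continuous u) : (metricVolume (D.sigma u)).IsOpenPosMeasure :=
  ⟨fun _ hU hne => D.metricVolume_pos_of_isOpen hu hU hne⟩

variable [T2Space Sig] (hu : ContMDiff (𝓡∂ m) 𝓘(ℝ, ℝ) ∞ u) (hs : ∀ x, gradNormSq (D.sigma u) u x < 1)

include hu hs

/-- The divergence of the flux does not depend on the chart. -/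
theorem chartDiv_eq_chartDiv {c c' : Sig} : EqOn (fun x => D.chartDiv u c (extChartAt (𝓡∂ m) c x))
    (fun x => D.chartDiv u c' (extChartAt (𝓡∂ m) c' x))
    ((extChartAt (𝓡∂ m) c).source ∩ (extChartAt (𝓡∂ m) c').source ∩ (𝓡∂ m).interior Sig) := by
  have := (𝓡∂ m).secondCountableTopology
  have := ChartedSpace.secondCountable_of_sigmaCompact (EuclideanHalfSpace m) Sig
  have := D.isOpenPosMeasure_sigma hu.continuous
  have := D.isFiniteMeasure_sigma hu
  set U := (extChartAt (𝓡∂ m) c).source ∩ (extChartAt (𝓡∂ m) c').source ∩ (𝓡∂ m).interior Sig with hUdef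
  have hU : IsOpen U := ((isOpen_extChartAt_source c).inter (isOpen_extChartAt_source c')).inter
    isOpen_manifold_interior
  have h1 : ContinuousOn (fun x => D.chartDiv u c (extChartAt (𝓡∂ m) c x)) U :=
    (D.chartDiv_comp_continuousOn hu hs c).mono fun x hx => ⟨hx.1.1, hx.2⟩
  have h2 : ContinuousOn (fun x => D.chartDiv u c' (extChartAt (𝓡∂ m) c' x)) U :=
    (D.chartDiv_comp_continuousOn hu hs c').mono fun x hx => ⟨hx.1.2, hx.2⟩
  refine Measure.eqOn_open_of_ae_eq (μ := metricVolume (D.sigma u)) ?_ hU h1 h2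
  rw [Filter.EventuallyEq, ae_restrict_iff' hU.measurableSet]
  -- The left side of the formula for one chart does not involve the chart. The two divergences
  -- therefore have the same integral against every smooth function supported in the overlap, and no
  -- transformation law for divergences is needed.
  have key := hU.ae_eq_zero_of_integral_contMDiff_smul_eq_zero (𝓡∂ m) (μ := metricVolume (D.sigma u))
    ((h1.sub h2).locallyIntegrableOn hU.measurableSet) fun g hg _ hgU => by
      have hg1 : ContMDiff (𝓡∂ m) 𝓘(ℝ, ℝ) 1 g := hg.of_le (by exact_mod_cast le_top)
      have e1 := D.integral_gradInner_chart hu hs hg1 (c := c) (fun x hx => (hgU hx).1.1)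
        fun x hx => (hgU hx).2
      have e2 := D.integral_gradInner_chart hu hs hg1 (c := c') (fun x hx => (hgU hx).1.2)
        fun x hx => (hgU hx).2
      have i1 := (continuous_mul_of_tsupport_subset hU hg.continuous hgU h1).integrable_of_hasCompactSupport
        (HasCompactSupport.of_compactSpace _) (μ := metricVolume (D.sigma u))
      have i2 := (continuous_mul_of_tsupport_subset hU hg.continuous hgU h2).integrable_of_hasCompactSupport
        (HasCompactSupport.of_compactSpace _) (μ := metricVolume (D.sigma u))
      simp only [Pi.sub_apply, smul_eq_mul, mul_sub]
      rw [integral_sub i1 i2]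
      linarith
  filter_upwards [key] with x hx hxU
  have := hx hxU
  simp only [Pi.sub_apply] at this
  linarith

/-- The divergence of the flux, as a function on the manifold. -/
noncomputable def fluxDiv (u : Sig → ℝ) (x : Sig) : ℝ := D.chartDiv u x (extChartAt (𝓡∂ m) x x)

theorem fluxDiv_eq {c x : Sig} (hx : x ∈ (extChartAt (𝓡∂ m) c).source)
    (hi : x ∈ (𝓡∂ m).interior Sig) : D.fluxDiv u x = D.chartDiv u c (extChartAt (𝓡∂ m) c x) :=
  D.chartDiv_eq_chartDiv hu hs (c := x) ⟨⟨mem_extChartAt_source x, hx⟩, hi⟩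

theorem fluxDiv_continuousOn : ContinuousOn (D.fluxDiv u) ((𝓡∂ m).interior Sig) := by
  intro x hx
  have hU : (extChartAt (𝓡∂ m) x).source ∩ (𝓡∂ m).interior Sig ∈ 𝓝 x :=
    inter_mem (extChartAt_source_mem_nhds x) (isOpen_manifold_interior.mem_nhds hx)
  have h1 : ContinuousOn (D.fluxDiv u) ((extChartAt (𝓡∂ m) x).source ∩ (𝓡∂ m).interior Sig) :=
    (D.chartDiv_comp_continuousOn hu hs x).congr fun z hz => D.fluxDiv_eq hu hs hz.1 hz.2
  exact (h1.continuousAt hU).continuousWithinAt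

/-- The weak form of the mean curvature equation. -/
theorem integral_gradInner {η : Sig → ℝ} (hη : ContMDiff (𝓡∂ m) 𝓘(ℝ, ℝ) 1 η)
    (hi : tsupport η ⊆ (𝓡∂ m).interior Sig) :
    ∫ x, D.lapseAlong u x ^ m * D.tilt u x * gradInner (D.sigma u) u η x ∂(metricVolume (D.sigma u))
      = -∫ x, η x * D.fluxDiv u x ∂(metricVolume (D.sigma u)) := by
  have := D.isFiniteMeasure_sigma hu
  have hu1 : ContMDiff (𝓡∂ m) 𝓘(ℝ, ℝ) 1 u := hu.of_le (by exact_mod_cast le_top)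
  obtain ⟨t, ht⟩ := isCompact_univ.elim_finite_subcover
    (fun c : Sig => (chartAt (EuclideanHalfSpace m) c).source)
    (fun c => (chartAt (EuclideanHalfSpace m) c).open_source)
    (fun x _ => mem_iUnion_of_mem x (mem_chart_source _ x))
  -- A partition of unity splits η into pieces, each supported in one chart, and both sides are
  -- linear in η.
  obtain ⟨χ, hχ⟩ := SmoothPartitionOfUnity.exists_isSubordinate (𝓡∂ m) (s := (univ : Set Sig))
    isClosed_univ (fun c : t => (chartAt (EuclideanHalfSpace m) (c : Sig)).source)
    (fun c => (chartAt (EuclideanHalfSpace m) (c : Sig)).open_source)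
    (by simpa [iUnion_subtype] using ht)
  have hsum : ∀ x, ∑ c, χ c x = 1 := fun x => by
    rw [← finsum_eq_sum_of_fintype]; exact χ.sum_eq_one (mem_univ x)
  have hχ1 : ∀ c, ContMDiff (𝓡∂ m) 𝓘(ℝ, ℝ) 1 (fun x => χ c x) := fun c =>
    (χ c).contMDiff.of_le (by exact_mod_cast le_top)
  have hprod : ∀ c, ContMDiff (𝓡∂ m) 𝓘(ℝ, ℝ) 1 (fun x => χ c x * η x) := fun c => (hχ1 c).mul hη
  have hts1 : ∀ c, tsupport (fun x => χ c x * η x) ⊆ (extChartAt (𝓡∂ m) (c : Sig)).source := fun c => by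
    rw [extChartAt_source]
    exact (closure_mono (Function.support_mul_subset_left _ _)).trans (hχ c)
  have hts2 : ∀ c, tsupport (fun x => χ c x * η x) ⊆ (𝓡∂ m).interior Sig := fun c =>
    (closure_mono (Function.support_mul_subset_right _ _)).trans hi
  have hdiv : ∀ c, ∀ x, (χ c x * η x) * D.chartDiv u c (extChartAt (𝓡∂ m) (c : Sig) x)
      = (χ c x * η x) * D.fluxDiv u x := by
    intro c x
    by_cases hx : x ∈ tsupport (fun x => χ c x * η x)
    · rw [D.fluxDiv_eq hu hs (hts1 c hx) (hts2 c hx)]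
    · have : χ c x * η x = 0 := image_eq_zero_of_notMem_tsupport (f := fun x => χ c x * η x) hx
      rw [this, zero_mul, zero_mul]
  have hgrad : ∀ x, gradInner (D.sigma u) u η x
      = ∑ c, gradInner (D.sigma u) u (fun x => χ c x * η x) x := by
    intro x
    have h1 : η = fun x => ∑ c, χ c x * η x := by
      ext x; rw [← Finset.sum_mul, hsum, one_mul]
    conv_lhs => rw [h1]
    exact dAlong_sum _ (fun c _ => (hprod c).mdifferentiable (by simp) x) _
  have hint : ∀ c, Integrable (fun x => D.lapseAlong u x ^ m * D.tilt u x *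
      gradInner (D.sigma u) u (fun x => χ c x * η x) x) (metricVolume (D.sigma u)) := fun c =>
    Continuous.integrable_of_hasCompactSupport ((((D.lapseAlong_continuous hu.continuous).pow m).mul
      (D.tilt_continuous hu1 hs)).mul (D.gradInner_continuous hu1 (hprod c) hu.continuous))
      (HasCompactSupport.of_compactSpace _)
  have hint2 : ∀ c, Integrable (fun x => (χ c x * η x) * D.fluxDiv u x) (metricVolume (D.sigma u)) :=
    fun c => Continuous.integrable_of_hasCompactSupport
      (continuous_mul_of_tsupport_subset isOpen_manifold_interior (hprod c).continuous (hts2 c)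
        (D.fluxDiv_continuousOn hu hs)) (HasCompactSupport.of_compactSpace _)
  have e1 : ∀ x, η x * D.fluxDiv u x = ∑ c, (χ c x * η x) * D.fluxDiv u x := fun x => by
    rw [← Finset.sum_mul, ← Finset.sum_mul, hsum, one_mul]
  simp only [hgrad, Finset.mul_sum, e1]
  rw [integral_finsetSum _ fun c _ => hint c, integral_finsetSum _ fun c _ => hint2 c,
    ← Finset.sum_neg_distrib]
  refine Finset.sum_congr rfl fun c _ => ?_
  rw [D.integral_gradInner_chart hu hs (hprod c) (hts1 c) (hts2 c)]
  simp only [hdiv]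

end WeakEquation

end SpacelikeHypersurface

/-! ### The divergence of the flux and the mean curvature -/

section Time

variable {E : Type*} [NormedAddCommGroup E] [NormedSpace ℝ E]

theorem fderiv_time_apply {f : ℝ × E → ℝ} {t : ℝ} {y : E} (hf : DifferentiableAt ℝ f (t, y)) :
    HasDerivAt (fun s => f (s, y)) (fderiv ℝ f (t, y) (1, 0)) t := by
  have h1 : HasDerivAt (fun s : ℝ => (s, y)) ((1 : ℝ), (0 : E)) t :=
    (hasDerivAt_id t).prodMk (hasDerivAt_const t y)
  exact hf.hasFDerivAt.comp_hasDerivAt t h1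

end Time

section SecondFundForm

variable {m : ℕ} {b : ℝ × EuclideanSpace ℝ (Fin m) → ℝ × EuclideanSpace ℝ (Fin m) →
      ℝ × EuclideanSpace ℝ (Fin m) → ℝ}

theorem coordSecondFundForm_smul {E : Type*} [NormedAddCommGroup E] [NormedSpace ℝ E]
    {F : E → ℝ × EuclideanSpace ℝ (Fin m)} {y : E} (hb : DifferentiableMetricAt b (F y)) (a : ℝ) (N)
    (v w : E) : coordSecondFundForm b F (a • N) y v w = a * coordSecondFundForm b F N y v w := by
  rw [coordSecondFundForm, coordSecondFundForm, hb.smul_right, hb.christoffelLower_smul]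
  ring

end SecondFundForm

namespace SpacelikeHypersurface

section Bounds

open Matrix

variable {m : ℕ} [NeZero m] {S : Type*} [TopologicalSpace S]
  [ChartedSpace (EuclideanSpace ℝ (Fin m)) S] {G : SplitSpacetime m S}
  {Sig : Type*} [TopologicalSpace Sig] [ChartedSpace (EuclideanHalfSpace m) Sig]
  (D : SpacelikeHypersurface G Sig) {u : Sig → ℝ}
  [IsManifold (𝓡 m) ∞ S] [IsManifold (𝓡∂ m) ∞ Sig]

omit [IsManifold (𝓡 m) ∞ S] in
theorem continuous_deriv_lapse :
    Continuous fun p : ℝ × Sig => deriv (fun s => G.lapse (s, D.proj p.2)) p.1 := by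
  refine continuous_iff_continuousAt.2 fun ⟨t, x⟩ => ?_
  set e := extChartAt (𝓡∂ m) x with he
  have hU : UniqueDiffOn ℝ (univ ×ˢ e.target : Set (ℝ × EuclideanSpace ℝ (Fin m))) :=
    uniqueDiffOn_univ.prod (uniqueDiffOn_extChartAt_target x)
  have h1 := ((D.chartLapse_contDiffOn x).continuousOn_fderivWithin hU (by simp)).clm_apply
    (continuousOn_const (c := ((1 : ℝ), (0 : EuclideanSpace ℝ (Fin m)))))
  have h2 : ContinuousOn (fun q : ℝ × EuclideanSpace ℝ (Fin m) =>
      deriv (fun s => D.chartLapse x (s, q.2)) q.1) (univ ×ˢ e.target) := by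
    refine h1.congr ?_
    rintro ⟨s, y⟩ ⟨-, hy⟩
    have hd := ((D.chartLapse_contDiffOn x).differentiableOn (by simp) (s, y)
      (mk_mem_prod (mem_univ _) hy)).hasFDerivWithinAt
    have hl : HasDerivWithinAt (fun r : ℝ => (r, y)) ((1 : ℝ), (0 : EuclideanSpace ℝ (Fin m))) univ s :=
      ((hasDerivAt_id s).prodMk (hasDerivAt_const s y)).hasDerivWithinAt
    have := hd.comp_hasDerivWithinAt s hl fun r _ => mk_mem_prod (mem_univ _) hy
    exact (hasDerivWithinAt_univ.1 this).deriv
  have h3 : ContinuousOn (fun p : ℝ × Sig => deriv (fun s => D.chartLapse x (s, e p.2)) p.1)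
      (univ ×ˢ e.source) := by
    refine h2.comp (f := fun p : ℝ × Sig => (p.1, e p.2)) ?_ fun p hp =>
      mk_mem_prod (mem_univ _) (e.map_source hp.2)
    exact continuousOn_fst.prodMk ((continuousOn_extChartAt x).comp continuousOn_snd fun p hp => hp.2)
  have h4 := h3.congr (g := fun p : ℝ × Sig => deriv (fun s => G.lapse (s, D.proj p.2)) p.1) fun p hp => by
    simp only [chartLapse]
    rw [e.left_inv hp.2]
  exact h4.continuousAt ((isOpen_univ.prod (isOpen_extChartAt_source x)).mem_nhds
    (mk_mem_prod (mem_univ _) (mem_extChartAt_source x)))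

omit [IsManifold (𝓡 m) ∞ S] [IsManifold (𝓡∂ m) ∞ Sig] in
theorem continuous_lapse_proj : Continuous fun p : ℝ × Sig => G.lapse (p.1, D.proj p.2) :=
  G.lapse_smooth.continuous.comp (continuous_fst.prodMk (D.proj_smooth.continuous.comp continuous_snd))

omit [IsManifold (𝓡 m) ∞ S] in
/-- Bounds for the lapse at bounded times. -/
theorem exists_lapse_bounds [CompactSpace Sig] (T : ℝ) : ∃ a₀ a₁ A : ℝ, 0 < a₀ ∧ 0 < a₁ ∧ 0 ≤ A ∧
    ∀ t ∈ Icc (-T) T, ∀ x : Sig, a₀ ≤ G.lapse (t, D.proj x) ∧ G.lapse (t, D.proj x) ≤ a₁ ∧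
      |deriv (fun s => G.lapse (s, D.proj x)) t| ≤ A * G.lapse (t, D.proj x) := by
  have hK : IsCompact (Icc (-T) T ×ˢ (univ : Set Sig)) := isCompact_Icc.prod isCompact_univ
  have hc := D.continuous_lapse_proj
  have hd : Continuous fun p : ℝ × Sig => deriv (fun s => G.lapse (s, D.proj p.2)) p.1
      / G.lapse (p.1, D.proj p.2) := D.continuous_deriv_lapse.div hc fun p => (G.lapse_pos _).ne'
  have hi : Continuous fun p : ℝ × Sig => (G.lapse (p.1, D.proj p.2))⁻¹ :=
    hc.inv₀ fun p => (G.lapse_pos _).ne'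
  obtain ⟨C₁, h₁⟩ := hK.exists_bound_of_continuousOn hc.continuousOn
  obtain ⟨C₂, h₂⟩ := hK.exists_bound_of_continuousOn hi.continuousOn
  obtain ⟨C₃, h₃⟩ := hK.exists_bound_of_continuousOn hd.continuousOn
  refine ⟨(|C₂| + 1)⁻¹, |C₁| + 1, |C₃|, by positivity, by positivity, abs_nonneg _, fun t ht x => ?_⟩
  have hp : (t, x) ∈ Icc (-T) T ×ˢ (univ : Set Sig) := ⟨ht, mem_univ _⟩
  have hpos := G.lapse_pos (t, D.proj x)
  have k1 := h₁ _ hp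
  have k2 := h₂ _ hp
  have k3 := h₃ _ hp
  simp only [Real.norm_eq_abs] at k1 k2 k3
  rw [abs_of_pos hpos] at k1
  rw [abs_of_pos (inv_pos.2 hpos)] at k2
  rw [abs_div, abs_of_pos hpos, div_le_iff₀ hpos] at k3
  refine ⟨?_, by linarith [le_abs_self C₁], k3.trans (by gcongr; exact le_abs_self _)⟩
  rw [inv_le_comm₀ (by positivity) hpos]
  linarith [le_abs_self C₂]

section AtPoint

variable {c : Sig} {y : EuclideanSpace ℝ (Fin m)}

/-- Time derivatives of the coefficients of the induced metric. -/
theorem fderiv_coordMetric_time (hy : y ∈ interior (extChartAt (𝓡∂ m) c).target) (i j : Fin m) :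
    fderiv ℝ (fun q => D.coordMetric c q (graphTangent (u ∘ (extChartAt (𝓡∂ m) c).symm) y i)
      (graphTangent (u ∘ (extChartAt (𝓡∂ m) c).symm) y j)) ((u ∘ (extChartAt (𝓡∂ m) c).symm) y, y) (1, 0)
      = 2 * (deriv (fun s => G.lapse (s, D.proj ((extChartAt (𝓡∂ m) c).symm y)))
          (u ((extChartAt (𝓡∂ m) c).symm y)) / D.lapseAlong u ((extChartAt (𝓡∂ m) c).symm y)) *
        graphGram (D.coordMetric c) (u ∘ (extChartAt (𝓡∂ m) c).symm) y i j
        + D.lapseAlong u ((extChartAt (𝓡∂ m) c).symm y) ^ 2 *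
          deriv (fun s => D.chartMetric c (s, y) i j) (u ((extChartAt (𝓡∂ m) c).symm y)) := by
  set û := u ∘ (extChartAt (𝓡∂ m) c).symm with hû
  set x := (extChartAt (𝓡∂ m) c).symm y with hx
  have h1 := (fderiv_time_apply (((D.coordMetric_differentiableMetricAt hy (û y)).diff
    (graphTangent û y i) (graphTangent û y j)))).deriv
  rw [← h1]
  have e1 : (fun s => D.coordMetric c (s, y) (graphTangent û y i) (graphTangent û y j))
      = fun s => G.lapse (s, D.proj x) ^ 2 * (-(chartPartial u c y i * chartPartial u c y j)
        + D.chartMetric c (s, y) i j) := by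
    ext s
    rw [D.coordMetric_eq hy, chartPartial_interior u hy, chartPartial_interior u hy]
    simp only [graphTangent, PiLp.single_apply, ite_mul, one_mul, zero_mul]
    simp [Finset.sum_ite_irrel]
    rfl
  have hl : DifferentiableAt ℝ (fun s => G.lapse (s, D.proj x)) (u x) := by
    have h := (D.chartLapse_contDiffOn c).contDiffAt (mem_of_superset (mem_nhds_interior_strip
      (isOpen_interior (s := (extChartAt (𝓡∂ m) c).target)) (t := u x) hy)
      (prod_mono (Subset.refl univ) interior_subset))
    exact (fderiv_time_apply (h.differentiableAt (by simp))).differentiableAt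
  have hm : DifferentiableAt ℝ (fun s => D.chartMetric c (s, y) i j) (u x) :=
    (D.chartMetric_contDiff_time (interior_subset hy) i j).differentiable (by simp) _
  rw [e1]
  have h2 := ((hl.hasDerivAt.pow 2).mul (hm.hasDerivAt.const_add
    (-(chartPartial u c y i * chartPartial u c y j)))).deriv
  refine Eq.trans h2 ?_
  rw [D.graphGram_coordMetric u hy]
  simp only [Matrix.smul_apply, Matrix.sub_apply, vecMulVec_apply, smul_eq_mul, ← hx]
  have e3 : D.chartGram u c y i j = D.chartMetric c (u x, y) i j := rfl
  have e4 : D.lapseAlong u x = G.lapse (u x, D.proj x) := rfl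
  have hpos := G.lapse_pos (u x, D.proj x)
  rw [e3, e4]
  simp only [Pi.pow_apply]
  push_cast
  field_simp
  ring

/-- A bound for the zeroth order terms in the divergence of the flux. -/
theorem abs_sum_inv_graphGram_le (hu : ContMDiff (𝓡∂ m) 𝓘(ℝ, ℝ) 1 u)
    (hs : gradNormSq (D.sigma u) u ((extChartAt (𝓡∂ m) c).symm y) < 1)
    (hy : y ∈ interior (extChartAt (𝓡∂ m) c).target) {A lam : ℝ}
    (hA : |deriv (fun s => G.lapse (s, D.proj ((extChartAt (𝓡∂ m) c).symm y)))
          (u ((extChartAt (𝓡∂ m) c).symm y))| ≤ A * D.lapseAlong u ((extChartAt (𝓡∂ m) c).symm y))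
    (hlam : 0 ≤ lam) (hl : ∀ v, |deriv (fun s => D.slice s ((extChartAt (𝓡∂ m) c).symm y) v v)
      (u ((extChartAt (𝓡∂ m) c).symm y))| ≤ lam * D.slice (u ((extChartAt (𝓡∂ m) c).symm y))
        ((extChartAt (𝓡∂ m) c).symm y) v v) :
    |∑ i, ∑ j, (graphGram (D.coordMetric c) (u ∘ (extChartAt (𝓡∂ m) c).symm) y)⁻¹ i j *
      fderiv ℝ (fun q => D.coordMetric c q (graphTangent (u ∘ (extChartAt (𝓡∂ m) c).symm) y i)
      (graphTangent (u ∘ (extChartAt (𝓡∂ m) c).symm) y j)) ((u ∘ (extChartAt (𝓡∂ m) c).symm) y, y) (1, 0)|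
      ≤ (2 * A + lam * D.tilt u ((extChartAt (𝓡∂ m) c).symm y) ^ 2) * m := by
  set û := u ∘ (extChartAt (𝓡∂ m) c).symm with hû
  set x := (extChartAt (𝓡∂ m) c).symm y with hx
  set g := graphGram (D.coordMetric c) û y with hg
  have hpos := D.lapseAlong_pos u x
  set A' := deriv (fun s => G.lapse (s, D.proj x)) (u x) / D.lapseAlong u x with hA'
  have hA'le : |A'| ≤ A := by rw [hA', abs_div, abs_of_pos hpos, div_le_iff₀ hpos]; exact hA
  set S' : Matrix (Fin m) (Fin m) ℝ := Matrix.of fun i j => 2 * A' * g i j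
    + D.lapseAlong u x ^ 2 * deriv (fun s => D.chartMetric c (s, y) i j) (u x) with hS'
  have hy' := interior_subset hy
  have hinn := D.sigma_isInnerForm u x
  have hMpd := D.chartGram_posDef u hy'
  set V : (Fin m → ℝ) → TangentSpace (𝓡∂ m) x := fun v => ∑ i, v i • frameVec c y i with hV
  have hpv : ∀ v, chartPartial u c y ⬝ᵥ v = dAlong u x (V v) := by
    intro v
    have h1 : dAlong u x (V v) = ∑ i, v i * dAlong u x (frameVec c y i) := by
      refine (map_sum (mfderiv (𝓡∂ m) 𝓘(ℝ, ℝ) u x) _ _).trans ?_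
      exact Finset.sum_congr rfl fun i _ => map_smul (mfderiv (𝓡∂ m) 𝓘(ℝ, ℝ) u x) _ _
    rw [h1]
    refine Finset.sum_congr rfl fun i _ => ?_
    rw [mul_comm]
    exact congrArg (v i * ·) (dAlong_chartFrame hy' (hu.mdifferentiable (by simp) _) _).symm
  have hquad : ∀ v, v ⬝ᵥ g *ᵥ v
      = D.lapseAlong u x ^ 2 * (D.sigma u x (V v) (V v) - dAlong u x (V v) ^ 2) := by
    intro v
    rw [hg, D.graphGram_coordMetric u hy, Matrix.smul_mulVec, Matrix.sub_mulVec,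
      Matrix.vecMulVec_mulVec, dotProduct_smul, dotProduct_sub, smul_eq_mul,
      show v ⬝ᵥ D.chartGram u c y *ᵥ v = D.sigma u x (V v) (V v) from hinn.dotProduct_gram _ v v]
    congr 2
    rw [op_smul_eq_smul, dotProduct_smul, dotProduct_comm v, hpv, smul_eq_mul, sq]
  -- The induced metric dominates α²σ only up to the factor w², because (du V)² may be as large as
  -- |du|² σ(V, V). This is the source of w² in the bound.
  have hlow : ∀ v, D.lapseAlong u x ^ 2 * D.sigma u x (V v) (V v)
      ≤ D.tilt u x ^ 2 * (v ⬝ᵥ g *ᵥ v) := by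
    intro v
    have h1 := dAlong_sq_le hinn u (V v)
    rw [hquad, D.tilt_sq hs, one_div, ← div_eq_inv_mul, le_div_iff₀ (by linarith)]
    nlinarith [pow_pos hpos 2]
  have hgpd : g.PosDef := by
    refine Matrix.PosDef.of_dotProduct_mulVec_pos ?_ ?_
    · rw [Matrix.IsHermitian, Matrix.conjTranspose_eq_transpose_of_trivial]
      exact graphGram_symm (u := û) (y₀ := y) (D.coordMetric_differentiableMetricAt hy _) y
    · intro v hv
      rw [star_trivial]
      have h1 := hMpd.dotProduct_mulVec_pos hv
      rw [star_trivial, show v ⬝ᵥ D.chartGram u c y *ᵥ v = D.sigma u x (V v) (V v) from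
        hinn.dotProduct_gram _ v v] at h1
      have h2 := hlow v
      have h3 := D.one_le_tilt hs
      by_contra h4
      nlinarith [pow_pos hpos 2, mul_pos (pow_pos hpos 2) h1, pow_pos (zero_lt_one.trans_le h3) 2]
  have hsymm : ∀ i j, S' i j = S' j i := by
    intro i j
    have h1 : g i j = g j i := congrFun (congrFun
      (graphGram_symm (u := û) (y₀ := y) (D.coordMetric_differentiableMetricAt hy _) y) j) i
    have h2 : ∀ s, D.chartMetric c (s, y) i j = D.chartMetric c (s, y) j i := fun s =>
      (D.slice_isInnerForm s x).symm _ _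
    simp only [hS', Matrix.of_apply, h1, h2]
  have e1 : ∑ i, ∑ j, g⁻¹ i j * fderiv ℝ (fun q => D.coordMetric c q (graphTangent û y i)
      (graphTangent û y j)) (û y, y) (1, 0) = (g⁻¹ * S').trace := by
    simp only [Matrix.trace, Matrix.diag_apply, Matrix.mul_apply]
    refine Finset.sum_congr rfl fun i _ => Finset.sum_congr rfl fun j _ => ?_
    rw [hsymm j i, hS', Matrix.of_apply, D.fderiv_coordMetric_time hy]
  rw [e1]
  have h := hgpd.abs_trace_inv_mul_le (S := S') (C := 2 * A + lam * D.tilt u x ^ 2) ?_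
  · simpa using h
  intro v
  have hder : v ⬝ᵥ (Matrix.of fun i j => deriv (fun s => D.chartMetric c (s, y) i j) (u x)) *ᵥ v
      = deriv (fun s => D.slice s x (V v) (V v)) (u x) := by
    have h1 := D.deriv_slice_chartFrame hy' (u x) (WithLp.toLp 2 v)
    rw [chartFrame_apply] at h1
    refine Eq.trans ?_ h1.symm
    simp only [dotProduct, Matrix.mulVec, Matrix.of_apply, Finset.mul_sum]
    exact Finset.sum_congr rfl fun i _ => Finset.sum_congr rfl fun j _ => by ring
  have hS'v : v ⬝ᵥ S' *ᵥ v = 2 * A' * (v ⬝ᵥ g *ᵥ v)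
      + D.lapseAlong u x ^ 2 * deriv (fun s => D.slice s x (V v) (V v)) (u x) := by
    rw [← hder]
    have : S' = (2 * A') • g + (D.lapseAlong u x ^ 2) •
        (Matrix.of fun i j => deriv (fun s => D.chartMetric c (s, y) i j) (u x)) := by
      ext i j; simp [hS']
    rw [this, Matrix.add_mulVec, Matrix.smul_mulVec, Matrix.smul_mulVec, dotProduct_add,
      dotProduct_smul, dotProduct_smul, smul_eq_mul, smul_eq_mul]
  have hnn : 0 ≤ v ⬝ᵥ g *ᵥ v := by
    have := hgpd.posSemidef.dotProduct_mulVec_nonneg v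
    rwa [star_trivial] at this
  rw [hS'v]
  calc _ ≤ |2 * A' * (v ⬝ᵥ g *ᵥ v)|
        + |D.lapseAlong u x ^ 2 * deriv (fun s => D.slice s x (V v) (V v)) (u x)| := abs_add_le _ _
    _ ≤ 2 * A * (v ⬝ᵥ g *ᵥ v) + lam * (D.tilt u x ^ 2 * (v ⬝ᵥ g *ᵥ v)) := by
        rw [abs_mul, abs_mul, abs_mul, abs_of_nonneg hnn, abs_two, abs_of_nonneg (sq_nonneg (D.lapseAlong u x))]
        refine add_le_add (by gcongr) ?_
        calc _ ≤ D.lapseAlong u x ^ 2 * (lam * D.slice (u x) x (V v) (V v)) := by gcongr; exact hl _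
          _ = lam * (D.lapseAlong u x ^ 2 * D.sigma u x (V v) (V v)) := by
              rw [D.sigma_eq_slice]; ring
          _ ≤ _ := mul_le_mul_of_nonneg_left (hlow v) hlam
    _ = _ := by ring

end AtPoint

/-- The divergence of the flux is the mean curvature, up to lower order terms. -/
theorem exists_abs_fluxDiv_sub_le [CompactSpace Sig] [Nonempty Sig] (T : ℝ) : ∃ B : ℝ, 0 ≤ B ∧ ∀ u : Sig → ℝ,
    ContMDiff (𝓡∂ m) 𝓘(ℝ, ℝ) ∞ u → (∀ x, gradNormSq (D.sigma u) u x < 1) →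
    (∀ x, u x ∈ Icc (-T) T) → ∀ x ∈ (𝓡∂ m).interior Sig,
      |D.fluxDiv u x - D.lapseAlong u x ^ (m + 1) * D.meanCurvature u x| ≤ B * D.tilt u x := by
  obtain ⟨a₀, a₁, A, ha₀, ha₁, hA, hlapse⟩ := D.exists_lapse_bounds T
  obtain ⟨lam, hlam, hsl⟩ := D.exists_abs_deriv_slice_le T
  refine ⟨a₁ ^ m * (2 * A + lam) * m, by positivity, fun u hu hs hT x hx => ?_⟩
  have hu1 : ContMDiff (𝓡∂ m) 𝓘(ℝ, ℝ) 1 u := hu.of_le (by exact_mod_cast le_top)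
  have hu2 : ContMDiff (𝓡∂ m) 𝓘(ℝ, ℝ) 2 u := hu.of_le ENat.LEInfty.out
  set y := extChartAt (𝓡∂ m) x x with hy₀
  have hy : y ∈ interior (extChartAt (𝓡∂ m) x).target :=
    (isInteriorPoint_iff_extChartAt (mem_extChartAt_source x)).1 hx
  have hxy : (extChartAt (𝓡∂ m) x).symm y = x := (extChartAt (𝓡∂ m) x).left_inv (mem_extChartAt_source x)
  set û := u ∘ (extChartAt (𝓡∂ m) x).symm with hû
  have hûy : û y = u x := congrArg u hxy
  have hûc : ContDiffAt ℝ 2 û y :=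
    (contDiffOn_comp_extChartAt_symm ENat.LEInfty.out hu2 x).contDiffAt
      (mem_of_superset (isOpen_interior.mem_nhds hy) interior_subset)
  have hs' := hs ((extChartAt (𝓡∂ m) x).symm y)
  have hb := D.coordMetric_differentiableMetricAt hy (û y)
  have hwpos : 0 < D.tilt u x := zero_lt_one.trans_le (D.one_le_tilt (hs x))
  have hw1 := D.one_le_tilt (hs x)
  have hapos := D.lapseAlong_pos u x
  have hdet := D.sqrt_det_graphGram hu1 hs' hy
  have hR := D.inv_graphGram_mulVec_time hu1 hs' hy
  have hd := D.gradNormSq_chart hu1 u (interior_subset hy)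
  have hw2 := D.tilt_sq (hs x)
  have hdens := D.chartDensity_pos u (interior_subset hy)
  have hgv : (gradVec (D.sigma u) u x : EuclideanSpace ℝ (Fin m))
      = ∑ i, ((D.chartGram u x y)⁻¹ *ᵥ chartPartial u x y) i •
        (EuclideanSpace.single i (1 : ℝ) : EuclideanSpace ℝ (Fin m)) := by
    have h1 := D.gradVec_chart hu1 u (interior_subset hy)
    have h2 : ∀ x', x' = x → (gradVec (D.sigma u) u x' : EuclideanSpace ℝ (Fin m))
      = (gradVec (D.sigma u) u x : EuclideanSpace ℝ (Fin m)) := by rintro _ rfl; rfl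
    rw [← h2 _ hxy]
    refine Eq.trans h1 ?_
    refine Finset.sum_congr rfl fun i _ => ?_
    exact congrArg (fun z : EuclideanSpace ℝ (Fin m) =>
      ((D.chartGram u x y)⁻¹ *ᵥ chartPartial u x y) i • z) (chartFrame_self x (EuclideanSpace.single i 1))
  rw [hxy] at hdet hd
  -- The normal part of ∂_t is αwN. The tangential correction adds w² Du to the spatial component
  -- and w²|Du|² to the time component, and 1 + w²|Du|² = w².
  have hdiv := div_graphFlux (b := D.coordMetric x) (u := û) (y₀ := y) hb hûc hdet.1
    (fun i => (D.chartFlux_contDiffAt hu hs' hy i).differentiableAt (by simp))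
    (N := (D.lapseAlong u x * D.tilt u x) • D.coordNormal u x) (by
      have hcn : D.coordNormal u x = (D.tilt u x / D.lapseAlong u x) • ((1 : ℝ),
          ∑ i, ((D.chartGram u x y)⁻¹ *ᵥ chartPartial u x y) i •
            (EuclideanSpace.single i (1 : ℝ) : EuclideanSpace ℝ (Fin m))) := by
        rw [← hgv]; rfl
      rw [hR, hxy, hcn, smul_smul]
      have e0 : D.lapseAlong u x * D.tilt u x * (D.tilt u x / D.lapseAlong u x) = D.tilt u x ^ 2 := by
        field_simp
      rw [e0]
      have hfst : D.tilt u x ^ 2 = 1 + ∑ k, D.tilt u x ^ 2 *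
          ((D.chartGram u x y)⁻¹ *ᵥ chartPartial u x y) k * chartPartial u x y k := by
        simp only [mul_assoc]
        rw [← Finset.mul_sum]
        have : ∑ k, ((D.chartGram u x y)⁻¹ *ᵥ chartPartial u x y) k * chartPartial u x y k
            = gradNormSq (D.sigma u) u x := by rw [hd, dotProduct_comm]; rfl
        rw [this, hw2]
        have : 1 - gradNormSq (D.sigma u) u x ≠ 0 := by linarith [hs x]
        field_simp
        ring
      refine Prod.ext ?_ ?_
      · simp only [Prod.smul_fst, Prod.fst_add, Prod.fst_sum, graphTangent, Pi.neg_apply, neg_neg,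
          Pi.smul_apply, smul_eq_mul, mul_one]
        rw [hfst]
        congr 1
        refine Finset.sum_congr rfl fun k _ => ?_
        rw [← hfst, chartPartial_interior u hy k]
      · simp only [Prod.smul_snd, Prod.snd_add, Prod.snd_sum, graphTangent, Pi.neg_apply, neg_neg,
          Pi.smul_apply, smul_eq_mul, zero_add, Finset.smul_sum, smul_smul])
  have htan : ∀ i : Fin m, fderiv ℝ (coordGraph u x) y (EuclideanSpace.single i 1) = graphTangent û y i := by
    intro i
    have h1 : HasFDerivAt (coordGraph u x) ((fderiv ℝ û y).prod (ContinuousLinearMap.id ℝ _)) y :=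
      (hûc.differentiableAt (by simp)).hasFDerivAt.prodMk (hasFDerivAt_id y)
    rw [h1.fderiv]; rfl
  have hH : D.meanCurvature u x = ∑ i, ∑ j, (graphGram (D.coordMetric x) û y)⁻¹ i j *
      coordSecondFundForm (D.coordMetric x) (fun y => (û y, y)) (D.coordNormal u x) y
        (EuclideanSpace.single i 1) (EuclideanSpace.single j 1) := by
    simp only [meanCurvature, ← hy₀, htan]
    rfl
  have hB := D.abs_sum_inv_graphGram_le (c := x) (y := y) hu1 hs' hy (A := A) (lam := lam)
    (hlapse _ (hT _) _).2.2 hlam.le (fun v => hsl _ (hT _) _ v)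
  rw [hxy] at hB
  set Q := ∑ i, ∑ j, (graphGram (D.coordMetric x) û y)⁻¹ i j *
      fderiv ℝ (fun q => D.coordMetric x q (graphTangent û y i) (graphTangent û y j)) (û y, y) (1, 0)
    with hQ
  have hsum : ∑ i, ∑ j, (graphGram (D.coordMetric x) û y)⁻¹ i j *
        (coordSecondFundForm (D.coordMetric x) (fun y => (û y, y))
          ((D.lapseAlong u x * D.tilt u x) • D.coordNormal u x) y (EuclideanSpace.single i 1)
          (EuclideanSpace.single j 1)
          - 1 / 2 * fderiv ℝ (fun q => D.coordMetric x q (graphTangent û y i) (graphTangent û y j)) (û y, y)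
            (1, 0)) = D.lapseAlong u x * D.tilt u x * D.meanCurvature u x - 1 / 2 * Q := by
    rw [hH, hQ]
    simp only [Finset.mul_sum, ← Finset.sum_sub_distrib]
    refine Finset.sum_congr rfl fun i _ => Finset.sum_congr rfl fun j _ => ?_
    rw [coordSecondFundForm_smul (F := fun y => (û y, y)) hb]
    ring
  have hflux : D.fluxDiv u x = (∑ i, fderiv ℝ (fun y => graphFlux (D.coordMetric x) û y i) y
      (EuclideanSpace.single i 1)) / chartDensity (D.sigma u) x y := rfl
  rw [hflux, hdiv, hsum, hdet.2]
  -- Since √det g = α^m √det σ / w, the factor w in αwN cancels in front of H, and the error Q of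
  -- order w² is divided by w.
  have e5 : D.lapseAlong u x ^ m * chartDensity (D.sigma u) x y / D.tilt u x *
      (D.lapseAlong u x * D.tilt u x * D.meanCurvature u x - 1 / 2 * Q) / chartDensity (D.sigma u) x y
      - D.lapseAlong u x ^ (m + 1) * D.meanCurvature u x
      = -(D.lapseAlong u x ^ m * Q / (2 * D.tilt u x)) := by
    field_simp
    ring
  rw [e5, abs_neg, abs_div, abs_mul, abs_of_pos (pow_pos hapos m), abs_of_pos (by positivity : 0 < 2 * D.tilt u x),
    div_le_iff₀ (by positivity)]
  have ha : D.lapseAlong u x ≤ a₁ := (hlapse _ (hT x) x).2.1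
  have h6 : |Q| ≤ ((2 * A + lam) * D.tilt u x ^ 2) * m := by
    refine hB.trans ?_
    gcongr
    nlinarith [one_le_pow₀ hw1 (n := 2)]
  calc D.lapseAlong u x ^ m * |Q| ≤ a₁ ^ m * (((2 * A + lam) * D.tilt u x ^ 2) * m) := by gcongr
    _ ≤ a₁ ^ m * (2 * A + lam) * m * D.tilt u x * (2 * D.tilt u x) := by
        have : 0 ≤ a₁ ^ m * ((2 * A + lam) * m * D.tilt u x ^ 2) := by positivity
        nlinarith

end Bounds

end SpacelikeHypersurface

namespace SpacelikeHypersurface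

/-! ### The projection of the hypersurface -/

section Projection

variable {m : ℕ} [NeZero m] {S : Type*} [TopologicalSpace S]
  [ChartedSpace (EuclideanSpace ℝ (Fin m)) S] {G : SplitSpacetime m S}
  {Sig : Type*} [TopologicalSpace Sig] [ChartedSpace (EuclideanHalfSpace m) Sig]
  (D : SpacelikeHypersurface G Sig)

omit [NeZero m] in
theorem vertical_inextendible (p : S) : G.InextendibleTimelike fun s => (s, p) := by
  refine ⟨⟨(by fun_prop), ∅, by simp, fun a b hab _ _ => ⟨?_, fun s hs => ?_⟩⟩, ?_, ?_⟩
  · exact (contMDiff_id.prodMk contMDiff_const).contMDiffOn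
  · have h1 : derivWithin (fun r : ℝ => r) (Icc a b) s = 1 :=
      derivWithin_id' _ _ (uniqueDiffOn_Icc hab s hs)
    have h2 : mfderivWithin 𝓘(ℝ, ℝ) (𝓡 m) (fun _ : ℝ => p) (Icc a b) s = 0 := mfderivWithin_const
    simp only [SplitSpacetime.FutureTimelike, SplitSpacetime.metric]
    rw [h1, h2]
    refine ⟨one_pos, ?_⟩
    have hpos := G.lapse_pos (s, p)
    have : G.spatial s p ((0 : TangentSpace 𝓘(ℝ, ℝ) s →L[ℝ] TangentSpace (𝓡 m) p) (1 : ℝ))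
        ((0 : TangentSpace 𝓘(ℝ, ℝ) s →L[ℝ] TangentSpace (𝓡 m) p) (1 : ℝ)) = 0 := by
      change G.spatial s p 0 0 = 0
      simp
    rw [this]
    nlinarith [pow_pos hpos 2]
  · rintro ⟨q, hq⟩
    exact not_tendsto_nhds_of_tendsto_atTop tendsto_id q.1 ((continuous_fst.tendsto q).comp hq)
  · rintro ⟨q, hq⟩
    exact not_tendsto_nhds_of_tendsto_atBot tendsto_id q.1 ((continuous_fst.tendsto q).comp hq)

/-- The vertical line over a point of S is an inextendible timelike curve, so an achronal set meets
it at most once. -/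
theorem proj_injective : Function.Injective D.proj := by
  intro x x' h
  have h1 := D.achronal _ (vertical_inextendible (G := G) (D.proj x)) (D.height x) (D.height x')
    ⟨x, rfl⟩ ⟨x', by simp [h]⟩
  exact D.injective (Prod.ext h1 h)

variable [IsManifold (𝓡 m) ∞ S] [IsManifold (𝓡∂ m) ∞ Sig]

/-- At interior points the projection has a differentiable local inverse. -/
theorem exists_local_inverse {x₀ : Sig} (hx₀ : x₀ ∈ (𝓡∂ m).interior Sig) :
    ∃ h : S → Sig, (∀ᶠ x in 𝓝 x₀, h (D.proj x) = x) ∧ (∀ᶠ p in 𝓝 (D.proj x₀), D.proj (h p) = p) ∧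
      MDifferentiableAt (𝓡 m) (𝓡∂ m) h (D.proj x₀) := by
  set e := extChartAt (𝓡∂ m) x₀ with he
  set e' := extChartAt (𝓡 m) (D.proj x₀) with he'
  set y₀ := e x₀ with hy₀
  have hyi : y₀ ∈ interior e.target := (isInteriorPoint_iff_extChartAt (mem_extChartAt_source x₀)).1 hx₀
  have hyt : y₀ ∈ e.target := interior_subset hyi
  have hey₀ : e.symm y₀ = x₀ := e.left_inv (mem_extChartAt_source x₀)
  have hr : range (𝓡∂ m) ∈ 𝓝 y₀ := mem_of_superset (isOpen_interior.mem_nhds hyi)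
    (interior_subset.trans (extChartAt_target_subset_range x₀))
  set F : EuclideanSpace ℝ (Fin m) → EuclideanSpace ℝ (Fin m) := e' ∘ D.proj ∘ e.symm with hF
  have hFc : ContDiffAt ℝ ∞ F y₀ := by
    have := ((contMDiffAt_iff_of_mem_source (x := x₀) (y := D.proj x₀) (mem_chart_source _ _)
      (mem_chart_source _ _)).1 (D.proj_smooth x₀)).2
    exact this.contDiffAt hr
  have hsymm : MDifferentiableAt 𝓘(ℝ, EuclideanSpace ℝ (Fin m)) (𝓡∂ m) e.symm y₀ :=
    (mdifferentiableWithinAt_extChartAt_symm hyt).mdifferentiableAt hr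
  have hsrc' : D.proj (e.symm y₀) ∈ e'.source := by rw [hey₀]; exact mem_extChartAt_source _
  have he'd : MDifferentiableAt (𝓡 m) 𝓘(ℝ, EuclideanSpace ℝ (Fin m)) e' (D.proj (e.symm y₀)) :=
    mdifferentiableAt_extChartAt (by rwa [← extChartAt_source (𝓡 m)])
  have hpd : MDifferentiableAt (𝓡∂ m) (𝓡 m) D.proj (e.symm y₀) := D.proj_smooth.mdifferentiable (by simp) _
  have hF' : fderiv ℝ F y₀ = (mfderiv (𝓡 m) 𝓘(ℝ, EuclideanSpace ℝ (Fin m)) e' (D.proj (e.symm y₀))).comp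
      ((mfderiv (𝓡∂ m) (𝓡 m) D.proj (e.symm y₀)).comp
        (mfderiv 𝓘(ℝ, EuclideanSpace ℝ (Fin m)) (𝓡∂ m) e.symm y₀)) := by
    rw [← mfderiv_eq_fderiv]
    exact (he'd.hasMFDerivAt.comp y₀ (hpd.hasMFDerivAt.comp y₀ hsymm.hasMFDerivAt)).mfderiv
  have hinj : Function.Injective (fderiv ℝ F y₀) := by
    rw [hF']
    refine (isInvertible_mfderiv_extChartAt hsrc').injective.comp
      ((D.mfderiv_proj_injective _).comp ?_)
    have := chartFrame_injective hyt
    rwa [chartFrame, mfderivWithin_of_mem_nhds hr] at this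
  -- Source and target have the same dimension, so the injective differential is invertible and the
  -- inverse function theorem applies to π in charts.
  let L := (LinearEquiv.ofInjectiveEndo (fderiv ℝ F y₀).toLinearMap hinj).toContinuousLinearEquiv
  have hL : (L : EuclideanSpace ℝ (Fin m) →L[ℝ] EuclideanSpace ℝ (Fin m)) = fderiv ℝ F y₀ := by
    ext v; rfl
  have hstrict : HasStrictFDerivAt F (L : EuclideanSpace ℝ (Fin m) →L[ℝ] EuclideanSpace ℝ (Fin m)) y₀ := by
    rw [hL]; exact hFc.hasStrictFDerivAt (by simp)
  set g := hstrict.localInverse F L y₀ with hg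
  have hgF : ∀ᶠ y in 𝓝 y₀, g (F y) = y := hstrict.eventually_left_inverse
  have hFg : ∀ᶠ z in 𝓝 (F y₀), F (g z) = z := hstrict.eventually_right_inverse
  have hgd : HasStrictFDerivAt g (L.symm : EuclideanSpace ℝ (Fin m) →L[ℝ] EuclideanSpace ℝ (Fin m)) (F y₀) :=
    hstrict.to_localInverse
  have hgy₀ : g (F y₀) = y₀ := hgF.self_of_nhds
  have hFy₀ : F y₀ = e' (D.proj x₀) := by simp only [hF, Function.comp_apply, hey₀]
  have he'c : ContinuousAt e' (D.proj x₀) := continuousAt_extChartAt (D.proj x₀)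
  have hgc : ContinuousAt (fun p => g (e' p)) (D.proj x₀) := by
    refine ContinuousAt.comp (g := g) ?_ he'c
    rw [← hFy₀]; exact hgd.hasFDerivAt.continuousAt
  have hgv : g (e' (D.proj x₀)) = y₀ := by rw [← hFy₀, hgy₀]
  refine ⟨fun p => e.symm (g (e' p)), ?_, ?_, ?_⟩
  · have h1 : ∀ᶠ x in 𝓝 x₀, g (F (e x)) = e x := (continuousAt_extChartAt x₀).eventually hgF
    filter_upwards [h1, extChartAt_source_mem_nhds (I := 𝓡∂ m) x₀] with x hx hxs
    have : F (e x) = e' (D.proj x) := by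
      simp only [hF, Function.comp_apply]; rw [e.left_inv hxs]
    rw [← this, hx, e.left_inv hxs]
  · have h1 : ∀ᶠ p in 𝓝 (D.proj x₀), F (g (e' p)) = e' p := by
      rw [hFy₀] at hFg; exact he'c.eventually hFg
    have h2 : ∀ᶠ p in 𝓝 (D.proj x₀), D.proj (e.symm (g (e' p))) ∈ e'.source := by
      have h3 : ContinuousAt (fun p => D.proj (e.symm (g (e' p)))) (D.proj x₀) := by
        refine D.proj_smooth.continuous.continuousAt.comp ?_
        refine ContinuousAt.comp (g := e.symm) ?_ hgc
        rw [hgv]; exact hsymm.continuousAt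
      refine h3.eventually ((isOpen_extChartAt_source _).mem_nhds ?_)
      change D.proj (e.symm (g (e' (D.proj x₀)))) ∈ e'.source
      rwa [hgv]
    filter_upwards [h1, h2, extChartAt_source_mem_nhds (I := 𝓡 m) (D.proj x₀)] with p hp hp2 hp3
    exact e'.injOn hp2 hp3 hp
  · have h1 : MDifferentiableAt (𝓡 m) 𝓘(ℝ, EuclideanSpace ℝ (Fin m)) (fun p => g (e' p)) (D.proj x₀) := by
      refine MDifferentiableAt.comp (g := g) (I' := 𝓘(ℝ, EuclideanSpace ℝ (Fin m))) (D.proj x₀) ?_ (mdifferentiableAt_extChartAt (mem_chart_source _ _))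
      rw [← hFy₀]
      exact hgd.hasFDerivAt.differentiableAt.mdifferentiableAt
    refine MDifferentiableAt.comp (g := e.symm) (D.proj x₀) ?_ h1
    rw [hgv]; exact hsymm

/-- Lifts of differentiable curves. -/
theorem exists_lift_deriv {x : ℝ → Sig} {q : ℝ → S} {s : ℝ} (hxc : ContinuousWithinAt x (Ici s) s)
    (hxi : x s ∈ (𝓡∂ m).interior Sig) (hq : ∀ᶠ r in 𝓝[Ici s] s, D.proj (x r) = q r)
    {A : TangentSpace 𝓘(ℝ, ℝ) s →L[ℝ] TangentSpace (𝓡 m) (q s)}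
    (hA : HasMFDerivWithinAt 𝓘(ℝ, ℝ) (𝓡 m) q (Ici s) s A) {t : ℝ} :
    ∃ ξ : TangentSpace (𝓡∂ m) (x s), D.slice t (x s) ξ ξ = G.spatial t (q s) (A (1 : ℝ)) (A (1 : ℝ)) ∧
      ∀ f : Sig → ℝ, ContMDiff (𝓡∂ m) 𝓘(ℝ, ℝ) 1 f →
        HasDerivWithinAt (fun r => f (x r)) (dAlong f (x s) ξ) (Ici s) s := by
  obtain ⟨h, hh1, hh2, hhd⟩ := D.exists_local_inverse hxi
  have hqs : D.proj (x s) = q s := hq.self_of_nhdsWithin (mem_Ici.2 le_rfl)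
  have hxq : x =ᶠ[𝓝[Ici s] s] fun r => h (q r) := by
    filter_upwards [hq, hxc.eventually hh1] with r hr1 hr2
    rw [← hr1, hr2]
  rw [hqs] at hhd
  have h1 : HasMFDerivWithinAt 𝓘(ℝ, ℝ) (𝓡∂ m) x (Ici s) s
      ((mfderiv (𝓡 m) (𝓡∂ m) h (q s)).comp A) :=
    (hhd.hasMFDerivAt.comp_hasMFDerivWithinAt s hA).congr_of_eventuallyEq hxq
      (hxq.self_of_nhdsWithin (mem_Ici.2 le_rfl))
  obtain ⟨X, hX⟩ : ∃ X : TangentSpace 𝓘(ℝ, ℝ) s →L[ℝ] TangentSpace (𝓡∂ m) (x s),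
    HasMFDerivWithinAt 𝓘(ℝ, ℝ) (𝓡∂ m) x (Ici s) s X := ⟨_, h1⟩
  have h2 : HasMFDerivWithinAt 𝓘(ℝ, ℝ) (𝓡 m) (fun r => D.proj (x r)) (Ici s) s
      ((mfderiv (𝓡∂ m) (𝓡 m) D.proj (x s)).comp X) :=
    (D.proj_smooth.mdifferentiable (by simp) _).hasMFDerivAt.comp_hasMFDerivWithinAt s hX
  have h3 : HasMFDerivWithinAt 𝓘(ℝ, ℝ) (𝓡 m) (fun r => D.proj (x r)) (Ici s) s A :=
    hA.congr_of_eventuallyEq hq hqs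
  have hu : UniqueMDiffWithinAt 𝓘(ℝ, ℝ) (Ici s) s :=
    (uniqueDiffWithinAt_Ici s).uniqueMDiffWithinAt
  have h4 := hu.eq h2 h3
  refine ⟨X (1 : ℝ), ?_, fun f hf => ?_⟩
  · have h5 : mfderiv (𝓡∂ m) (𝓡 m) D.proj (x s) (X (1 : ℝ)) = A (1 : ℝ) := congrArg (fun B => B (1 : ℝ)) h4
    have h6 : ∀ p p' : S, ∀ v : EuclideanSpace ℝ (Fin m), p = p' →
      G.spatial t p (v : EuclideanSpace ℝ (Fin m)) (v : EuclideanSpace ℝ (Fin m)) = G.spatial t p' (v : EuclideanSpace ℝ (Fin m)) (v : EuclideanSpace ℝ (Fin m)) := by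
      rintro p _ v rfl; rfl
    refine Eq.trans ?_ (h6 _ _ (A (1 : ℝ)) hqs)
    rw [slice, h5]
  · have h7 := (hf.mdifferentiable (by simp) (x s)).hasMFDerivAt.comp_hasMFDerivWithinAt s hX
    obtain ⟨B, hB, hB1⟩ : ∃ B : ℝ →L[ℝ] ℝ, HasFDerivWithinAt (fun r => f (x r)) B (Ici s) s ∧
      B 1 = dAlong f (x s) (X (1 : ℝ)) := ⟨_, h7.hasFDerivWithinAt, rfl⟩
    rw [← hB1]
    exact hB.hasDerivWithinAt

end Projection

end SpacelikeHypersurface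

/-! ### Monotonicity and convergence along curves -/

section Convergence

theorem le_of_right_deriv_nonneg {g : ℝ → ℝ} {a b : ℝ} (hab : a ≤ b) (hg : ContinuousOn g (Icc a b))
    (h : ∀ s ∈ Ico a b, ∃ g', 0 ≤ g' ∧ HasDerivWithinAt g g' (Ici s) s) : g a ≤ g b := by
  choose! g' hg' hgd using h
  exact image_le_of_deriv_right_le_deriv_boundary (f := fun _ => g a) (f' := fun _ => 0)
    continuousOn_const (fun x _ => hasDerivWithinAt_const _ _ _) le_rfl hg hgd hg' ⟨hab, le_rfl⟩

theorem exists_tendsto_of_right_deriv_nonneg {g : ℝ → ℝ} (hg : ContinuousOn g (Ici 0))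
    (h : ∀ s, 0 ≤ s → ∃ g', 0 ≤ g' ∧ HasDerivWithinAt g g' (Ici s) s) {M : ℝ}
    (hM : ∀ s, 0 ≤ s → g s ≤ M) : ∃ l, Tendsto g atTop (𝓝 l) := by
  have hmono : Monotone fun s => g (max s 0) := by
    intro a b hab
    refine le_of_right_deriv_nonneg (max_le_max_right 0 hab)
      (hg.mono fun s hs => (le_max_right a 0).trans hs.1) fun s hs => h s ((le_max_right a 0).trans hs.1)
  have h1 := tendsto_atTop_ciSup hmono ⟨M, by rintro _ ⟨s, rfl⟩; exact hM _ (le_max_right _ _)⟩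
  refine ⟨_, h1.congr' ?_⟩
  filter_upwards [eventually_ge_atTop 0] with s hs
  simp only [max_eq_left hs]

theorem eventually_pos_of_right_deriv_pos {g : ℝ → ℝ} {s g' : ℝ} (hg : HasDerivWithinAt g g' (Ici s) s)
    (hg' : 0 < g') (h0 : g s = 0) : ∀ᶠ r in 𝓝[>] s, 0 < g r := by
  have h1 := (hasDerivWithinAt_iff_tendsto_slope.1 hg).eventually (lt_mem_nhds hg')
  rw [Ici_sdiff_left] at h1
  filter_upwards [h1, self_mem_nhdsWithin] with r hr hrs
  rw [slope_def_field, h0, sub_zero] at hr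
  have : 0 < r - s := sub_pos.2 hrs
  exact (div_pos_iff_of_pos_right this).1 hr

variable {m : ℕ} [NeZero m] {Sig : Type*} [TopologicalSpace Sig] [T2Space Sig] [CompactSpace Sig]
  [ChartedSpace (EuclideanHalfSpace m) Sig] [IsManifold (𝓡∂ m) ∞ Sig]

/-- A curve converges if all smooth functions converge along it. -/
theorem exists_tendsto_of_smooth {x : ℝ → Sig} (h : ∀ f : Sig → ℝ, ContMDiff (𝓡∂ m) 𝓘(ℝ, ℝ) ∞ f →
    ∃ l, Tendsto (fun s => f (x s)) atTop (𝓝 l)) : ∃ x₀, Tendsto x atTop (𝓝 x₀) := by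
  obtain ⟨x₀, hx₀⟩ := exists_clusterPt_of_compactSpace (map x atTop)
  refine ⟨x₀, fun V hV => ?_⟩
  obtain ⟨f, hfV⟩ := ((SmoothBumpFunction.nhds_basis_tsupport (I := 𝓡∂ m) x₀).mem_iff).1 hV
  obtain ⟨l, hl⟩ := h f f.contMDiff
  have hf1 : f x₀ = 1 := f.eq_one
  have hN : {z | (3 / 4 : ℝ) < f z} ∈ 𝓝 x₀ :=
    f.continuous.continuousAt.eventually (lt_mem_nhds (by rw [hf1]; norm_num))
  have hfreq : ∃ᶠ s in atTop, (3 / 4 : ℝ) < f (x s) :=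
    (mapClusterPt_iff_frequently.1 hx₀) _ hN
  -- Along the curve the bump function f exceeds 3/4 at arbitrarily late times, because x₀ is a
  -- cluster point. As f converges along the curve, it is eventually above 1/2, which keeps the
  -- curve in the support.
  have hl2 : 3 / 4 ≤ l := by
    by_contra hlt
    push Not at hlt
    exact hfreq ((hl.eventually (gt_mem_nhds hlt)).mono fun s hs => not_lt.2 hs.le)
  have hev := hl.eventually (lt_mem_nhds (show (1 / 2 : ℝ) < l by linarith))
  rw [mem_map]
  filter_upwards [hev] with s hs
  refine hfV.2 (subset_tsupport _ ?_)
  rw [Function.mem_support]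
  intro h0
  rw [h0] at hs
  norm_num at hs

end Convergence

namespace SpacelikeHypersurface

/-! ### One-sided velocities of causal curves -/

section Development

variable {m : ℕ} {S : Type*} [TopologicalSpace S]
  [ChartedSpace (EuclideanSpace ℝ (Fin m)) S] (G : SplitSpacetime m S)

/-- Causal curves with one-sided velocities, future directed for `ε = 1` and past directed for
`ε = -1`. -/
structure RightCausal (ε : ℝ) (β : ℝ → ℝ × S) : Prop where
  cont : ContinuousOn β (Ici 0)
  vel : ∀ s, 0 ≤ s → ∃ (θ : ℝ) (A : TangentSpace 𝓘(ℝ, ℝ) s →L[ℝ] TangentSpace (𝓡 m) (β s).2),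
    0 < ε * θ ∧ G.spatial (β s).1 (β s).2 (A (1 : ℝ)) (A (1 : ℝ)) ≤ θ ^ 2 ∧
    HasDerivWithinAt (fun r => (β r).1) θ (Ici s) s ∧
    HasMFDerivWithinAt 𝓘(ℝ, ℝ) (𝓡 m) (fun r => (β r).2) (Ici s) s A

/-- Local finiteness leaves a break-free interval on either side of every time, a break included.
This is what yields one-sided velocities everywhere. -/
theorem exists_Ioo_disjoint {B : Set ℝ} (hB : ∀ a b, (B ∩ Icc a b).Finite) (s : ℝ) :
    (∃ b > s, Disjoint B (Ioo s b)) ∧ ∃ a < s, Disjoint B (Ioo a s) := by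
  have hfin : ((B ∩ Icc (s - 1) (s + 1)) \ {s}).Finite := (hB _ _).subset sdiff_subset
  have hn : ((B ∩ Icc (s - 1) (s + 1)) \ {s})ᶜ ∈ 𝓝 s :=
    hfin.isClosed.isOpen_compl.mem_nhds (by simp)
  obtain ⟨δ, hδ, hball⟩ := Metric.mem_nhds_iff.1 hn
  have key : ∀ r, |r - s| < δ → |r - s| ≤ 1 → r ≠ s → r ∉ B := by
    intro r h1 h2 h3 hr
    rw [abs_le] at h2
    exact hball (show r ∈ Metric.ball s δ by rwa [Metric.mem_ball, Real.dist_eq])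
      ⟨⟨hr, by constructor <;> linarith⟩, h3⟩
  constructor
  · refine ⟨s + min δ 1, by have := lt_min hδ one_pos; linarith, disjoint_left.2 fun r hr hr2 => ?_⟩
    refine key r ?_ ?_ hr2.1.ne' hr <;> rw [abs_of_pos (by linarith [hr2.1])]
    · linarith [hr2.2, min_le_left δ 1]
    · linarith [hr2.2, min_le_right δ 1]
  · refine ⟨s - min δ 1, by have := lt_min hδ one_pos; linarith, disjoint_left.2 fun r hr hr2 => ?_⟩
    refine key r ?_ ?_ hr2.2.ne hr <;> rw [abs_of_neg (by linarith [hr2.2])]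
    · linarith [hr2.1, min_le_left δ 1]
    · linarith [hr2.1, min_le_right δ 1]

variable {G}

theorem spatial_le_of_futureCausal {p : ℝ × S} {V : ℝ × TangentSpace (𝓡 m) p.2}
    (h : G.FutureCausal p V) : 0 < V.1 ∧ G.spatial p.1 p.2 V.2 V.2 ≤ V.1 ^ 2 := by
  refine ⟨h.1, ?_⟩
  have h2 := h.2
  rw [SplitSpacetime.metric] at h2
  have hpos := pow_pos (G.lapse_pos p) 2
  by_contra hlt
  push Not at hlt
  nlinarith

variable [IsManifold (𝓡 m) ∞ S]

omit [IsManifold (𝓡 m) ∞ S] in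
theorem RightCausal.of_future {γ : ℝ → ℝ × S}
    (h : SplitSpacetime.PiecewiseCurve G.FutureCausal (Ici 0) γ) : RightCausal G 1 γ := by
  obtain ⟨hc, B, hB, hγ⟩ := h
  refine ⟨hc, fun s hs => ?_⟩
  obtain ⟨⟨b, hb, hd⟩, -⟩ := exists_Ioo_disjoint hB s
  obtain ⟨h1, h2⟩ := hγ s b hb (fun r hr => hs.trans hr.1) hd
  have hsm : s ∈ Icc s b := ⟨le_rfl, hb.le⟩
  have h3 := spatial_le_of_futureCausal (h2 s hsm)
  have hn : Icc s b ∈ 𝓝[Ici s] s := Icc_mem_nhdsGE hb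
  have hm : MDifferentiableWithinAt 𝓘(ℝ, ℝ) (𝓘(ℝ, ℝ).prod (𝓡 m)) γ (Icc s b) s :=
    (h1 s hsm).mdifferentiableWithinAt (by simp)
  have hm1 : MDifferentiableWithinAt 𝓘(ℝ, ℝ) 𝓘(ℝ, ℝ) (fun r => (γ r).1) (Icc s b) s := hm.fst
  have hm2 : MDifferentiableWithinAt 𝓘(ℝ, ℝ) (𝓡 m) (fun r => (γ r).2) (Icc s b) s := hm.snd
  exact ⟨_, _, by rw [one_mul]; exact h3.1, h3.2,
    hm1.differentiableWithinAt.hasDerivWithinAt.mono_of_mem_nhdsWithin hn,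
    hm2.hasMFDerivWithinAt.mono_of_mem_nhdsWithin hn⟩

omit [IsManifold (𝓡 m) ∞ S] in
-- Reversing the parameter turns left derivatives of γ into right derivatives and past developments
-- into future ones up to the sign ε, so one argument covers both halves of D(Σ).
theorem RightCausal.of_past {γ : ℝ → ℝ × S}
    (h : SplitSpacetime.PiecewiseCurve G.FutureCausal (Iic 0) γ) :
    RightCausal G (-1) fun s => γ (-s) := by
  obtain ⟨hc, B, hB, hγ⟩ := h
  refine ⟨hc.comp continuousOn_neg fun s hs => by simpa using hs, fun s hs => ?_⟩
  obtain ⟨-, ⟨a, ha, hd⟩⟩ := exists_Ioo_disjoint hB (-s)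
  obtain ⟨h1, h2⟩ := hγ a (-s) ha (fun r hr => hr.2.trans (by simpa using hs)) hd
  have hsm : -s ∈ Icc a (-s) := ⟨ha.le, le_rfl⟩
  have h3 := spatial_le_of_futureCausal (h2 (-s) hsm)
  have hm : MDifferentiableWithinAt 𝓘(ℝ, ℝ) (𝓘(ℝ, ℝ).prod (𝓡 m)) γ (Icc a (-s)) (-s) :=
    (h1 (-s) hsm).mdifferentiableWithinAt (by simp)
  have hm1 : MDifferentiableWithinAt 𝓘(ℝ, ℝ) 𝓘(ℝ, ℝ) (fun r => (γ r).1) (Icc a (-s)) (-s) := hm.fst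
  have hm2 : MDifferentiableWithinAt 𝓘(ℝ, ℝ) (𝓡 m) (fun r => (γ r).2) (Icc a (-s)) (-s) := hm.snd
  have hn : Icc s (-a) ∈ 𝓝[Ici s] s := Icc_mem_nhdsGE (by linarith)
  have hmaps : MapsTo (fun r : ℝ => -r) (Icc s (-a)) (Icc a (-s)) := fun r hr =>
    ⟨by linarith [hr.2], by linarith [hr.1]⟩
  have hneg : HasMFDerivWithinAt 𝓘(ℝ, ℝ) 𝓘(ℝ, ℝ) (fun r : ℝ => -r) (Icc s (-a)) s
      (-ContinuousLinearMap.id ℝ ℝ) :=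
    (hasFDerivAt_id s).neg.hasFDerivWithinAt.hasMFDerivWithinAt
  have d1 := (hm1.differentiableWithinAt.hasDerivWithinAt.scomp s
    ((hasDerivAt_neg s).hasDerivWithinAt (s := Icc s (-a))) hmaps).mono_of_mem_nhdsWithin hn
  have d2 := (hm2.hasMFDerivWithinAt.comp s hneg hmaps).mono_of_mem_nhdsWithin hn
  refine ⟨_, _, ?_, ?_, d1, d2⟩
  · simpa using h3.1
  · set A := mfderivWithin 𝓘(ℝ, ℝ) (𝓡 m) (fun r => (γ r).2) (Icc a (-s)) (-s) with hA
    have e1 : (A.comp (-ContinuousLinearMap.id ℝ ℝ)) (1 : ℝ) = -A (1 : ℝ) := by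
      change A (-(1 : ℝ)) = _
      exact map_neg A (1 : ℝ)
    have h4 := h3.2
    have e2 : G.spatial (γ (-s)).1 (γ (-s)).2 (-A (1 : ℝ)) (-A (1 : ℝ))
        = G.spatial (γ (-s)).1 (γ (-s)).2 (A (1 : ℝ)) (A (1 : ℝ)) := by
      simp
    have e3 : (-1 : ℝ) • derivWithin (fun r => (γ r).1) (Icc a (-s)) (-s)
        = -derivWithin (fun r => (γ r).1) (Icc a (-s)) (-s) := by simp
    rw [e3, neg_sq]
    refine le_trans (le_of_eq ?_) h4
    refine Eq.trans ?_ e2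
    exact congrArg (fun z => G.spatial (γ (-s)).1 (γ (-s)).2 z z) e1

end Development

end SpacelikeHypersurface

namespace SpacelikeHypersurface

/-! ### Spacelike graphs lie in the Cauchy development -/

section Development

variable {m : ℕ} [NeZero m] {S : Type*} [TopologicalSpace S] [T2Space S]
  [ChartedSpace (EuclideanSpace ℝ (Fin m)) S] [IsManifold (𝓡 m) ∞ S] {G : SplitSpacetime m S}
  {Sig : Type*} [TopologicalSpace Sig] [CompactSpace Sig] [T2Space Sig]
  [ChartedSpace (EuclideanHalfSpace m) Sig] [IsManifold (𝓡∂ m) ∞ Sig]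
  (D : SpacelikeHypersurface G Sig)

omit [IsManifold (𝓡 m) ∞ S] [T2Space Sig] [IsManifold (𝓡∂ m) ∞ Sig] in
theorem isClosedEmbedding_proj : IsClosedEmbedding D.proj :=
  D.proj_smooth.continuous.isClosedEmbedding D.proj_injective

/-- The points between the graph of `U` and the hypersurface. -/
def regionBetween (ε : ℝ) (U : Sig → ℝ) : Set (ℝ × S) :=
  {p | ∃ x, D.proj x = p.2 ∧ 0 ≤ ε * (p.1 - U x) ∧ 0 ≤ ε * (D.height x - p.1)}

omit [IsManifold (𝓡 m) ∞ S] [T2Space Sig] [IsManifold (𝓡∂ m) ∞ Sig] in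
theorem isClosed_regionBetween (ε : ℝ) {U : Sig → ℝ} (hU : Continuous U) :
    IsClosed (D.regionBetween ε U) := by
  have h1 : IsClosed {q : ℝ × Sig | 0 ≤ ε * (q.1 - U q.2) ∧ 0 ≤ ε * (D.height q.2 - q.1)} := by
    have a1 : Continuous fun q : ℝ × Sig => ε * (q.1 - U q.2) := by fun_prop
    have a2 : Continuous fun q : ℝ × Sig => ε * (D.height q.2 - q.1) := by fun_prop
    exact (isClosed_le continuous_const a1).inter (isClosed_le continuous_const a2)
  have h2 : IsClosedEmbedding (Prod.map id D.proj : ℝ × Sig → ℝ × S) :=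
    IsClosedEmbedding.id.prodMap D.isClosedEmbedding_proj
  convert h2.isClosedMap _ h1 using 1
  ext ⟨t, p⟩
  constructor
  · rintro ⟨x, rfl, h⟩
    exact ⟨(t, x), h, rfl⟩
  · rintro ⟨⟨t', x⟩, h, he⟩
    cases he
    exact ⟨x, rfl, h⟩

variable {ε : ℝ} (hε : ε = 1 ∨ ε = -1) {β : ℝ → ℝ × S} (hβ : RightCausal G ε β) {U : Sig → ℝ}
  (hU : ContMDiff (𝓡∂ m) 𝓘(ℝ, ℝ) 1 U) (hs : ∀ x, gradNormSq (D.sigma U) U x < 1)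
  (hb : ∀ x ∈ (𝓡∂ m).boundary Sig, U x = D.height x) (hnc : ∀ s, 0 ≤ s → β s ∉ D.carrier)

include hε hb hnc in
omit [T2Space S] [IsManifold (𝓡 m) ∞ S] [CompactSpace Sig] [T2Space Sig] [IsManifold (𝓡∂ m) ∞ Sig] in
-- The curve avoids Σ, so it lies strictly on one side of it; over a boundary point the graph of U
-- and Σ have equal height, and the region between them has no such point.
theorem interior_of_regionBetween {s : ℝ} (hs0 : 0 ≤ s) {x : Sig} (hx : D.proj x = (β s).2)
    (h1 : 0 ≤ ε * ((β s).1 - U x)) (h2 : 0 ≤ ε * (D.height x - (β s).1)) :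
    x ∈ (𝓡∂ m).interior Sig ∧ 0 < ε * (D.height x - (β s).1) := by
  have hne : ε * (D.height x - (β s).1) ≠ 0 := by
    refine mul_ne_zero (by rcases hε with h | h <;> simp [h]) fun h => ?_
    exact hnc s hs0 ⟨x, Prod.ext (sub_eq_zero.1 h) hx⟩
  have hpos := lt_of_le_of_ne h2 hne.symm
  refine ⟨?_, hpos⟩
  by_contra hi
  rw [← mem_compl_iff, ModelWithCorners.compl_interior] at hi
  rw [hb x hi] at h1
  have : ε * ((β s).1 - D.height x) = -(ε * (D.height x - (β s).1)) := by ring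
  linarith

include hε hβ hU hs hb hnc in
omit [T2Space Sig] in
-- A continuity argument. The region is closed, and the curve cannot leave it: not over ∂Σ, where
-- the region consists of points of Σ, and not through Σ, which it avoids. At contact with the graph
-- of U the causal velocity satisfies |dU(ξ)| < |θ|, so the curve strictly moves off the graph into
-- the region.
theorem mem_regionBetween (h0 : β 0 ∈ D.regionBetween ε U) : ∀ s, 0 ≤ s → β s ∈ D.regionBetween ε U := by
  intro b hb0
  have hcl : IsClosed ({s | β s ∈ D.regionBetween ε U} ∩ Icc 0 b) := by
    rw [inter_comm]
    exact (hβ.cont.mono fun s hs => hs.1).preimage_isClosed_of_isClosed isClosed_Icc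
      (D.isClosed_regionBetween ε hU.continuous)
  refine hcl.Icc_subset_of_forall_exists_gt h0 ?_ ⟨hb0, le_rfl⟩
  rintro s ⟨⟨x, hx, h1, h2⟩, hs0, -⟩ y hy
  obtain ⟨hxi, h2'⟩ := D.interior_of_regionBetween hε hb hnc hs0 hx h1 h2
  obtain ⟨h, hh1, hh2, hhd⟩ := D.exists_local_inverse hxi
  obtain ⟨θ, A, hθ, hA, hd1, hd2⟩ := hβ.vel s hs0
  have hβc : ContinuousWithinAt β (Ici s) s :=
    (hβ.cont s hs0).mono (Ici_subset_Ici.2 hs0)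
  have hβ2 : ContinuousWithinAt (fun r => (β r).2) (Ici s) s := hβc.snd
  have hhs : h (β s).2 = x := by rw [← hx]; exact hh1.self_of_nhds
  rw [hx] at hhd hh2
  have hXc : ContinuousWithinAt (fun r => h (β r).2) (Ici s) s :=
    ContinuousAt.comp_continuousWithinAt (f := fun r => (β r).2) hhd.continuousAt hβ2
  have hXp : ∀ᶠ r in 𝓝[Ici s] s, D.proj (h (β r).2) = (β r).2 := hβ2.eventually hh2
  have hev1 : ∀ᶠ r in 𝓝[>] s, 0 < ε * (D.height (h (β r).2) - (β r).1) := by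
    have hc : ContinuousWithinAt (fun r => ε * (D.height (h (β r).2) - (β r).1)) (Ici s) s :=
      (((D.height.continuous.continuousAt).comp_continuousWithinAt hXc).sub hβc.fst).const_mul ε
    refine (hc.eventually (lt_mem_nhds ?_)).filter_mono (nhdsWithin_mono _ Ioi_subset_Ici_self)
    simpa only [hhs] using h2'
  have hev2 : ∀ᶠ r in 𝓝[>] s, 0 < ε * ((β r).1 - U (h (β r).2)) := by
    have hc : ContinuousWithinAt (fun r => ε * ((β r).1 - U (h (β r).2))) (Ici s) s :=
      (hβc.fst.sub ((hU.continuous.continuousAt).comp_continuousWithinAt hXc)).const_mul ε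
    rcases h1.lt_or_eq with hlt | heq
    · refine (hc.eventually (lt_mem_nhds ?_)).filter_mono (nhdsWithin_mono _ Ioi_subset_Ici_self)
      simpa only [hhs] using hlt
    · obtain ⟨ξ, hξ, hf⟩ := D.exists_lift_deriv (x := fun r => h (β r).2) (q := fun r => (β r).2) hXc
        (by simpa only [hhs] using hxi) hXp hd2 (t := (β s).1)
      have hder := (hd1.sub (hf U hU)).const_mul ε
      refine eventually_pos_of_right_deriv_pos hder ?_ (by simp only [hhs]; exact heq.symm)
      have hUs : (β s).1 = U (h (β s).2) := by
        rw [hhs]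
        have := mul_eq_zero.1 heq.symm
        rcases hε with h | h <;> rw [h] at this <;> norm_num at this <;> linarith
      have hle := dAlong_sq_le (D.sigma_isInnerForm U (h (β s).2)) U ξ
      have e1 : D.sigma U (h (β s).2) ξ ξ ≤ θ ^ 2 := by
        rw [sigma_eq_slice, ← hUs]
        exact hξ.le.trans hA
      have hg := hs (h (β s).2)
      have hθ2 : 0 < θ ^ 2 := by
        have : θ ≠ 0 := by rintro rfl; simp at hθ
        positivity
      have e2 : dAlong U (h (β s).2) ξ ^ 2 < θ ^ 2 := by
        have hn := (D.sigma_isInnerForm U (h (β s).2)).self_nonneg ξ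
        have hg0 := gradNormSq_nonneg (D.sigma_isInnerForm U (h (β s).2)) U
        nlinarith
      have e3 : dAlong U (h (β s).2) ξ ^ 2 < (ε * θ) ^ 2 := by
        have : ε ^ 2 = 1 := by rcases hε with h | h <;> simp [h]
        rwa [mul_pow, this, one_mul]
      have e4 := abs_lt_of_sq_lt_sq' e3 hθ.le
      rcases hε with h | h <;> rw [h] at e4 ⊢ <;> linarith [e4.1, e4.2]
  have hev3 : ∀ᶠ r in 𝓝[>] s, D.proj (h (β r).2) = (β r).2 :=
    hXp.filter_mono (nhdsWithin_mono _ Ioi_subset_Ici_self)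
  obtain ⟨r, hr1, hr2, hr3, hr4⟩ := (hev1.and (hev2.and (hev3.and (Ioc_mem_nhdsGT hy)))).exists
  exact ⟨r, ⟨_, hr3, hr2.le, hr1.le⟩, hr4⟩

include hε hβ hU hs hb hnc in
/-- A causal curve that starts on a spacelike graph with the same boundary and avoids the
hypersurface has an endpoint. -/
theorem RightCausal.exists_tendsto (h0 : β 0 ∈ D.regionBetween ε U) :
    ∃ q, Tendsto β atTop (𝓝 q) := by
  have hR := D.mem_regionBetween hε hβ hU hs hb hnc h0
  have hX : ∀ s, ∃ x, 0 ≤ s → D.proj x = (β s).2 ∧ 0 ≤ ε * ((β s).1 - U x) ∧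
      0 ≤ ε * (D.height x - (β s).1) := by
    intro s
    by_cases hs0 : 0 ≤ s
    · obtain ⟨x, hx⟩ := hR s hs0
      exact ⟨x, fun _ => hx⟩
    · obtain ⟨x, -⟩ := hR 0 le_rfl
      exact ⟨x, fun h => absurd h hs0⟩
  choose x hx using hX
  have hxc : ContinuousOn x (Ici 0) := by
    rw [D.isClosedEmbedding_proj.isInducing.continuousOn_iff]
    exact hβ.cont.snd.congr fun s hs0 => (hx s hs0).1
  obtain ⟨T, hT⟩ : ∃ T : ℝ, ∀ z : Sig, |U z| ≤ T ∧ |D.height z| ≤ T := by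
    obtain ⟨T₁, h₁⟩ := isCompact_univ.exists_bound_of_continuousOn (f := U) hU.continuous.continuousOn
    obtain ⟨T₂, h₂⟩ := isCompact_univ.exists_bound_of_continuousOn (f := D.height) D.height.continuous.continuousOn
    exact ⟨max T₁ T₂, fun z => ⟨(h₁ z trivial).trans (le_max_left _ _), (h₂ z trivial).trans (le_max_right _ _)⟩⟩
  have htT : ∀ s, 0 ≤ s → (β s).1 ∈ Icc (-T) T := by
    intro s hs0
    obtain ⟨-, h1, h2⟩ := hx s hs0
    have a1 := abs_le.1 (hT (x s)).1
    have a2 := abs_le.1 (hT (x s)).2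
    rcases hε with h | h <;> rw [h] at h1 h2 <;> constructor <;> linarith
  have hder : ∀ f : Sig → ℝ, ContMDiff (𝓡∂ m) 𝓘(ℝ, ℝ) 1 f → ∀ s, 0 ≤ s → ∃ (θ : ℝ) (ξ : TangentSpace (𝓡∂ m) (x s)),
      0 < ε * θ ∧ D.slice (β s).1 (x s) ξ ξ ≤ θ ^ 2 ∧ HasDerivWithinAt (fun r => (β r).1) θ (Ici s) s ∧
      HasDerivWithinAt (fun r => f (x r)) (dAlong f (x s) ξ) (Ici s) s := by
    intro f hf s hs0
    obtain ⟨θ, A, hθ, hA, hd1, hd2⟩ := hβ.vel s hs0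
    have hi := (D.interior_of_regionBetween hε hb hnc hs0 (hx s hs0).1 (hx s hs0).2.1 (hx s hs0).2.2).1
    obtain ⟨ξ, hξ, hξf⟩ := D.exists_lift_deriv (x := x) (q := fun r => (β r).2)
      ((hxc s hs0).mono (Ici_subset_Ici.2 hs0)) hi
      (eventually_mem_nhdsWithin.mono fun r hr => (hx r (hs0.trans hr)).1) hd2 (t := (β s).1)
    exact ⟨θ, ξ, hθ, hξ.le.trans hA, hd1, hξf f hf⟩
  have habs : |ε| = 1 := by rcases hε with h | h <;> simp [h]
  have hεt : ∀ s, 0 ≤ s → ε * (β s).1 ≤ T := by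
    intro s hs0
    refine (le_abs_self _).trans ?_
    rw [abs_mul, habs, one_mul, abs_le]
    exact htT s hs0
  obtain ⟨l, hl⟩ : ∃ l, Tendsto (fun s => ε * (β s).1) atTop (𝓝 l) := by
    refine exists_tendsto_of_right_deriv_nonneg (hβ.cont.fst.const_mul ε) (fun s hs0 => ?_) hεt
    obtain ⟨θ, A, hθ, -, hd1, -⟩ := hβ.vel s hs0
    exact ⟨_, hθ.le, hd1.const_mul ε⟩
  obtain ⟨x₀, hx₀⟩ : ∃ x₀, Tendsto x atTop (𝓝 x₀) := by
    refine exists_tendsto_of_smooth (m := m) fun f hf => ?_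
    have hf1 : ContMDiff (𝓡∂ m) 𝓘(ℝ, ℝ) 1 f := hf.of_le (by exact_mod_cast le_top)
    obtain ⟨L, hL, hLf⟩ := D.exists_dAlong_sq_le hf1 T
    obtain ⟨M, hM⟩ := isCompact_univ.exists_bound_of_continuousOn (f := f) hf.continuous.continuousOn
    -- The velocity is causal, so |df(ξ)| ≤ L|θ|, and adding L times the directed time ετ makes f
    -- monotone along the curve. Both this sum and ετ are bounded, hence converge, and so does f.
    obtain ⟨l', hl'⟩ : ∃ l, Tendsto (fun s => f (x s) + L * (ε * (β s).1)) atTop (𝓝 l) := by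
      refine exists_tendsto_of_right_deriv_nonneg (M := M + L * T) ?_ (fun s hs0 => ?_) fun s hs0 => ?_
      · exact (hf.continuous.comp_continuousOn hxc).add ((hβ.cont.fst.const_mul ε).const_mul L)
      · obtain ⟨θ, ξ, hθ, hξ, hd1, hd2⟩ := hder f hf1 s hs0
        refine ⟨_, ?_, hd2.add ((hd1.const_mul ε).const_mul L)⟩
        have h1 := hLf _ (htT s hs0) (x s) ξ
        have h2 : dAlong f (x s) ξ ^ 2 ≤ (L * (ε * θ)) ^ 2 := by
          have : ε ^ 2 = 1 := by rcases hε with h | h <;> simp [h]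
          calc _ ≤ L ^ 2 * θ ^ 2 := h1.trans (mul_le_mul_of_nonneg_left hξ (sq_nonneg _))
            _ = _ := by rw [mul_pow, mul_pow, this, one_mul]
        have h3 := abs_le_of_sq_le_sq' h2 (mul_nonneg hL hθ.le)
        linarith [h3.1]
      · exact add_le_add ((le_abs_self _).trans (hM _ trivial)) (mul_le_mul_of_nonneg_left (hεt s hs0) hL)
    refine ⟨_, (hl'.sub (hl.const_mul L)).congr fun s => by ring⟩
  have h1 : Tendsto (fun s => (β s).1) atTop (𝓝 (ε * l)) := by
    refine (hl.const_mul ε).congr fun s => ?_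
    rcases hε with h | h <;> rw [h] <;> ring
  have h2 : Tendsto (fun s => (β s).2) atTop (𝓝 (D.proj x₀)) := by
    refine ((D.proj_smooth.continuous.tendsto x₀).comp hx₀).congr' ?_
    filter_upwards [eventually_ge_atTop 0] with s hs0
    exact (hx s hs0).1
  exact ⟨_, h1.prodMk_nhds h2⟩

include hU hs hb in
omit hnc in
/-- Spacelike graphs with the same boundary lie in the Cauchy development. -/
theorem graph_mem_development (x : Sig) : D.graphMap U x ∈ G.development D.carrier := by
  rcases le_total (U x) (D.height x) with h | h
  · right
    intro γ hγ h0 hne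
    by_contra! hc
    exact hne (RightCausal.exists_tendsto D (Or.inl rfl) (RightCausal.of_future hγ) hU hs hb
      hc ⟨x, by rw [h0], by rw [h0]; simp, by rw [h0]; simpa using h⟩)
  · left
    intro γ hγ h0 hne
    by_contra! hc
    obtain ⟨q, hq⟩ := RightCausal.exists_tendsto D (ε := -1) (Or.inr rfl) (RightCausal.of_past hγ) hU hs hb
      (fun s hs0 => hc (-s) (by linarith)) ⟨x, by simp [h0], by simp [h0], by simpa [h0] using h⟩
    refine hne ⟨q, ?_⟩
    simpa [Function.comp_def] using hq.comp tendsto_neg_atBot_atTop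

omit hb hs hU hnc hε hβ in
-- The graph is contained in D(Σ), whose closure is compact, so the time function is bounded on it
-- independently of u.
theorem exists_abs_le_of_isCompact (hC : IsCompact (closure (G.development D.carrier))) :
    ∃ T, 0 ≤ T ∧ ∀ u : Sig → ℝ, ContMDiff (𝓡∂ m) 𝓘(ℝ, ℝ) 1 u → (∀ x, gradNormSq (D.sigma u) u x < 1) →
      (∀ x ∈ (𝓡∂ m).boundary Sig, u x = D.height x) → ∀ x, u x ∈ Icc (-T) T := by
  obtain ⟨M, hM⟩ := (hC.image continuous_fst).isBounded.exists_norm_le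
  refine ⟨max M 0, le_max_right _ _, fun u hu hs hb x => ?_⟩
  refine abs_le.1 ?_
  exact (hM _ ⟨_, subset_closure (D.graph_mem_development hu hs hb x), rfl⟩).trans (le_max_left _ _)

omit hb hs hU hnc hε hβ in
-- Without boundary every constant height would be an admissible spacelike graph, and T + 1 violates
-- the height bound T.
theorem boundary_nonempty_of_isCompact [Nonempty Sig]
    (hC : IsCompact (closure (G.development D.carrier))) : ((𝓡∂ m).boundary Sig).Nonempty := by
  by_contra hne
  rw [not_nonempty_iff_eq_empty] at hne
  obtain ⟨x⟩ := ‹Nonempty Sig›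
  obtain ⟨T, hT0, hT⟩ := D.exists_abs_le_of_isCompact hC
  have h := hT (fun _ => T + 1) contMDiff_const (fun x => by
    rw [gradNormSq, dAlong_const]; exact one_pos) (by simp [hne]) x
  linarith [h.2]

end Development

end SpacelikeHypersurface

/-! ### Riemannian distances -/

section Distance

variable {m : ℕ} [NeZero m] {Sig : Type*} [TopologicalSpace Sig]
  [ChartedSpace (EuclideanHalfSpace m) Sig]
  {σ σ' : (x : Sig) → TangentSpace (𝓡∂ m) x → TangentSpace (𝓡∂ m) x → ℝ}

/-- The extended norm of the metric `σ`. -/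
@[reducible] noncomputable def metricENorm
    (σ : (x : Sig) → TangentSpace (𝓡∂ m) x → TangentSpace (𝓡∂ m) x → ℝ) (x : Sig) :
    ENorm (TangentSpace (𝓡∂ m) x) := ⟨fun v => ENNReal.ofReal √(σ x v v)⟩

theorem enormSMulClass_metricENorm (hσ : ∀ x, IsInnerForm (σ x)) (x : Sig) :
    letI := metricENorm σ x
    ENormSMulClass ℝ (TangentSpace (𝓡∂ m) x) := by
  let := metricENorm σ x
  refine ⟨fun r v => ?_⟩
  change ENNReal.ofReal √(σ x (r • v) (r • v)) = ‖r‖ₑ * ENNReal.ofReal √(σ x v v)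
  rw [(hσ x).smul_left, (hσ x).smul_right, ← mul_assoc, Real.sqrt_mul (mul_self_nonneg r),
    Real.sqrt_mul_self_eq_abs, ENNReal.ofReal_mul (abs_nonneg r), Real.enorm_eq_ofReal_abs]

theorem metricDist_eq_riemannianEDist (hσ : ∀ x, IsInnerForm (σ x)) (x y : Sig) :
    letI := metricENorm σ
    metricDist σ x y = Manifold.riemannianEDist (𝓡∂ m) x y := by
  let := metricENorm σ
  have := enormSMulClass_metricENorm hσ
  apply le_antisymm
  · refine le_of_forall_gt fun r hr => ?_
    obtain ⟨γ, h0, h1, hγ, hlen⟩ := Manifold.exists_lt_of_riemannianEDist_lt hr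
    refine lt_of_le_of_lt ?_ hlen
    rw [Manifold.pathELength_eq_lintegral_mfderivWithin_Icc]
    exact iInf_le_of_le γ (iInf_le_of_le hγ (iInf_le_of_le h0 (iInf_le_of_le h1 le_rfl)))
  · refine le_iInf fun γ => le_iInf fun hγ => le_iInf fun h0 => le_iInf fun h1 => ?_
    refine (Manifold.riemannianEDist_le_pathELength hγ h0 h1 zero_le_one).trans ?_
    rw [Manifold.pathELength_eq_lintegral_mfderivWithin_Icc]
    rfl

theorem metricDist_self (hσ : ∀ x, IsInnerForm (σ x)) (x : Sig) : metricDist σ x x = 0 := by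
  let := metricENorm σ
  have := enormSMulClass_metricENorm hσ
  rw [metricDist_eq_riemannianEDist hσ, Manifold.riemannianEDist_self]

theorem metricDist_comm (hσ : ∀ x, IsInnerForm (σ x)) (x y : Sig) : metricDist σ x y = metricDist σ y x := by
  let := metricENorm σ
  have := enormSMulClass_metricENorm hσ
  rw [metricDist_eq_riemannianEDist hσ, metricDist_eq_riemannianEDist hσ, Manifold.riemannianEDist_comm]

theorem metricDist_triangle [IsManifold (𝓡∂ m) ∞ Sig] (hσ : ∀ x, IsInnerForm (σ x)) (x y z : Sig) :
    metricDist σ x z ≤ metricDist σ x y + metricDist σ y z := by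
  let := metricENorm σ
  have := enormSMulClass_metricENorm hσ
  simp only [metricDist_eq_riemannianEDist hσ]
  exact Manifold.riemannianEDist_triangle

theorem metricDist_le_lintegral {γ : ℝ → Sig} (hγ : ContMDiffOn 𝓘(ℝ, ℝ) (𝓡∂ m) 1 γ (Icc 0 1))
    {x y : Sig} (h0 : γ 0 = x) (h1 : γ 1 = y) :
    metricDist σ x y ≤ ∫⁻ s in Icc (0 : ℝ) 1, ENNReal.ofReal √(σ (γ s)
        (mfderivWithin 𝓘(ℝ, ℝ) (𝓡∂ m) γ (Icc 0 1) s (1 : ℝ))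
        (mfderivWithin 𝓘(ℝ, ℝ) (𝓡∂ m) γ (Icc 0 1) s (1 : ℝ))) := by
  rw [metricDist]
  exact iInf_le_of_le γ (iInf_le_of_le hγ (iInf_le_of_le h0 (iInf_le_of_le h1 le_rfl)))

theorem le_mul_metricDist {K : ℝ} (hK : 0 < K) {A : ℝ≥0∞} {x y : Sig}
    (h : ∀ γ : ℝ → Sig, ContMDiffOn 𝓘(ℝ, ℝ) (𝓡∂ m) 1 γ (Icc 0 1) → γ 0 = x → γ 1 = y →
      A ≤ ∫⁻ s in Icc (0 : ℝ) 1, ENNReal.ofReal (K * √(σ (γ s)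
        (mfderivWithin 𝓘(ℝ, ℝ) (𝓡∂ m) γ (Icc 0 1) s (1 : ℝ))
        (mfderivWithin 𝓘(ℝ, ℝ) (𝓡∂ m) γ (Icc 0 1) s (1 : ℝ))))) :
    A ≤ ENNReal.ofReal K * metricDist σ x y := by
  have hK0 : ENNReal.ofReal K ≠ 0 := by simpa using hK
  rw [mul_comm, ← ENNReal.div_le_iff_le_mul (Or.inl hK0) (Or.inl ENNReal.ofReal_ne_top)]
  refine le_iInf fun γ => le_iInf fun hγ => le_iInf fun h0 => le_iInf fun h1 => ?_
  rw [ENNReal.div_le_iff_le_mul (Or.inl hK0) (Or.inl ENNReal.ofReal_ne_top), mul_comm,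
    ← lintegral_const_mul' _ _ ENNReal.ofReal_ne_top]
  simp_rw [← ENNReal.ofReal_mul hK.le]
  exact h γ hγ h0 h1

theorem metricDist_le_mul {K : ℝ} (hK : 0 < K) (h : ∀ x v, σ x v v ≤ K ^ 2 * σ' x v v) (x y : Sig) :
    metricDist σ x y ≤ ENNReal.ofReal K * metricDist σ' x y := by
  refine le_mul_metricDist hK fun γ hγ h0 h1 => ?_
  refine (metricDist_le_lintegral hγ h0 h1).trans ?_
  refine lintegral_mono fun s => ENNReal.ofReal_le_ofReal ?_
  rw [← Real.sqrt_sq hK.le, ← Real.sqrt_mul (sq_nonneg _)]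
  exact Real.sqrt_le_sqrt (h _ _)

theorem ofReal_abs_sub_le_metricDist {f : Sig → ℝ} (hf : ContMDiff (𝓡∂ m) 𝓘(ℝ, ℝ) 1 f) {L : ℝ}
    (hL : 0 < L) (h : ∀ x v, dAlong f x v ^ 2 ≤ L ^ 2 * σ x v v) (x y : Sig) :
    ENNReal.ofReal |f x - f y| ≤ ENNReal.ofReal L * metricDist σ x y := by
  refine le_mul_metricDist hL fun γ hγ h0 h1 => ?_
  have hc : ContDiffOn ℝ 1 (f ∘ γ) (Icc 0 1) := contMDiffOn_iff_contDiffOn.1 (hf.comp_contMDiffOn hγ)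
  have h2 := enorm_sub_le_lintegral_derivWithin_Icc_of_contDiffOn_Icc hc zero_le_one
  simp only [Function.comp_apply, h0, h1] at h2
  rw [abs_sub_comm, ← Real.enorm_eq_ofReal_abs]
  refine h2.trans (setLIntegral_mono' measurableSet_Icc fun s hs => ?_)
  rw [Real.enorm_eq_ofReal_abs]
  refine ENNReal.ofReal_le_ofReal ?_
  have hd : derivWithin (f ∘ γ) (Icc 0 1) s
      = dAlong f (γ s) (mfderivWithin 𝓘(ℝ, ℝ) (𝓡∂ m) γ (Icc 0 1) s (1 : ℝ)) := by
    have h3 := (hf.mdifferentiable (by simp) (γ s)).hasMFDerivAt.comp_hasMFDerivWithinAt s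
      ((hγ s hs).mdifferentiableWithinAt (by simp)).hasMFDerivWithinAt
    obtain ⟨B, hB, hB1⟩ : ∃ B : ℝ →L[ℝ] ℝ, HasFDerivWithinAt (f ∘ γ) B (Icc 0 1) s ∧
      B 1 = dAlong f (γ s) (mfderivWithin 𝓘(ℝ, ℝ) (𝓡∂ m) γ (Icc 0 1) s (1 : ℝ)) :=
      ⟨_, h3.hasFDerivWithinAt, rfl⟩
    rw [← hB1]
    exact hB.hasDerivWithinAt.derivWithin (uniqueDiffOn_Icc zero_lt_one s hs)
  rw [hd, ← Real.sqrt_sq hL.le, ← Real.sqrt_mul (sq_nonneg _)]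
  exact Real.abs_le_sqrt (h _ _)

end Distance

namespace SpacelikeHypersurface

/-! ### Comparison with Euclidean distance in charts -/

section Distance

variable {m : ℕ} [NeZero m] {S : Type*} [TopologicalSpace S]
  [ChartedSpace (EuclideanSpace ℝ (Fin m)) S] [IsManifold (𝓡 m) ∞ S] {G : SplitSpacetime m S}
  {Sig : Type*} [TopologicalSpace Sig]
  [ChartedSpace (EuclideanHalfSpace m) Sig] [IsManifold (𝓡∂ m) ∞ Sig]
  (D : SpacelikeHypersurface G Sig)

/-- In charts, Riemannian distances are bounded by multiples of the Euclidean distance. -/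
theorem exists_metricDist_le_segment {u : Sig → ℝ} (hu : Continuous u) (c : Sig)
    {y₀ : EuclideanSpace ℝ (Fin m)} (hy₀ : y₀ ∈ (extChartAt (𝓡∂ m) c).target) :
    ∃ C δ : ℝ, 0 ≤ C ∧ 0 < δ ∧ range (𝓡∂ m) ∩ Metric.ball y₀ δ ⊆ (extChartAt (𝓡∂ m) c).target ∧
      ∀ a ∈ range (𝓡∂ m) ∩ Metric.ball y₀ δ, ∀ b ∈ range (𝓡∂ m) ∩ Metric.ball y₀ δ,
      metricDist (D.sigma u) ((extChartAt (𝓡∂ m) c).symm a) ((extChartAt (𝓡∂ m) c).symm b)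
        ≤ ENNReal.ofReal (C * ‖b - a‖) := by
  set e := extChartAt (𝓡∂ m) c with he
  have hgc : ∀ i j, ContinuousOn (fun y => D.chartMetric c (u (e.symm y), y) i j) e.target := fun i j =>
    (D.chartMetric_contDiffOn c i j).continuousOn.comp (f := fun y => (u (e.symm y), y))
      ((hu.comp_continuousOn (continuousOn_extChartAt_symm c)).prodMk continuousOn_id)
      fun y hy => mk_mem_prod (mem_univ _) hy
  have hb : ∃ M : ℝ, 0 ≤ M ∧ ∀ᶠ y in 𝓝[range (𝓡∂ m)] y₀, y ∈ e.target ∧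
      ∀ i j, |D.chartMetric c (u (e.symm y), y) i j| ≤ M := by
    refine ⟨∑ i, ∑ j, (|D.chartMetric c (u (e.symm y₀), y₀) i j| + 1), by positivity, ?_⟩
    have ht : ∀ᶠ y in 𝓝[range (𝓡∂ m)] y₀, y ∈ e.target := target_mem_nhdsWithin_range hy₀
    refine ht.and ?_
    refine eventually_all.2 fun i => eventually_all.2 fun j => ?_
    have h1 := ((hgc i j y₀ hy₀).mono_of_mem_nhdsWithin (target_mem_nhdsWithin_range hy₀)).abs.eventually
      (gt_mem_nhds (lt_add_one _))
    filter_upwards [h1] with y hy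
    refine hy.le.trans ?_
    refine le_trans ?_ (Finset.single_le_sum (f := fun i => ∑ j, (|D.chartMetric c (u (e.symm y₀), y₀) i j| + 1))
      (fun _ _ => by positivity) (Finset.mem_univ i))
    exact Finset.single_le_sum (f := fun j => |D.chartMetric c (u (e.symm y₀), y₀) i j| + 1)
      (fun _ _ => by positivity) (Finset.mem_univ j)
  obtain ⟨M, hM0, hM⟩ := hb
  obtain ⟨δ, hδ, hball⟩ := Metric.mem_nhdsWithin_iff.1 hM
  refine ⟨√(∑ _i : Fin m, ∑ _j : Fin m, M), δ, Real.sqrt_nonneg _, hδ,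
    fun y hy => (hball ⟨hy.2, hy.1⟩).1, fun a ha b hb => ?_⟩
  have hseg : ∀ s ∈ Icc (0 : ℝ) 1, a + s • (b - a) ∈ range (𝓡∂ m) ∩ Metric.ball y₀ δ := by
    intro s hs
    have hconv : Convex ℝ (range (𝓡∂ m) ∩ Metric.ball y₀ δ) :=
      (𝓡∂ m).convex_range.inter (convex_ball _ _)
    exact hconv.add_smul_sub_mem ha hb hs
  have hprop : ∀ s ∈ Icc (0 : ℝ) 1, a + s • (b - a) ∈ e.target ∧
      ∀ i j, |D.chartMetric c (u (e.symm (a + s • (b - a))), a + s • (b - a)) i j| ≤ M := fun s hs =>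
    hball ⟨(hseg s hs).2, (hseg s hs).1⟩
  have hg : ContDiff ℝ 1 fun s : ℝ => a + s • (b - a) := by fun_prop
  have hγ : ContMDiffOn 𝓘(ℝ, ℝ) (𝓡∂ m) 1 (fun s : ℝ => e.symm (a + s • (b - a))) (Icc 0 1) := by
    have h1 : ContMDiffOn 𝓘(ℝ, EuclideanSpace ℝ (Fin m)) (𝓡∂ m) 1 e.symm e.target := by
      have : IsManifold (𝓡∂ m) 1 Sig := IsManifold.of_le (n := ∞) (by exact_mod_cast le_top)
      exact contMDiffOn_extChartAt_symm c
    exact h1.comp hg.contMDiff.contMDiffOn fun s hs => (hprop s hs).1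
  have hder : ∀ s ∈ Icc (0 : ℝ) 1, mfderivWithin 𝓘(ℝ, ℝ) (𝓡∂ m) (fun s : ℝ => e.symm (a + s • (b - a))) (Icc 0 1) s (1 : ℝ)
      = chartFrame c (a + s • (b - a)) (b - a) := by
    intro s hs
    have h1 : HasMFDerivWithinAt 𝓘(ℝ, EuclideanSpace ℝ (Fin m)) (𝓡∂ m) e.symm (range (𝓡∂ m)) (a + s • (b - a))
        (chartFrame c (a + s • (b - a))) :=
      (mdifferentiableWithinAt_extChartAt_symm (hprop s hs).1).hasMFDerivWithinAt
    have h2 : HasFDerivWithinAt (fun s : ℝ => a + s • (b - a)) (ContinuousLinearMap.toSpanSingleton ℝ (b - a)) (Icc 0 1) s := by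
      have := ((hasDerivAt_id s).smul_const (b - a)).const_add a
      rw [one_smul] at this
      exact this.hasFDerivAt.hasFDerivWithinAt
    have h3 := h1.comp (f := fun s : ℝ => a + s • (b - a)) s h2.hasMFDerivWithinAt fun s hs => (hseg s hs).1
    have h4 := h3.mfderivWithin ((uniqueDiffOn_Icc zero_lt_one s hs).uniqueMDiffWithinAt)
    refine (congrArg (fun A => A (1 : ℝ)) h4).trans ?_
    change chartFrame c (a + s • (b - a)) ((1 : ℝ) • (b - a)) = _
    rw [one_smul]
  refine (metricDist_le_lintegral hγ (by rw [zero_smul, add_zero]) (by rw [one_smul, add_sub_cancel])).trans ?_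
  calc _ ≤ ∫⁻ s in Icc (0 : ℝ) 1, ENNReal.ofReal (√(∑ _i : Fin m, ∑ _j : Fin m, M) * ‖b - a‖) := by
        refine setLIntegral_mono' measurableSet_Icc fun s hs => ENNReal.ofReal_le_ofReal ?_
        rw [hder s hs, ← Real.sqrt_sq (norm_nonneg (b - a)), ← Real.sqrt_mul (by positivity)]
        refine Real.sqrt_le_sqrt ?_
        rw [sigma_eq_slice, slice_chartFrame, Finset.sum_mul]
        refine Finset.sum_le_sum fun i _ => ?_
        rw [Finset.sum_mul]
        refine Finset.sum_le_sum fun j _ => ?_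
        have hi := PiLp.norm_apply_le (p := 2) (b - a) i
        have hj := PiLp.norm_apply_le (p := 2) (b - a) j
        refine (le_abs_self _).trans ?_
        rw [abs_mul, abs_mul, mul_comm M, sq]
        exact mul_le_mul (mul_le_mul hi hj (abs_nonneg _) (norm_nonneg _)) ((hprop s hs).2 i j)
          (abs_nonneg _) (by positivity)
    _ = _ := by simp

end Distance

end SpacelikeHypersurface

/-! ### Coordinates of boundary and interior points -/

section HalfSpace

variable {m : ℕ} [NeZero m] {Sig : Type*} [TopologicalSpace Sig]
  [ChartedSpace (EuclideanHalfSpace m) Sig]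

theorem extChartAt_zero_nonneg (c x : Sig) : 0 ≤ extChartAt (𝓡∂ m) c x 0 :=
  (chartAt (EuclideanHalfSpace m) c x).2

theorem mem_range_halfSpace {y : EuclideanSpace ℝ (Fin m)} (hy : 0 ≤ y 0) : y ∈ range (𝓡∂ m) := by
  rw [range_modelWithCornersEuclideanHalfSpace]; exact hy

variable [IsManifold (𝓡∂ m) ∞ Sig]

theorem isInteriorPoint_iff_zero_lt {c x : Sig} (hx : x ∈ (extChartAt (𝓡∂ m) c).source) :
    x ∈ (𝓡∂ m).interior Sig ↔ 0 < extChartAt (𝓡∂ m) c x 0 := by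
  have h0 : x ∈ (𝓡∂ m).interior Sig ↔ _ := isInteriorPoint_iff_extChartAt hx
  rw [h0]
  constructor
  · intro h
    have h1 := interior_mono (extChartAt_target_subset_range c) h
    rwa [interior_range_modelWithCornersEuclideanHalfSpace] at h1
  · intro h
    have h1 : extChartAt (𝓡∂ m) c x ∈ interior (range (𝓡∂ m)) := by
      rw [interior_range_modelWithCornersEuclideanHalfSpace]; exact h
    have h2 := target_mem_nhdsWithin_range ((extChartAt (𝓡∂ m) c).map_source hx)
    rw [mem_interior_iff_mem_nhds]
    rwa [nhdsWithin_eq_nhds.2 (mem_interior_iff_mem_nhds.1 h1)] at h2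

theorem isBoundaryPoint_iff_eq_zero {c x : Sig} (hx : x ∈ (extChartAt (𝓡∂ m) c).source) :
    x ∈ (𝓡∂ m).boundary Sig ↔ extChartAt (𝓡∂ m) c x 0 = 0 := by
  rw [← ModelWithCorners.compl_interior, mem_compl_iff, isInteriorPoint_iff_zero_lt hx, not_lt]
  exact ⟨fun h => le_antisymm h (extChartAt_zero_nonneg c x), fun h => h.le⟩

/-- A bump function times a coordinate. -/
theorem contMDiff_bump_mul_coord [T2Space Sig] {c : Sig} (f : SmoothBumpFunction (𝓡∂ m) c) (i : Fin m) :
    ContMDiff (𝓡∂ m) 𝓘(ℝ, ℝ) ∞ fun x => f x * extChartAt (𝓡∂ m) c x i := by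
  refine f.contMDiff_smul (g := fun x => extChartAt (𝓡∂ m) c x i) ?_
  have h1 := contMDiffOn_extChartAt (I := 𝓡∂ m) (n := ∞) (x := c)
  exact ((EuclideanSpace.proj (𝕜 := ℝ) i).contDiff.contMDiff).comp_contMDiffOn h1

end HalfSpace

/-! ### Volumes of slabs -/

/-- The slab lies in a box with one side 2ρ and the others 2R. A bound linear in ρ is all that is
needed, and it holds in every dimension m ≥ 1. -/
theorem volume_slab_le {m : ℕ} [NeZero m] (s ρ R : ℝ) (hρ : 0 ≤ ρ) :
    volume {y : EuclideanSpace ℝ (Fin m) | |y 0 - s| ≤ ρ ∧ ∀ i, |y i| ≤ R}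
      ≤ ENNReal.ofReal (2 * |2 * R| ^ (m - 1) * ρ) := by
  set lo : Fin m → ℝ := fun i => if i = 0 then s - ρ else -R
  set hi : Fin m → ℝ := fun i => if i = 0 then s + ρ else R
  have hsub : {y : EuclideanSpace ℝ (Fin m) | |y 0 - s| ≤ ρ ∧ ∀ i, |y i| ≤ R}
      ⊆ (MeasurableEquiv.toLp 2 (Fin m → ℝ)).symm ⁻¹' (Icc lo hi) := by
    rintro y ⟨h0, h1⟩
    rw [abs_le] at h0
    refine ⟨fun i => ?_, fun i => ?_⟩ <;> have hi' := abs_le.1 (h1 i) <;> simp only [lo, hi] <;>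
      split_ifs with h
    · subst h; change _ ≤ y 0; linarith
    · exact hi'.1
    · subst h; change y 0 ≤ _; linarith
    · exact hi'.2
  refine (measure_mono hsub).trans ?_
  rw [(EuclideanSpace.volume_preserving_symm_measurableEquiv_toLp (Fin m)).measure_preimage
    measurableSet_Icc.nullMeasurableSet, Real.volume_Icc_pi,
    Fintype.prod_eq_mul_prod_compl (0 : Fin m)]
  have e1 : ∀ i ∈ ({0} : Finset (Fin m))ᶜ, ENNReal.ofReal (hi i - lo i) ≤ ENNReal.ofReal |2 * R| := by
    intro i hi'
    have h0 : i ≠ 0 := by simpa using hi'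
    simp only [lo, hi, h0, if_false]
    exact ENNReal.ofReal_le_ofReal ((le_abs_self _).trans_eq (by ring_nf))
  have e2 : ENNReal.ofReal (hi 0 - lo 0) = ENNReal.ofReal (2 * ρ) := by
    simp only [lo, hi, if_true]; ring_nf
  rw [e2]
  refine (mul_le_mul_right (Finset.prod_le_prod' e1) _).trans ?_
  rw [Finset.prod_const, Finset.card_compl, Finset.card_singleton, Fintype.card_fin,
    ← ENNReal.ofReal_pow (abs_nonneg _), ← ENNReal.ofReal_mul (by positivity)]
  exact ENNReal.ofReal_le_ofReal (by ring_nf; rfl)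

namespace SpacelikeHypersurface

/-! ### Topology and diameter of the graph metrics -/

section Distance

variable {m : ℕ} [NeZero m] {S : Type*} [TopologicalSpace S]
  [ChartedSpace (EuclideanSpace ℝ (Fin m)) S] [IsManifold (𝓡 m) ∞ S] {G : SplitSpacetime m S}
  {Sig : Type*} [TopologicalSpace Sig]
  [ChartedSpace (EuclideanHalfSpace m) Sig] [IsManifold (𝓡∂ m) ∞ Sig]
  (D : SpacelikeHypersurface G Sig) {u : Sig → ℝ} (hu : Continuous u)
include hu

theorem eventually_metricDist_lt (x : Sig) {ε : ℝ} (hε : 0 < ε) :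
    ∀ᶠ y in 𝓝 x, metricDist (D.sigma u) x y < ENNReal.ofReal ε := by
  obtain ⟨C, δ, hC, hδ, -, h⟩ := D.exists_metricDist_le_segment hu x (mem_extChartAt_target x)
  set e := extChartAt (𝓡∂ m) x
  have hmin : 0 < min δ (ε / (C + 1)) := lt_min hδ (by positivity)
  have h1 : ∀ᶠ y in 𝓝 x, e y ∈ Metric.ball (e x) (min δ (ε / (C + 1))) :=
    (continuousAt_extChartAt x).eventually (Metric.ball_mem_nhds _ hmin)
  filter_upwards [h1, extChartAt_source_mem_nhds (I := 𝓡∂ m) x] with y hy hys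
  rw [Metric.mem_ball, lt_min_iff] at hy
  have h2 := h (e x) ⟨mem_range_halfSpace (extChartAt_zero_nonneg x x), Metric.mem_ball_self hδ⟩ (e y)
    ⟨mem_range_halfSpace (extChartAt_zero_nonneg x y), hy.1⟩
  rw [e.left_inv (mem_extChartAt_source x), e.left_inv hys] at h2
  refine h2.trans_lt ((ENNReal.ofReal_lt_ofReal_iff hε).2 ?_)
  have h3 := hy.2
  rw [dist_eq_norm, lt_div_iff₀ (by positivity)] at h3
  nlinarith [norm_nonneg (e y - e x)]

theorem isOpen_metricBall (x : Sig) (r : ℝ) : IsOpen (metricBall (D.sigma u) x r) := by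
  rw [isOpen_iff_mem_nhds]
  intro y hy
  have hy' : metricDist (D.sigma u) x y < ENNReal.ofReal r := hy
  obtain ⟨ε, hε, hlt⟩ := ENNReal.lt_iff_exists_add_pos_lt.1 hy'
  filter_upwards [D.eventually_metricDist_lt hu y (NNReal.coe_pos.2 hε)] with z hz
  refine (metricDist_triangle (D.sigma_isInnerForm u) x y z).trans_lt ?_
  rw [ENNReal.ofReal_coe_nnreal] at hz
  exact (add_le_add_right hz.le _).trans_lt hlt

/-- The points at finite distance from p form a set that is open and closed, hence everything by
connectedness; compactness then bounds the distance. -/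
theorem exists_metricDist_le [CompactSpace Sig] [ConnectedSpace Sig] :
    ∃ R : ℝ, 0 < R ∧ ∀ x y, metricDist (D.sigma u) x y ≤ ENNReal.ofReal R := by
  obtain ⟨p⟩ : Nonempty Sig := inferInstance
  have htri := metricDist_triangle (D.sigma_isInnerForm u)
  have hcomm := metricDist_comm (D.sigma_isInnerForm u)
  have hfin : ∀ x, metricDist (D.sigma u) p x < ⊤ := by
    have hcl : IsClopen {x | metricDist (D.sigma u) p x < ⊤} := by
      constructor
      · rw [← isOpen_compl_iff, isOpen_iff_mem_nhds]
        intro x hx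
        filter_upwards [D.eventually_metricDist_lt hu x one_pos] with y hy hy2
        refine hx ((htri p y x).trans_lt (ENNReal.add_lt_top.2 ⟨hy2, ?_⟩))
        rw [hcomm]
        exact hy.trans ENNReal.ofReal_lt_top
      · rw [isOpen_iff_mem_nhds]
        intro x hx
        filter_upwards [D.eventually_metricDist_lt hu x one_pos] with y hy
        exact (htri p x y).trans_lt (ENNReal.add_lt_top.2 ⟨hx, hy.trans ENNReal.ofReal_lt_top⟩)
    have huniv := hcl.eq_univ ⟨p, by
      change metricDist _ _ _ < _
      rw [metricDist_self (D.sigma_isInnerForm u)]; exact ENNReal.zero_lt_top⟩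
    exact fun x => (huniv.ge (mem_univ x) :)
  obtain ⟨R, hR⟩ : ∃ R : ℝ≥0, ∀ x ∈ (univ : Set Sig), metricDist (D.sigma u) p x ≤ R := by
    refine isCompact_univ.induction_on (p := fun s => ∃ R : ℝ≥0, ∀ x ∈ s, metricDist (D.sigma u) p x ≤ R)
      ⟨0, by simp⟩ (fun s t hst ⟨R, hR⟩ => ⟨R, fun x hx => hR x (hst hx)⟩) ?_ ?_
    · rintro s t ⟨R, hR⟩ ⟨R', hR'⟩
      refine ⟨max R R', ?_⟩
      rintro x (hx | hx)
      · exact (hR x hx).trans (ENNReal.coe_le_coe.2 (le_max_left _ _))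
      · exact (hR' x hx).trans (ENNReal.coe_le_coe.2 (le_max_right _ _))
    · intro x _
      refine ⟨_, mem_nhdsWithin_of_mem_nhds (D.eventually_metricDist_lt hu x one_pos),
        (metricDist (D.sigma u) p x + 1).toNNReal, fun y hy => ?_⟩
      rw [ENNReal.coe_toNNReal (ENNReal.add_lt_top.2 ⟨hfin x, ENNReal.one_lt_top⟩).ne]
      refine (htri p x y).trans (add_le_add_right ?_ _)
      have hy' : metricDist (D.sigma u) x y < ENNReal.ofReal 1 := hy
      simpa using hy'.le
  refine ⟨R + R + 1, by positivity, fun x y => (htri x p y).trans ?_⟩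
  rw [hcomm x p]
  refine (add_le_add (hR x trivial) (hR y trivial)).trans ?_
  rw [← ENNReal.coe_add, ← ENNReal.ofReal_coe_nnreal]
  exact ENNReal.ofReal_le_ofReal (by push_cast; linarith)

end Distance

end SpacelikeHypersurface

namespace SpacelikeHypersurface

/-! ### Boundary distance and volumes of balls -/

section BoundaryDefining

variable {m : ℕ} [NeZero m] {S : Type*} [TopologicalSpace S]
  [ChartedSpace (EuclideanSpace ℝ (Fin m)) S] [IsManifold (𝓡 m) ∞ S] {G : SplitSpacetime m S}
  {Sig : Type*} [TopologicalSpace Sig] [T2Space Sig] [CompactSpace Sig]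
  [ChartedSpace (EuclideanHalfSpace m) Sig] [IsManifold (𝓡∂ m) ∞ Sig]
  (D : SpacelikeHypersurface G Sig) {u : Sig → ℝ} (hu : Continuous u)
include hu

omit [T2Space Sig] [CompactSpace Sig] in
/-- Around a boundary point, coordinates bound the distance from the boundary. -/
theorem exists_near_boundary {p c : Sig} (hp : p ∈ (𝓡∂ m).boundary Sig)
    (hpc : p ∈ (extChartAt (𝓡∂ m) c).source) :
    ∃ C, 0 ≤ C ∧ ∀ᶠ x in 𝓝 p, ∃ q ∈ (𝓡∂ m).boundary Sig,
      metricDist (D.sigma u) x q ≤ ENNReal.ofReal (C * extChartAt (𝓡∂ m) c x 0) := by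
  set e := extChartAt (𝓡∂ m) c
  obtain ⟨C, δ, hC, hδ, hsub, h⟩ := D.exists_metricDist_le_segment hu c (e.map_source hpc)
  have hp0 : e p 0 = 0 := (isBoundaryPoint_iff_eq_zero hpc).1 hp
  -- The foot point on the boundary hyperplane; its Euclidean distance from a is the coordinate a 0.
  set b : EuclideanSpace ℝ (Fin m) → EuclideanSpace ℝ (Fin m) := fun a =>
    a - a 0 • EuclideanSpace.single 0 (1 : ℝ) with hb
  have hb0 : ∀ a, b a 0 = 0 := fun a => by simp [hb]
  have hbc : Continuous b := by
    have : Continuous fun a : EuclideanSpace ℝ (Fin m) => a 0 := (EuclideanSpace.proj (𝕜 := ℝ) 0).continuous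
    exact continuous_id.sub (this.smul continuous_const)
  have hbp : b (e p) = e p := by simp [hb, hp0]
  have hec : ContinuousAt e p := continuousAt_extChartAt' hpc
  have h1 : ∀ᶠ x in 𝓝 p, e x ∈ Metric.ball (e p) δ := hec.eventually (Metric.ball_mem_nhds _ hδ)
  have h2 : ∀ᶠ x in 𝓝 p, b (e x) ∈ Metric.ball (e p) δ := by
    have : ContinuousAt (fun x => b (e x)) p := hbc.continuousAt.comp hec
    refine this.eventually ?_
    change ∀ᶠ y in 𝓝 (b (e p)), _
    rw [hbp]
    exact Metric.ball_mem_nhds _ hδ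
  refine ⟨C, hC, ?_⟩
  filter_upwards [h1, h2, (isOpen_extChartAt_source c).mem_nhds hpc] with x hx1 hx2 hxs
  have hbr : b (e x) ∈ range (𝓡∂ m) ∩ Metric.ball (e p) δ := ⟨mem_range_halfSpace (hb0 _).ge, hx2⟩
  have hbt := hsub hbr
  refine ⟨e.symm (b (e x)), ?_, ?_⟩
  · rw [isBoundaryPoint_iff_eq_zero (e.map_target hbt)]
    change e (e.symm (b (e x))) 0 = 0
    rw [e.right_inv hbt, hb0]
  · have h3 := h (e x) ⟨mem_range_halfSpace (extChartAt_zero_nonneg c x), hx1⟩ _ hbr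
    rw [e.left_inv hxs] at h3
    refine h3.trans_eq ?_
    have : ‖b (e x) - e x‖ = e x 0 := by
      have h4 : b (e x) - e x = -(e x 0 • EuclideanSpace.single 0 (1 : ℝ)) := by simp [hb]
      rw [h4, norm_neg, norm_smul, PiLp.norm_single, Real.norm_eq_abs,
        abs_of_nonneg (extChartAt_zero_nonneg c x), norm_one, mul_one]
    rw [this]

/-- A smooth function that vanishes exactly on the boundary and bounds the distance from it. -/
theorem exists_boundary_defining [ConnectedSpace Sig] (hne : ((𝓡∂ m).boundary Sig).Nonempty) :
    ∃ ζ : Sig → ℝ, ContMDiff (𝓡∂ m) 𝓘(ℝ, ℝ) ∞ ζ ∧ (∀ x ∈ (𝓡∂ m).boundary Sig, ζ x = 0) ∧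
      (∀ x ∈ (𝓡∂ m).interior Sig, 0 < ζ x) ∧ ∃ C, 0 < C ∧ ∀ x, ∃ q ∈ (𝓡∂ m).boundary Sig,
        metricDist (D.sigma u) x q ≤ ENNReal.ofReal (C * ζ x) := by
  have hf : ∀ c : Sig, Nonempty (SmoothBumpFunction (𝓡∂ m) c) := fun c =>
    ⟨(((SmoothBumpFunction.nhds_basis_tsupport (I := 𝓡∂ m) c).mem_iff).1 univ_mem).choose⟩
  have f : ∀ c : Sig, SmoothBumpFunction (𝓡∂ m) c := fun c => Classical.choice (hf c)
  obtain ⟨ι, -, hι⟩ := isCompact_univ.elim_nhds_subcover (fun c => {x | 1 / 2 < f c x})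
    (fun c _ => (f c).continuous.continuousAt.eventually (lt_mem_nhds (by rw [(f c).eq_one]; norm_num)))
  -- The function ζ is a finite sum of bump functions times the coordinate transverse to the
  -- boundary. Each term is nonnegative and vanishes on the boundary, and at least one bump exceeds
  -- 1/2 at every point.
  set g : Sig → Sig → ℝ := fun c x => f c x * extChartAt (𝓡∂ m) c x 0 with hg
  have hg0 : ∀ c x, 0 ≤ g c x := fun c x => mul_nonneg (f c).nonneg (extChartAt_zero_nonneg c x)
  have hcov : ∀ x, ∃ c ∈ ι, 1 / 2 < f c x ∧ x ∈ (extChartAt (𝓡∂ m) c).source := by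
    intro x
    obtain ⟨c, hc, hx⟩ := mem_iUnion₂.1 (hι (mem_univ x))
    have hx' : 1 / 2 < f c x := hx
    refine ⟨c, hc, hx', ?_⟩
    rw [extChartAt_source]
    exact (f c).support_subset_source (Function.mem_support.2 (by linarith))
  have hgle : ∀ c ∈ ι, ∀ x, g c x ≤ ∑ c ∈ ι, g c x := fun c hc x =>
    Finset.single_le_sum (f := fun c => g c x) (fun c _ => hg0 c x) hc
  have hpos : ∀ x ∈ (𝓡∂ m).interior Sig, 0 < ∑ c ∈ ι, g c x := by
    intro x hx
    obtain ⟨c, hc, hfx, hxs⟩ := hcov x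
    exact (mul_pos (by linarith) ((isInteriorPoint_iff_zero_lt hxs).1 hx)).trans_le (hgle c hc x)
  have hsm : ContMDiff (𝓡∂ m) 𝓘(ℝ, ℝ) ∞ fun x => ∑ c ∈ ι, g c x :=
    contMDiff_finsetSum fun c _ => contMDiff_bump_mul_coord (f c) 0
  refine ⟨fun x => ∑ c ∈ ι, g c x, hsm, fun x hx => Finset.sum_eq_zero fun c _ => ?_, hpos, ?_⟩
  · by_cases hfx : f c x = 0
    · simp [hg, hfx]
    · have hxs : x ∈ (extChartAt (𝓡∂ m) c).source := by
        rw [extChartAt_source]; exact (f c).support_subset_source hfx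
      change f c x * extChartAt (𝓡∂ m) c x 0 = 0
      rw [(isBoundaryPoint_iff_eq_zero hxs).1 hx, mul_zero]
  obtain ⟨q₀, hq₀⟩ := hne
  obtain ⟨R, hR, hRle⟩ := D.exists_metricDist_le hu
  have hloc : ∀ p : Sig, ∃ C, 0 ≤ C ∧ ∀ᶠ x in 𝓝 p, ∃ q ∈ (𝓡∂ m).boundary Sig,
      metricDist (D.sigma u) x q ≤ ENNReal.ofReal (C * ∑ c ∈ ι, g c x) := by
    intro p
    by_cases hp : p ∈ (𝓡∂ m).interior Sig
    · have hp0 := hpos p hp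
      -- Near an interior point ζ is bounded below, so the diameter R bounds the distance to an
      -- arbitrary fixed boundary point q₀.
      refine ⟨2 * R / ∑ c ∈ ι, g c p, by positivity, ?_⟩
      filter_upwards [hsm.continuous.continuousAt.eventually (lt_mem_nhds (half_lt_self hp0))] with x hx
      refine ⟨q₀, hq₀, (hRle x q₀).trans (ENNReal.ofReal_le_ofReal ?_)⟩
      rw [div_mul_eq_mul_div, le_div_iff₀ hp0]
      nlinarith
    · rw [← mem_compl_iff, ModelWithCorners.compl_interior] at hp
      obtain ⟨c, hc, hfp, hps⟩ := hcov p
      obtain ⟨C, hC, hev⟩ := D.exists_near_boundary hu hp hps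
      refine ⟨2 * C, by positivity, ?_⟩
      filter_upwards [hev, (f c).continuous.continuousAt.eventually (lt_mem_nhds hfp)] with x hx hfx
      obtain ⟨q, hq, hle⟩ := hx
      refine ⟨q, hq, hle.trans (ENNReal.ofReal_le_ofReal ?_)⟩
      have h1 := hgle c hc x
      have h2 : extChartAt (𝓡∂ m) c x 0 ≤ 2 * g c x := by
        have := extChartAt_zero_nonneg (m := m) c x
        simp only [hg]
        nlinarith
      calc _ ≤ C * (2 * g c x) := mul_le_mul_of_nonneg_left h2 hC
        _ = 2 * C * g c x := by ring
        _ ≤ _ := mul_le_mul_of_nonneg_left h1 (by positivity)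
  obtain ⟨C, hC0, hC⟩ : ∃ C, 0 ≤ C ∧ ∀ x ∈ (univ : Set Sig), ∃ q ∈ (𝓡∂ m).boundary Sig,
      metricDist (D.sigma u) x q ≤ ENNReal.ofReal (C * ∑ c ∈ ι, g c x) := by
    refine isCompact_univ.induction_on (p := fun s => ∃ C, 0 ≤ C ∧ ∀ x ∈ s, ∃ q ∈ (𝓡∂ m).boundary Sig,
      metricDist (D.sigma u) x q ≤ ENNReal.ofReal (C * ∑ c ∈ ι, g c x)) ⟨0, le_rfl, by simp⟩
      (fun s t hst ⟨C, h0, hC⟩ => ⟨C, h0, fun x hx => hC x (hst hx)⟩) ?_ ?_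
    · rintro s t ⟨C, h0, hC⟩ ⟨C', h0', hC'⟩
      have hmax : ∀ x, C * ∑ c ∈ ι, g c x ≤ max C C' * ∑ c ∈ ι, g c x ∧
          C' * ∑ c ∈ ι, g c x ≤ max C C' * ∑ c ∈ ι, g c x := fun x =>
        ⟨mul_le_mul_of_nonneg_right (le_max_left _ _) (Finset.sum_nonneg fun c _ => hg0 c x),
          mul_le_mul_of_nonneg_right (le_max_right _ _) (Finset.sum_nonneg fun c _ => hg0 c x)⟩
      refine ⟨max C C', h0.trans (le_max_left _ _), ?_⟩
      rintro x (hx | hx)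
      · obtain ⟨q, hq, h⟩ := hC x hx
        exact ⟨q, hq, h.trans (ENNReal.ofReal_le_ofReal (hmax x).1)⟩
      · obtain ⟨q, hq, h⟩ := hC' x hx
        exact ⟨q, hq, h.trans (ENNReal.ofReal_le_ofReal (hmax x).2)⟩
    · intro x _
      obtain ⟨C, h0, hC⟩ := hloc x
      exact ⟨_, mem_nhdsWithin_of_mem_nhds hC, C, h0, fun y hy => hy⟩
  refine ⟨C + 1, by positivity, fun x => ?_⟩
  obtain ⟨q, hq, h⟩ := hC x trivial
  refine ⟨q, hq, h.trans (ENNReal.ofReal_le_ofReal ?_)⟩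
  have := Finset.sum_nonneg fun c (_ : c ∈ ι) => hg0 c x
  nlinarith

variable [Nonempty Sig] [MeasurableSpace Sig] [BorelSpace Sig]

/-- Volumes of balls are at most linear in the radius. -/
theorem exists_metricVolume_metricBall_le :
    ∃ C, 0 < C ∧ ∀ x, ∀ r, 0 < r →
      metricVolume (D.sigma u) (metricBall (D.sigma u) x r) ≤ ENNReal.ofReal (C * r) := by
  have := metricVolume_isFiniteMeasure (D.sigma_isInnerForm u) (D.chartDensity_continuousOn hu)
  obtain ⟨T, hT⟩ := isCompact_univ.exists_bound_of_continuousOn (f := u) hu.continuousOn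
  have huT : ∀ x, u x ∈ Icc (-T) T := fun x => abs_le.1 (hT x trivial)
  have hlip : ∀ g : Sig → ℝ, ContMDiff (𝓡∂ m) 𝓘(ℝ, ℝ) ∞ g → ∃ L, 0 < L ∧ ∀ x r y, 0 < r →
      y ∈ metricBall (D.sigma u) x r → |g x - g y| ≤ L * r := by
    intro g hg
    have hg1 : ContMDiff (𝓡∂ m) 𝓘(ℝ, ℝ) 1 g := hg.of_le (by exact_mod_cast le_top)
    obtain ⟨L, hL, h⟩ := D.exists_dAlong_sq_le hg1 T
    refine ⟨L + 1, by positivity, fun x r y hr hy => ?_⟩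
    have h1 := ofReal_abs_sub_le_metricDist (σ := D.sigma u) hg1 (L := L + 1) (by positivity) (fun x v => (h _ (huT x) x v).trans
      (mul_le_mul_of_nonneg_right (by nlinarith) (D.slice_nonneg _ _ _))) x y
    have hy' : metricDist (D.sigma u) x y < ENNReal.ofReal r := hy
    have h2 := h1.trans (mul_le_mul_right hy'.le _)
    rwa [← ENNReal.ofReal_mul (by positivity), ENNReal.ofReal_le_ofReal_iff (by positivity)] at h2
  have hloc : ∀ p : Sig, ∃ C, 0 < C ∧ ∀ᶠ x in 𝓝 p, ∀ r, 0 < r →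
      metricVolume (D.sigma u) (metricBall (D.sigma u) x r) ≤ ENNReal.ofReal (C * r) := by
    intro p
    obtain ⟨f, -⟩ := ((SmoothBumpFunction.nhds_basis_tsupport (I := 𝓡∂ m) p).mem_iff).1 univ_mem
    set e := extChartAt (𝓡∂ m) p with he
    obtain ⟨L₁, hL₁, h₁⟩ := hlip f f.contMDiff
    obtain ⟨L₂, hL₂, h₂⟩ := hlip _ (contMDiff_bump_mul_coord f 0)
    set K : Set (EuclideanSpace ℝ (Fin m)) := Metric.closedBall (e p) f.rOut ∩ range (𝓡∂ m) with hK
    have hKc : IsCompact K := (isCompact_closedBall _ _).inter_right (𝓡∂ m).isClosed_range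
    have hKt : K ⊆ e.target := f.closedBall_subset
    obtain ⟨M, hM⟩ := hKc.exists_bound_of_continuousOn ((D.chartDensity_continuousOn hu p).mono hKt)
    obtain ⟨R, hR⟩ := hKc.isBounded.exists_norm_le
    have hfK : ∀ y, 1 / 2 < f y → y ∈ e.source ∧ e y ∈ K := by
      intro y hy
      have hys : y ∈ Function.support f := Function.mem_support.2 (by linarith)
      rw [f.support_eq_inter_preimage] at hys
      refine ⟨by rw [he, extChartAt_source]; exact hys.1, Metric.ball_subset_closedBall hys.2,
        mem_range_halfSpace (extChartAt_zero_nonneg p y)⟩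
    -- For r < r₀ the bump f, which exceeds 3/4 at the centre, varies by less than 1/4 and stays
    -- above 1/2 on the ball, which therefore lies in the chart. For r ≥ r₀ the total volume V is at
    -- most (V / r₀) r.
    set r₀ : ℝ := 1 / (4 * L₁) with hr₀
    have hr₀pos : 0 < r₀ := by positivity
    set V : ℝ := (metricVolume (D.sigma u) univ).toReal with hV
    set C₁ : ℝ := |M| * (2 * |2 * R| ^ (m - 1) * (2 * (L₂ + |R| * L₁))) with hC₁
    have hC₁0 : 0 ≤ C₁ := by positivity
    refine ⟨C₁ + V / r₀ + 1, by positivity, ?_⟩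
    filter_upwards [f.continuous.continuousAt.eventually
      (lt_mem_nhds (show (3 / 4 : ℝ) < f p by rw [f.eq_one]; norm_num))] with x hx r hr
    obtain ⟨-, hxK⟩ := hfK x (by linarith)
    by_cases hrr : r₀ ≤ r
    · refine (measure_mono (subset_univ _)).trans ?_
      rw [← ENNReal.ofReal_toReal (measure_ne_top (metricVolume (D.sigma u)) univ)]
      refine ENNReal.ofReal_le_ofReal ?_
      have h3 : V ≤ V / r₀ * r := by
        rw [div_mul_eq_mul_div, le_div_iff₀ hr₀pos]
        exact mul_le_mul_of_nonneg_left hrr ENNReal.toReal_nonneg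
      rw [add_mul, add_mul]
      nlinarith
    push Not at hrr
    have hBm : MeasurableSet (metricBall (D.sigma u) x r) := (D.isOpen_metricBall hu x r).measurableSet
    have hf2 : ∀ y ∈ metricBall (D.sigma u) x r, 1 / 2 < f y := by
      intro y hy
      have h3 := abs_le.1 (h₁ x r y hr hy)
      have h4 : L₁ * r < 1 / 4 := by
        rw [hr₀, lt_div_iff₀ (by positivity)] at hrr
        linarith
      linarith [h3.2]
    rw [metricVolume_apply_of_subset (D.sigma_isInnerForm u) (c := p) hBm
      (fun y hy => (hfK y (hf2 y hy)).1), chartMeasure_apply p hBm]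
    have hslab : ∀ z ∈ e.target ∩ e.symm ⁻¹' metricBall (D.sigma u) x r,
        z ∈ K ∧ |z 0 - e x 0| ≤ 2 * (L₂ + |R| * L₁) * r := by
      rintro z ⟨hzt, hzB⟩
      have hf3 := hf2 _ hzB
      have hK3 := (hfK _ hf3).2
      rw [e.right_inv hzt] at hK3
      refine ⟨hK3, ?_⟩
      have h3 := h₁ x r _ hr hzB
      have h4 := h₂ x r _ hr hzB
      have h5 : |e x 0| ≤ |R| := (PiLp.norm_apply_le (e x) 0).trans ((hR _ hxK).trans (le_abs_self R))
      change |f x * e x 0 - f (e.symm z) * e (e.symm z) 0| ≤ _ at h4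
      rw [e.right_inv hzt] at h4
      -- The coordinate itself is not defined globally. Its variation over the ball is recovered
      -- from the Lipschitz bounds for f and for f times the coordinate.
      have h6 : f (e.symm z) * (z 0 - e x 0)
          = -(f x * e x 0 - f (e.symm z) * z 0) + e x 0 * (f x - f (e.symm z)) := by ring
      have h7 : |f (e.symm z) * (z 0 - e x 0)| ≤ L₂ * r + |R| * (L₁ * r) := by
        rw [h6]
        refine (abs_add_le _ _).trans (add_le_add (by rwa [abs_neg]) ?_)
        rw [abs_mul]
        exact mul_le_mul h5 h3 (abs_nonneg _) (abs_nonneg _)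
      rw [abs_mul, abs_of_nonneg f.nonneg] at h7
      have h8 : 1 / 2 * |z 0 - e x 0| ≤ f (e.symm z) * |z 0 - e x 0| :=
        mul_le_mul_of_nonneg_right hf3.le (abs_nonneg _)
      nlinarith
    calc _ ≤ ∫⁻ _ in e.target ∩ e.symm ⁻¹' metricBall (D.sigma u) x r, ENNReal.ofReal |M| := by
          refine setLIntegral_mono' (measurableSet_chart_preimage p hBm) fun z hz => ?_
          exact ENNReal.ofReal_le_ofReal ((le_abs_self _).trans ((hM z (hslab z hz).1).trans (le_abs_self M)))
      _ ≤ ENNReal.ofReal |M| * ENNReal.ofReal (2 * |2 * R| ^ (m - 1) * (2 * (L₂ + |R| * L₁) * r)) := by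
          rw [setLIntegral_const]
          refine mul_le_mul_right ((measure_mono fun z hz => ?_).trans
            (volume_slab_le (e x 0) (2 * (L₂ + |R| * L₁) * r) R (by positivity))) _
          exact ⟨(hslab z hz).2, fun i => (PiLp.norm_apply_le z i).trans (hR z (hslab z hz).1)⟩
      _ ≤ _ := by
          rw [← ENNReal.ofReal_mul (abs_nonneg M)]
          refine ENNReal.ofReal_le_ofReal ?_
          have h3 : |M| * (2 * |2 * R| ^ (m - 1) * (2 * (L₂ + |R| * L₁) * r)) = C₁ * r := by
            rw [hC₁]; ring
          have h4 : 0 ≤ V / r₀ * r := by positivity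
          rw [h3, add_mul, add_mul]
          linarith
  obtain ⟨C, hC0, hC⟩ : ∃ C, 0 < C ∧ ∀ x ∈ (univ : Set Sig), ∀ r, 0 < r →
      metricVolume (D.sigma u) (metricBall (D.sigma u) x r) ≤ ENNReal.ofReal (C * r) := by
    refine isCompact_univ.induction_on (p := fun s => ∃ C, 0 < C ∧ ∀ x ∈ s, ∀ r, 0 < r →
      metricVolume (D.sigma u) (metricBall (D.sigma u) x r) ≤ ENNReal.ofReal (C * r)) ⟨1, one_pos, by simp⟩
      (fun s t hst ⟨C, h0, hC⟩ => ⟨C, h0, fun x hx => hC x (hst hx)⟩) ?_ ?_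
    · rintro s t ⟨C, h0, hC⟩ ⟨C', h0', hC'⟩
      refine ⟨C + C', by positivity, ?_⟩
      rintro x (hx | hx) r hr
      · exact (hC x hx r hr).trans (ENNReal.ofReal_le_ofReal (by nlinarith))
      · exact (hC' x hx r hr).trans (ENNReal.ofReal_le_ofReal (by nlinarith))
    · intro x _
      obtain ⟨C, h0, hC⟩ := hloc x
      exact ⟨_, mem_nhdsWithin_of_mem_nhds hC, C, h0, fun y hy => hy⟩
  exact ⟨C, hC0, fun x => hC x trivial⟩

end BoundaryDefining

end SpacelikeHypersurface

/-! ### A truncation -/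

section Ramp

/-- The function that grows linearly from `0` at `κ` to `1` at `2κ`. -/
noncomputable def ramp (κ t : ℝ) : ℝ := min 1 (max 0 (t / κ - 1))

/-- A `C¹` truncation of the positive part, the primitive of `ramp`. -/
noncomputable def rampInt (κ r : ℝ) : ℝ := ∫ t in (0 : ℝ)..r, ramp κ t

variable {κ : ℝ}

theorem ramp_continuous (κ : ℝ) : Continuous (ramp κ) := by unfold ramp; fun_prop

theorem ramp_nonneg (t : ℝ) : 0 ≤ ramp κ t := le_min zero_le_one (le_max_left _ _)

theorem ramp_le_one (t : ℝ) : ramp κ t ≤ 1 := min_le_left _ _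

theorem ramp_eq_zero (hκ : 0 < κ) {t : ℝ} (ht : t ≤ κ) : ramp κ t = 0 := by
  have : t / κ - 1 ≤ 0 := by rw [sub_nonpos, div_le_one hκ]; exact ht
  rw [ramp, max_eq_left this, min_eq_right zero_le_one]

theorem ramp_eq_one (hκ : 0 < κ) {t : ℝ} (ht : 2 * κ ≤ t) : ramp κ t = 1 := by
  have : 1 ≤ t / κ - 1 := by rw [le_sub_iff_add_le, le_div_iff₀ hκ]; linarith
  rw [ramp, max_eq_right (by linarith), min_eq_left this]

theorem ramp_mono (hκ : 0 < κ) : Monotone (ramp κ) := fun a b hab => by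
  unfold ramp; gcongr

theorem rampInt_hasDerivAt (κ r : ℝ) : HasDerivAt (rampInt κ) (ramp κ r) r :=
  (ramp_continuous κ).integral_hasStrictDerivAt 0 r |>.hasDerivAt

theorem rampInt_contDiff (κ : ℝ) : ContDiff ℝ 1 (rampInt κ) := by
  rw [contDiff_one_iff_deriv]
  refine ⟨fun r => (rampInt_hasDerivAt κ r).differentiableAt, ?_⟩
  have : deriv (rampInt κ) = ramp κ := funext fun r => (rampInt_hasDerivAt κ r).deriv
  rw [this]
  exact ramp_continuous κ

theorem rampInt_monotone (κ : ℝ) : Monotone (rampInt κ) :=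
  monotone_of_deriv_nonneg (fun r => (rampInt_hasDerivAt κ r).differentiableAt) fun r => by
    rw [(rampInt_hasDerivAt κ r).deriv]; exact ramp_nonneg r

theorem rampInt_eq_zero (hκ : 0 < κ) {r : ℝ} (hr : r ≤ κ) : rampInt κ r = 0 := by
  rw [rampInt, intervalIntegral.integral_congr (g := fun _ => 0), intervalIntegral.integral_zero]
  intro t ht
  exact ramp_eq_zero hκ (ht.2.trans (max_le hκ.le hr))

theorem rampInt_nonneg (hκ : 0 < κ) (r : ℝ) : 0 ≤ rampInt κ r := by
  rcases le_total r κ with h | h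
  · exact (rampInt_eq_zero hκ h).ge
  · exact (rampInt_eq_zero hκ le_rfl).symm.le.trans (rampInt_monotone κ h)

/-- The integrand `ramp` is monotone. With this inequality the term |η| w of the equation is
controlled by the factor that the gradient of η produces, and can be absorbed. -/
theorem rampInt_le_mul (hκ : 0 < κ) {r : ℝ} (hr : 0 ≤ r) : rampInt κ r ≤ r * ramp κ r := by
  have := intervalIntegral.integral_mono_on (μ := volume) hr ((ramp_continuous κ).intervalIntegrable 0 r)
    (continuous_const (y := ramp κ r) |>.intervalIntegrable 0 r) fun t ht => ramp_mono hκ ht.2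
  simpa [rampInt] using this

theorem rampInt_le (hκ : 0 < κ) {r : ℝ} (hr : 0 ≤ r) : rampInt κ r ≤ r :=
  (rampInt_le_mul hκ hr).trans (mul_le_of_le_one_right hr (ramp_le_one r))

theorem sub_le_rampInt (hκ : 0 < κ) {r : ℝ} (hr : 2 * κ ≤ r) : r - 2 * κ ≤ rampInt κ r := by
  have h1 := intervalIntegral.integral_add_adjacent_intervals
    ((ramp_continuous κ).intervalIntegrable (μ := volume) 0 (2 * κ)) ((ramp_continuous κ).intervalIntegrable (2 * κ) r)
  have h2 : ∫ t in (2 * κ)..r, ramp κ t = r - 2 * κ := by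
    rw [intervalIntegral.integral_congr (g := fun _ => (1 : ℝ)), intervalIntegral.integral_const]
    · simp
    · intro t ht
      rw [uIcc_of_le hr] at ht
      exact ramp_eq_one hκ ht.1
  have h3 := rampInt_nonneg hκ (2 * κ)
  rw [h2] at h1
  simp only [rampInt] at h3 ⊢
  linarith

end Ramp

namespace SpacelikeHypersurface

/-! ### The tested equation for controlled graphs -/

section Estimates

variable {m : ℕ} [NeZero m] {S : Type*} [TopologicalSpace S]
  [ChartedSpace (EuclideanSpace ℝ (Fin m)) S] [IsManifold (𝓡 m) ∞ S] {G : SplitSpacetime m S}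
  {Sig : Type*} [TopologicalSpace Sig] [T2Space Sig] [CompactSpace Sig] [Nonempty Sig]
  [ChartedSpace (EuclideanHalfSpace m) Sig] [IsManifold (𝓡∂ m) ∞ Sig]
  [MeasurableSpace Sig] [BorelSpace Sig]
  (D : SpacelikeHypersurface G Sig)

/-- Spacelike graphs with bounded height, whose mean curvature is the sum of an integrable function
and a multiple of the tilt. -/
structure IsControlled (T Cρ Λ : ℝ) (u : Sig → ℝ) : Prop where
  smooth : ContMDiff (𝓡∂ m) 𝓘(ℝ, ℝ) ∞ u
  spacelike : ∀ x, gradNormSq (D.sigma u) u x < 1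
  mem_Icc : ∀ x, u x ∈ Icc (-T) T
  boundary_eq : ∀ x ∈ (𝓡∂ m).boundary Sig, u x = D.height x
  equation : ∃ f : Sig → ℝ, Continuous f ∧ ∫ x, |f x| ∂(metricVolume (D.sigma u)) ≤ Cρ ∧
    ∀ x ∈ (𝓡∂ m).interior Sig, |D.meanCurvature u x - f x| ≤ Λ * D.tilt u x

variable {D}

omit [IsManifold (𝓡 m) ∞ S] [T2Space Sig] [IsManifold (𝓡∂ m) ∞ Sig] [BorelSpace Sig] in
theorem IsControlled.contMDiff_one {T Cρ Λ : ℝ} {u : Sig → ℝ} (h : D.IsControlled T Cρ Λ u) :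
    ContMDiff (𝓡∂ m) 𝓘(ℝ, ℝ) 1 u := h.smooth.of_le (by exact_mod_cast le_top)

variable (D)

/-- The weak form of the equation, tested with small functions. -/
theorem exists_integral_gradInner_le (T : ℝ) {Cρ Λ : ℝ} (hCρ : 0 ≤ Cρ) (hΛ : 0 ≤ Λ) :
    ∃ C, 0 ≤ C ∧ ∀ u, D.IsControlled T Cρ Λ u → ∀ η : Sig → ℝ, ContMDiff (𝓡∂ m) 𝓘(ℝ, ℝ) 1 η →
      tsupport η ⊆ (𝓡∂ m).interior Sig → ∀ b, (∀ x, |η x| ≤ b) →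
      ∫ x, D.lapseAlong u x ^ m * D.tilt u x * gradInner (D.sigma u) u η x ∂(metricVolume (D.sigma u))
        ≤ C * (b + ∫ x, |η x| * D.tilt u x ∂(metricVolume (D.sigma u))) := by
  obtain ⟨a₀, a₁, A, ha₀, ha₁, -, hlapse⟩ := D.exists_lapse_bounds T
  obtain ⟨B, hB, hdiv⟩ := D.exists_abs_fluxDiv_sub_le T
  -- The first summand pays for the integrable part f of H, the second for the part of H bounded by
  -- Λw and for the difference between the divergence and α^(m+1) H.
  refine ⟨a₁ ^ (m + 1) * Cρ + (a₁ ^ (m + 1) * Λ + B), by positivity, fun u hu η hη hi b hb => ?_⟩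
  have := D.isFiniteMeasure_sigma hu.smooth
  obtain ⟨f, hf, hfC, heq⟩ := hu.equation
  have hw : Continuous (D.tilt u) := D.tilt_continuous hu.contMDiff_one hu.spacelike
  have hint : ∀ g : Sig → ℝ, Continuous g → Integrable g (metricVolume (D.sigma u)) := fun g hg =>
    hg.integrable_of_hasCompactSupport (HasCompactSupport.of_compactSpace _)
  have hηc := hη.continuous
  have hb0 : 0 ≤ b := (abs_nonneg _).trans (hb (Classical.arbitrary Sig))
  rw [D.integral_gradInner hu.smooth hu.spacelike hη hi]
  have hpt : ∀ x, ‖η x * D.fluxDiv u x‖ ≤ a₁ ^ (m + 1) * b * |f x|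
      + (a₁ ^ (m + 1) * Λ + B) * (|η x| * D.tilt u x) := by
    intro x
    have hw1 := D.one_le_tilt (hu.spacelike x)
    by_cases hx : x ∈ tsupport η
    · have h1 := hdiv u hu.smooth hu.spacelike hu.mem_Icc x (hi hx)
      have h2 := heq x (hi hx)
      have h3 : |D.lapseAlong u x ^ (m + 1)| ≤ a₁ ^ (m + 1) := by
        rw [abs_of_pos (pow_pos (D.lapseAlong_pos u x) _)]
        exact pow_le_pow_left₀ (D.lapseAlong_pos u x).le (hlapse _ (hu.mem_Icc x) x).2.1 _
      have h4 : |D.meanCurvature u x| ≤ |f x| + Λ * D.tilt u x := by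
        have := abs_sub_abs_le_abs_sub (D.meanCurvature u x) (f x)
        linarith
      have h5 : |D.fluxDiv u x| ≤ a₁ ^ (m + 1) * (|f x| + Λ * D.tilt u x) + B * D.tilt u x := by
        have h6 := abs_sub_abs_le_abs_sub (D.fluxDiv u x) (D.lapseAlong u x ^ (m + 1) * D.meanCurvature u x)
        rw [abs_mul] at h6
        have h7 := mul_le_mul h3 h4 (abs_nonneg _) (by positivity)
        linarith
      rw [Real.norm_eq_abs, abs_mul]
      have h8 := mul_le_mul_of_nonneg_left h5 (abs_nonneg (η x))
      have h9 : a₁ ^ (m + 1) * |η x| * |f x| ≤ a₁ ^ (m + 1) * b * |f x| := by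
        have := hb x
        gcongr
      nlinarith
    · rw [image_eq_zero_of_notMem_tsupport hx]
      simp only [zero_mul, norm_zero, abs_zero, mul_zero, add_zero]
      positivity
  have h1 := norm_integral_le_of_norm_le
    (((hint _ hf.abs).const_mul (a₁ ^ (m + 1) * b)).add ((hint _ (hηc.abs.mul hw)).const_mul (a₁ ^ (m + 1) * Λ + B)))
    (Eventually.of_forall hpt)
  simp only [Pi.add_apply] at h1
  rw [integral_add ((hint _ hf.abs).const_mul _) ((hint _ (hηc.abs.mul hw)).const_mul _),
    integral_const_mul, integral_const_mul] at h1
  have hI : 0 ≤ ∫ x, |η x| * D.tilt u x ∂(metricVolume (D.sigma u)) :=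
    integral_nonneg fun x => mul_nonneg (abs_nonneg _) (zero_le_one.trans (D.one_le_tilt (hu.spacelike x)))
  have h2 : a₁ ^ (m + 1) * b * ∫ x, |f x| ∂(metricVolume (D.sigma u)) ≤ a₁ ^ (m + 1) * b * Cρ :=
    mul_le_mul_of_nonneg_left hfC (by positivity)
  refine (neg_le_abs _).trans (h1.trans ?_)
  have h3 : 0 ≤ a₁ ^ (m + 1) * Cρ * ∫ x, |η x| * D.tilt u x ∂(metricVolume (D.sigma u)) := by positivity
  have h4 : 0 ≤ (a₁ ^ (m + 1) * Λ + B) * b := by positivity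
  simp only [Pi.mul_apply] at *
  nlinarith

end Estimates

end SpacelikeHypersurface

/-- Write d² - (1 - δ)d = δ - (1 - d)(δ + d). Here δ + d ≤ 2, and w(1 - d) ≤ w²(1 - d²) = 1 because
w(1 + d) ≥ 1. -/
theorem tilt_mul_sub_ge {d δ w : ℝ} (hd : 0 ≤ d) (hd1 : d < 1) (hδ : δ < 1) (hw : 1 ≤ w)
    (hwd : w ^ 2 * (1 - d ^ 2) = 1) : δ * w - 2 ≤ w * (d ^ 2 - (1 - δ) * d) := by
  have h1 : w * ((1 - d) * (δ + d)) ≤ w * ((1 - d) * 2) :=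
    mul_le_mul_of_nonneg_left (mul_le_mul_of_nonneg_left (by linarith) (by linarith)) (by linarith)
  have h2 : w * (1 - d) ≤ w ^ 2 * (1 - d ^ 2) := by
    have : w ^ 2 * (1 - d ^ 2) = w * (1 - d) * (w * (1 + d)) := by ring
    rw [this]
    exact le_mul_of_one_le_right (mul_nonneg (by linarith) (by linarith)) (by nlinarith)
  nlinarith

namespace SpacelikeHypersurface

/-! ### Integrability of the tilt away from coincidence sets -/

section Global

variable {m : ℕ} [NeZero m] {S : Type*} [TopologicalSpace S]
  [ChartedSpace (EuclideanSpace ℝ (Fin m)) S] [IsManifold (𝓡 m) ∞ S] {G : SplitSpacetime m S}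
  {Sig : Type*} [TopologicalSpace Sig] [T2Space Sig] [CompactSpace Sig] [Nonempty Sig]
  [ChartedSpace (EuclideanHalfSpace m) Sig] [IsManifold (𝓡∂ m) ∞ Sig]
  [MeasurableSpace Sig] [BorelSpace Sig]
  (D : SpacelikeHypersurface G Sig)

omit [T2Space Sig] [Nonempty Sig] [MeasurableSpace Sig] [BorelSpace Sig] in
/-- The metrics of graphs with bounded heights are uniformly equivalent. -/
theorem exists_sigma_le (T : ℝ) : ∃ K : ℝ, 1 ≤ K ∧ ∀ u v : Sig → ℝ, (∀ x, u x ∈ Icc (-T) T) →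
    (∀ x, v x ∈ Icc (-T) T) → ∀ x w, D.sigma u x w w ≤ K ^ 2 * D.sigma v x w w := by
  obtain ⟨lam, hlam, h⟩ := D.exists_abs_deriv_slice_le T
  -- Two heights in [-T, T] differ by at most 2|T|, and K² = e^(2λ|T|) is the corresponding factor.
  refine ⟨Real.exp (lam * |T|), Real.one_le_exp (by positivity), fun u v hu hv x w => ?_⟩
  refine (D.slice_le_exp_mul h (hv x) (hu x) x w).trans
    (mul_le_mul_of_nonneg_right ?_ (D.slice_nonneg _ _ _))
  rw [← Real.exp_nat_mul]
  refine Real.exp_le_exp.2 ?_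
  have h1 : |u x - v x| ≤ 2 * |T| := by
    have := le_abs_self T
    rw [abs_le]
    constructor <;> linarith [(hu x).1, (hu x).2, (hv x).1, (hv x).2]
  push_cast
  nlinarith

omit [T2Space Sig] [IsManifold (𝓡 m) ∞ S] in
theorem metricVolume_sigma_le {u v : Sig → ℝ} {K : ℝ} (hK : 0 ≤ K)
    (h : ∀ x w, D.sigma u x w w ≤ K ^ 2 * D.sigma v x w w) (A : Set Sig) :
    metricVolume (D.sigma u) A ≤ ENNReal.ofReal (K ^ m) * metricVolume (D.sigma v) A := by
  have h1 := metricVolume_le_smul (σ := D.sigma u) (σ' := D.sigma v) (K := (K ^ m).toNNReal) fun c y hy => by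
    rw [Real.coe_toNNReal _ (by positivity)]
    exact D.chartDensity_le h hK hy
  have h2 := h1 A
  rwa [Measure.smul_apply, ENNReal.smul_def, smul_eq_mul] at h2

variable {T Cρ Λ : ℝ} (hφT : ∀ x, D.height x ∈ Icc (-T) T) (hCρ : 0 ≤ Cρ) (hΛ : 0 ≤ Λ)

include hφT in
omit [T2Space Sig] in
theorem exists_metricVolume_univ_le : ∃ V, 0 ≤ V ∧ ∀ u : Sig → ℝ, (∀ x, u x ∈ Icc (-T) T) →
    (metricVolume (D.sigma u)).real univ ≤ V := by
  obtain ⟨K, hK, h⟩ := D.exists_sigma_le T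
  have := metricVolume_isFiniteMeasure (D.sigma_isInnerForm D.height)
    (D.chartDensity_continuousOn D.height.continuous)
  refine ⟨K ^ m * (metricVolume (D.sigma D.height)).real univ, by positivity, fun u hu => ?_⟩
  refine ENNReal.toReal_le_of_le_ofReal (by positivity) ?_
  rw [ENNReal.ofReal_mul (by positivity), measureReal_def, ENNReal.ofReal_toReal (measure_ne_top _ _)]
  exact D.metricVolume_sigma_le (by linarith) (h u _ hu hφT) univ

variable {Φ : Sig → ℝ} (hΦ : ContMDiff (𝓡∂ m) 𝓘(ℝ, ℝ) 1 Φ)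
  (hΦs : ∀ x, gradNormSq (D.sigma Φ) Φ x < 1) (hΦT : ∀ x, Φ x ∈ Icc (-T) T)
  (hΦb : ∀ x ∈ (𝓡∂ m).boundary Sig, Φ x = D.height x)

include hφT hCρ hΛ hΦ hΦs hΦT hΦb in
-- The test function is s times the truncated positive part of e^(ku) - e^(kΦ), with k = sl and l
-- large; s = 1 treats {u > Φ} and s = -1 treats {u < Φ}. Differentiating the exponentials produces
-- the factor l, so the gradient term dominates the zeroth order term C₁ ∫ |η| w. The bound does not
-- depend on the truncation κ.
theorem exists_integral_ramp_le {s : ℝ} (hs : s = 1 ∨ s = -1) :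
    ∃ k C, 0 < s * k ∧ ∀ u, D.IsControlled T Cρ Λ u → ∀ κ, 0 < κ →
      ∫ x, ramp κ (Real.exp (k * u x) - Real.exp (k * Φ x)) * D.tilt u x ∂(metricVolume (D.sigma u)) ≤ C := by
  obtain ⟨a₀, a₁, A, ha₀, ha₁, -, hlapse⟩ := D.exists_lapse_bounds T
  obtain ⟨δ, hδ, hδ1, hδΦ⟩ := D.exists_dAlong_sq_le_of_gradNormSq_lt hΦ hΦs
  obtain ⟨lam, hlam, hsl⟩ := D.exists_abs_deriv_slice_le T
  obtain ⟨C₁, hC₁, hweak⟩ := D.exists_integral_gradInner_le T hCρ hΛ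
  obtain ⟨V, hV0, hV⟩ := D.exists_metricVolume_univ_le hφT
  -- The first summand makes l a₀^m δ ≥ C₁ + 1, one more than has to be absorbed; the second gives l
  -- ≥ λ/2, which compensates for comparing the slice metrics at the heights Φ and u.
  set l : ℝ := (C₁ + 1) / (a₀ ^ m * δ) + lam with hl
  have hl0 : 0 < l := by positivity
  have hl1 : C₁ + 1 ≤ l * (a₀ ^ m * δ) := by
    rw [hl, add_mul, div_mul_cancel₀ _ (by positivity)]
    have : 0 ≤ lam * (a₀ ^ m * δ) := by positivity
    linarith
  have hl2 : lam / 2 ≤ l := by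
    have : 0 ≤ (C₁ + 1) / (a₀ ^ m * δ) := by positivity
    linarith
  have hss : s * s = 1 := by rcases hs with h | h <;> rw [h] <;> norm_num
  have habs : |s| = 1 := by rcases hs with h | h <;> simp [h]
  set k : ℝ := s * l with hk
  have hsk : s * k = l := by rw [hk, ← mul_assoc, hss, one_mul]
  set M : ℝ := Real.exp (l * T) with hM
  have hkT : ∀ t ∈ Icc (-T) T, Real.exp (k * t) ≤ M ∧ 1 ≤ M * Real.exp (k * t) := by
    intro t ht
    have h1 : |k * t| ≤ l * T := by
      rw [hk, abs_mul, abs_mul, habs, one_mul, abs_of_pos hl0]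
      exact mul_le_mul_of_nonneg_left (abs_le.2 ht) hl0.le
    refine ⟨Real.exp_le_exp.2 ((le_abs_self _).trans h1), ?_⟩
    rw [hM, ← Real.exp_add]
    exact Real.one_le_exp (by linarith [neg_le_of_abs_le h1])
  refine ⟨k, M * ((C₁ + 2 * l * a₁ ^ m * V) * M), by rw [hsk]; exact hl0, fun u hu κ hκ => ?_⟩
  have := D.isFiniteMeasure_sigma hu.smooth
  have hu1 := hu.contMDiff_one
  have hw : Continuous (D.tilt u) := D.tilt_continuous hu1 hu.spacelike
  have hint : ∀ g : Sig → ℝ, Continuous g → Integrable g (metricVolume (D.sigma u)) := fun g hg =>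
    hg.integrable_of_hasCompactSupport (HasCompactSupport.of_compactSpace _)
  set h : Sig → ℝ := fun x => Real.exp (k * u x) - Real.exp (k * Φ x) with hh
  have hexp : ContDiff ℝ 1 fun t : ℝ => Real.exp (k * t) := by fun_prop
  have hh1 : ContMDiff (𝓡∂ m) 𝓘(ℝ, ℝ) 1 h :=
    (hexp.contMDiff.comp hu1).sub (hexp.contMDiff.comp hΦ)
  have hη1 : ContMDiff (𝓡∂ m) 𝓘(ℝ, ℝ) 1 fun x => s * rampInt κ (h x) :=
    contMDiff_const.mul ((rampInt_contDiff κ).contMDiff.comp hh1)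
  have hcl : IsClosed {x | κ ≤ h x} := isClosed_le continuous_const hh1.continuous
  have hsupp : tsupport (fun x => s * rampInt κ (h x)) ⊆ (𝓡∂ m).interior Sig := by
    refine (closure_minimal (fun x hx => ?_) hcl).trans fun x (hx : κ ≤ h x) => ?_
    · by_contra hlt
      exact hx (by simp only [rampInt_eq_zero hκ (not_le.1 hlt).le, mul_zero])
    · by_contra hi
      rw [← mem_compl_iff, ModelWithCorners.compl_interior] at hi
      simp only [hh, hu.boundary_eq x hi, hΦb x hi, sub_self] at hx
      linarith
  have hle : ∀ x, h x ≤ Real.exp (k * u x) := fun x => by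
    simp only [hh]; linarith [Real.exp_pos (k * Φ x)]
  have hη : ∀ x, |s * rampInt κ (h x)| ≤ ramp κ (h x) * Real.exp (k * u x) := by
    intro x
    rw [abs_mul, habs, one_mul, abs_of_nonneg (rampInt_nonneg hκ _)]
    rcases le_total 0 (h x) with h0 | h0
    · refine (rampInt_le_mul hκ h0).trans ?_
      rw [mul_comm]
      exact mul_le_mul_of_nonneg_left (hle x) (ramp_nonneg _)
    · rw [rampInt_eq_zero hκ (h0.trans hκ.le)]
      exact mul_nonneg (ramp_nonneg _) (Real.exp_pos _).le
  have hηb : ∀ x, |s * rampInt κ (h x)| ≤ M := fun x => (hη x).trans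
    ((mul_le_of_le_one_left (Real.exp_pos _).le (ramp_le_one _)).trans (hkT _ (hu.mem_Icc x)).1)
  have hmain := hweak u hu _ hη1 hsupp M hηb
  have hgrad : ∀ x, gradInner (D.sigma u) u (fun x => s * rampInt κ (h x)) x
      = l * ramp κ (h x) * (Real.exp (k * u x) * gradNormSq (D.sigma u) u x
        - Real.exp (k * Φ x) * dAlong Φ x (gradVec (D.sigma u) u x)) := by
    intro x
    have hexpd : ∀ t : ℝ, HasDerivAt (fun t => Real.exp (k * t)) (k * Real.exp (k * t)) t := fun t => by
      simpa [mul_comm] using ((hasDerivAt_id t).const_mul k).exp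
    have hux := hu1.mdifferentiable (by simp) x
    have hΦx := hΦ.mdifferentiable (by simp) x
    have d1 : ∀ v, dAlong h x v = k * Real.exp (k * u x) * dAlong u x v
        - k * Real.exp (k * Φ x) * dAlong Φ x v := fun v => by
      rw [← dAlong_comp (hexpd (u x)) hux, ← dAlong_comp (hexpd (Φ x)) hΦx]
      exact dAlong_sub ((hexp.contMDiff.comp hu1).mdifferentiable (by simp) x)
        ((hexp.contMDiff.comp hΦ).mdifferentiable (by simp) x) v
    rw [gradInner, dAlong_comp ((rampInt_hasDerivAt κ (h x)).const_mul s)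
      (hh1.mdifferentiable (by simp) x), d1, ← hsk]
    change s * _ * (k * _ * gradNormSq (D.sigma u) u x - _) = _
    ring
  have hpt : ∀ x, l * (a₀ ^ m * δ) * (ramp κ (h x) * Real.exp (k * u x) * D.tilt u x)
      - 2 * l * a₁ ^ m * (ramp κ (h x) * Real.exp (k * u x))
      ≤ D.lapseAlong u x ^ m * D.tilt u x * gradInner (D.sigma u) u (fun x => s * rampInt κ (h x)) x := by
    intro x
    rw [hgrad]
    by_cases hhx : h x ≤ κ
    · rw [ramp_eq_zero hκ hhx]; simp
    push Not at hhx
    set g := gradVec (D.sigma u) u x with hg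
    have hd2 : gradNormSq (D.sigma u) u x = D.sigma u x g g := gradNormSq_eq (D.sigma_isInnerForm u x) u
    set d : ℝ := √(gradNormSq (D.sigma u) u x) with hd
    have hd0 : 0 ≤ gradNormSq (D.sigma u) u x := gradNormSq_nonneg (D.sigma_isInnerForm u x) u
    have hdd : d ^ 2 = gradNormSq (D.sigma u) u x := Real.sq_sqrt hd0
    have hd1 : d < 1 := (Real.sqrt_lt' one_pos).2 (by simpa using hu.spacelike x)
    have hw1 := D.one_le_tilt (hu.spacelike x)
    have hwd : D.tilt u x ^ 2 * (1 - d ^ 2) = 1 := by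
      rw [D.tilt_sq (hu.spacelike x), hdd]
      exact one_div_mul_cancel (by linarith [hu.spacelike x])
    have hkey := tilt_mul_sub_ge (Real.sqrt_nonneg _) hd1 hδ1 hw1 hwd
    have hpos : 0 < k * (u x - Φ x) := by
      have h1 : Real.exp (k * Φ x) < Real.exp (k * u x) := by simp only [hh] at hhx; linarith
      have := Real.exp_lt_exp.1 h1
      linarith
    have hkabs : k * (u x - Φ x) = l * |u x - Φ x| := by
      rw [← abs_of_pos hpos, hk, abs_mul, abs_mul, habs, one_mul, abs_of_pos hl0]
    -- The bound |dΦ| ≤ 1 - δ holds for the slice metric at height Φ. Passing to height u costs at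
    -- most e^(l|u - Φ|), and where h > κ this factor times e^(kΦ) is exactly e^(ku).
    have hΦg : Real.exp (k * Φ x) * dAlong Φ x g ≤ Real.exp (k * u x) * ((1 - δ) * d) := by
      have h1 := (hδΦ x g).trans (mul_le_mul_of_nonneg_left
        (D.slice_le_exp_mul hsl (hu.mem_Icc x) (hΦT x) x g) (sq_nonneg _))
      have h2 : dAlong Φ x g ^ 2 ≤ (Real.exp (l * |u x - Φ x|) * ((1 - δ) * d)) ^ 2 := by
        refine h1.trans ?_
        have h3 : Real.exp (lam * |Φ x - u x|) ≤ Real.exp (l * |u x - Φ x|) ^ 2 := by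
          rw [← Real.exp_nat_mul, abs_sub_comm]
          refine Real.exp_le_exp.2 ?_
          push_cast
          nlinarith [abs_nonneg (u x - Φ x)]
        have h4 : D.slice (u x) x g g = d ^ 2 := by rw [hdd, hd2]; rfl
        rw [h4, mul_pow, mul_pow]
        have h5 : 0 ≤ (1 - δ) ^ 2 * d ^ 2 := by positivity
        nlinarith [mul_le_mul_of_nonneg_left h3 h5]
      have h3 := (abs_le_of_sq_le_sq' h2 (mul_nonneg (Real.exp_pos _).le
        (mul_nonneg (by linarith) (Real.sqrt_nonneg _)))).2
      calc _ ≤ Real.exp (k * Φ x) * (Real.exp (l * |u x - Φ x|) * ((1 - δ) * d)) :=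
            mul_le_mul_of_nonneg_left h3 (Real.exp_pos _).le
        _ = _ := by
            rw [← mul_assoc, ← Real.exp_add, ← hkabs]
            ring_nf
    have hR := ramp_nonneg (κ := κ) (h x)
    have hE := Real.exp_pos (k * u x)
    have hα := D.lapseAlong_pos u x
    have hα0 : a₀ ^ m ≤ D.lapseAlong u x ^ m := pow_le_pow_left₀ ha₀.le (hlapse _ (hu.mem_Icc x) x).1 m
    have hα1 : D.lapseAlong u x ^ m ≤ a₁ ^ m := pow_le_pow_left₀ hα.le (hlapse _ (hu.mem_Icc x) x).2.1 m
    have s1 : Real.exp (k * u x) * (d ^ 2 - (1 - δ) * d)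
        ≤ Real.exp (k * u x) * gradNormSq (D.sigma u) u x - Real.exp (k * Φ x) * dAlong Φ x g := by
      rw [← hdd]; linarith
    have s2 : a₀ ^ m * (δ * D.tilt u x) - 2 * a₁ ^ m
        ≤ D.lapseAlong u x ^ m * (D.tilt u x * (d ^ 2 - (1 - δ) * d)) := by
      have t1 := mul_le_mul_of_nonneg_left hkey (pow_pos hα m).le
      have t2 : a₀ ^ m * (δ * D.tilt u x) ≤ D.lapseAlong u x ^ m * (δ * D.tilt u x) :=
        mul_le_mul_of_nonneg_right hα0 (by positivity)
      linarith
    calc _ = l * ramp κ (h x) * Real.exp (k * u x) * (a₀ ^ m * (δ * D.tilt u x) - 2 * a₁ ^ m) := by ring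
      _ ≤ l * ramp κ (h x) * Real.exp (k * u x) *
          (D.lapseAlong u x ^ m * (D.tilt u x * (d ^ 2 - (1 - δ) * d))) :=
          mul_le_mul_of_nonneg_left s2 (by positivity)
      _ = D.lapseAlong u x ^ m * D.tilt u x * (l * ramp κ (h x)) *
          (Real.exp (k * u x) * (d ^ 2 - (1 - δ) * d)) := by ring
      _ ≤ D.lapseAlong u x ^ m * D.tilt u x * (l * ramp κ (h x)) * _ :=
          mul_le_mul_of_nonneg_left s1 (by positivity)
      _ = _ := by ring
  have hwc : Continuous fun x => ramp κ (h x) * Real.exp (k * u x) :=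
    ((ramp_continuous κ).comp hh1.continuous).mul (hexp.continuous.comp hu1.continuous)
  have hlap := D.lapseAlong_continuous hu1.continuous
  have i1 := hint _ (hwc.mul hw)
  have i2 := hint _ hwc
  have i3 := hint _ (((hlap.pow m).mul hw).mul (D.gradInner_continuous hu1 hη1 hu1.continuous))
  have i4 := hint _ (hη1.continuous.abs.mul hw)
  have j1 : l * (a₀ ^ m * δ) * ∫ x, ramp κ (h x) * Real.exp (k * u x) * D.tilt u x ∂(metricVolume (D.sigma u))
      - 2 * l * a₁ ^ m * ∫ x, ramp κ (h x) * Real.exp (k * u x) ∂(metricVolume (D.sigma u))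
      ≤ ∫ x, D.lapseAlong u x ^ m * D.tilt u x * gradInner (D.sigma u) u (fun x => s * rampInt κ (h x)) x
        ∂(metricVolume (D.sigma u)) := by
    rw [← integral_const_mul, ← integral_const_mul]
    exact (integral_sub (i1.const_mul _) (i2.const_mul _)).symm.trans_le
      (integral_mono ((i1.const_mul (l * (a₀ ^ m * δ))).sub (i2.const_mul (2 * l * a₁ ^ m))) i3 hpt)
  have j2 : ∫ x, |s * rampInt κ (h x)| * D.tilt u x ∂(metricVolume (D.sigma u))
      ≤ ∫ x, ramp κ (h x) * Real.exp (k * u x) * D.tilt u x ∂(metricVolume (D.sigma u)) := integral_mono i4 i1 fun x => mul_le_mul_of_nonneg_right (hη x)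
    (zero_le_one.trans (D.one_le_tilt (hu.spacelike x)))
  have j3 : ∫ x, ramp κ (h x) * Real.exp (k * u x) ∂(metricVolume (D.sigma u)) ≤ V * M := by
    have := integral_mono i2 (integrable_const M) fun x =>
      (mul_le_of_le_one_left (Real.exp_pos _).le (ramp_le_one _)).trans (hkT _ (hu.mem_Icc x)).1
    rw [integral_const, smul_eq_mul] at this
    exact this.trans (mul_le_mul_of_nonneg_right (hV u hu.mem_Icc) (Real.exp_pos _).le)
  have i5 := hint _ (((ramp_continuous κ).comp hh1.continuous).mul hw)
  have j4 : ∫ x, ramp κ (h x) * D.tilt u x ∂(metricVolume (D.sigma u))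
      ≤ M * ∫ x, ramp κ (h x) * Real.exp (k * u x) * D.tilt u x ∂(metricVolume (D.sigma u)) := by
    rw [← integral_const_mul]
    refine integral_mono i5 (i1.const_mul M) fun x => ?_
    have h1 := (hkT _ (hu.mem_Icc x)).2
    have h2 : 0 ≤ ramp κ (h x) * D.tilt u x :=
      mul_nonneg (ramp_nonneg _) (zero_le_one.trans (D.one_le_tilt (hu.spacelike x)))
    calc ramp κ (h x) * D.tilt u x ≤ ramp κ (h x) * D.tilt u x * (M * Real.exp (k * u x)) :=
          le_mul_of_one_le_right h2 h1
      _ = _ := by ring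
  refine j4.trans (mul_le_mul_of_nonneg_left ?_ (Real.exp_pos _).le)
  have hI0 : 0 ≤ ∫ x, ramp κ (h x) * Real.exp (k * u x) * D.tilt u x ∂(metricVolume (D.sigma u)) :=
    integral_nonneg fun x => mul_nonneg (mul_nonneg (ramp_nonneg _) (Real.exp_pos _).le)
      (zero_le_one.trans (D.one_le_tilt (hu.spacelike x)))
  -- With I = ∫ ramp · e^(ku) w, the lower bound (C₁ + 1) I minus the volume term and the upper
  -- bound C₁ (M + I) leave I ≤ C₁ M + 2 l a₁^m V M.
  have j5 := mul_le_mul_of_nonneg_left j2 hC₁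
  have j6 := mul_le_mul_of_nonneg_left j3 (show 0 ≤ 2 * l * a₁ ^ m by positivity)
  have j7 := mul_le_mul_of_nonneg_right hl1 hI0
  linarith

include hφT hCρ hΛ hΦ hΦs hΦT hΦb in
-- The bound for the truncated integrals is uniform in κ. With κ = 1/(n + 1) the sets {h ≥ 2κ}, on
-- which `ramp` equals 1, increase to a set containing {s(u - Φ) > 0}.
theorem exists_lintegral_tilt_le_of_pos {s : ℝ} (hs : s = 1 ∨ s = -1) :
    ∃ C : ℝ, ∀ u, D.IsControlled T Cρ Λ u → ∫⁻ x in {x | 0 < s * (u x - Φ x)},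
      ENNReal.ofReal (D.tilt u x) ∂(metricVolume (D.sigma u)) ≤ ENNReal.ofReal C := by
  obtain ⟨k, C, hsk, hC⟩ := D.exists_integral_ramp_le hφT hCρ hΛ hΦ hΦs hΦT hΦb hs
  refine ⟨C, fun u hu => ?_⟩
  have := D.isFiniteMeasure_sigma hu.smooth
  have hu1 := hu.contMDiff_one
  have hw : Continuous (D.tilt u) := D.tilt_continuous hu1 hu.spacelike
  set h : Sig → ℝ := fun x => Real.exp (k * u x) - Real.exp (k * Φ x) with hh
  have hhc : Continuous h := by
    have := hu1.continuous
    have := hΦ.continuous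
    fun_prop
  have hset : {x | 0 < s * (u x - Φ x)} ⊆ ⋃ n : ℕ, {x | 2 * (1 / ((n : ℝ) + 1)) ≤ h x} := by
    intro x (hx : 0 < s * (u x - Φ x))
    have h1 : 0 < k * (u x - Φ x) := by rcases hs with h | h <;> rw [h] at hx hsk <;> nlinarith
    have h2 : 0 < h x := sub_pos.2 (Real.exp_lt_exp.2 (by linarith))
    obtain ⟨n, hn⟩ := exists_nat_one_div_lt (half_pos h2)
    exact mem_iUnion.2 ⟨n, show 2 * (1 / ((n : ℝ) + 1)) ≤ h x by linarith⟩
  have hmono : Monotone fun n : ℕ => {x | 2 * (1 / ((n : ℝ) + 1)) ≤ h x} := by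
    intro a b hab x (hx : _ ≤ h x)
    refine le_trans ?_ hx
    have : (a : ℝ) ≤ b := by exact_mod_cast hab
    gcongr
  refine (lintegral_mono_set hset).trans ?_
  have hm : ∀ A : Set Sig, MeasurableSet A → ∫⁻ x in A, ENNReal.ofReal (D.tilt u x) ∂(metricVolume (D.sigma u))
      = ((metricVolume (D.sigma u)).withDensity fun x => ENNReal.ofReal (D.tilt u x)) A := fun A hA =>
    (withDensity_apply _ hA).symm
  have hmeas : ∀ n : ℕ, MeasurableSet {x | 2 * (1 / ((n : ℝ) + 1)) ≤ h x} := fun n =>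
    (isClosed_le continuous_const hhc).measurableSet
  rw [hm _ (MeasurableSet.iUnion hmeas), hmono.measure_iUnion]
  refine iSup_le fun n => ?_
  rw [← hm _ (hmeas n)]
  set κ : ℝ := 1 / ((n : ℝ) + 1) with hκ
  have hκ0 : 0 < κ := by positivity
  have hw0 : ∀ x, 0 ≤ D.tilt u x := fun x => zero_le_one.trans (D.one_le_tilt (hu.spacelike x))
  have i1 : Integrable (fun x => ramp κ (h x) * D.tilt u x) (metricVolume (D.sigma u)) :=
    (((ramp_continuous κ).comp hhc).mul hw).integrable_of_hasCompactSupport (HasCompactSupport.of_compactSpace _)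
  refine le_trans ?_ (ENNReal.ofReal_le_ofReal (hC u hu κ hκ0))
  rw [ofReal_integral_eq_lintegral_ofReal i1 (Eventually.of_forall fun x => mul_nonneg (ramp_nonneg _) (hw0 x))]
  refine (setLIntegral_mono' (hmeas n) fun x hx => ?_).trans (setLIntegral_le_lintegral _ _)
  rw [ramp_eq_one hκ0 hx, one_mul]

include hφT hCρ hΛ hΦ hΦs hΦT hΦb in
/-- The tilt is integrable away from the coincidence set with a given spacelike graph. -/
theorem exists_lintegral_tilt_le_of_ne :
    ∃ C : ℝ, 0 ≤ C ∧ ∀ u, D.IsControlled T Cρ Λ u → ∫⁻ x in {x | u x ≠ Φ x},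
      ENNReal.ofReal (D.tilt u x) ∂(metricVolume (D.sigma u)) ≤ ENNReal.ofReal C := by
  obtain ⟨C, hC⟩ := D.exists_lintegral_tilt_le_of_pos hφT hCρ hΛ hΦ hΦs hΦT hΦb (Or.inl rfl)
  obtain ⟨C', hC'⟩ := D.exists_lintegral_tilt_le_of_pos hφT hCρ hΛ hΦ hΦs hΦT hΦb (Or.inr rfl)
  refine ⟨|C| + |C'|, by positivity, fun u hu => ?_⟩
  have hsub : {x | u x ≠ Φ x} ⊆ {x | 0 < 1 * (u x - Φ x)} ∪ {x | 0 < -1 * (u x - Φ x)} := by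
    intro x (hx : u x ≠ Φ x)
    rcases lt_or_gt_of_ne hx with h | h
    · right; change 0 < -1 * (u x - Φ x); linarith
    · left; change 0 < 1 * (u x - Φ x); linarith
  refine (lintegral_mono_set hsub).trans ((lintegral_union_le _ _ _).trans ?_)
  rw [ENNReal.ofReal_add (abs_nonneg _) (abs_nonneg _)]
  exact add_le_add ((hC u hu).trans (ENNReal.ofReal_le_ofReal (le_abs_self _)))
    ((hC' u hu).trans (ENNReal.ofReal_le_ofReal (le_abs_self _)))

end Global

end SpacelikeHypersurface

theorem add_sq_le_of_sq_le {a b α β q : ℝ} (hα : 0 ≤ α) (hβ : 0 ≤ β) (hq : 0 ≤ q)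
    (ha : a ^ 2 ≤ α ^ 2 * q) (hb : b ^ 2 ≤ β ^ 2 * q) : (a + b) ^ 2 ≤ (α + β) ^ 2 * q := by
  have hs := Real.sq_sqrt hq
  have h1 : |a| ≤ α * √q := abs_le_of_sq_le_sq (by rw [mul_pow, hs]; exact ha) (by positivity)
  have h2 : |b| ≤ β * √q := abs_le_of_sq_le_sq (by rw [mul_pow, hs]; exact hb) (by positivity)
  have h3 : |a + b| ≤ (α + β) * √q := (abs_add_le a b).trans (by linarith)
  calc (a + b) ^ 2 = |a + b| ^ 2 := (sq_abs _).symm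
    _ ≤ ((α + β) * √q) ^ 2 := pow_le_pow_left₀ (abs_nonneg _) h3 2
    _ = _ := by rw [mul_pow, hs]

namespace SpacelikeHypersurface

/-! ### Spacelike perturbations of the hypersurface -/

section Perturbation

variable {m : ℕ} [NeZero m] {S : Type*} [TopologicalSpace S]
  [ChartedSpace (EuclideanSpace ℝ (Fin m)) S] {G : SplitSpacetime m S}
  {Sig : Type*} [TopologicalSpace Sig]
  [ChartedSpace (EuclideanHalfSpace m) Sig]
  (D : SpacelikeHypersurface G Sig)

/-- On the gradient of φ the induced metric takes the value α²(|dφ|² - |dφ|⁴), which has to be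
positive unless the gradient vanishes. -/
theorem height_gradNormSq_lt (x : Sig) : gradNormSq (D.sigma D.height) D.height x < 1 := by
  have hi := D.sigma_isInnerForm D.height x
  set g := gradVec (D.sigma D.height) D.height x with hg
  have h1 : gradNormSq (D.sigma D.height) D.height x = D.sigma D.height x g g := gradNormSq_eq hi _
  by_cases h0 : g = 0
  · rw [h1, h0, hi.zero_left]; exact one_pos
  · have h2 := D.spacelike x g h0
    have h3 : 0 < G.lapse (D.height x, D.proj x) ^ 2 := pow_pos (G.lapse_pos _) 2
    have h4 : 0 < G.lapse (D.height x, D.proj x) ^ 2 *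
        (-(gradNormSq (D.sigma D.height) D.height x * gradNormSq (D.sigma D.height) D.height x)
          + D.sigma D.height x g g) := h2
    rw [← h1] at h4
    have h5 := (mul_pos_iff_of_pos_left h3).1 h4
    nlinarith [gradNormSq_nonneg hi D.height]

variable [IsManifold (𝓡 m) ∞ S] [T2Space Sig] [CompactSpace Sig] [IsManifold (𝓡∂ m) ∞ Sig]

omit [T2Space Sig] in
/-- Small perturbations of the hypersurface are spacelike. -/
theorem exists_spacelike_perturbation {ζ : Sig → ℝ} (hζ : ContMDiff (𝓡∂ m) 𝓘(ℝ, ℝ) 1 ζ) :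
    ∃ c, 0 < c ∧ ∀ x, gradNormSq (D.sigma fun x => D.height x + c * ζ x) (fun x => D.height x + c * ζ x) x < 1 := by
  have hφ : ContMDiff (𝓡∂ m) 𝓘(ℝ, ℝ) 1 D.height := D.height_smooth.of_le (by exact_mod_cast le_top)
  obtain ⟨δ, hδ, hδ1, hδφ⟩ := D.exists_dAlong_sq_le_of_gradNormSq_lt hφ D.height_gradNormSq_lt
  obtain ⟨M, hM⟩ := isCompact_univ.exists_bound_of_continuousOn (f := ζ) hζ.continuous.continuousOn
  obtain ⟨M', hM'⟩ := isCompact_univ.exists_bound_of_continuousOn (f := D.height) D.height.continuous.continuousOn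
  set T := |M| + |M'| with hT
  obtain ⟨L, hL, hLζ⟩ := D.exists_dAlong_sq_le hζ T
  obtain ⟨lam, hlam, hsl⟩ := D.exists_abs_deriv_slice_le T
  -- The square bounds the differential of φ + cζ at height φ, and the exponential is the cost of
  -- moving to height φ + cζ. At c = 0 the product is (1 - δ)² < 1.
  have hev : ∀ᶠ c in 𝓝[>] (0 : ℝ), ((1 - δ) + c * L) ^ 2 * Real.exp (lam * (c * |M|)) < 1 := by
    have hc : Continuous fun c : ℝ => ((1 - δ) + c * L) ^ 2 * Real.exp (lam * (c * |M|)) := by fun_prop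
    refine (hc.continuousAt.eventually (gt_mem_nhds ?_)).filter_mono nhdsWithin_le_nhds
    simp only [zero_mul, add_zero, mul_zero, Real.exp_zero, mul_one]
    nlinarith
  obtain ⟨c, hc, hc0, hc1⟩ := (hev.and (Ioc_mem_nhdsGT (zero_lt_one' ℝ))).exists
  refine ⟨c, hc0, fun x => lt_of_le_of_lt (gradNormSq_le_of_forall (D.sigma_isInnerForm _ x) (by positivity)
    fun v => ?_) hc⟩
  have hζx : |ζ x| ≤ |M| := (hM x trivial).trans (le_abs_self M)
  have hφx : |D.height x| ≤ |M'| := (hM' x trivial).trans (le_abs_self M')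
  have hcζ : |c * ζ x| ≤ c * |M| := by
    rw [abs_mul, abs_of_pos hc0]; exact mul_le_mul_of_nonneg_left hζx hc0.le
  have hcζ' : |c * ζ x| ≤ |M| := hcζ.trans (mul_le_of_le_one_left (abs_nonneg _) hc1)
  have hφT : D.height x ∈ Icc (-T) T := abs_le.1 (hφx.trans (by rw [hT]; linarith [abs_nonneg M]))
  have hΦT : D.height x + c * ζ x ∈ Icc (-T) T :=
    abs_le.1 ((abs_add_le _ _).trans (by rw [hT]; linarith))
  have hd : dAlong (fun x => D.height x + c * ζ x) x v = dAlong D.height x v + c * dAlong ζ x v := by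
    have h1 := hζ.mdifferentiable (by simp) x
    have h2 : ContMDiff (𝓡∂ m) 𝓘(ℝ, ℝ) 1 fun x => c * ζ x := contMDiff_const.mul hζ
    rw [dAlong_add (hφ.mdifferentiable (by simp) x) (h2.mdifferentiable (by simp) x),
      dAlong_mul mdifferentiableAt_const h1, dAlong_const, mul_zero, add_zero]
  rw [hd]
  have hq := D.slice_nonneg (D.height x) x v
  have h1 := add_sq_le_of_sq_le (α := 1 - δ) (β := c * L) (by linarith) (by positivity) hq (hδφ x v)
    (show (c * dAlong ζ x v) ^ 2 ≤ _ by
      rw [mul_pow, mul_pow, mul_assoc]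
      exact mul_le_mul_of_nonneg_left (hLζ _ hφT x v) (sq_nonneg c))
  refine h1.trans ?_
  rw [mul_assoc]
  refine mul_le_mul_of_nonneg_left ?_ (sq_nonneg _)
  refine (D.slice_le_exp_mul hsl hΦT hφT x v).trans
    (mul_le_mul_of_nonneg_right (Real.exp_le_exp.2 (mul_le_mul_of_nonneg_left ?_ hlam.le)) (D.slice_nonneg _ _ _))
  rw [sub_add_cancel_left, abs_neg]
  exact hcζ

end Perturbation

/-! ### Integrability of the tilt in the interior -/

section Local

variable {m : ℕ} [NeZero m] {S : Type*} [TopologicalSpace S]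
  [ChartedSpace (EuclideanSpace ℝ (Fin m)) S] [IsManifold (𝓡 m) ∞ S] {G : SplitSpacetime m S}
  {Sig : Type*} [TopologicalSpace Sig] [T2Space Sig] [CompactSpace Sig] [ConnectedSpace Sig]
  [ChartedSpace (EuclideanHalfSpace m) Sig] [IsManifold (𝓡∂ m) ∞ Sig]
  [MeasurableSpace Sig] [BorelSpace Sig]
  (D : SpacelikeHypersurface G Sig)
  {T Cρ Λ : ℝ} (hT : ∀ u : Sig → ℝ, ContMDiff (𝓡∂ m) 𝓘(ℝ, ℝ) 1 u → (∀ x, gradNormSq (D.sigma u) u x < 1) →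
      (∀ x ∈ (𝓡∂ m).boundary Sig, u x = D.height x) → ∀ x, u x ∈ Icc (-T) T)
  (hCρ : 0 ≤ Cρ) (hΛ : 0 ≤ Λ) (hne : ((𝓡∂ m).boundary Sig).Nonempty)

include hT in
omit [T2Space Sig] [CompactSpace Sig] [ConnectedSpace Sig] [MeasurableSpace Sig] [BorelSpace Sig] [IsManifold (𝓡 m) ∞ S] [IsManifold (𝓡∂ m) ∞ Sig] in
theorem height_mem_Icc (x : Sig) : D.height x ∈ Icc (-T) T :=
  hT _ (D.height_smooth.of_le (by exact_mod_cast le_top)) D.height_gradNormSq_lt (fun _ _ => rfl) x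

include hT hCρ hΛ hne in
-- The spacelike graphs φ and φ + cζ have the same boundary but differ at every interior point, so u
-- differs there from at least one of them, and the estimates off the two coincidence sets cover the
-- interior.
theorem exists_lintegral_tilt_interior_le :
    ∃ C : ℝ, 0 ≤ C ∧ ∀ u, D.IsControlled T Cρ Λ u → ∫⁻ x in (𝓡∂ m).interior Sig,
      ENNReal.ofReal (D.tilt u x) ∂(metricVolume (D.sigma u)) ≤ ENNReal.ofReal C := by
  have hφT := D.height_mem_Icc hT
  have hφ : ContMDiff (𝓡∂ m) 𝓘(ℝ, ℝ) 1 D.height := D.height_smooth.of_le (by exact_mod_cast le_top)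
  obtain ⟨ζ, hζ, hζb, hζi, -⟩ := D.exists_boundary_defining D.height.continuous hne
  have hζ1 : ContMDiff (𝓡∂ m) 𝓘(ℝ, ℝ) 1 ζ := hζ.of_le (by exact_mod_cast le_top)
  obtain ⟨c, hc, hcs⟩ := D.exists_spacelike_perturbation hζ1
  have hΦ : ContMDiff (𝓡∂ m) 𝓘(ℝ, ℝ) 1 fun x => D.height x + c * ζ x := hφ.add (contMDiff_const.mul hζ1)
  have hΦb : ∀ x ∈ (𝓡∂ m).boundary Sig, D.height x + c * ζ x = D.height x := fun x hx => by
    rw [hζb x hx, mul_zero, add_zero]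
  obtain ⟨C, hC0, hC⟩ := D.exists_lintegral_tilt_le_of_ne hφT hCρ hΛ hφ D.height_gradNormSq_lt hφT fun _ _ => rfl
  obtain ⟨C', hC0', hC'⟩ := D.exists_lintegral_tilt_le_of_ne hφT hCρ hΛ hΦ hcs (hT _ hΦ hcs hΦb) hΦb
  refine ⟨C + C', by positivity, fun u hu => ?_⟩
  have hsub : (𝓡∂ m).interior Sig ⊆ {x | u x ≠ D.height x} ∪ {x | u x ≠ D.height x + c * ζ x} := by
    intro x hx
    by_cases h : u x = D.height x
    · right
      change u x ≠ _
      rw [h]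
      have := mul_pos hc (hζi x hx)
      linarith
    · exact Or.inl h
  refine (lintegral_mono_set hsub).trans ((lintegral_union_le _ _ _).trans ?_)
  rw [ENNReal.ofReal_add hC0 hC0']
  exact add_le_add (hC u hu) (hC' u hu)

end Local

end SpacelikeHypersurface

namespace SpacelikeHypersurface

/-! ### Linear growth of the tilt integral over balls -/

section Local

variable {m : ℕ} [NeZero m] {S : Type*} [TopologicalSpace S]
  [ChartedSpace (EuclideanSpace ℝ (Fin m)) S] [IsManifold (𝓡 m) ∞ S] {G : SplitSpacetime m S}
  {Sig : Type*} [TopologicalSpace Sig] [T2Space Sig] [CompactSpace Sig] [ConnectedSpace Sig]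
  [ChartedSpace (EuclideanHalfSpace m) Sig] [IsManifold (𝓡∂ m) ∞ Sig]
  [MeasurableSpace Sig] [BorelSpace Sig]
  (D : SpacelikeHypersurface G Sig)
  {T Cρ Λ : ℝ} (hT : ∀ u : Sig → ℝ, ContMDiff (𝓡∂ m) 𝓘(ℝ, ℝ) 1 u → (∀ x, gradNormSq (D.sigma u) u x < 1) →
      (∀ x ∈ (𝓡∂ m).boundary Sig, u x = D.height x) → ∀ x, u x ∈ Icc (-T) T)
  (hCρ : 0 ≤ Cρ) (hΛ : 0 ≤ Λ) (hne : ((𝓡∂ m).boundary Sig).Nonempty)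

omit [T2Space Sig] [CompactSpace Sig] [ConnectedSpace Sig] [MeasurableSpace Sig] [BorelSpace Sig]
  [IsManifold (𝓡 m) ∞ S] [IsManifold (𝓡∂ m) ∞ Sig] in
-- A function with |du| < 1 for σ_u is 1-Lipschitz for the distance of σ_u itself.
theorem abs_sub_le_of_mem_metricBall {u : Sig → ℝ} (hu : ContMDiff (𝓡∂ m) 𝓘(ℝ, ℝ) 1 u)
    (hus : ∀ x, gradNormSq (D.sigma u) u x < 1) {x y : Sig} {r : ℝ}
    (hy : y ∈ metricBall (D.sigma u) x r) : |u y - u x| ≤ r := by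
  have h1 := ofReal_abs_sub_le_metricDist hu one_pos (σ := D.sigma u) (fun z v => by
    rw [one_pow]
    exact (dAlong_sq_le (D.sigma_isInnerForm u z) u v).trans
      (mul_le_mul_of_nonneg_right (hus z).le ((D.sigma_isInnerForm u z).self_nonneg v))) x y
  rw [ENNReal.ofReal_one, one_mul] at h1
  have h2 := (ENNReal.ofReal_lt_ofReal_iff'.1 (h1.trans_lt hy)).1
  rw [abs_sub_comm]
  exact h2.le

include hT hCρ hΛ hne in
-- The equation is tested with P(u) times a cutoff in ζ, where P is a rescaled arctan. The values of
-- P(u) are of size r/R while P' is bounded below where |u - u(x)| ≤ r, which contains the ball. The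
-- derivative of P yields w|Du|² on the ball; all other terms carry a factor r/R and are controlled
-- by the integral of w over the interior.
theorem exists_integral_tilt_mul_gradNormSq_ball_le {K Cζ : ℝ} {ζ : Sig → ℝ} (hK : 0 < K) (hCζ : 0 < Cζ)
    (hζ : ContMDiff (𝓡∂ m) 𝓘(ℝ, ℝ) 1 ζ) (hζb : ∀ x ∈ (𝓡∂ m).boundary Sig, ζ x = 0)
    (hζd : ∀ u : Sig → ℝ, (∀ x, u x ∈ Icc (-T) T) → ∀ x, ∃ q ∈ (𝓡∂ m).boundary Sig,
      metricDist (D.sigma u) x q ≤ ENNReal.ofReal (K * (Cζ * ζ x))) :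
    ∃ C : ℝ, 0 ≤ C ∧ ∀ u, D.IsControlled T Cρ Λ u → ∀ (x : Sig) (R : ℝ), 0 < R →
      (∀ q ∈ (𝓡∂ m).boundary Sig, ENNReal.ofReal (2 * R) ≤ metricDist (D.sigma u) x q) →
      ∀ r, 0 < r → r < R →
        ∫ y, (metricBall (D.sigma u) x r).indicator
          (fun y => D.tilt u y * gradNormSq (D.sigma u) u y) y ∂(metricVolume (D.sigma u)) ≤ C * (r / R) := by
  obtain ⟨a₀, a₁, A, ha₀, ha₁, -, hlapse⟩ := D.exists_lapse_bounds T
  obtain ⟨L, hL, hLζ⟩ := D.exists_dAlong_sq_le hζ T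
  obtain ⟨Z, hZ⟩ := isCompact_univ.exists_bound_of_continuousOn (f := ζ) hζ.continuous.continuousOn
  have hZ0 : 0 ≤ Z := (norm_nonneg _).trans (hZ (Classical.arbitrary Sig) trivial)
  obtain ⟨C₁, hC₁, hweak⟩ := D.exists_integral_gradInner_le T hCρ hΛ
  obtain ⟨W, hW0, hW⟩ := D.exists_lintegral_tilt_interior_le hT hCρ hΛ hne
  refine ⟨4 * K * Cζ * (C₁ * (2 * Z * (1 + W)) + a₁ ^ m * (2 * L * W)) / a₀ ^ m, by positivity,
    fun u hu x R hR hxR r hr hrR => ?_⟩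
  have := D.isFiniteMeasure_sigma hu.smooth
  have hu1 := hu.contMDiff_one
  have hw : Continuous (D.tilt u) := D.tilt_continuous hu1 hu.spacelike
  have hint : ∀ g : Sig → ℝ, Continuous g → Integrable g (metricVolume (D.sigma u)) := fun g hg =>
    hg.integrable_of_hasCompactSupport (HasCompactSupport.of_compactSpace _)
  have hw0 : ∀ x, 0 ≤ D.tilt u x := fun x => zero_le_one.trans (D.one_le_tilt (hu.spacelike x))
  have hIm : MeasurableSet ((𝓡∂ m).interior Sig) := isOpen_manifold_interior.measurableSet
  have hBm := (D.isOpen_metricBall hu1.continuous x r).measurableSet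
  set B := metricBall (D.sigma u) x r with hB
  set I := (𝓡∂ m).interior Sig with hI
  have hWr : ∫ y, I.indicator (D.tilt u) y ∂(metricVolume (D.sigma u)) ≤ W := by
    rw [integral_indicator hIm, integral_eq_lintegral_of_nonneg_ae (Eventually.of_forall hw0)
      hw.aestronglyMeasurable]
    exact ENNReal.toReal_le_of_le_ofReal hW0 (hW u hu)
  -- Points of the ball are at distance at least 2R - r > R from the boundary, and that distance is
  -- at most K Cζ ζ. Hence ζ ≥ 4κ on the ball, and the cutoff `rampInt` is at least 2κ there.
  set κ : ℝ := R / (4 * K * Cζ) with hκ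
  have hκ0 : 0 < κ := by positivity
  have hζB : ∀ y ∈ B, 4 * κ ≤ ζ y := by
    intro y hy
    obtain ⟨q, hq, hd⟩ := hζd u hu.mem_Icc y
    have h1 := (hxR q hq).trans (metricDist_triangle (D.sigma_isInnerForm u) x y q)
    have h2 : ENNReal.ofReal (2 * R) ≤ ENNReal.ofReal r + ENNReal.ofReal (K * (Cζ * ζ y)) :=
      h1.trans (add_le_add (le_of_lt hy) hd)
    have h3 : 0 ≤ K * (Cζ * ζ y) := by
      by_contra! h
      rw [ENNReal.ofReal_of_nonpos h.le, add_zero] at h2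
      have := (ENNReal.ofReal_le_ofReal_iff hr.le).1 h2
      linarith
    rw [← ENNReal.ofReal_add hr.le h3, ENNReal.ofReal_le_ofReal_iff (by positivity)] at h2
    have h4 : 4 * κ = R / (K * Cζ) := by rw [hκ]; field_simp
    rw [h4, div_le_iff₀ (by positivity)]
    linarith
  have hζI : ∀ y, y ∉ I → ζ y = 0 := fun y hy => hζb y (by
    rwa [← mem_compl_iff, hI, ModelWithCorners.compl_interior] at hy)
  -- For |t - u(x)| ≤ r the derivative is at least 1/(2κ), so the product with the cutoff 2κ is at
  -- least 1. Everywhere |P| ≤ 2r/κ, since |arctan| < π/2 ≤ 2.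
  set P : ℝ → ℝ := fun t => r / κ * Real.arctan ((t - u x) / r) with hP
  have hPd : ∀ t, HasDerivAt P (r / κ * (1 / (1 + ((t - u x) / r) ^ 2) * (1 / r))) t := fun t =>
    ((((hasDerivAt_id t).sub_const (u x)).div_const r).arctan).const_mul _
  have hPc : ContDiff ℝ 1 P := by
    have : ContDiff ℝ 1 fun t : ℝ => (t - u x) / r := by fun_prop
    exact contDiff_const.mul (Real.contDiff_arctan.comp this)
  have hPb : ∀ t, |P t| ≤ r / κ * 2 := fun t => by
    rw [hP, abs_mul, abs_of_pos (by positivity)]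
    refine mul_le_mul_of_nonneg_left (abs_le.2 ⟨?_, ?_⟩) (by positivity)
    · linarith [Real.neg_pi_div_two_lt_arctan ((t - u x) / r), Real.pi_le_four]
    · linarith [Real.arctan_lt_pi_div_two ((t - u x) / r), Real.pi_le_four]
  have hf1 : ContMDiff (𝓡∂ m) 𝓘(ℝ, ℝ) 1 fun y => P (u y) := hPc.contMDiff.comp hu1
  have hf2 : ContMDiff (𝓡∂ m) 𝓘(ℝ, ℝ) 1 fun y => rampInt κ (ζ y) := (rampInt_contDiff κ).contMDiff.comp hζ
  have hη1 : ContMDiff (𝓡∂ m) 𝓘(ℝ, ℝ) 1 fun y => P (u y) * rampInt κ (ζ y) := hf1.mul hf2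
  have hcl : IsClosed {y | κ ≤ ζ y} := isClosed_le continuous_const hζ.continuous
  have hsupp : tsupport (fun y => P (u y) * rampInt κ (ζ y)) ⊆ I := by
    refine (closure_minimal (fun y hy => ?_) hcl).trans fun y (hy : κ ≤ ζ y) => ?_
    · by_contra hlt
      exact hy (by simp only [rampInt_eq_zero hκ0 (not_le.1 hlt).le, mul_zero])
    · by_contra hi
      rw [hζI y hi] at hy
      linarith
  set b : ℝ := r / κ * 2 * Z with hb
  have hb0 : 0 ≤ b := by positivity
  have hηb : ∀ y, |P (u y) * rampInt κ (ζ y)| ≤ b := fun y => by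
    have h1 : rampInt κ (ζ y) ≤ Z := by
      rcases le_total 0 (ζ y) with h | h
      · exact (rampInt_le hκ0 h).trans ((le_abs_self _).trans (hZ y trivial))
      · rw [rampInt_eq_zero hκ0 (h.trans hκ0.le)]; exact hZ0
    rw [abs_mul, abs_of_nonneg (rampInt_nonneg hκ0 _)]
    exact mul_le_mul (hPb _) h1 (rampInt_nonneg hκ0 _) (by positivity)
  have hmain := hweak u hu _ hη1 hsupp b hηb
  have hgrad : ∀ y, gradInner (D.sigma u) u (fun y => P (u y) * rampInt κ (ζ y)) y
      = P (u y) * (ramp κ (ζ y) * dAlong ζ y (gradVec (D.sigma u) u y))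
        + rampInt κ (ζ y) * (r / κ * (1 / (1 + ((u y - u x) / r) ^ 2) * (1 / r))
          * gradNormSq (D.sigma u) u y) := fun y => by
    rw [gradInner, dAlong_mul (hf1.mdifferentiable (by simp) y) (hf2.mdifferentiable (by simp) y),
      dAlong_comp (rampInt_hasDerivAt κ (ζ y)) (hζ.mdifferentiable (by simp) y),
      dAlong_comp (hPd (u y)) (hu1.mdifferentiable (by simp) y)]
    rfl
  have hpt : ∀ y, a₀ ^ m * B.indicator (fun y => D.tilt u y * gradNormSq (D.sigma u) u y) y
      - a₁ ^ m * (2 * L * (r / κ)) * I.indicator (D.tilt u) y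
      ≤ D.lapseAlong u y ^ m * D.tilt u y *
        gradInner (D.sigma u) u (fun y => P (u y) * rampInt κ (ζ y)) y := by
    intro y
    rw [hgrad]
    have hd0 : 0 ≤ gradNormSq (D.sigma u) u y := gradNormSq_nonneg (D.sigma_isInnerForm u y) u
    have hd1 := hu.spacelike y
    have hα := D.lapseAlong_pos u y
    have hα0 : a₀ ^ m ≤ D.lapseAlong u y ^ m := pow_le_pow_left₀ ha₀.le (hlapse _ (hu.mem_Icc y) y).1 m
    have hα1 : D.lapseAlong u y ^ m ≤ a₁ ^ m := pow_le_pow_left₀ hα.le (hlapse _ (hu.mem_Icc y) y).2.1 m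
    have hwy := hw0 y
    have hαm := pow_pos hα m
    -- The term where the cutoff is differentiated: |Du| < 1 bounds dζ(Du) by L, and the term
    -- vanishes off the interior, so it costs at most 2L r/κ times w there.
    have e1 : -(2 * L * (r / κ)) * I.indicator 1 y
        ≤ P (u y) * (ramp κ (ζ y) * dAlong ζ y (gradVec (D.sigma u) u y)) := by
      by_cases hy : y ∈ I
      · rw [indicator_of_mem hy, Pi.one_apply, mul_one]
        refine neg_le_of_abs_le ?_
        have h1 : |dAlong ζ y (gradVec (D.sigma u) u y)| ≤ L := by
          refine abs_le_of_sq_le_sq ((hLζ _ (hu.mem_Icc y) y _).trans ?_) hL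
          refine mul_le_of_le_one_right (sq_nonneg L) ?_
          have : gradNormSq (D.sigma u) u y
            = D.slice (u y) y (gradVec (D.sigma u) u y) (gradVec (D.sigma u) u y) :=
              gradNormSq_eq (D.sigma_isInnerForm u y) u
          linarith
        have h2 : |ramp κ (ζ y) * dAlong ζ y (gradVec (D.sigma u) u y)| ≤ L := by
          rw [abs_mul, abs_of_nonneg (ramp_nonneg _)]
          exact (mul_le_of_le_one_left (abs_nonneg _) (ramp_le_one _)).trans h1
        rw [abs_mul]
        calc _ ≤ r / κ * 2 * L := mul_le_mul (hPb _) h2 (abs_nonneg _) (by positivity)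
          _ = _ := by ring
      · rw [indicator_of_notMem hy, hζI y hy, ramp_eq_zero hκ0 hκ0.le]
        simp
    have e2 : B.indicator (fun y => gradNormSq (D.sigma u) u y) y
        ≤ rampInt κ (ζ y) * (r / κ * (1 / (1 + ((u y - u x) / r) ^ 2) * (1 / r))
          * gradNormSq (D.sigma u) u y) := by
      by_cases hy : y ∈ B
      · rw [indicator_of_mem hy]
        have h1 := D.abs_sub_le_of_mem_metricBall hu1 hu.spacelike hy
        have h2 : 2 * κ ≤ rampInt κ (ζ y) :=
          le_trans (by linarith [hζB y hy]) (sub_le_rampInt hκ0 (by linarith [hζB y hy]))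
        have h3 : ((u y - u x) / r) ^ 2 ≤ 1 := by
          rw [sq_le_one_iff_abs_le_one, abs_div, abs_of_pos hr]
          exact div_le_one_of_le₀ h1 hr.le
        have h4 : 1 / 2 ≤ 1 / (1 + ((u y - u x) / r) ^ 2) :=
          one_div_le_one_div_of_le (by positivity) (by linarith)
        calc gradNormSq (D.sigma u) u y = 2 * κ * (r / κ * (1 / 2 * (1 / r)) * gradNormSq (D.sigma u) u y) := by
              field_simp
          _ ≤ _ := mul_le_mul h2 (by gcongr) (by positivity) (rampInt_nonneg hκ0 _)
      · rw [indicator_of_notMem hy]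
        exact mul_nonneg (rampInt_nonneg hκ0 _) (by positivity)
    have i1 : B.indicator (fun y => D.tilt u y * gradNormSq (D.sigma u) u y) y
        = D.tilt u y * B.indicator (fun y => gradNormSq (D.sigma u) u y) y := by
      by_cases hy : y ∈ B <;> simp [hy]
    have i2 : I.indicator (D.tilt u) y = D.tilt u y * I.indicator 1 y := by
      by_cases hy : y ∈ I <;> simp [hy]
    have n1 : 0 ≤ B.indicator (fun y => gradNormSq (D.sigma u) u y) y := by
      by_cases hy : y ∈ B <;> simp [hy, hd0]
    have n2 : 0 ≤ I.indicator (1 : Sig → ℝ) y := by by_cases hy : y ∈ I <;> simp [hy]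
    rw [i1, i2]
    have f1 := mul_le_mul_of_nonneg_left (add_le_add e1 e2) (mul_nonneg hαm.le hwy)
    have f2 := mul_le_mul_of_nonneg_right hα0 (mul_nonneg hwy n1)
    have f3 := mul_le_mul_of_nonneg_right hα1
      (mul_nonneg (mul_nonneg (mul_nonneg (mul_nonneg two_pos.le hL) (div_pos hr hκ0).le) hwy) n2)
    linarith
  have hlap := D.lapseAlong_continuous hu1.continuous
  have i1 := (hint _ (hw.mul (D.gradNormSq_continuous hu1 hu1.continuous))).indicator hBm
  have i2 := (hint _ hw).indicator hIm
  have i3 := hint _ (((hlap.pow m).mul hw).mul (D.gradInner_continuous hu1 hη1 hu1.continuous))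
  have i4 := hint _ (hη1.continuous.abs.mul hw)
  have j1 : a₀ ^ m * ∫ y, B.indicator (fun y => D.tilt u y * gradNormSq (D.sigma u) u y) y
        ∂(metricVolume (D.sigma u))
      - a₁ ^ m * (2 * L * (r / κ)) * ∫ y, I.indicator (D.tilt u) y ∂(metricVolume (D.sigma u))
      ≤ ∫ y, D.lapseAlong u y ^ m * D.tilt u y *
        gradInner (D.sigma u) u (fun y => P (u y) * rampInt κ (ζ y)) y ∂(metricVolume (D.sigma u)) := by
    rw [← integral_const_mul, ← integral_const_mul]
    exact (integral_sub (i1.const_mul _) (i2.const_mul _)).symm.trans_le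
      (integral_mono ((i1.const_mul (a₀ ^ m)).sub (i2.const_mul (a₁ ^ m * (2 * L * (r / κ))))) i3 hpt)
  have j2 : ∫ y, |P (u y) * rampInt κ (ζ y)| * D.tilt u y ∂(metricVolume (D.sigma u)) ≤ b * W := by
    have h : ∫ y, |P (u y) * rampInt κ (ζ y)| * D.tilt u y ∂(metricVolume (D.sigma u))
        ≤ ∫ y, b * I.indicator (D.tilt u) y ∂(metricVolume (D.sigma u)) :=
      integral_mono i4 (i2.const_mul b) fun y => by
        by_cases hy : y ∈ I
        · rw [indicator_of_mem hy]
          exact mul_le_mul_of_nonneg_right (hηb y) (hw0 y)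
        · simp only [indicator_of_notMem hy, hζI y hy, rampInt_eq_zero hκ0 hκ0.le]
          simp
    rw [integral_const_mul] at h
    exact h.trans (mul_le_mul_of_nonneg_left hWr hb0)
  have k1 := mul_le_mul_of_nonneg_left j2 hC₁
  have k2 := mul_le_mul_of_nonneg_left hWr (show 0 ≤ a₁ ^ m * (2 * L * (r / κ)) by positivity)
  set J := ∫ y, B.indicator (fun y => D.tilt u y * gradNormSq (D.sigma u) u y) y ∂(metricVolume (D.sigma u))
  have k3 : a₀ ^ m * J ≤ C₁ * (b + b * W) + a₁ ^ m * (2 * L * (r / κ)) * W := by linarith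
  have k4 : r / κ = 4 * K * Cζ * (r / R) := by rw [hκ]; field_simp
  have ha₀m : 0 < a₀ ^ m := by positivity
  rw [div_mul_eq_mul_div, le_div_iff₀ ha₀m, mul_comm J]
  refine k3.trans (le_of_eq ?_)
  rw [hb, k4]
  ring

include hT hCρ hΛ hne in
/-- The local energy estimate: the integral of the tilt over small balls is linear in the radius. -/
theorem exists_lintegral_tilt_ball_le :
    ∃ C : ℝ, 0 ≤ C ∧ ∀ u, D.IsControlled T Cρ Λ u → ∀ (x : Sig) (R : ℝ), 0 < R →
      (∀ q ∈ (𝓡∂ m).boundary Sig, ENNReal.ofReal (2 * R) ≤ metricDist (D.sigma u) x q) →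
      ∀ r, 0 < r → r < R →
        ∫⁻ y in metricBall (D.sigma u) x r, ENNReal.ofReal (D.tilt u y) ∂(metricVolume (D.sigma u))
          ≤ ENNReal.ofReal (C * (r / R)) := by
  have hφT := D.height_mem_Icc hT
  obtain ⟨K, hK, hKσ⟩ := D.exists_sigma_le T
  have hK0 : 0 < K := by linarith
  obtain ⟨ζ, hζ, hζb, hζi, Cζ, hCζ, hζd⟩ := D.exists_boundary_defining D.height.continuous hne
  obtain ⟨CV, hCV, hvol⟩ := D.exists_metricVolume_metricBall_le D.height.continuous
  obtain ⟨R₀, hR₀, hdiam⟩ := D.exists_metricDist_le D.height.continuous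
  have hdist : ∀ u v : Sig → ℝ, (∀ x, u x ∈ Icc (-T) T) → (∀ x, v x ∈ Icc (-T) T) → ∀ x y,
      metricDist (D.sigma u) x y ≤ ENNReal.ofReal K * metricDist (D.sigma v) x y := fun u v hu hv x y =>
    metricDist_le_mul hK0 (hKσ u v hu hv) x y
  obtain ⟨C, hC0, hC⟩ := D.exists_integral_tilt_mul_gradNormSq_ball_le hT hCρ hΛ hne hK0 hCζ
    (hζ.of_le (by exact_mod_cast le_top)) hζb fun u hu x => by
      obtain ⟨q, hq, hd⟩ := hζd x
      refine ⟨q, hq, (hdist u _ hu hφT x q).trans ?_⟩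
      rw [ENNReal.ofReal_mul hK0.le]
      gcongr
  refine ⟨C + K ^ m * (CV * K) * (K * R₀), by positivity, fun u hu x R hR hxR r hr hrR => ?_⟩
  have := D.isFiniteMeasure_sigma hu.smooth
  have hu1 := hu.contMDiff_one
  have hw : Continuous (D.tilt u) := D.tilt_continuous hu1 hu.spacelike
  have hg := D.gradNormSq_continuous hu1 hu1.continuous
  have hBm := (D.isOpen_metricBall hu1.continuous x r).measurableSet
  have hw0 : ∀ x, 0 ≤ D.tilt u x := fun x => zero_le_one.trans (D.one_le_tilt (hu.spacelike x))
  have hint : Integrable (fun y => D.tilt u y * gradNormSq (D.sigma u) u y) (metricVolume (D.sigma u)) :=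
    (hw.mul hg).integrable_of_hasCompactSupport (HasCompactSupport.of_compactSpace _)
  have h1 := hC u hu x R hR hxR r hr hrR
  rw [integral_indicator hBm] at h1
  -- There is a boundary point within the diameter bound K R₀, so R is bounded and a volume linear
  -- in r is also bounded by a multiple of r/R.
  have hRK : R ≤ K * R₀ := by
    obtain ⟨q, hq⟩ := hne
    have h := (hxR q hq).trans ((hdist u _ hu.mem_Icc hφT x q).trans (mul_le_mul_right (hdiam x q) _))
    rw [← ENNReal.ofReal_mul hK0.le, ENNReal.ofReal_le_ofReal_iff (by positivity)] at h
    linarith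
  have hB : metricVolume (D.sigma u) (metricBall (D.sigma u) x r)
      ≤ ENNReal.ofReal (K ^ m * (CV * K) * (K * R₀) * (r / R)) := by
    have hsub : metricBall (D.sigma u) x r ⊆ metricBall (D.sigma D.height) x (K * r) := fun y hy => by
      change metricDist (D.sigma D.height) x y < ENNReal.ofReal (K * r)
      refine (hdist _ u hφT hu.mem_Icc x y).trans_lt ?_
      rw [ENNReal.ofReal_mul hK0.le]
      exact ENNReal.mul_lt_mul_right (ENNReal.ofReal_pos.2 hK0).ne' ENNReal.ofReal_ne_top hy
    refine (D.metricVolume_sigma_le hK0.le (hKσ u _ hu.mem_Icc hφT) _).trans ?_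
    refine (mul_le_mul_right ((measure_mono hsub).trans (hvol x (K * r) (by positivity))) _).trans ?_
    rw [← ENNReal.ofReal_mul (by positivity)]
    refine ENNReal.ofReal_le_ofReal ?_
    have h2 : r ≤ K * R₀ * (r / R) := by
      rw [mul_div_assoc', le_div_iff₀ hR, mul_comm]
      exact mul_le_mul_of_nonneg_right hRK hr.le
    calc K ^ m * (CV * (K * r)) = K ^ m * (CV * K) * r := by ring
      _ ≤ K ^ m * (CV * K) * (K * R₀ * (r / R)) := mul_le_mul_of_nonneg_left h2 (by positivity)
      _ = _ := by ring
  -- The identity w²(1 - |Du|²) = 1 gives w - w|Du|² = 1/w ≤ 1, so only the volume of the ball has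
  -- to be added.
  have hptw : ∀ y, ENNReal.ofReal (D.tilt u y)
      ≤ ENNReal.ofReal (D.tilt u y * gradNormSq (D.sigma u) u y) + 1 := fun y => by
    rw [← ENNReal.ofReal_one, ← ENNReal.ofReal_add (mul_nonneg (hw0 y)
      (gradNormSq_nonneg (D.sigma_isInnerForm u y) u)) zero_le_one]
    refine ENNReal.ofReal_le_ofReal ?_
    have h2 := D.tilt_sq (hu.spacelike y)
    rw [eq_div_iff (by linarith [hu.spacelike y])] at h2
    nlinarith [D.one_le_tilt (hu.spacelike y)]
  calc _ ≤ ∫⁻ y in metricBall (D.sigma u) x r, (ENNReal.ofReal (D.tilt u y * gradNormSq (D.sigma u) u y) + 1)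
        ∂(metricVolume (D.sigma u)) := lintegral_mono hptw
    _ = ENNReal.ofReal (∫ y in metricBall (D.sigma u) x r, D.tilt u y * gradNormSq (D.sigma u) u y
        ∂(metricVolume (D.sigma u))) + metricVolume (D.sigma u) (metricBall (D.sigma u) x r) := by
      rw [lintegral_add_right _ measurable_const, setLIntegral_const, one_mul,
        ofReal_integral_eq_lintegral_ofReal hint.integrableOn (Eventually.of_forall fun y =>
          mul_nonneg (hw0 y) (gradNormSq_nonneg (D.sigma_isInnerForm u y) u))]
    _ ≤ ENNReal.ofReal (C * (r / R)) + ENNReal.ofReal (K ^ m * (CV * K) * (K * R₀) * (r / R)) :=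
      add_le_add (ENNReal.ofReal_le_ofReal h1) hB
    _ = _ := by rw [← ENNReal.ofReal_add (by positivity) (by positivity), ← add_mul]

end Local

end SpacelikeHypersurface

/-- Split the space by the sign of f. On each of the two sets the integral of |f| is, up to sign,
the signed measure of that set, which its total variation dominates. -/
theorem ofReal_integral_abs_le_totalVariation {Z : Type*} [MeasurableSpace Z] {μ : Measure Z} {f : Z → ℝ}
    (hfm : Measurable f) (hf : Integrable f μ) :
    ENNReal.ofReal (∫ x, |f x| ∂μ) ≤ SignedMeasure.totalVariation (μ.withDensityᵥ f) univ := by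
  have hP : MeasurableSet {x | 0 ≤ f x} := measurableSet_le measurable_const hfm
  have h1 : ∫ x in {x | 0 ≤ f x}, |f x| ∂μ = ∫ x in {x | 0 ≤ f x}, f x ∂μ :=
    setIntegral_congr_fun hP fun x hx => abs_of_nonneg hx
  have h2 : ∫ x in {x | 0 ≤ f x}ᶜ, |f x| ∂μ = -∫ x in {x | 0 ≤ f x}ᶜ, f x ∂μ := by
    rw [← integral_neg]
    exact setIntegral_congr_fun hP.compl fun x (hx : ¬ 0 ≤ f x) => abs_of_nonpos (not_le.1 hx).le
  have h3 : ∀ A, MeasurableSet A → ENNReal.ofReal |∫ x in A, f x ∂μ| ≤ SignedMeasure.totalVariation (μ.withDensityᵥ f) A :=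
    fun A hA => by
      have := SignedMeasure.enorm_le_totalVariation (μ.withDensityᵥ f) A
      rwa [withDensityᵥ_apply hf hA, Real.enorm_eq_ofReal_abs] at this
  rw [← integral_add_compl hP hf.abs, h1, h2, ← measure_add_measure_compl hP]
  refine (ENNReal.ofReal_le_ofReal (add_le_add (le_abs_self _) (neg_le_abs _))).trans ?_
  exact ENNReal.ofReal_add_le.trans (add_le_add (h3 _ hP) (h3 _ hP.compl))

/-- Each covering set that meets A is replaced by a ball centred at one of its points in A, with
radius its diameter plus a small summable excess. The excess makes the radii positive and turns the
diameter bound into the strict inequality defining the ball. -/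
theorem exists_metricBall_cover_of_hausdorffOne_eq_zero {m : ℕ} [NeZero m] {Sig : Type*} [TopologicalSpace Sig]
    [ChartedSpace (EuclideanHalfSpace m) Sig]
    {σ : (x : Sig) → TangentSpace (𝓡∂ m) x → TangentSpace (𝓡∂ m) x → ℝ} {A : Set Sig}
    (h : hausdorffOne σ A = 0) (hA : A.Nonempty) {ε : ℝ≥0∞} (hε : 0 < ε) :
    ∃ (x : ℕ → Sig) (r : ℕ → ℝ), (∀ n, x n ∈ A) ∧ (∀ n, 0 < r n) ∧
      A ⊆ ⋃ n, metricBall σ (x n) (r n) ∧ ∑' n, ENNReal.ofReal (r n) ≤ ε := by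
  have hε2 : ε / 2 ≠ 0 := (ENNReal.half_pos hε.ne').ne'
  -- The scale δ = 1 serves only to make all diameters finite; smallness comes from the sum.
  have h0 := ENNReal.iSup_eq_zero.1 (ENNReal.iSup_eq_zero.1 h 1) one_pos
  rw [← nonpos_iff_eq_zero] at h0
  have h1 := h0.trans_lt (pos_iff_ne_zero.2 (ENNReal.inv_ne_zero.2 (ENNReal.inv_ne_top.2 hε2)))
  rw [inv_inv] at h1
  obtain ⟨t, ht⟩ := iInf_lt_iff.1 h1
  obtain ⟨hcov, ht⟩ := iInf_lt_iff.1 ht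
  obtain ⟨hdiam, ht⟩ := iInf_lt_iff.1 ht
  obtain ⟨ε', hε', hsum⟩ := ENNReal.exists_pos_sum_of_countable hε2 ℕ
  obtain ⟨e, he⟩ := hA
  classical
  set d : ℕ → ℝ≥0∞ := fun n => ⨆ x ∈ t n, ⨆ y ∈ t n, metricDist σ x y with hd
  have hdt : ∀ n, d n ≠ ⊤ := fun n => ((hdiam n).trans_lt ENNReal.one_lt_top).ne
  have hr : ∀ n, ENNReal.ofReal ((d n).toReal + ε' n) = d n + ε' n := fun n => by
    rw [ENNReal.ofReal_add ENNReal.toReal_nonneg (ε' n).coe_nonneg, ENNReal.ofReal_toReal (hdt n),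
      ENNReal.ofReal_coe_nnreal]
  -- Covering sets that miss A are not needed; their balls get the arbitrary centre e, so that all
  -- centres lie in A.
  refine ⟨fun n => if hn : (t n ∩ A).Nonempty then hn.some else e, fun n => (d n).toReal + ε' n,
    fun n => ?_, fun n => add_pos_of_nonneg_of_pos ENNReal.toReal_nonneg (hε' n), fun y hy => ?_, ?_⟩
  · by_cases hn : (t n ∩ A).Nonempty
    · simp only [dif_pos hn]; exact hn.some_mem.2
    · simp only [dif_neg hn]; exact he
  · obtain ⟨n, hn⟩ := mem_iUnion.1 (hcov hy)
    have hne : (t n ∩ A).Nonempty := ⟨y, hn, hy⟩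
    refine mem_iUnion.2 ⟨n, ?_⟩
    simp only [dif_pos hne]
    change metricDist σ hne.some y < ENNReal.ofReal ((d n).toReal + ε' n)
    rw [hr]
    refine lt_of_le_of_lt ?_ (ENNReal.lt_add_right (hdt n) (ENNReal.coe_pos.2 (hε' n)).ne')
    exact (le_iSup₂ (f := fun y (_ : y ∈ t n) => metricDist σ hne.some y) y hn).trans
      (le_iSup₂ (f := fun x (_ : x ∈ t n) => ⨆ y ∈ t n, metricDist σ x y) hne.some hne.some_mem.1)
  · simp only [hr]
    rw [ENNReal.tsum_add]
    exact (add_le_add ht.le hsum.le).trans (ENNReal.add_halves ε).le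

/-! ### Approximating sequences and absence of concentration -/

namespace SpacelikeHypersurface

variable {m : ℕ} [NeZero m] {S : Type*} [TopologicalSpace S]
  [ChartedSpace (EuclideanSpace ℝ (Fin m)) S] [IsManifold (𝓡 m) ∞ S] {G : SplitSpacetime m S}
  {Sig : Type*} [TopologicalSpace Sig] [T2Space Sig] [CompactSpace Sig] [ConnectedSpace Sig]
  [ChartedSpace (EuclideanHalfSpace m) Sig] [IsManifold (𝓡∂ m) ∞ Sig]
  [MeasurableSpace Sig] [BorelSpace Sig]
  (D : SpacelikeHypersurface G Sig)
  {T : ℝ} (hT : ∀ u : Sig → ℝ, ContMDiff (𝓡∂ m) 𝓘(ℝ, ℝ) 1 u → (∀ x, gradNormSq (D.sigma u) u x < 1) →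
      (∀ x ∈ (𝓡∂ m).boundary Sig, u x = D.height x) → ∀ x, u x ∈ Icc (-T) T)
  (hne : ((𝓡∂ m).boundary Sig).Nonempty)

include hT in
omit [T2Space Sig] in
-- The bound on the total variation becomes an L¹ bound for the density, and what remains of H is
-- ḡ(X_j, N), bounded by Λw. The resulting control depends on j only through u, with the same
-- constants for all j.
theorem Approximates.isControlled {ρ : D.weaklySpacelike → SignedMeasure Sig}
    {X : (p : ℝ × S) → ℝ × TangentSpace (𝓡 m) p.2} {Cρ Λ : ℝ≥0}
    {ρs : ℕ → D.weaklySpacelike → SignedMeasure Sig}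
    {Xs : ℕ → (p : ℝ × S) → ℝ × TangentSpace (𝓡 m) p.2}
    (h : D.Approximates ρ X Cρ Λ ρs Xs) {j : ℕ} {u : D.weaklySpacelike}
    (hu : D.IsSmoothSolution (ρs j) (Xs j) u) : D.IsControlled T Cρ Λ u.1 := by
  have hu1 : ContMDiff (𝓡∂ m) 𝓘(ℝ, ℝ) 1 u.1 := hu.smooth.of_le (by exact_mod_cast le_top)
  refine ⟨hu.smooth, hu.spacelike, hT _ hu1 hu.spacelike u.2.2.2, u.2.2.2, ?_⟩
  obtain ⟨f, hf, hρ, heq⟩ := hu.equation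
  have := D.isFiniteMeasure_sigma hu.smooth
  refine ⟨f, hf.continuous, ?_, fun x hx => ?_⟩
  · have h1 := ofReal_integral_abs_le_totalVariation (μ := metricVolume (D.sigma u.1))
      hf.continuous.measurable
      (hf.continuous.integrable_of_hasCompactSupport (HasCompactSupport.of_compactSpace _))
    rw [← hρ] at h1
    have h2 := h1.trans (h.measure_bound j u)
    rw [← ENNReal.ofReal_coe_nnreal] at h2
    exact (ENNReal.ofReal_le_ofReal_iff Cρ.2).1 h2
  · rw [heq x hx, add_sub_cancel_left]
    exact h.field_bound j u u.2 x hx (hu1.mdifferentiable (by simp) x) (hu.spacelike x)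

include hne in
omit [MeasurableSpace Sig] [BorelSpace Sig] in
-- The function ζ vanishes on the boundary, is bounded below by some c > 0 on E, and is Lipschitz
-- with one constant for all σ_u of bounded height.
theorem exists_le_metricDist_boundary {E : Set Sig} (hE : IsCompact E) (hEi : E ⊆ (𝓡∂ m).interior Sig) :
    ∃ R : ℝ, 0 < R ∧ ∀ u : Sig → ℝ, (∀ x, u x ∈ Icc (-T) T) → ∀ x ∈ E, ∀ q ∈ (𝓡∂ m).boundary Sig,
      ENNReal.ofReal (2 * R) ≤ metricDist (D.sigma u) x q := by
  obtain ⟨ζ, hζ, hζb, hζi, -⟩ := D.exists_boundary_defining D.height.continuous hne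
  have hζ1 : ContMDiff (𝓡∂ m) 𝓘(ℝ, ℝ) 1 ζ := hζ.of_le (by exact_mod_cast le_top)
  obtain ⟨c, hc, hcE⟩ := hE.exists_forall_le' hζ.continuous.continuousOn fun x hx => hζi x (hEi hx)
  obtain ⟨L, hL, hLζ⟩ := D.exists_dAlong_sq_le hζ1 T
  refine ⟨c / (2 * (L + 1)), by positivity, fun u hu x hx q hq => ?_⟩
  have h1 := ofReal_abs_sub_le_metricDist hζ1 (L := L + 1) (σ := D.sigma u) (by linarith) (fun z v =>
    (hLζ _ (hu z) z v).trans (mul_le_mul_of_nonneg_right (pow_le_pow_left₀ hL (by linarith) 2)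
      (D.slice_nonneg _ _ _))) x q
  rw [hζb q hq, sub_zero] at h1
  by_contra! hlt
  have h2 := ENNReal.mul_lt_mul_right (a := ENNReal.ofReal (L + 1))
    (ENNReal.ofReal_pos.2 (by linarith)).ne' ENNReal.ofReal_ne_top hlt
  rw [← ENNReal.ofReal_mul (by linarith)] at h2
  have h3 : (L + 1) * (2 * (c / (2 * (L + 1)))) = c := by field_simp
  rw [h3] at h2
  exact absurd (h1.trans_lt h2) (not_lt.2 (ENNReal.ofReal_le_ofReal ((hcE x hx).trans (le_abs_self _))))

include hT hne in
/-- Compact sets of zero one-dimensional measure carry no concentration of the tilt. -/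
theorem locallyUniformlyIntegrable_of_diff {Cρ Λ : ℝ} (hCρ : 0 ≤ Cρ) (hΛ : 0 ≤ Λ) {u : ℕ → Sig → ℝ}
    (hu : ∀ j, D.IsControlled T Cρ Λ (u j)) {E : Set Sig} (hE : IsCompact E)
    (hEi : E ⊆ (𝓡∂ m).interior Sig) (hE0 : hausdorffOne (D.sigma D.height) E = 0)
    (h : LocallyUniformlyIntegrable (metricVolume (D.sigma D.height)) (fun j => D.tilt (u j))
      ((𝓡∂ m).interior Sig \ E)) :
    LocallyUniformlyIntegrable (metricVolume (D.sigma D.height)) (fun j => D.tilt (u j))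
      ((𝓡∂ m).interior Sig) := by
  rcases E.eq_empty_or_nonempty with rfl | hEne
  · rwa [sdiff_empty] at h
  intro Q hQ hQi ε hε
  have hφT := D.height_mem_Icc hT
  obtain ⟨K, hK, hKσ⟩ := D.exists_sigma_le T
  have hK0 : 0 < K := by linarith
  obtain ⟨C, hC0, hC⟩ := D.exists_lintegral_tilt_ball_le hT hCρ hΛ hne
  obtain ⟨R, hR, hRE⟩ := D.exists_le_metricDist_boundary (T := T) hne hE hEi
  set c : ℝ := K ^ m * (C * (K / R)) with hc
  have hc0 : 0 ≤ c := by positivity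
  have hε' : (0 : ℝ) < ε := hε
  -- The first entry keeps every enlarged radius K r_n below R, so the local estimate applies. The
  -- second makes c times the total radius at most ε/2.
  set θ : ℝ := min (R / (2 * K)) (ε / 2 / (c + 1)) with hθ
  have hθ0 : 0 < θ := lt_min (by positivity) (by positivity)
  obtain ⟨x, r, hx, hr, hcov, hsum⟩ := exists_metricBall_cover_of_hausdorffOne_eq_zero hE0 hEne
    (ENNReal.ofReal_pos.2 hθ0)
  set U := ⋃ n, metricBall (D.sigma D.height) (x n) (r n) with hU
  have hUo : IsOpen U := isOpen_iUnion fun n => D.isOpen_metricBall D.height.continuous _ _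
  have hrK : ∀ n, K * r n < R := fun n => by
    have h1 := (ENNReal.ofReal_le_ofReal_iff hθ0.le).1 ((ENNReal.le_tsum n).trans hsum)
    have h2 := mul_le_mul_of_nonneg_left (h1.trans (min_le_left _ _)) hK0.le
    have h3 : K * (R / (2 * K)) = R / 2 := by field_simp
    linarith
  have hvol : ∀ j, metricVolume (D.sigma D.height)
      ≤ ENNReal.ofReal (K ^ m) • metricVolume (D.sigma (u j)) := fun j =>
    Measure.le_iff'.2 fun A => D.metricVolume_sigma_le hK0.le (hKσ _ _ hφT (hu j).mem_Icc) A
  have hball : ∀ j n, ∫⁻ y in metricBall (D.sigma D.height) (x n) (r n), ENNReal.ofReal |D.tilt (u j) y|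
      ∂(metricVolume (D.sigma D.height)) ≤ ENNReal.ofReal c * ENNReal.ofReal (r n) := fun j n => by
    have hsub : metricBall (D.sigma D.height) (x n) (r n) ⊆ metricBall (D.sigma (u j)) (x n) (K * r n) :=
      fun y hy => by
        change metricDist (D.sigma (u j)) (x n) y < ENNReal.ofReal (K * r n)
        refine (metricDist_le_mul hK0 (hKσ _ _ (hu j).mem_Icc hφT) _ _).trans_lt ?_
        rw [ENNReal.ofReal_mul hK0.le]
        exact ENNReal.mul_lt_mul_right (ENNReal.ofReal_pos.2 hK0).ne' ENNReal.ofReal_ne_top hy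
    have habs : ∀ y, |D.tilt (u j) y| = D.tilt (u j) y := fun y =>
      abs_of_nonneg (zero_le_one.trans (D.one_le_tilt ((hu j).spacelike y)))
    simp only [habs]
    calc _ ≤ ∫⁻ y in metricBall (D.sigma (u j)) (x n) (K * r n), ENNReal.ofReal (D.tilt (u j) y)
          ∂(ENNReal.ofReal (K ^ m) • metricVolume (D.sigma (u j))) :=
          lintegral_mono' (Measure.restrict_mono hsub (hvol j)) le_rfl
      _ = ENNReal.ofReal (K ^ m) * ∫⁻ y in metricBall (D.sigma (u j)) (x n) (K * r n),
          ENNReal.ofReal (D.tilt (u j) y) ∂(metricVolume (D.sigma (u j))) := by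
          rw [Measure.restrict_smul, lintegral_smul_measure, smul_eq_mul]
      _ ≤ ENNReal.ofReal (K ^ m) * ENNReal.ofReal (C * (K * r n / R)) := mul_le_mul_right
          (hC (u j) (hu j) (x n) R hR (hRE _ (hu j).mem_Icc _ (hx n)) _ (mul_pos hK0 (hr n)) (hrK n)) _
      _ = _ := by
          rw [← ENNReal.ofReal_mul (by positivity), ← ENNReal.ofReal_mul hc0, hc]
          congr 1
          ring
  have hUε : ∀ j, ∫⁻ y in U, ENNReal.ofReal |D.tilt (u j) y| ∂(metricVolume (D.sigma D.height))
      ≤ ENNReal.ofReal (ε / 2) := fun j => by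
    refine (lintegral_iUnion_le _ _).trans ((ENNReal.tsum_le_tsum (hball j)).trans ?_)
    rw [ENNReal.tsum_mul_left]
    refine (mul_le_mul_right hsum _).trans ?_
    rw [← ENNReal.ofReal_mul hc0]
    refine ENNReal.ofReal_le_ofReal ?_
    have h1 := min_le_right (R / (2 * K)) (ε / 2 / (c + 1))
    rw [← hθ, le_div_iff₀ (by positivity)] at h1
    linarith
  -- The set Q \ U is compact and misses E, so the hypothesis applies to it. With ε/4 there and ε/2
  -- on U the supremum is at most 3ε/4, strictly below ε.
  obtain ⟨δ, hδ, hδQ⟩ := h (Q \ U) (hQ.diff hUo) (fun y hy => ⟨hQi hy.1, fun hyE => hy.2 (hcov hyE)⟩)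
    (ε / 4) (by positivity)
  refine ⟨δ, hδ, fun A hA hAQ hAδ => ?_⟩
  have h1 := hδQ (A \ U) (hA.diff hUo.measurableSet) (sdiff_subset_sdiff_left hAQ)
    ((measure_mono sdiff_subset).trans_lt hAδ)
  have h2 : (⨆ j, ∫⁻ y in A, ENNReal.ofReal |D.tilt (u j) y| ∂(metricVolume (D.sigma D.height)))
      ≤ ENNReal.ofReal (ε / 2) + (ε / 4 : ℝ≥0) := iSup_le fun j => by
    have hsub : A ⊆ U ∪ A \ U := by rw [union_sdiff_self]; exact subset_union_right
    refine (lintegral_mono_set hsub).trans ((lintegral_union_le _ _ _).trans ?_)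
    exact add_le_add (hUε j) ((le_iSup (fun j => ∫⁻ y in A \ U, ENNReal.ofReal |D.tilt (u j) y|
      ∂(metricVolume (D.sigma D.height))) j).trans h1.le)
  refine h2.trans_lt ?_
  rw [← ENNReal.ofReal_coe_nnreal, ← ENNReal.ofReal_coe_nnreal, ← ENNReal.ofReal_add (by positivity) (by positivity),
    ENNReal.ofReal_lt_ofReal_iff hε']
  push_cast
  linarith

end SpacelikeHypersurface

theorem mainTheorem3 {m : ℕ} [NeZero m]
    {S : Type*} [TopologicalSpace S] [T2Space S] [SecondCountableTopology S]
    [ChartedSpace (EuclideanSpace ℝ (Fin m)) S] [IsManifold (𝓡 m) ∞ S]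
    (G : SplitSpacetime m S) (hG : G.SlicesCauchy)
    {Sig : Type*} [TopologicalSpace Sig] [T2Space Sig] [CompactSpace Sig] [ConnectedSpace Sig]
    [ChartedSpace (EuclideanHalfSpace m) Sig] [IsManifold (𝓡∂ m) ∞ Sig]
    [MeasurableSpace Sig] [BorelSpace Sig]
    (D : SpacelikeHypersurface G Sig)
    (hC : IsCompact (closure (G.development D.carrier)))
    (ρ : D.weaklySpacelike → SignedMeasure Sig)
    (hρ : ∀ η : C(Sig, ℝ), Continuous fun u => signedIntegral (ρ u) η)
    (X : (p : ℝ × S) → ℝ × TangentSpace (𝓡 m) p.2)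
    (hX : SplitSpacetime.ContinuousField (closure (G.development D.carrier)) X)
    (Cρ Λ : ℝ≥0) :
    ∃ C : ℝ≥0, ∀ (ρs : ℕ → D.weaklySpacelike → SignedMeasure Sig)
      (Xs : ℕ → (p : ℝ × S) → ℝ × TangentSpace (𝓡 m) p.2)
      (u : ℕ → D.weaklySpacelike),
      D.Approximates ρ X Cρ Λ ρs Xs →
      (∀ j, D.IsSmoothSolution (ρs j) (Xs j) (u j)) →
      (∀ x ∈ (𝓡∂ m).interior Sig, ∀ r : ℝ, 0 < r →
        ENNReal.ofReal r < D.halfBoundaryDist u x → ∀ j,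
          ∫⁻ y in metricBall (D.sigma (u j).1) x r, ENNReal.ofReal (D.tilt (u j).1 y)
              ∂(metricVolume (D.sigma (u j).1))
            ≤ C / D.halfBoundaryDist u x * ENNReal.ofReal r) ∧
      ∀ E : Set Sig, IsCompact E → E ⊆ (𝓡∂ m).interior Sig →
        hausdorffOne (D.sigma D.height) E = 0 →
        (LocallyUniformlyIntegrable (metricVolume (D.sigma D.height))
            (fun j => D.tilt (u j).1) ((𝓡∂ m).interior Sig \ E) ↔
          LocallyUniformlyIntegrable (metricVolume (D.sigma D.height))
            (fun j => D.tilt (u j).1) ((𝓡∂ m).interior Sig)) := by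
  obtain ⟨T, -, hT⟩ := D.exists_abs_le_of_isCompact hC
  have hne : ((𝓡∂ m).boundary Sig).Nonempty := D.boundary_nonempty_of_isCompact hC
  obtain ⟨C, hC0, hCb⟩ := D.exists_lintegral_tilt_ball_le hT Cρ.2 Λ.2 hne
  refine ⟨⟨C, hC0⟩, fun ρs Xs u happ hsol => ?_⟩
  have hu : ∀ j, D.IsControlled T Cρ Λ (u j).1 := fun j => happ.isControlled D hT (hsol j)
  refine ⟨fun x hx r hr hrx j => ?_, fun E hE hEi hE0 => ⟨fun h =>
    D.locallyUniformlyIntegrable_of_diff hT hne Cρ.2 Λ.2 hu hE hEi hE0 h,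
    fun h Q hQ hQE => h Q hQ (hQE.trans sdiff_subset)⟩⟩
  set R := D.halfBoundaryDist u x with hR
  have hle : ∀ q ∈ (𝓡∂ m).boundary Sig, 2 * R ≤ metricDist (D.sigma (u j).1) x q := fun q hq => by
    rw [hR, SpacelikeHypersurface.halfBoundaryDist, ENNReal.mul_div_cancel two_ne_zero ENNReal.ofNat_ne_top]
    exact (iInf_le _ j).trans (iInf₂_le q hq)
  have hRt : R ≠ ⊤ := by
    intro htop
    obtain ⟨q, hq⟩ := hne
    obtain ⟨B, -, hB⟩ := D.exists_metricDist_le (u j).1.continuous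
    have h1 := (hle q hq).trans (hB x q)
    rw [htop, ENNReal.mul_top two_ne_zero, top_le_iff] at h1
    exact ENNReal.ofReal_ne_top h1
  -- The value r_x is finite because the boundary is nonempty and distances are bounded, and
  -- positive because r lies below it; so it can serve as the real number R of the local estimate.
  have hR0 : 0 < R.toReal := ENNReal.toReal_pos (zero_le.trans_lt hrx).ne' hRt
  have hrR : r < R.toReal := (ENNReal.ofReal_lt_iff_lt_toReal hr.le hRt).1 hrx
  refine (hCb (u j).1 (hu j) x R.toReal hR0 (fun q hq => ?_) r hr hrR).trans (le_of_eq ?_)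
  · rw [ENNReal.ofReal_mul two_pos.le, ENNReal.ofReal_toReal hRt, ENNReal.ofReal_ofNat]
    exact hle q hq
  · rw [mul_div_assoc', mul_div_right_comm, ENNReal.ofReal_mul (by positivity), ENNReal.ofReal_div_of_pos hR0,
      ENNReal.ofReal_toReal hRt]
    congr 2
    exact ENNReal.ofReal_eq_coe_nnreal hC0
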